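/- Let $g,n\ge 0$ be integers. A Jacobi diagram is a finite uni-trivalent graph with a cyclic order of the three half-edges at each trivalent vertex and a label in $\{1^+,\dots,g^+,1^-,\dots,g^-\}$ at each univalent vertex; diagrams are considered up to isomorphism, and in pictures the cyclic orders are counterclockwise. Let $\mathcal J^c_{n,2}$ be the set of connected Jacobi diagrams with $n$ trivalent vertices and first Betti number $2$. The AS relators are the sums $J+J'$, where $J'$ is $J$ with the cyclic order at one trivalent vertex reversed. The IHX relators are $I-H+X$, for three diagrams which agree except near one edge joining two different trivalent vertices; if the four strands ending there are $a,b,c,d$ counterclockwise from the upper right and $e,e'$ are the two halves of the edge, the cyclic orders at its end points are $(e,a,b),(e',c,d)$ in $I$, $(e,b,c),(e',d,a)$ in $H$ and $(e,a,c),(e',d,b)$ in $X$. The self-loop relators are the diagrams having an edge that joins a vertex to itself. Let $\mathcal A^c_{n,2}$ be the quotient of $\mathbb Z\mathcal J^c_{n,2}$ by the submodule generated by all AS, IHX and self-loop relators. The spine of a diagram is what remains after successively collapsing all edges incident to univalent vertices. Let $\Theta_n\subset\mathcal J^c_{n,2}$ be the set of diagrams whose spine is (a subdivision of) the theta graph,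 and let $\mathcal R_\Theta\subset\mathbb Z\Theta_n$ be the submodule generated by the AS and IHX relators all of whose terms lie in $\Theta_n$. A diagram $J\in\mathcal J^c_{n,2}$ is in eyeglass form if its spine consists of a left circle, a right circle and a horizontal line joining them, drawn in the plane so that the line carries rooted trees $t_1,\dots,t_r$ ($r\ge 0$) from left to right, all above the line, and the two circles carry (possibly no) rooted trees, all outside of the circles. For $S\subset\{1,\dots,r\}$ let $D_S$ be the following diagram: cut the left circle and the right circle open at their joints with the line; join the two upper ends by an upper horizontal strand carrying the trees $t_i$, $i\in S$, and the two lower ends by a lower horizontal strand carrying the trees $t_i$, $i\notin S$, in both cases in increasing order of $i$ from left to right and above the strand; and add a vertical edge joining the left end of the upper strand to the left end of the lower strand, to the left of all these trees. Let $D'_S$ be obtained in the same way, but with the two ends of the left arc interchanged (they cross before they reach the vertical edge and arrive there from the left). Then every $J\in\mathcal J^c_{n,2}\setminus\Theta_n$ is, modulo the AS relators, equal up to sign to a diagram in eyeglass form; all $D_S$ and $D'_S$ belong to $\Theta_n$; and there is a unique (well-defined) homomorphism $$f\colon \mathbb Z\mathcal J^c_{n,2}/\mathrm{AS}\to \mathbb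 Z\Theta_n/\mathcal R_\Theta$$ such that $f(J)=J$ for $J\in\Theta_n$ and $$f(J)=\sum_{S\subset\{1,\dots,r\}}D_S-\sum_{S\subset\{1,\dots,r\}}D'_S$$ for every $J$ in eyeglass form (and every way of presenting it so). The map $f$ induces an isomorphism $\mathcal A^c_{n,2}\to\mathbb Z\Theta_n/\mathcal R_\Theta$, and its inverse is the map induced by the inclusion $\mathbb Z\Theta_n\hookrightarrow\mathbb Z\mathcal J^c_{n,2}$. -/

import Mathlib

open scoped Classical

noncomputable section

namespace Jacobi

/-- A Jacobi diagram with labels in `L`, i.e. a finite uni-trivalent graph with a cyclic order at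
each trivalent vertex and a label at each univalent vertex, described by its half-edges.

`inv` exchanges the two halves of an edge. `rot` sends a half-edge to the next one, in the cyclic
order (counterclockwise in pictures), at the same vertex: the vertices are the orbits of `rot`, the
trivalent vertices are the orbits of size three and the univalent ones are the fixed points. -/
structure Diagram (L : Type) where
  H : Type
  finite : Finite H
  inv : Equiv.Perm H
  rot : Equiv.Perm H
  inv_inv : ∀ h, inv (inv h) = h
  inv_ne : ∀ h, inv h ≠ h
  rot_cube : ∀ h, rot (rot (rot h)) = h
  label : H → Option L
  label_isSome : ∀ h, (label h).isSome ↔ rot h = h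

variable {L : Type}

namespace Diagram

/-- Isomorphisms of Jacobi diagrams. -/
structure Iso (J K : Diagram L) where
  equiv : J.H ≃ K.H
  map_inv : ∀ h, equiv (J.inv h) = K.inv (equiv h)
  map_rot : ∀ h, equiv (J.rot h) = K.rot (equiv h)
  map_label : ∀ h, K.label (equiv h) = J.label h

instance setoid (L : Type) : Setoid (Diagram L) where
  r J K := Nonempty (Iso J K)
  iseqv :=
    { refl := fun J => ⟨⟨Equiv.refl _, fun _ => rfl, fun _ => rfl, fun _ => rfl⟩⟩
      symm := by
        rintro J K ⟨e, h1, h2, h3⟩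
        refine ⟨⟨e.symm, fun h => ?_, fun h => ?_, fun h => ?_⟩⟩
        · rw [Equiv.symm_apply_eq, h1, e.apply_symm_apply]
        · rw [Equiv.symm_apply_eq, h2, e.apply_symm_apply]
        · rw [← h3, e.apply_symm_apply]
      trans := by
        rintro J K M ⟨e, h1, h2, h3⟩ ⟨e', h1', h2', h3'⟩
        refine ⟨⟨e.trans e', fun h => ?_, fun h => ?_, fun h => ?_⟩⟩
        · simp [h1, h1']
        · simp [h2, h2']
        · simp [h3, h3'] }

/-- The graph is non-empty and connected. -/
def Connected (J : Diagram L) : Prop :=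
  Nonempty J.H ∧
    ∀ x y : J.H, Relation.EqvGen (fun a b => b = J.inv a ∨ b = J.rot a) x y

/-- The number of trivalent vertices (the internal degree); each one carries three half-edges. -/
def numTriv (J : Diagram L) : ℕ := Nat.card {h : J.H // J.rot h ≠ h} / 3

/-- The number of univalent vertices. -/
def numUniv (J : Diagram L) : ℕ := Nat.card {h : J.H // J.rot h = h}

/-- The number of edges; each one consists of two half-edges. -/
def numEdges (J : Diagram L) : ℕ := Nat.card J.H / 2

/-- The first Betti number of a connected diagram, `1 - χ`. -/
def betti (J : Diagram L) : ℤ := 1 - ((J.numTriv : ℤ) + J.numUniv - J.numEdges)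

/-- Connected, with `n` trivalent vertices and first Betti number two. -/
def IsTwoLoop (n : ℕ) (J : Diagram L) : Prop :=
  J.Connected ∧ J.numTriv = n ∧ J.betti = 2

/-! ### The spine -/

/-- `J.Hanging h`: on its side containing the vertex of `h`, the edge of `h` ends in a rooted tree
(a univalent vertex, or a trivalent vertex whose two other edges end in rooted trees). These are the
edges that get collapsed, from the end `h`, when one successively collapses the edges incident to a
univalent vertex. -/
inductive Hanging (J : Diagram L) : J.H → Prop
  | leaf (h : J.H) : J.rot h = h → Hanging J h
  | node (h : J.H) : Hanging J (J.inv (J.rot h)) → Hanging J (J.inv (J.rot.symm h)) → Hanging J h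

/-- The half-edge `h` belongs to an edge of the spine, i.e. its edge is never collapsed. -/
def InSpine (J : Diagram L) (h : J.H) : Prop := ¬ J.Hanging h ∧ ¬ J.Hanging (J.inv h)

/-- The half-edges occurring in a list of edges. -/
def darts {H : Type} (ps : List (H × H)) : List H := ps.flatMap fun p => [p.1, p.2]

/-- The spine of `J` consists exactly of the (pairwise different) edges listed in `ps`. -/
structure SpineIs (J : Diagram L) (ps : List (J.H × J.H)) : Prop where
  nodup : (darts ps).Nodup
  edge : ∀ p ∈ ps, J.inv p.1 = p.2
  mem_iff : ∀ h, h ∈ darts ps ↔ J.InSpine h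

/-- A trivalent vertex passed by a path, given as `(t, s)`: `t` is its half-edge not on the path,
which is to the left (`s = true`) or to the right (`s = false`) of the path. This is the half-edge
through which the path enters. -/
def inDart {H : Type} (rot : Equiv.Perm H) (m : H × Bool) : H := if m.2 then rot m.1 else rot.symm m.1

/-- The half-edge through which the path leaves, see `inDart`. -/
def outDart {H : Type} (rot : Equiv.Perm H) (m : H × Bool) : H := if m.2 then rot.symm m.1 else rot m.1

/-- The edges of the path that leaves through the half-edge `x`, passes the vertices `ms` in this
order, and arrives at the half-edge `y`. -/
def path {H : Type} (rot : Equiv.Perm H) : H → List (H × Bool) → H → List (H × H)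
  | x, [], y => [(x, y)]
  | x, m :: ms, y => (x, inDart rot m) :: path rot (outDart rot m) ms y

/-- All trees to the left of the path. -/
def onLeft {H : Type} (ts : List H) : List (H × Bool) := ts.map fun t => (t, true)

/-- All trees to the right of the path. -/
def onRight {H : Type} (ts : List H) : List (H × Bool) := ts.map fun t => (t, false)

/-- The spine of `J` is (a subdivision of) the theta graph: there are two vertices, the one with
half-edges `u, rot u, rot⁻¹ u` and the one with half-edges `v, w, w'`, joined by three paths. -/
def HasThetaSpine (J : Diagram L) : Prop :=
  ∃ (u v w w' : J.H) (a b c : List (J.H × Bool)),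
    ((w = J.rot v ∧ w' = J.rot.symm v) ∨ (w = J.rot.symm v ∧ w' = J.rot v)) ∧
    J.SpineIs (path J.rot u a v ++ path J.rot (J.rot u) b w ++ path J.rot (J.rot.symm u) c w')

/-! ### Changing the edges of a diagram -/

/-- The diagram with the same vertices as `J` in which the place of the half-edge `x` is taken by
the strand which is attached at `π x` in `J`. -/
def reattach (J : Diagram L) (π : Equiv.Perm J.H) : Diagram L :=
  { J with
    inv := π⁻¹ * J.inv * π
    inv_inv := fun h => by simp [J.inv_inv]
    inv_ne := fun h hh => J.inv_ne (π h) (by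
      have := congrArg π hh
      simpa using this) }

/-- Add the edges `ps` to the pairing `d`, overriding it. -/
def overrideEdges {H : Type} (d : H → H) : List (H × H) → H → H
  | [] => d
  | p :: ps => Function.update (Function.update (overrideEdges d ps) p.1 p.2) p.2 p.1

theorem overrideEdges_of_notMem {H : Type} (d : H → H) (ps : List (H × H)) (h : H)
    (hh : h ∉ darts ps) : overrideEdges d ps h = d h := by
  induction ps with
  | nil => rfl
  | cons p ps ih =>
    simp only [darts, List.flatMap_cons, List.cons_append, List.nil_append, List.mem_cons,
      not_or] at hh
    simp only [overrideEdges]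
    rw [Function.update_of_ne hh.2.1, Function.update_of_ne hh.1]
    exact ih hh.2.2

theorem overrideEdges_of_mem {H : Type} (d : H → H) (ps : List (H × H))
    (hps : (darts ps).Nodup) (p : H × H) (hp : p ∈ ps) :
    overrideEdges d ps p.1 = p.2 ∧ overrideEdges d ps p.2 = p.1 ∧ p.1 ≠ p.2 := by
  induction ps with
  | nil => simp at hp
  | cons q ps ih =>
    have hn : (q.1 :: q.2 :: darts ps).Nodup := hps
    simp only [List.nodup_cons, List.mem_cons, not_or] at hn
    obtain ⟨⟨h1, h2⟩, h3, h4⟩ := hn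
    simp only [overrideEdges]
    rcases List.mem_cons.1 hp with rfl | hp
    · exact ⟨by rw [Function.update_of_ne h1, Function.update_self],
        by rw [Function.update_self], h1⟩
    · have hm1 : p.1 ∈ darts ps := List.mem_flatMap.2 ⟨p, hp, by simp⟩
      have hm2 : p.2 ∈ darts ps := List.mem_flatMap.2 ⟨p, hp, by simp⟩
      obtain ⟨i1, i2, i3⟩ := ih h4 hp
      refine ⟨?_, ?_, i3⟩
      · rw [Function.update_of_ne, Function.update_of_ne, i1]
        · intro hq; exact h2 (hq ▸ hm1)
        · intro hq; exact h3 (hq ▸ hm1)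
      · rw [Function.update_of_ne, Function.update_of_ne, i2]
        · intro hq; exact h2 (hq ▸ hm2)
        · intro hq; exact h3 (hq ▸ hm2)

theorem overrideEdges_involutive {H : Type} (d : H → H) (hd : ∀ h, d (d h) = h)
    (ps : List (H × H)) (hps : (darts ps).Nodup) (hc : ∀ h ∈ darts ps, d h ∈ darts ps) :
    Function.Involutive (overrideEdges d ps) := by
  intro h
  by_cases hh : h ∈ darts ps
  · obtain ⟨p, hp, hm⟩ := List.mem_flatMap.1 hh
    obtain ⟨i1, i2, -⟩ := overrideEdges_of_mem d ps hps p hp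
    simp only [List.mem_cons, List.not_mem_nil, or_false] at hm
    rcases hm with rfl | rfl
    · rw [i1, i2]
    · rw [i2, i1]
  · have : d h ∉ darts ps := fun hm => hh (by simpa [hd] using hc _ hm)
    rw [overrideEdges_of_notMem d ps h hh, overrideEdges_of_notMem d ps _ this, hd]

/-- The diagram with the same vertices as `J` whose edges are those listed in `ps`, together with
the edges of `J` at the half-edges not occurring in `ps`. -/
def rewire (J : Diagram L) (ps : List (J.H × J.H)) (hps : (darts ps).Nodup)
    (hc : ∀ h ∈ darts ps, J.inv h ∈ darts ps) : Diagram L :=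
  { J with
    inv := (overrideEdges_involutive J.inv J.inv_inv ps hps hc).toPerm
    inv_inv := overrideEdges_involutive J.inv J.inv_inv ps hps hc
    inv_ne := fun h hh => by
      change overrideEdges J.inv ps h = h at hh
      by_cases hm : h ∈ darts ps
      · obtain ⟨p, hp, hm⟩ := List.mem_flatMap.1 hm
        obtain ⟨i1, i2, i3⟩ := overrideEdges_of_mem J.inv ps hps p hp
        simp only [List.mem_cons, List.not_mem_nil, or_false] at hm
        rcases hm with rfl | rfl
        · exact i3 (hh.symm.trans i1)
        · exact i3 (i2.symm.trans hh)
      · rw [overrideEdges_of_notMem _ ps h hm] at hh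
        exact J.inv_ne h hh }

/-! ### Eyeglass diagrams and the associated theta diagrams -/

/-- The edges of an eyeglass graph. The line leaves the left joint through `u`, passes the vertices
carrying the trees `line` (above the line), and arrives at the right joint through `v`; the left and
right circles, both followed clockwise from their joint, carry the trees `left` and `right` outside
of the circle. -/
def eyeglassEdges {H : Type} (rot : Equiv.Perm H) (u v : H) (left line right : List H) :
    List (H × H) :=
  path rot (rot.symm u) (onLeft left) (rot u) ++ path rot u (onLeft line) v ++
    path rot (rot.symm v) (onLeft right) (rot v)

/-- A presentation of `J` as an eyeglass diagram in which all trees on the line are above it and all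
trees on the two circles are outside. -/
structure EyeglassForm (J : Diagram L) where
  u : J.H
  v : J.H
  left : List J.H
  line : List J.H
  right : List J.H
  spine : J.SpineIs (eyeglassEdges J.rot u v left line right)

/-- The right-hand part of a theta diagram in the shuffle sums, from the upper to the lower end of
the vertical bar: the trees of the line which are in `S` sit above the upper strand, then comes the
right circle, then the remaining trees of the line sit above the lower strand, i.e. to the right
of the path, which runs backwards there. -/
def shuffleWord {H : Type} (line right : List H) (S : Finset H) : List (H × Bool) :=
  onLeft (line.filter (· ∈ S)) ++ onLeft right ++ onRight (line.filter (· ∉ S)).reverse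

/-- The spine of a term of the first sum. The upper and lower ends of the vertical bar `(u, v)` have,
counterclockwise, the half-edges bar, right, left and bar, left, right. -/
def thetaEdges {H : Type} (rot : Equiv.Perm H) (u v : H) (left line right : List H)
    (S : Finset H) : List (H × H) :=
  (u, v) :: (path rot (rot v) (onLeft left) (rot.symm u) ++
    path rot (rot u) (shuffleWord line right S) (rot.symm v))

/-- The spine of a term of the second sum: the two ends of the left arc are interchanged. -/
def crossedEdges {H : Type} (rot : Equiv.Perm H) (u v : H) (left line right : List H)
    (S : Finset H) : List (H × H) :=
  (u, v) :: (path rot (rot.symm u) (onLeft left) (rot v) ++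
    path rot (rot u) (shuffleWord line right S) (rot.symm v))

theorem darts_append {H : Type} (ps qs : List (H × H)) :
    darts (ps ++ qs) = darts ps ++ darts qs := List.flatMap_append

theorem darts_cons {H : Type} (p : H × H) (ps : List (H × H)) :
    darts (p :: ps) = p.1 :: p.2 :: darts ps := rfl

theorem count_darts_path {H : Type} (rot : Equiv.Perm H) (h x : H) (ms : List (H × Bool)) (y : H) :
    (darts (path rot x ms y)).count h =
      [x, y].count h + ((ms.map Prod.fst).map fun t => [rot t, rot.symm t].count h).sum := by
  induction ms generalizing x with
  | nil => simp [path, darts]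
  | cons m ms ih =>
    obtain ⟨t, s⟩ := m
    rw [path, darts_cons, List.count_cons, List.count_cons, ih]
    cases s <;> simp [inDart, outDart, List.count_cons] <;> omega

theorem sum_shuffleWord {H : Type} (line right : List H) (S : Finset H) (f : H → ℕ) :
    (((shuffleWord line right S).map Prod.fst).map f).sum =
      (line.map f).sum + (right.map f).sum := by
  have h : ∀ l : List H, ((l.filter (· ∈ S)).map f).sum + ((l.filter (· ∉ S)).map f).sum =
      (l.map f).sum := by
    intro l
    induction l with
    | nil => rfl
    | cons t l ih =>
      by_cases ht : t ∈ S
      · simp only [ht, List.filter_cons, List.map_cons, List.sum_cons, not_true, decide_true,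
          decide_false, if_true, Bool.false_eq_true, if_false] at ih ⊢
        omega
      · simp only [ht, List.filter_cons, List.map_cons, List.sum_cons, not_false_iff, decide_true,
          decide_false, if_true, Bool.false_eq_true, if_false] at ih ⊢
        omega
  rw [← h line]
  simp only [shuffleWord, onLeft, onRight, List.map_append, List.map_map, List.sum_append,
    List.map_reverse, List.sum_reverse]
  change (List.map f _).sum + (List.map f _).sum + (List.map f _).sum = _
  omega

theorem thetaEdges_perm {H : Type} (rot : Equiv.Perm H) (u v : H) (left line right : List H)
    (S : Finset H) : (darts (thetaEdges rot u v left line right S)).Perm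
      (darts (eyeglassEdges rot u v left line right)) := by
  rw [List.perm_iff_count]
  intro h
  simp only [thetaEdges, eyeglassEdges, darts_append, darts_cons, List.count_append,
    List.count_cons, count_darts_path, sum_shuffleWord]
  simp only [onLeft, List.map_map, Function.comp_def, List.count_nil]
  omega

theorem crossedEdges_perm {H : Type} (rot : Equiv.Perm H) (u v : H) (left line right : List H)
    (S : Finset H) : (darts (crossedEdges rot u v left line right S)).Perm
      (darts (eyeglassEdges rot u v left line right)) := by
  rw [List.perm_iff_count]
  intro h
  simp only [crossedEdges, eyeglassEdges, darts_append, darts_cons, List.count_append,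
    List.count_cons, count_darts_path, sum_shuffleWord]
  simp only [onLeft, List.map_map, Function.comp_def, List.count_nil]
  omega

theorem SpineIs.closed {J : Diagram L} {ps qs : List (J.H × J.H)} (h : J.SpineIs ps)
    (hq : (darts qs).Perm (darts ps)) : ∀ x ∈ darts qs, J.inv x ∈ darts qs := by
  intro x hx
  rw [hq.mem_iff, h.mem_iff] at hx ⊢
  exact ⟨hx.2, by rw [J.inv_inv]; exact hx.1⟩

/-- The term of the first sum in which the trees in `S` sit on the upper strand. -/
def EyeglassForm.theta {J : Diagram L} (E : J.EyeglassForm) (S : Finset J.H) : Diagram L :=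
  J.rewire (thetaEdges J.rot E.u E.v E.left E.line E.right S)
    ((thetaEdges_perm ..).nodup_iff.2 E.spine.nodup) (E.spine.closed (thetaEdges_perm ..))

/-- The term of the second sum in which the trees in `S` sit on the upper strand. -/
def EyeglassForm.crossed {J : Diagram L} (E : J.EyeglassForm) (S : Finset J.H) : Diagram L :=
  J.rewire (crossedEdges J.rot E.u E.v E.left E.line E.right S)
    ((crossedEdges_perm ..).nodup_iff.2 E.spine.nodup) (E.spine.closed (crossedEdges_perm ..))

/-! ### Relations -/

/-- The diagram with the cyclic order reversed at the vertex of the half-edge `e`. -/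
def flip (J : Diagram L) (e : J.H) : Diagram L :=
  J.reattach (Equiv.swap (J.rot e) (J.rot.symm e))

/-- The edge of `e` joins two different trivalent vertices. -/
def IsInner (J : Diagram L) (e : J.H) : Prop :=
  J.rot e ≠ e ∧ J.rot (J.inv e) ≠ J.inv e ∧ J.inv e ≠ J.rot e ∧ J.inv e ≠ J.rot.symm e

/-- Draw the edge of `e` as the vertical bar of the letter I, with `e` at the top. The four other
strands at its ends are, counterclockwise from the upper right, `rot e`, `rot⁻¹ e`, `rot e'` and
`rot⁻¹ e'`, where `e' = inv e`. This is the diagram with I replaced by H. -/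
def toH (J : Diagram L) (e : J.H) : Diagram L :=
  J.reattach
    [J.rot e, J.rot.symm e, J.rot (J.inv e), J.rot.symm (J.inv e)].formPerm

/-- The diagram with I replaced by X (two crossing strands joined by a horizontal bar below the
crossing), see `toH`. -/
def toX (J : Diagram L) (e : J.H) : Diagram L :=
  J.reattach [J.rot.symm e, J.rot (J.inv e), J.rot.symm (J.inv e)].formPerm

end Diagram

/-- Isomorphism classes of Jacobi diagrams. -/
abbrev IsoClass (L : Type) : Type 1 := Quotient (Diagram.setoid L)

/-- The isomorphism class of a diagram. -/
def cls (J : Diagram L) : IsoClass L := Quotient.mk _ J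

/-- The set of connected Jacobi diagrams with `n` trivalent vertices and first Betti number two. -/
def TwoLoop (L : Type) (n : ℕ) : Set (IsoClass L) := {c | ∃ J, cls J = c ∧ J.IsTwoLoop n}

/-- The subset of the diagrams whose spine is the theta graph. -/
def Theta (L : Type) (n : ℕ) : Set (IsoClass L) :=
  {c | ∃ J, cls J = c ∧ J.IsTwoLoop n ∧ J.HasThetaSpine}

theorem theta_subset (L : Type) (n : ℕ) : Theta L n ⊆ TwoLoop L n :=
  fun _ ⟨J, h, hJ, _⟩ => ⟨J, h, hJ⟩

section Modules

variable (D : Set (IsoClass L))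

/-- The free abelian group on the set of diagrams `D`. -/
abbrev Free : Type 1 := D →₀ ℤ

/-- The generator given by a diagram. -/
def gen (J : Diagram L) (h : cls J ∈ D) : Free D := Finsupp.single ⟨cls J, h⟩ 1

/-- The AS relators among diagrams in `D`. -/
def relAS : Set (Free D) :=
  {x | ∃ (J : Diagram L) (e : J.H) (h : cls J ∈ D) (h' : cls (J.flip e) ∈ D),
    J.rot e ≠ e ∧ x = gen D J h + gen D (J.flip e) h'}

/-- The IHX relators among diagrams in `D`. -/
def relIHX : Set (Free D) :=
  {x | ∃ (J : Diagram L) (e : J.H) (h : cls J ∈ D) (h' : cls (J.toH e) ∈ D)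
    (h'' : cls (J.toX e) ∈ D),
    J.IsInner e ∧ x = gen D J h - gen D (J.toH e) h' + gen D (J.toX e) h''}

/-- The self-loop relators in `D`: diagrams with an edge joining a vertex to itself. -/
def relLoop : Set (Free D) :=
  {x | ∃ (J : Diagram L) (e : J.H) (h : cls J ∈ D), J.inv e = J.rot e ∧ x = gen D J h}

end Modules

/-- The free abelian group on the 2-loop diagrams modulo the AS relation. -/
abbrev TwoLoopModAS (L : Type) (n : ℕ) : Type 1 :=
  Free (TwoLoop L n) ⧸ Submodule.span ℤ (relAS (TwoLoop L n))

/-- The module of 2-loop diagrams modulo the AS, IHX and self-loop relations. -/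
abbrev A2 (L : Type) (n : ℕ) : Type 1 :=
  Free (TwoLoop L n) ⧸ Submodule.span ℤ
    (relAS (TwoLoop L n) ∪ relIHX (TwoLoop L n) ∪ relLoop (TwoLoop L n))

/-- The free abelian group on the theta diagrams modulo the AS and IHX relators among them. -/
abbrev ThetaMod (L : Type) (n : ℕ) : Type 1 :=
  Free (Theta L n) ⧸ Submodule.span ℤ (relAS (Theta L n) ∪ relIHX (Theta L n))

/-- The inclusion of the free abelian group on theta diagrams into that on 2-loop diagrams. -/
def incl (L : Type) (n : ℕ) : Free (Theta L n) →ₗ[ℤ] Free (TwoLoop L n) :=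
  Finsupp.lmapDomain ℤ ℤ (Set.inclusion (theta_subset L n))

/-- The class of a 2-loop diagram modulo AS. -/
def modAS {n : ℕ} (J : Diagram L) (h : cls J ∈ TwoLoop L n) : TwoLoopModAS L n :=
  Submodule.Quotient.mk (gen _ J h)

/-- The class of a theta diagram. -/
def thetaMk {n : ℕ} (J : Diagram L) (h : cls J ∈ Theta L n) : ThetaMod L n :=
  Submodule.Quotient.mk (gen _ J h)

/-- `f` is the identity on theta diagrams, and is given on eyeglass diagrams by the difference of
the two shuffle sums (whose terms are theta diagrams). -/
structure IsRewriting {n : ℕ} (f : TwoLoopModAS L n →ₗ[ℤ] ThetaMod L n) : Prop where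
  theta : ∀ (J : Diagram L) (h : cls J ∈ Theta L n),
    f (modAS J (theta_subset L n h)) = thetaMk J h
  eyeglass : ∀ (J : Diagram L) (h : cls J ∈ TwoLoop L n) (E : J.EyeglassForm),
    ∃ (h₁ : ∀ S, cls (E.theta S) ∈ Theta L n) (h₂ : ∀ S, cls (E.crossed S) ∈ Theta L n),
      f (modAS J h) = ∑ S ∈ E.line.toFinset.powerset, thetaMk (E.theta S) (h₁ S) -
        ∑ S ∈ E.line.toFinset.powerset, thetaMk (E.crossed S) (h₂ S)

end Jacobi

end

noncomputable section
namespace Jacobi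
variable {L : Type}

/-! Collapsing the edges at univalent vertices leaves a spine with trees attached. For first Betti
number two the spine has exactly two trivalent vertices (joints), so a diagram is described by three
words of trees, written along the three strands of an eyeglass or of a theta graph
(`IsTwoLoop.classification`).

By AS and IHX inside the trees, at their roots and between neighbouring trees, a word matters only
through its image in the free associative ring on the labels: a tree is a Lie element, a tree to the
right of its strand gets a minus sign, juxtaposition is multiplication, and reading a strand
backwards is the antipode `S`. Hence the class of a theta diagram extends to a triadditive form
`θ(a, b, c)` in its arms (`thetaForm_wordAlg`). It is symmetric in the arms, satisfies `θ(a, b, c) =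
θ(S a, S c, S b)`, and IHX at a joint gives `θ(xa, b, c) + θ(a, xb, c) + θ(a, b, xc) = 0` for a
label `x` (`isThetaForm_thetaForm`).

In the shuffle sums each tree of the line goes either to the upper strand, where it multiplies the
right circle `r` from the left, or to the lower strand, where it multiplies from the right with a
sign. Summing over all subsets is therefore the adjoint action of the line `m` on `r`
(`sum_shuffleWord_eq_adj`). The crossed and uncrossed left arcs give `l` and `S l`, so the value of
`f` on an eyeglass diagram is `E(l, m, r) = θ(1, ad(m) r, S l - l)`.

What has to be checked is now algebra. The words of an eyeglass are unique up to half a turn of the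
picture, and `E(r, S m, l) = E(l, m, r)` (`eyeglassForm_swap`). AS at a joint holds because `E(S l,
m, r) = -E(l, m, r)`, and self-loops vanish because `E(1, m, r) = 0`. IHX inside or at the root of a
tree is the Jacobi identity or the expansion of a bracket; IHX at the line is `E(l, T m, r) = -E([T,
l], m, r)`, or the definition of `E` if the line is bare. Modulo AS the three diagrams of an IHX
relator play interchangeable roles, and this reduces the remaining edges to these cases
(`respectsIHX`). If none of the three is an eyeglass, the relator lies among the theta diagrams.

The map so obtained is the identity on theta diagrams. Conversely IHX moves the trees of a line one
by one onto the circle and finally opens the bare line into two theta diagrams, so theta diagrams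
generate the whole quotient (`thetaIncl_surjective`) and the two maps are mutually inverse. -/

/-- Rooted planar binary trees with labelled leaves. -/
inductive RTree (L : Type)
  | leaf (l : L)
  | node (A B : RTree L)

/-- A sequence of rooted trees, each attached to the left (`true`) or right of a strand. -/
abbrev Word (L : Type) := List (RTree L × Bool)

/-- The word read along the strand with the opposite direction. -/
def bar {α : Type} (w : List (α × Bool)) : List (α × Bool) :=
  (w.map fun m => (m.1, !m.2)).reverse

@[simp] theorem bar_nil {α : Type} : bar ([] : List (α × Bool)) = [] := rfl

@[simp] theorem bar_cons {α : Type} (m : α × Bool) (w : List (α × Bool)) :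
    bar (m :: w) = bar w ++ [(m.1, !m.2)] := by simp [bar]

@[simp] theorem bar_append {α : Type} (v w : List (α × Bool)) :
    bar (v ++ w) = bar w ++ bar v := by simp [bar]

@[simp] theorem bar_bar {α : Type} (w : List (α × Bool)) : bar (bar w) = w := by
  induction w with
  | nil => rfl
  | cons m w ih => simp [ih]

namespace Diagram

/-! ### Trees, paths and skeletons, with the multiset of half-edges they use -/

section Components

variable {H : Type} (rot : Equiv.Perm H) (lab : H → Option L) (inv : Equiv.Perm H)

/-- The half-edges at the vertex of `h`. -/
def orb (h : H) : Multiset H := {h} + {rot h} + {rot.symm h}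

/-- On its side containing the vertex of `h`, the edge of `h` ends in the rooted tree `T`, whose
vertices have the half-edges `M`. -/
inductive IsTree : H → RTree L → Multiset H → Prop
  | leaf (h : H) (l : L) : rot h = h → lab h = some l → IsTree h (.leaf l) {h}
  | node (h : H) (A B : RTree L) (M N : Multiset H) : rot h ≠ h →
      IsTree (inv (rot h)) A M → IsTree (inv (rot.symm h)) B N →
      IsTree h (.node A B) (orb rot h + M + N)

/-- Starting through the half-edge `x` and passing trees according to the word `w` one arrives at
the half-edge `y`; the vertices in between (including those of the trees) have half-edges `M`. -/
inductive IsPath : H → Word L → H → Multiset H → Prop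
  | nil (x : H) : IsPath x [] (inv x) 0
  | cons (x t : H) (T : RTree L) (s : Bool) (w : Word L) (y : H) (M N : Multiset H) :
      inv x = inDart rot (t, s) → rot t ≠ t → IsTree rot lab inv (inv t) T M →
      IsPath (outDart rot (t, s)) w y N → IsPath x ((T, s) :: w) y (orb rot t + M + N)

/-- A collection of paths, with half-edges `M` (end points included). -/
inductive ArePaths : List (H × Word L × H) → Multiset H → Prop
  | nil : ArePaths [] 0
  | cons (x : H) (w : Word L) (y : H) (P : List (H × Word L × H)) (M N : Multiset H) :
      IsPath rot lab inv x w y M → ArePaths P N →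
      ArePaths ((x, w, y) :: P) ({x} + {y} + M + N)

/-- The end points of a collection of paths. -/
def ends {H L : Type} (P : List (H × Word L × H)) : Multiset H :=
  (P.map fun p => ({p.1} + {p.2.2} : Multiset H)).sum

/-- The graph consists of the vertices of `u` and `v` and of the paths `P` between them. -/
def Skeleton (u v : H) (P : List (H × Word L × H)) : Prop :=
  ends P = orb rot u + orb rot v ∧ ∃ M, ArePaths rot lab inv P M ∧ ∀ h, M.count h = 1

variable {rot lab inv}

theorem self_mem_orb (h : H) : h ∈ orb rot h := by simp [orb]

theorem rot_mem_orb (h : H) : rot h ∈ orb rot h := by simp [orb]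

theorem rot_symm_mem_orb (h : H) : rot.symm h ∈ orb rot h := by simp [orb]

theorem mem_orb {h x : H} : x ∈ orb rot h ↔ x = h ∨ x = rot h ∨ x = rot.symm h := by
  simp [orb]

theorem rot_rot (hr : ∀ h, rot (rot (rot h)) = h) (h : H) : rot (rot h) = rot.symm h := by
  rw [Equiv.eq_symm_apply, hr]

theorem symm_symm (hr : ∀ h, rot (rot (rot h)) = h) (h : H) : rot.symm (rot.symm h) = rot h := by
  rw [Equiv.symm_apply_eq, Equiv.symm_apply_eq, hr]

theorem rot_eq_symm_iff (hr : ∀ h, rot (rot (rot h)) = h) (h : H) :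
    rot h = rot.symm h ↔ rot h = h := by
  rw [Equiv.eq_symm_apply]
  constructor
  · intro e
    have := hr h
    rwa [e] at this
  · intro e; rw [e, e]

theorem symm_eq_self_iff (h : H) : rot.symm h = h ↔ rot h = h := by
  rw [Equiv.symm_apply_eq, eq_comm]

theorem rot_rot_ne {t : H} (ht : rot t ≠ t) : rot (rot t) ≠ rot t := fun h => ht (rot.injective h)

theorem rot_symm_ne {t : H} (ht : rot t ≠ t) : rot (rot.symm t) ≠ rot.symm t := by
  rw [Equiv.apply_symm_apply]
  intro h
  exact ht (by rw [Equiv.eq_symm_apply] at h; exact h)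

theorem orb_rot (hr : ∀ h, rot (rot (rot h)) = h) (h : H) : orb rot (rot h) = orb rot h := by
  simp only [orb, rot_rot hr, Equiv.symm_apply_apply]; abel

theorem orb_symm (hr : ∀ h, rot (rot (rot h)) = h) (h : H) :
    orb rot (rot.symm h) = orb rot h := by
  simp only [orb, symm_symm hr, Equiv.apply_symm_apply]; abel

theorem map_rot_orb (hr : ∀ h, rot (rot (rot h)) = h) (h : H) :
    (orb rot h).map rot = orb rot h := by
  simp only [orb, Multiset.map_add, Multiset.map_singleton, rot_rot hr, Equiv.apply_symm_apply]
  abel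

theorem inDart_mem_orb (m : H × Bool) : inDart rot m ∈ orb rot m.1 := by
  unfold inDart; split <;> simp [orb]

theorem outDart_mem_orb (m : H × Bool) : outDart rot m ∈ orb rot m.1 := by
  unfold outDart; split <;> simp [orb]

@[simp] theorem inDart_true (t : H) : inDart rot (t, true) = rot t := rfl
@[simp] theorem outDart_true (t : H) : outDart rot (t, true) = rot.symm t := rfl
@[simp] theorem inDart_false (t : H) : inDart rot (t, false) = rot.symm t := rfl
@[simp] theorem outDart_false (t : H) : outDart rot (t, false) = rot t := rfl

theorem inDart_not (t : H) (s : Bool) : inDart rot (t, !s) = outDart rot (t, s) := by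
  cases s <;> rfl

theorem outDart_not (t : H) (s : Bool) : outDart rot (t, !s) = inDart rot (t, s) := by
  cases s <;> rfl

theorem orb_eq_darts (t : H) (s : Bool) :
    orb rot t = {t} + {inDart rot (t, s)} + {outDart rot (t, s)} := by
  cases s <;> simp only [orb, inDart_true, outDart_true, inDart_false, outDart_false]
  abel

theorem IsTree.root_mem {h : H} {T : RTree L} {M : Multiset H} (hT : IsTree rot lab inv h T M) :
    h ∈ M := by
  cases hT <;> simp [orb]

/-- The labels and the two permutations leave no choice: a univalent vertex forces a leaf, any other
vertex a node. Hence the words read along a strand are well defined. -/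
theorem IsTree.unique {h : H} {T T' : RTree L} {M M' : Multiset H}
    (hT : IsTree rot lab inv h T M) (hT' : IsTree rot lab inv h T' M') : T = T' ∧ M = M' := by
  induction hT generalizing T' M' with
  | leaf h l h1 h2 =>
    cases hT' with
    | leaf _ l' _ h2' => rw [h2, Option.some_inj] at h2'; exact ⟨by rw [h2'], rfl⟩
    | node _ _ _ _ _ h' => exact absurd h1 h'
  | node h A B M N h1 _ _ ihA ihB =>
    cases hT' with
    | leaf _ l' h' _ => exact absurd h' h1
    | node _ _ _ _ _ _ hA hB =>
      obtain ⟨rfl, rfl⟩ := ihA hA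
      obtain ⟨rfl, rfl⟩ := ihB hB
      exact ⟨rfl, rfl⟩

theorem IsPath.end_eq {x y : H} {M : Multiset H} (h : IsPath rot lab inv x [] y M) :
    inv x = y ∧ M = 0 := by
  cases h; exact ⟨rfl, rfl⟩

theorem IsPath.nil' {x y : H} (h : inv x = y) : IsPath rot lab inv x [] y 0 := by
  subst h; exact .nil x

theorem IsPath.append {x y z : H} {v w : Word L} {t : H} {T : RTree L} {s : Bool}
    {M N K : Multiset H} (h : IsPath rot lab inv x v y M) (hy : y = inDart rot (t, s))
    (ht : rot t ≠ t) (hT : IsTree rot lab inv (inv t) T N)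
    (hw : IsPath rot lab inv (outDart rot (t, s)) w z K) :
    IsPath rot lab inv x (v ++ (T, s) :: w) z (M + (orb rot t + N + K)) := by
  induction h with
  | nil x => simpa using IsPath.cons x t T s w z N K hy ht hT hw
  | cons x t' T' s' w' y' M' N' h1 h2 h3 h4 ih =>
    have := IsPath.cons x t' T' s' _ z M' _ h1 h2 h3 (ih hy)
    rw [← add_assoc] at this
    exact this

theorem IsPath.split {x z : H} {v w : Word L} {T : RTree L} {s : Bool} {M : Multiset H}
    (h : IsPath rot lab inv x (v ++ (T, s) :: w) z M) :
    ∃ t M₁ N M₂, IsPath rot lab inv x v (inDart rot (t, s)) M₁ ∧ rot t ≠ t ∧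
      IsTree rot lab inv (inv t) T N ∧ IsPath rot lab inv (outDart rot (t, s)) w z M₂ ∧
      M = M₁ + (orb rot t + N + M₂) := by
  induction v generalizing x M with
  | nil =>
    rw [List.nil_append] at h
    cases h with
    | cons x t T s w y M N h1 h2 h3 h4 =>
      exact ⟨t, 0, M, N, IsPath.nil' h1, h2, h3, h4, by simp⟩
  | cons m v ih =>
    rw [List.cons_append] at h
    cases h with
    | cons x t' T' s' _ y M' N' h1 h2 h3 h4 =>
      obtain ⟨t, M₁, N, M₂, k1, k2, k3, k4, rfl⟩ := ih h4
      exact ⟨t, _, N, M₂, .cons x t' T' s' v _ M' M₁ h1 h2 h3 k1, k2, k3, k4, by abel⟩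

/-- Backwards, a vertex is entered through its former outgoing half-edge, which puts its tree on the
other side; hence the negated sides in `bar`. -/
theorem IsPath.reverse (hi : ∀ h, inv (inv h) = h) {x y : H} {w : Word L} {M : Multiset H}
    (h : IsPath rot lab inv x w y M) : IsPath rot lab inv y (bar w) x M := by
  induction h with
  | nil x => exact IsPath.nil' (hi x)
  | cons x t T s w y M N h1 h2 h3 h4 ih =>
    have := ih.append (t := t) (s := !s) (w := []) (K := 0) (inDart_not t s).symm h2 h3
      (IsPath.nil' (y := x) (by rw [outDart_not, ← h1, hi]))
    rw [bar_cons]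
    convert this using 1
    abel

/-- Splits the path at a letter whose vertex or tree contains `d`, so that an operation at `d` can
be studied at that letter alone. -/
theorem IsPath.mem_cases {x y d : H} {w : Word L} {M : Multiset H}
    (h : IsPath rot lab inv x w y M) (hd : d ∈ M) :
    ∃ w₁ T s w₂, w = w₁ ++ (T, s) :: w₂ ∧ ∃ t M₁ N M₂,
      IsPath rot lab inv x w₁ (inDart rot (t, s)) M₁ ∧ rot t ≠ t ∧
      IsTree rot lab inv (inv t) T N ∧ IsPath rot lab inv (outDart rot (t, s)) w₂ y M₂ ∧
      M = M₁ + (orb rot t + N + M₂) ∧ (d ∈ orb rot t ∨ d ∈ N) := by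
  induction h with
  | nil x => simp at hd
  | cons x t T s w y M N h1 h2 h3 h4 ih =>
    by_cases hd' : d ∈ orb rot t ∨ d ∈ M
    · exact ⟨[], T, s, w, rfl, t, 0, M, N, IsPath.nil' h1, h2, h3, h4, by simp, hd'⟩
    · have : d ∈ N := by simp only [Multiset.mem_add] at hd; tauto
      obtain ⟨w₁, T', s', w₂, rfl, t', M₁, N', M₂, k1, k2, k3, k4, rfl, k5⟩ := ih this
      exact ⟨(T, s) :: w₁, T', s', w₂, rfl, t', _, N', M₂,
        .cons x t T s w₁ _ M M₁ h1 h2 h3 k1, k2, k3, k4, by abel, k5⟩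

theorem ends_cons {x y : H} {w : Word L} {P : List (H × Word L × H)} :
    ends ((x, w, y) :: P) = {x} + {y} + ends P := by simp [ends]

@[simp] theorem ends_nil : ends ([] : List (H × Word L × H)) = 0 := rfl

theorem ArePaths.ends_le {P : List (H × Word L × H)} {M : Multiset H}
    (h : ArePaths rot lab inv P M) : ends P ≤ M := by
  induction h with
  | nil => simp
  | cons x w y P M N h1 h2 ih =>
    rw [ends_cons, add_assoc _ M]
    exact add_le_add le_rfl (ih.trans (by simp))

theorem ArePaths.perm {P Q : List (H × Word L × H)} (hPQ : P.Perm Q) {M : Multiset H}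
    (h : ArePaths rot lab inv P M) : ArePaths rot lab inv Q M := by
  induction hPQ generalizing M with
  | nil => exact h
  | cons p _ ih =>
    cases h with
    | cons x w y P M N h1 h2 => exact .cons _ _ _ _ _ _ h1 (ih h2)
  | swap p q l =>
    cases h with
    | cons x w y P M N h1 h2 =>
      cases h2 with
      | cons x' w' y' P' M' N' h1' h2' =>
        convert ArePaths.cons _ _ _ _ _ _ h1' (.cons _ _ _ _ _ _ h1 h2') using 1
        abel
  | trans _ _ ih1 ih2 => exact ih2 (ih1 h)

theorem ends_perm {P Q : List (H × Word L × H)} (hPQ : P.Perm Q) : ends P = ends Q :=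
  (hPQ.map _).sum_eq

theorem Skeleton.perm {P Q : List (H × Word L × H)} (hPQ : P.Perm Q) {u v : H}
    (h : Skeleton rot lab inv u v P) : Skeleton rot lab inv u v Q := by
  obtain ⟨h1, M, h2, h3⟩ := h
  exact ⟨by rw [← ends_perm hPQ, h1], M, h2.perm hPQ, h3⟩

theorem Skeleton.reverse_head (hi : ∀ h, inv (inv h) = h) {u v x y : H} {w : Word L}
    {P : List (H × Word L × H)} (h : Skeleton rot lab inv u v ((x, w, y) :: P)) :
    Skeleton rot lab inv u v ((y, bar w, x) :: P) := by
  obtain ⟨h1, M, h2, h3⟩ := h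
  refine ⟨by rw [← h1, ends_cons, ends_cons]; abel, M, ?_, h3⟩
  cases h2 with
  | cons x w y P M N k1 k2 =>
    convert ArePaths.cons _ _ _ _ _ _ (k1.reverse hi) k2 using 1
    abel

theorem Skeleton.swap {u v : H} {P : List (H × Word L × H)}
    (h : Skeleton rot lab inv u v P) : Skeleton rot lab inv v u P :=
  ⟨by rw [h.1, add_comm], h.2⟩

/-! ### Conjugating the pairing -/

theorem IsTree.conj {π : Equiv.Perm H} {h : H} {T : RTree L} {M : Multiset H}
    (hT : IsTree rot lab inv h T M) (hπ : ∀ z ∈ M, π z = z) :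
    IsTree rot lab (π⁻¹ * inv * π) h T M := by
  induction hT with
  | leaf h l h1 h2 => exact .leaf h l h1 h2
  | node h A B M N h1 hA hB ihA ihB =>
    have e : ∀ z ∈ orb rot h + M + N, π⁻¹ z = z := fun z hz => by
      rw [Equiv.Perm.inv_eq_iff_eq, hπ z hz]
    refine .node h A B M N h1 ?_ ?_
    · rw [Equiv.Perm.mul_apply, Equiv.Perm.mul_apply, hπ (rot h) (by simp [orb]),
        e _ (by simp [hA.root_mem])]
      exact ihA fun z hz => hπ z (by simp [hz])
    · rw [Equiv.Perm.mul_apply, Equiv.Perm.mul_apply, hπ (rot.symm h) (by simp [orb]),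
        e _ (by simp [hB.root_mem])]
      exact ihB fun z hz => hπ z (by simp [hz])

/-- The permutation may move the two end points but nothing in between, so the outer edges are
re-hung at the preimages of `x` and `y` and the rest of the path is untouched. -/
theorem IsPath.conj {π : Equiv.Perm H} {x y : H} {w : Word L} {M : Multiset H}
    (h : IsPath rot lab inv x w y M) (hπ : ∀ z ∈ M, π z = z) :
    IsPath rot lab (π⁻¹ * inv * π) (π⁻¹ x) w (π⁻¹ y) M := by
  induction h with
  | nil x => exact IsPath.nil' (by simp)
  | cons x t T s w y M N h1 h2 h3 h4 ih =>
    have e : ∀ z ∈ orb rot t + M + N, π⁻¹ z = z := fun z hz => by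
      rw [Equiv.Perm.inv_eq_iff_eq, hπ z hz]
    refine .cons _ t T s w _ M N ?_ h2 ?_ ?_
    · have := e (inDart rot (t, s)) (by simp [inDart_mem_orb (t, s)])
      change π⁻¹ (inv (π (π.symm x))) = _
      rw [π.apply_symm_apply, h1, this]
    · rw [Equiv.Perm.mul_apply, Equiv.Perm.mul_apply, hπ t (by simp [orb]),
        e _ (by simp [h3.root_mem])]
      exact h3.conj fun z hz => hπ z (by simp [hz])
    · have := ih fun z hz => hπ z (by simp [hz])
      rwa [e _ (by simp [outDart_mem_orb (t, s)])] at this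

theorem ArePaths.conj {π : Equiv.Perm H} {P : List (H × Word L × H)} {M : Multiset H}
    (h : ArePaths rot lab inv P M) (hπ : ∀ z ∈ M, π z = z) :
    ArePaths rot lab (π⁻¹ * inv * π) P M := by
  induction h with
  | nil => exact .nil
  | cons x w y P M N h1 h2 ih =>
    refine .cons _ _ _ _ _ _ ?_ (ih fun z hz => hπ z (by simp [hz]))
    have := h1.conj (π := π) fun z hz => hπ z (by simp [hz])
    rwa [Equiv.Perm.inv_eq_iff_eq.2 (hπ x (by simp)).symm,
      Equiv.Perm.inv_eq_iff_eq.2 (hπ y (by simp)).symm] at this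

/-! ### Transport along isomorphisms -/

section Transport

variable {H' : Type} {rot' : Equiv.Perm H'} {lab' : H' → Option L} {inv' : Equiv.Perm H'}
  (φ : H ≃ H')

theorem map_symm_of_map (hrot : ∀ h, φ (rot h) = rot' (φ h))
    (h : H) : φ (rot.symm h) = rot'.symm (φ h) := by
  rw [Equiv.eq_symm_apply, ← hrot, Equiv.apply_symm_apply]

theorem map_orb (hrot : ∀ h, φ (rot h) = rot' (φ h))
    (h : H) : (orb rot h).map φ = orb rot' (φ h) := by
  simp [orb, hrot, map_symm_of_map φ hrot]

theorem map_inDart (hrot : ∀ h, φ (rot h) = rot' (φ h))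
    (m : H × Bool) : φ (inDart rot m) = inDart rot' (φ m.1, m.2) := by
  unfold inDart; split <;> simp_all [map_symm_of_map φ hrot]

theorem map_outDart (hrot : ∀ h, φ (rot h) = rot' (φ h))
    (m : H × Bool) : φ (outDart rot m) = outDart rot' (φ m.1, m.2) := by
  unfold outDart; split <;> simp_all [map_symm_of_map φ hrot]

theorem IsTree.map (hrot : ∀ h, φ (rot h) = rot' (φ h))
    (hinv : ∀ h, φ (inv h) = inv' (φ h)) (hlab : ∀ h, lab' (φ h) = lab h)
    {h : H} {T : RTree L} {M : Multiset H} (hT : IsTree rot lab inv h T M) :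
    IsTree rot' lab' inv' (φ h) T (M.map φ) := by
  induction hT with
  | leaf h l h1 h2 => exact .leaf _ l (by rw [← hrot, h1]) (by rw [hlab, h2])
  | node h A B M N h1 hA hB ihA ihB =>
    rw [Multiset.map_add, Multiset.map_add, map_orb φ hrot]
    refine .node _ A B _ _ (by rwa [← hrot, Ne, φ.apply_eq_iff_eq]) ?_ ?_
    · rwa [← hrot, ← hinv]
    · rwa [← map_symm_of_map φ hrot, ← hinv]

theorem IsPath.map (hrot : ∀ h, φ (rot h) = rot' (φ h))
    (hinv : ∀ h, φ (inv h) = inv' (φ h)) (hlab : ∀ h, lab' (φ h) = lab h)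
    {x y : H} {w : Word L} {M : Multiset H} (h : IsPath rot lab inv x w y M) :
    IsPath rot' lab' inv' (φ x) w (φ y) (M.map φ) := by
  induction h with
  | nil x => exact IsPath.nil' (hinv x).symm
  | cons x t T s w y M N h1 h2 h3 h4 ih =>
    rw [Multiset.map_add, Multiset.map_add, map_orb φ hrot]
    refine .cons _ (φ t) T s w _ _ _ ?_ (by rwa [← hrot, Ne, φ.apply_eq_iff_eq]) ?_ ?_
    · rw [← hinv, h1, map_inDart φ hrot]
    · rw [← hinv]; exact h3.map φ hrot hinv hlab
    · rwa [map_outDart φ hrot] at ih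

theorem ArePaths.map (hrot : ∀ h, φ (rot h) = rot' (φ h))
    (hinv : ∀ h, φ (inv h) = inv' (φ h)) (hlab : ∀ h, lab' (φ h) = lab h)
    {P : List (H × Word L × H)} {M : Multiset H}
    (h : ArePaths rot lab inv P M) :
    ArePaths rot' lab' inv' (P.map fun p => (φ p.1, p.2.1, φ p.2.2)) (M.map φ) := by
  induction h with
  | nil => exact .nil
  | cons x w y P M N h1 h2 ih =>
    simp only [Multiset.map_add, Multiset.map_singleton, List.map_cons]
    exact .cons _ _ _ _ _ _ (h1.map φ hrot hinv hlab) ih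

theorem Skeleton.map (hrot : ∀ h, φ (rot h) = rot' (φ h))
    (hinv : ∀ h, φ (inv h) = inv' (φ h)) (hlab : ∀ h, lab' (φ h) = lab h)
    {u v : H} {P : List (H × Word L × H)}
    (h : Skeleton rot lab inv u v P) :
    Skeleton rot' lab' inv' (φ u) (φ v) (P.map fun p => (φ p.1, p.2.1, φ p.2.2)) := by
  obtain ⟨h1, M, h2, h3⟩ := h
  refine ⟨?_, _, h2.map φ hrot hinv hlab, fun h => ?_⟩
  · rw [← map_orb φ hrot, ← map_orb φ hrot, ← Multiset.map_add, ← h1]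
    clear h1 h2
    induction P with
    | nil => rfl
    | cons p P ih => simp only [ends, List.map_cons, List.sum_cons, Multiset.map_add] at ih ⊢
                     rw [ih]; simp
  · rw [← φ.apply_symm_apply h, Multiset.count_map_eq_count' φ M φ.injective, h3]

end Transport

end Components


/-! ### Counting half-edges -/

section Counting

variable {H : Type} {rot : Equiv.Perm H} {lab : H → Option L} {inv : Equiv.Perm H}

theorem countP_orb {h : H} (hh : rot h ≠ h) :
    (orb rot h).countP (fun x => rot x ≠ x) = 3 ∧ (orb rot h).countP (fun x => rot x = x) = 0 := by
  have h1 : rot (rot h) ≠ rot h := rot_rot_ne hh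
  have h2 : rot (rot.symm h) ≠ rot.symm h := rot_symm_ne hh
  constructor
  · rw [Multiset.countP_eq_card.2]
    · simp [orb]
    · intro x hx
      rcases mem_orb.1 hx with rfl | rfl | rfl <;> assumption
  · rw [Multiset.countP_eq_zero]
    intro x hx
    rcases mem_orb.1 hx with rfl | rfl | rfl <;> assumption

theorem IsTree.map_rot (hr : ∀ h, rot (rot (rot h)) = h) {h : H} {T : RTree L} {M : Multiset H}
    (hT : IsTree rot lab inv h T M) : M.map rot = M := by
  induction hT with
  | leaf h l h1 h2 => simp [h1]
  | node h A B M N h1 hA hB ihA ihB => simp [map_rot_orb hr, ihA, ihB]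

/-- All edges of a tree except the root edge have both halves in `M`; adding the outer half of the
root edge restores closure under the pairing. -/
theorem IsTree.map_inv (hi : ∀ h, inv (inv h) = h) {h : H} {T : RTree L} {M : Multiset H}
    (hT : IsTree rot lab inv h T M) : ({inv h} + M).map inv = {inv h} + M := by
  induction hT with
  | leaf h l h1 h2 => simp [hi]; exact Multiset.pair_comm _ _
  | node h A B M N h1 hA hB ihA ihB =>
    simp only [hi, Multiset.map_add, Multiset.map_singleton, orb] at ihA ihB ⊢
    calc _ = {h} + {inv h} + ({inv (rot h)} + M.map inv) + ({inv (rot.symm h)} + N.map inv) := by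
          abel
      _ = _ := by rw [ihA, ihB]; abel

/-- A binary tree has one leaf more than it has nodes, and a node accounts for three half-edges. -/
theorem IsTree.countP {h : H} {T : RTree L} {M : Multiset H}
    (hT : IsTree rot lab inv h T M) :
    M.countP (fun x => rot x ≠ x) + 3 = 3 * M.countP (fun x => rot x = x) := by
  induction hT with
  | leaf h l h1 h2 => simp [← Multiset.cons_zero, h1]
  | node h A B M N h1 hA hB ihA ihB =>
    simp only [Multiset.countP_add, countP_orb h1]
    omega

theorem IsPath.map_rot (hr : ∀ h, rot (rot (rot h)) = h) {x y : H} {w : Word L} {M : Multiset H}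
    (h : IsPath rot lab inv x w y M) : M.map rot = M := by
  induction h with
  | nil x => rfl
  | cons x t T s w y M N h1 h2 h3 h4 ih => simp [map_rot_orb hr, h3.map_rot hr, ih]

theorem IsPath.map_inv (hi : ∀ h, inv (inv h) = h) {x y : H} {w : Word L} {M : Multiset H}
    (h : IsPath rot lab inv x w y M) : ({x} + {y} + M).map inv = {x} + {y} + M := by
  induction h with
  | nil x => simp [hi]; exact Multiset.pair_comm _ _
  | cons x t T s w y M N h1 h2 h3 h4 ih =>
    have h3' := h3.map_inv hi
    have h1' : inv (inDart rot (t, s)) = x := by rw [← h1, hi]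
    simp only [hi, Multiset.map_add, Multiset.map_singleton, orb_eq_darts t s] at h3' ih ⊢
    rw [h1, h1']
    calc _ = {inDart rot (t, s)} + {x} + ({inv t} + M.map inv) +
          ({inv (outDart rot (t, s))} + {inv y} + N.map inv) := by abel
      _ = _ := by rw [h3', ih]; abel

/-- The vertex of a letter on the strand compensates for the one node its tree has less than leaves.
So the inside of a path is balanced, and only the joints contribute an excess. -/
theorem IsPath.countP {x y : H} {w : Word L} {M : Multiset H}
    (h : IsPath rot lab inv x w y M) :
    M.countP (fun x => rot x ≠ x) = 3 * M.countP (fun x => rot x = x) := by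
  induction h with
  | nil x => rfl
  | cons x t T s w y M N h1 h2 h3 h4 ih =>
    have := h3.countP
    simp only [Multiset.countP_add, countP_orb h2]
    omega

theorem ArePaths.map_inv (hi : ∀ h, inv (inv h) = h) {P : List (H × Word L × H)} {M : Multiset H}
    (h : ArePaths rot lab inv P M) : M.map inv = M := by
  induction h with
  | nil => rfl
  | cons x w y P M N h1 h2 ih => rw [Multiset.map_add, h1.map_inv hi, ih]

/-- Separates the end points from a balanced rest that is closed under rotation, so that the excess
of `M` is the excess of its end points. -/
theorem ArePaths.exists_inner (hr : ∀ h, rot (rot (rot h)) = h) {P : List (H × Word L × H)}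
    {M : Multiset H} (h : ArePaths rot lab inv P M) : ∃ M₀, M = ends P + M₀ ∧ M₀.map rot = M₀ ∧
      M₀.countP (fun x => rot x ≠ x) = 3 * M₀.countP (fun x => rot x = x) := by
  induction h with
  | nil => exact ⟨0, rfl, rfl, rfl⟩
  | cons x w y P M N h1 h2 ih =>
    obtain ⟨M₀, rfl, k2, k3⟩ := ih
    refine ⟨M + M₀, by rw [ends_cons]; abel, by rw [Multiset.map_add, h1.map_rot hr, k2], ?_⟩
    have := h1.countP
    simp only [Multiset.countP_add]
    omega

theorem count_eq_of_map_eq {M : Multiset H} {σ : Equiv.Perm H} (h : M.map σ = M) (x : H) :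
    M.count (σ x) = M.count x := by
  conv_lhs => rw [← h]
  exact Multiset.count_map_eq_count' σ M σ.injective x

theorem countP_eq_mul [Finite H] {M : Multiset H} {d : ℕ} (hd : ∀ h, M.count h = d)
    (p : H → Prop) [DecidablePred p] : M.countP p = d * Nat.card {h // p h} := by
  have := Fintype.ofFinite H
  rw [Nat.card_eq_fintype_card, Fintype.card_subtype, Multiset.countP_eq_card_filter,
    ← Multiset.toFinset_sum_count_eq]
  rw [Finset.sum_subset (Finset.subset_univ _) (fun x _ hx => Multiset.count_eq_zero.2 (by simpa using hx)),
    Finset.card_filter, Finset.mul_sum]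
  refine Finset.sum_congr rfl fun x _ => ?_
  rw [Multiset.count_filter, hd]
  split <;> simp

/-- In a connected graph, a collection of half-edges which is closed under passing to the other
half of the edge and to the other half-edges of the vertex covers all half-edges equally often. -/
theorem count_const {M : Multiset H} (hrot : M.map rot = M) (hinv : M.map inv = M)
    {x y : H} (hxy : Relation.EqvGen (fun a b => b = inv a ∨ b = rot a) x y) :
    M.count x = M.count y := by
  induction hxy with
  | rel a b h =>
    rcases h with rfl | rfl
    · exact (count_eq_of_map_eq hinv a).symm
    · exact (count_eq_of_map_eq hrot a).symm
  | refl => rfl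
  | symm _ _ _ ih => exact ih.symm
  | trans _ _ _ _ _ ih1 ih2 => exact ih1.trans ih2

end Counting

/-- This is the Euler characteristic: with `T` trivalent and `U` univalent half-edges, `T/3 + U - (T
+ U)/2 = -1`. -/
theorem IsTwoLoop.card_eq {n : ℕ} {J : Diagram L} (h : J.IsTwoLoop n) :
    Nat.card {h : J.H // J.rot h ≠ h} = 3 * Nat.card {h : J.H // J.rot h = h} + 6 := by
  obtain ⟨-, -, h⟩ := h
  have := J.finite
  have := Fintype.ofFinite J.H
  have e1 : Nat.card J.H = Nat.card {h : J.H // J.rot h = h} + Nat.card {h : J.H // J.rot h ≠ h} := by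
    rw [← Nat.card_sum]
    exact Nat.card_congr (Equiv.sumCompl fun h => J.rot h = h).symm
  -- A map of order three has orbits of size one or three, so the trivalent half-edges are divisible
  -- by three in number and the truncated division in `numTriv` is exact. The same argument modulo
  -- two, below, serves `numEdges`.
  have e2 : Nat.card J.H ≡ Nat.card {h : J.H // J.rot h = h} [MOD 3] := by
    have := Equiv.Perm.card_fixedPoints_modEq (f := (fun x => J.rot x : Function.End J.H)) (p := 3) (n := 1)
      (by funext x; exact J.rot_cube x)
    rw [← Nat.card_eq_fintype_card, ← Nat.card_eq_fintype_card] at this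
    exact this
  have e3 : Nat.card J.H ≡ 0 [MOD 2] := by
    have := Equiv.Perm.card_fixedPoints_modEq (f := (fun x => J.inv x : Function.End J.H)) (p := 2) (n := 1)
      (by funext x; exact J.inv_inv x)
    rw [← Nat.card_eq_fintype_card, ← Nat.card_eq_fintype_card] at this
    have h0 : IsEmpty (Function.fixedPoints (fun x => J.inv x : Function.End J.H)) :=
      ⟨fun x => J.inv_ne x.1 x.2⟩
    rwa [@Nat.card_of_isEmpty _ h0] at this
  unfold betti numTriv numUniv numEdges at h
  unfold Nat.ModEq at e2 e3
  omega

/-- Connectedness makes the multiplicity of a closed multiset a constant `d`, which multiplies the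
excess `6` of the whole diagram by `d`. Comparing excesses computes `d` without any argument about
disjointness. -/
theorem IsTwoLoop.count_eq {n : ℕ} {J : Diagram L} (h : J.IsTwoLoop n) {M : Multiset J.H}
    (hrot : M.map J.rot = M) (hinv : M.map J.inv = M) :
    ∃ d, (∀ h, M.count h = d) ∧
      M.countP (fun x => J.rot x ≠ x) = 3 * M.countP (fun x => J.rot x = x) + 6 * d := by
  have := J.finite
  obtain ⟨⟨x₀⟩, hc⟩ := h.1
  have hd : ∀ y, M.count y = M.count x₀ := fun y => count_const hrot hinv (hc y x₀)
  refine ⟨_, hd, ?_⟩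
  rw [countP_eq_mul hd, countP_eq_mul hd, h.card_eq]
  ring

/-- The six half-edges at the two joints give excess six and the inner parts give none, so the
multiplicity is one. This shows at once that the paths and trees are pairwise disjoint and that they
exhaust the diagram. -/
theorem IsTwoLoop.count_eq_one {n : ℕ} {J : Diagram L} (h : J.IsTwoLoop n) {u v : J.H}
    {P : List (J.H × Word L × J.H)} {M : Multiset J.H}
    (hP : ArePaths J.rot J.label J.inv P M)
    (hends : ends P = orb J.rot u + orb J.rot v) (hu : J.rot u ≠ u) (hv : J.rot v ≠ v) :
    ∀ z, M.count z = 1 := by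
  obtain ⟨M₀, h1, h2, h3⟩ := hP.exists_inner J.rot_cube
  have hrot : M.map J.rot = M := by
    rw [h1, hends]; simp [map_rot_orb J.rot_cube, h2]
  obtain ⟨d, hd, e⟩ := h.count_eq hrot (hP.map_inv J.inv_inv)
  rw [h1, hends] at e
  simp only [Multiset.countP_add, countP_orb hu, countP_orb hv] at e
  have : d = 1 := by omega
  exact this ▸ hd

theorem IsTwoLoop.skeleton {n : ℕ} {J : Diagram L} (h : J.IsTwoLoop n) {u v : J.H}
    {P : List (J.H × Word L × J.H)} {M : Multiset J.H}
    (hP : ArePaths J.rot J.label J.inv P M)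
    (hends : ends P = orb J.rot u + orb J.rot v) (hu : J.rot u ≠ u) (hv : J.rot v ≠ v) :
    Skeleton J.rot J.label J.inv u v P :=
  ⟨hends, M, hP, h.count_eq_one hP hends hu hv⟩


/-! ### Skeletons and spines -/

theorem exists_isTree_of_hanging {J : Diagram L} {h : J.H} (hh : J.Hanging h) :
    ∃ T M, IsTree J.rot J.label J.inv h T M := by
  have leaf : ∀ h, J.rot h = h → ∃ T M, IsTree J.rot J.label J.inv h T M := fun h h1 => by
    obtain ⟨l, hl⟩ := Option.isSome_iff_exists.1 ((J.label_isSome h).2 h1)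
    exact ⟨_, _, .leaf h l h1 hl⟩
  induction hh with
  | leaf h h1 => exact leaf h h1
  | node h hA hB ihA ihB =>
    -- `Hanging.node` is also available at a univalent vertex, where the tree has to be a leaf.
    by_cases h1 : J.rot h = h
    · exact leaf h h1
    · obtain ⟨A, M, hA⟩ := ihA
      obtain ⟨B, N, hB⟩ := ihB
      exact ⟨_, _, .node h A B M N h1 hA hB⟩

theorem IsTree.hanging {J : Diagram L} {h : J.H} {T : RTree L} {M : Multiset J.H}
    (hT : IsTree J.rot J.label J.inv h T M) : J.Hanging h := by
  induction hT with
  | leaf h l h1 h2 => exact .leaf h h1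
  | node h A B M N h1 hA hB ihA ihB => exact .node h ihA ihB

theorem IsTree.hanging_mem {J : Diagram L} {h : J.H} {T : RTree L} {M : Multiset J.H}
    (hT : IsTree J.rot J.label J.inv h T M) :
    ∀ x ∈ M, J.Hanging x ∨ J.Hanging (J.inv x) := by
  induction hT with
  | leaf h l h1 h2 =>
    intro x hx
    rw [Multiset.mem_singleton] at hx
    exact Or.inl (hx ▸ .leaf h h1)
  | node h A B M N h1 hA hB ihA ihB =>
    intro x hx
    simp only [Multiset.mem_add, mem_orb] at hx
    rcases hx with ((rfl | rfl | rfl) | hx) | hx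
    · exact Or.inl (.node _ hA.hanging hB.hanging)
    · exact Or.inr hA.hanging
    · exact Or.inr hB.hanging
    · exact ihA x hx
    · exact ihB x hx

/-- Every vertex met by a path or its trees has a collapsible edge, which prevents it from being a
joint. -/
theorem IsPath.exists_hanging {J : Diagram L} {x y : J.H} {w : Word L} {M : Multiset J.H}
    (h : IsPath J.rot J.label J.inv x w y M) :
    ∀ d ∈ M, ∃ d' ∈ orb J.rot d, J.Hanging d' ∨ J.Hanging (J.inv d') := by
  induction h with
  | nil x => simp
  | cons x t T s w y M N h1 h2 h3 h4 ih =>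
    intro d hd
    simp only [Multiset.mem_add, mem_orb] at hd
    rcases hd with ((rfl | rfl | rfl) | hd) | hd
    · exact ⟨_, self_mem_orb _, Or.inr h3.hanging⟩
    · exact ⟨t, by simp [mem_orb], Or.inr h3.hanging⟩
    · exact ⟨t, by simp [mem_orb], Or.inr h3.hanging⟩
    · exact ⟨_, self_mem_orb _, h3.hanging_mem d hd⟩
    · exact ih d hd

theorem ArePaths.exists_hanging {J : Diagram L} {P : List (J.H × Word L × J.H)}
    {M : Multiset J.H} (h : ArePaths J.rot J.label J.inv P M) :
    ∀ d ∈ M, d ∈ ends P ∨ ∃ d' ∈ orb J.rot d, J.Hanging d' ∨ J.Hanging (J.inv d') := by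
  induction h with
  | nil => simp
  | cons x w y P M N h1 h2 ih =>
    intro d hd
    rw [ends_cons]
    simp only [Multiset.mem_add] at hd ⊢
    rcases hd with (hd | hd) | hd
    · exact Or.inl (Or.inl hd)
    · exact Or.inr (h1.exists_hanging d hd)
    · rcases ih d hd with h | h
      · exact Or.inl (Or.inr h)
      · exact Or.inr h

/-- In a set of edges that can always be continued, the inductive construction of `Hanging` never
reaches a leaf, so nothing in the set is collapsed. -/
theorem not_hanging_of_closed {J : Diagram L} (D : Set J.H) (hinv : ∀ d ∈ D, J.inv d ∈ D)
    (hrot : ∀ d ∈ D, J.rot d ≠ d ∧ (J.rot d ∈ D ∨ J.rot.symm d ∈ D)) (d : J.H) (hd : d ∈ D) :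
    ¬ J.Hanging d := by
  intro hh
  induction hh with
  | leaf h h1 => exact (hrot h hd).1 h1
  | node h _ _ ihA ihB =>
    rcases (hrot h hd).2 with h' | h'
    · exact ihA (hinv _ h')
    · exact ihB (hinv _ h')

theorem mem_darts_path {H : Type} {rot : Equiv.Perm H} {d x y : H} {ms : List (H × Bool)} :
    d ∈ darts (path rot x ms y) ↔
      d = x ∨ d = y ∨ ∃ m ∈ ms, d = rot m.1 ∨ d = rot.symm m.1 := by
  rw [← List.count_pos_iff, count_darts_path]
  simp only [List.map_map, Nat.add_pos_iff_pos_or_pos, List.count_pos_iff, List.mem_cons,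
    List.not_mem_nil, or_false, List.sum_pos_iff_exists_pos_nat, or_assoc]
  simp [List.count_pos_iff]

theorem IsPath.exists_list {J : Diagram L} {x y : J.H} {w : Word L} {M : Multiset J.H}
    (h : IsPath J.rot J.label J.inv x w y M) :
    ∃ ms : List (J.H × Bool), ms.map Prod.snd = w.map Prod.snd ∧ (∀ m ∈ ms, J.rot m.1 ≠ m.1) ∧
      (∀ p ∈ path J.rot x ms y, J.inv p.1 = p.2) ∧
      ∃ N : Multiset J.H, (darts (path J.rot x ms y) : Multiset J.H) + N = {x} + {y} + M ∧
        ∀ h ∈ N, J.Hanging h ∨ J.Hanging (J.inv h) := by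
  induction h with
  | nil x => exact ⟨[], rfl, by simp, by simp [path], 0, by simp [path, darts]; rfl, by simp⟩
  | cons x t T s w y M N h1 h2 h3 h4 ih =>
    obtain ⟨ms, k1, k2, k3, N', k4, k5⟩ := ih
    refine ⟨(t, s) :: ms, by simp [k1], by simpa [h2] using k2, ?_, {t} + M + N', ?_, ?_⟩
    · intro p hp
      rcases List.mem_cons.1 hp with rfl | hp
      · exact h1
      · exact k3 p hp
    · rw [path, darts_cons, orb_eq_darts t s]
      rw [← Multiset.cons_coe, ← Multiset.cons_coe, ← Multiset.singleton_add,
        ← Multiset.singleton_add]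
      calc _ = {x} + {inDart J.rot (t, s)} + {t} + M +
            ((darts (path J.rot (outDart J.rot (t, s)) ms y) : Multiset J.H) + N') := by abel
        _ = _ := by rw [k4]; abel
    · intro h hh
      simp only [Multiset.mem_add, Multiset.mem_singleton] at hh
      rcases hh with (rfl | hh) | hh
      · exact Or.inr h3.hanging
      · exact h3.hanging_mem h hh
      · exact k5 h hh

/-- The edges of a collection of paths. -/
def pathEdges {H : Type} (rot : Equiv.Perm H) (Q : List (H × List (H × Bool) × H)) :
    List (H × H) :=
  Q.flatMap fun q => path rot q.1 q.2.1 q.2.2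

theorem ArePaths.exists_list {J : Diagram L} {P : List (J.H × Word L × J.H)} {M : Multiset J.H}
    (h : ArePaths J.rot J.label J.inv P M) :
    ∃ Q : List (J.H × List (J.H × Bool) × J.H),
      List.Forall₂ (fun p q => q.1 = p.1 ∧ q.2.2 = p.2.2 ∧
        q.2.1.map Prod.snd = p.2.1.map Prod.snd) P Q ∧
      (∀ q ∈ Q, ∀ m ∈ q.2.1, J.rot m.1 ≠ m.1) ∧
      (∀ p ∈ pathEdges J.rot Q, J.inv p.1 = p.2) ∧
      ∃ N : Multiset J.H, (darts (pathEdges J.rot Q) : Multiset J.H) + N = M ∧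
        ∀ h ∈ N, J.Hanging h ∨ J.Hanging (J.inv h) := by
  induction h with
  | nil => exact ⟨[], .nil, by simp, by simp [pathEdges], 0, by simp [pathEdges, darts], by simp⟩
  | cons x w y P M N h1 h2 ih =>
    obtain ⟨Q, k1, k2, k3, N', rfl, k5⟩ := ih
    obtain ⟨ms, l1, l2, l3, K, l4, l5⟩ := h1.exists_list
    refine ⟨(x, ms, y) :: Q, .cons ⟨rfl, rfl, l1⟩ k1, ?_, ?_, K + N', ?_, ?_⟩
    · intro q hq
      rcases List.mem_cons.1 hq with rfl | hq
      · exact l2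
      · exact k2 q hq
    · intro p hp
      rw [pathEdges, List.flatMap_cons, List.mem_append] at hp
      rcases hp with hp | hp
      · exact l3 p hp
      · exact k3 p hp
    · rw [← l4, pathEdges, List.flatMap_cons, darts_append, ← Multiset.coe_add, ← pathEdges]
      abel
    · intro h hh
      rcases Multiset.mem_add.1 hh with hh | hh
      · exact l5 h hh
      · exact k5 h hh

theorem mem_darts_iff {H : Type} {ps : List (H × H)} {d : H} :
    d ∈ darts ps ↔ ∃ p ∈ ps, d = p.1 ∨ d = p.2 := by
  simp [darts]

theorem mem_darts_pathEdges {H : Type} {rot : Equiv.Perm H}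
    {Q : List (H × List (H × Bool) × H)} {d : H} :
    d ∈ darts (pathEdges rot Q) ↔
      ∃ q ∈ Q, d = q.1 ∨ d = q.2.2 ∨ ∃ m ∈ q.2.1, d = rot m.1 ∨ d = rot.symm m.1 := by
  constructor
  · intro h
    obtain ⟨p, hp, hd⟩ := mem_darts_iff.1 h
    obtain ⟨q, hq, hp⟩ := List.mem_flatMap.1 hp
    exact ⟨q, hq, mem_darts_path.1 (mem_darts_iff.2 ⟨p, hp, hd⟩)⟩
  · rintro ⟨q, hq, h⟩
    obtain ⟨p, hp, hd⟩ := mem_darts_iff.1 (mem_darts_path.2 h)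
    exact mem_darts_iff.2 ⟨p, List.mem_flatMap.2 ⟨q, hq, hp⟩, hd⟩

theorem mem_ends {H L : Type} {P : List (H × Word L × H)} {d : H} :
    d ∈ ends P ↔ ∃ p ∈ P, d = p.1 ∨ d = p.2.2 := by
  induction P with
  | nil => simp
  | cons p P ih =>
    obtain ⟨x, w, y⟩ := p
    rw [ends_cons]
    simp [ih, or_assoc]

theorem exists_of_forall₂_left {α β : Type*} {R : α → β → Prop} {l : List α} {m : List β}
    (h : List.Forall₂ R l m) {a : α} (ha : a ∈ l) : ∃ b ∈ m, R a b := by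
  induction h with
  | nil => simp at ha
  | cons hab _ ih =>
    rcases List.mem_cons.1 ha with rfl | ha
    · exact ⟨_, List.mem_cons_self, hab⟩
    · obtain ⟨b, hb, h⟩ := ih ha
      exact ⟨b, List.mem_cons_of_mem _ hb, h⟩

theorem exists_of_forall₂_right {α β : Type*} {R : α → β → Prop} {l : List α} {m : List β}
    (h : List.Forall₂ R l m) {b : β} (hb : b ∈ m) : ∃ a ∈ l, R a b := by
  induction h with
  | nil => simp at hb
  | cons hab _ ih =>
    rcases List.mem_cons.1 hb with rfl | hb
    · exact ⟨_, List.mem_cons_self, hab⟩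
    · obtain ⟨a, ha, h⟩ := ih hb
      exact ⟨a, List.mem_cons_of_mem _ ha, h⟩

theorem Skeleton.nodup {H : Type} {rot : Equiv.Perm H} {lab : H → Option L} {inv : Equiv.Perm H}
    {u v : H} {P : List (H × Word L × H)} (h : Skeleton rot lab inv u v P) :
    (orb rot u + orb rot v).Nodup := by
  obtain ⟨h1, M, h2, h3⟩ := h
  rw [← h1]
  exact Multiset.nodup_of_le h2.ends_le (Multiset.nodup_iff_count_le_one.2 fun x => (h3 x).le)

theorem Skeleton.rot_ne {H : Type} {rot : Equiv.Perm H} {lab : H → Option L} {inv : Equiv.Perm H}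
    {u v : H} {P : List (H × Word L × H)} (h : Skeleton rot lab inv u v P) :
    rot u ≠ u ∧ rot v ≠ v := by
  have := h.nodup
  simp only [orb, Multiset.singleton_add, Multiset.cons_add, Multiset.nodup_cons, Multiset.mem_cons,
    Multiset.mem_singleton, not_or] at this
  exact ⟨Ne.symm this.1.1, Ne.symm this.2.2.2.1.1⟩

/-- The edges of the paths can be continued at both ends, so none of them collapses. Every other
half-edge lies in a tree or on the edge at its root, so its edge does collapse. -/
theorem Skeleton.exists_spineIs {J : Diagram L} {u v : J.H} {P : List (J.H × Word L × J.H)}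
    (h : Skeleton J.rot J.label J.inv u v P) :
    ∃ Q : List (J.H × List (J.H × Bool) × J.H),
      List.Forall₂ (fun p q => q.1 = p.1 ∧ q.2.2 = p.2.2 ∧
        q.2.1.map Prod.snd = p.2.1.map Prod.snd) P Q ∧ J.SpineIs (pathEdges J.rot Q) := by
  obtain ⟨hu, hv⟩ := h.rot_ne
  obtain ⟨h1, M, h2, h3⟩ := h
  obtain ⟨Q, k1, k2, k3, N, k4, k5⟩ := h2.exists_list
  have hinv : ∀ d ∈ darts (pathEdges J.rot Q), J.inv d ∈ darts (pathEdges J.rot Q) := by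
    intro d hd
    obtain ⟨p, hp, hd⟩ := mem_darts_iff.1 hd
    refine mem_darts_iff.2 ⟨p, hp, ?_⟩
    rcases hd with rfl | rfl
    · exact Or.inr (k3 p hp)
    · left; rw [← k3 p hp, J.inv_inv]
  have hends : ∀ d ∈ orb J.rot u + orb J.rot v, d ∈ darts (pathEdges J.rot Q) := by
    intro d hd
    rw [← h1] at hd
    obtain ⟨p, hp, hd⟩ := mem_ends.1 hd
    obtain ⟨q, hq, h1, h2, -⟩ := exists_of_forall₂_left k1 hp
    exact mem_darts_pathEdges.2 ⟨q, hq, by rw [h1, h2]; tauto⟩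
  have hends' : ∀ d ∈ orb J.rot u + orb J.rot v, J.rot d ≠ d ∧
      J.rot d ∈ darts (pathEdges J.rot Q) := by
    intro d hd
    refine ⟨?_, hends _ ?_⟩
    · simp only [Multiset.mem_add, mem_orb] at hd
      rcases hd with (rfl | rfl | rfl) | (rfl | rfl | rfl)
      exacts [hu, rot_rot_ne hu, rot_symm_ne hu, hv, rot_rot_ne hv, rot_symm_ne hv]
    · rw [← map_rot_orb J.rot_cube u, ← map_rot_orb J.rot_cube v, ← Multiset.map_add]
      exact Multiset.mem_map_of_mem _ hd
  have hrot : ∀ d ∈ darts (pathEdges J.rot Q), J.rot d ≠ d ∧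
      (J.rot d ∈ darts (pathEdges J.rot Q) ∨ J.rot.symm d ∈ darts (pathEdges J.rot Q)) := by
    intro d hd
    obtain ⟨q, hq, hd⟩ := mem_darts_pathEdges.1 hd
    obtain ⟨p, hp, e1, e2, -⟩ := exists_of_forall₂_right k1 hq
    rcases hd with hd | hd | ⟨m, hm, hd⟩
    · have := hends' d (by rw [← h1]; exact mem_ends.2 ⟨p, hp, Or.inl (hd.trans e1)⟩)
      exact ⟨this.1, Or.inl this.2⟩
    · have := hends' d (by rw [← h1]; exact mem_ends.2 ⟨p, hp, Or.inr (hd.trans e2)⟩)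
      exact ⟨this.1, Or.inl this.2⟩
    · rcases hd with rfl | rfl
      · refine ⟨rot_rot_ne (k2 q hq m hm), Or.inl ?_⟩
        rw [rot_rot J.rot_cube]
        exact mem_darts_pathEdges.2 ⟨q, hq, Or.inr (Or.inr ⟨m, hm, Or.inr rfl⟩)⟩
      · refine ⟨rot_symm_ne (k2 q hq m hm), Or.inr ?_⟩
        rw [symm_symm J.rot_cube]
        exact mem_darts_pathEdges.2 ⟨q, hq, Or.inr (Or.inr ⟨m, hm, Or.inl rfl⟩)⟩
  have hnot := not_hanging_of_closed {d | d ∈ darts (pathEdges J.rot Q)} hinv hrot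
  refine ⟨Q, k1, ?_, k3, fun d => ⟨fun hd => ⟨hnot d hd, hnot _ (hinv d hd)⟩, fun hd => ?_⟩⟩
  · rw [← Multiset.coe_nodup]
    refine Multiset.nodup_of_le (t := M) (k4 ▸ Multiset.le_add_right _ _) ?_
    exact Multiset.nodup_iff_count_le_one.2 fun x => (h3 x).le
  · have : d ∈ M := Multiset.count_pos.1 (by rw [h3]; simp)
    rw [← k4, Multiset.mem_add] at this
    rcases this with h | h
    · simpa using h
    · rcases k5 d h with h | h
      · exact absurd h hd.1
      · exact absurd h hd.2

theorem inSpine_inv {J : Diagram L} {h : J.H} : J.InSpine (J.inv h) ↔ J.InSpine h := by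
  unfold InSpine
  rw [J.inv_inv, and_comm]

/-- The vertex of `h` is trivalent in the spine. -/
def IsJoint (J : Diagram L) (h : J.H) : Prop := ∀ d ∈ orb J.rot h, J.InSpine d

theorem Skeleton.isJoint_iff {J : Diagram L} {u v : J.H} {P : List (J.H × Word L × J.H)}
    (h : Skeleton J.rot J.label J.inv u v P) (d : J.H) :
    J.IsJoint d ↔ d ∈ orb J.rot u ∨ d ∈ orb J.rot v := by
  rw [← Multiset.mem_add]
  obtain ⟨Q, k1, k2⟩ := h.exists_spineIs
  obtain ⟨h1, M, h2, h3⟩ := h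
  constructor
  · intro hd
    have : d ∈ M := Multiset.count_pos.1 (by rw [h3]; simp)
    rcases h2.exists_hanging d this with h | ⟨d', hd', h⟩
    · exact h1 ▸ h
    · have := hd d' hd'
      exact absurd h (not_or.2 this)
  · intro hd d' hd'
    rw [← k2.mem_iff]
    have hd' : d' ∈ orb J.rot u + orb J.rot v := by
      rw [Multiset.mem_add, mem_orb, mem_orb] at hd
      rcases hd with (rfl | rfl | rfl) | (rfl | rfl | rfl) <;>
        (try simp only [orb_rot J.rot_cube, orb_symm J.rot_cube] at hd') <;> simp [hd']
    rw [← h1] at hd'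
    obtain ⟨p, hp, hd⟩ := mem_ends.1 hd'
    obtain ⟨q, hq, h1, h2, -⟩ := exists_of_forall₂_left k1 hp
    exact mem_darts_pathEdges.2 ⟨q, hq, by rw [h1, h2]; tauto⟩

/-- A path in the spine, given by half-edges, yields a path passing trees. -/
theorem exists_isPath_of_path {J : Diagram L} (x y : J.H) (ms : List (J.H × Bool))
    (hedge : ∀ p ∈ path J.rot x ms y, J.inv p.1 = p.2)
    (hrot : ∀ m ∈ ms, J.rot m.1 ≠ m.1)
    (hms : ∀ m ∈ ms, J.Hanging (J.inv m.1)) :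
    ∃ w M, IsPath J.rot J.label J.inv x w y M ∧
      List.Forall₂ (fun m l => m.2 = l.2 ∧
        ∃ N, IsTree J.rot J.label J.inv (J.inv m.1) l.1 N) ms w := by
  induction ms generalizing x with
  | nil => exact ⟨[], 0, IsPath.nil' (hedge (x, y) (by simp [path])), .nil⟩
  | cons m ms ih =>
    obtain ⟨t, s⟩ := m
    obtain ⟨w, M, h1, h2⟩ := ih (outDart J.rot (t, s))
      (fun p hp => hedge p (List.mem_cons_of_mem _ hp))
      (fun m hm => hrot m (List.mem_cons_of_mem _ hm))
      (fun m hm => hms m (List.mem_cons_of_mem _ hm))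
    obtain ⟨T, N, hT⟩ := exists_isTree_of_hanging (hms _ List.mem_cons_self)
    have hx : J.inv x = inDart J.rot (t, s) := hedge (x, inDart J.rot (t, s)) (by simp [path])
    refine ⟨(T, s) :: w, _, .cons x t T s w y N M hx (hrot _ List.mem_cons_self) hT h1,
      .cons ⟨rfl, N, hT⟩ h2⟩

theorem coe_darts_path {H : Type} (rot : Equiv.Perm H) (x : H) (ms : List (H × Bool)) (y : H) :
    (darts (path rot x ms y) : Multiset H) =
      {x} + {y} + (ms.map fun m => ({rot m.1} + {rot.symm m.1} : Multiset H)).sum := by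
  induction ms generalizing x with
  | nil => simp [path, darts]; rfl
  | cons m ms ih =>
    obtain ⟨t, s⟩ := m
    rw [path, darts_cons, ← Multiset.cons_coe, ← Multiset.cons_coe, ih, ← Multiset.singleton_add,
      ← Multiset.singleton_add]
    cases s <;> simp only [inDart_true, inDart_false, outDart_true, outDart_false, List.map_cons,
      List.sum_cons] <;> abel

theorem coe_darts_pathEdges {H : Type} (rot : Equiv.Perm H) (Q : List (H × List (H × Bool) × H)) :
    (darts (pathEdges rot Q) : Multiset H) =
      (Q.map fun q => ({q.1} + {q.2.2} : Multiset H)).sum +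
      ((Q.flatMap fun q => q.2.1).map fun m => ({rot m.1} + {rot.symm m.1} : Multiset H)).sum := by
  induction Q with
  | nil => simp [pathEdges, darts]
  | cons q Q ih =>
    rw [pathEdges, List.flatMap_cons, darts_append, ← Multiset.coe_add, ← pathEdges, ih,
      coe_darts_path]
    simp only [List.map_cons, List.sum_cons, List.flatMap_cons, List.map_append, List.sum_append]
    abel

/-! ### Letters in a list of spine edges without repetitions -/

section SpineLetters

variable {H : Type} {rot : Equiv.Perm H} {E : Multiset H} {A : List (H × Bool)}

theorem mem_sum_letters {x : H} :
    x ∈ (A.map fun m => ({rot m.1} + {rot.symm m.1} : Multiset H)).sum ↔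
      ∃ m ∈ A, x = rot m.1 ∨ x = rot.symm m.1 := by
  induction A with
  | nil => simp
  | cons m A ih => rw [List.map_cons, List.sum_cons, Multiset.mem_add, ih]; simp

theorem rot_ne_of_nodup (hr : ∀ h, rot (rot (rot h)) = h)
    (hA : (E + (A.map fun m => ({rot m.1} + {rot.symm m.1} : Multiset H)).sum).Nodup)
    {m : H × Bool} (hm : m ∈ A) : rot m.1 ≠ m.1 := by
  rw [(List.perm_cons_erase hm).map _ |>.sum_eq, List.map_cons, List.sum_cons] at hA
  intro h
  have := (Multiset.nodup_add.1 (Multiset.nodup_add.1 hA).2.1).1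
  rw [← (rot_eq_symm_iff hr _).2 h] at this
  simp at this

/-- If the half-edge were listed, a neighbour at its vertex would be accounted for twice: by this
letter, and by an end point or another letter. -/
theorem notMem_of_nodup (hr : ∀ h, rot (rot (rot h)) = h) (hE : E.map rot = E)
    (hA : (E + (A.map fun m => ({rot m.1} + {rot.symm m.1} : Multiset H)).sum).Nodup)
    {m : H × Bool} (hm : m ∈ A) :
    m.1 ∉ E + (A.map fun m => ({rot m.1} + {rot.symm m.1} : Multiset H)).sum := by
  have hne := rot_ne_of_nodup hr hA hm
  intro h
  rw [(List.perm_cons_erase hm).map _ |>.sum_eq, List.map_cons, List.sum_cons] at hA h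
  simp only [Multiset.mem_add, Multiset.mem_singleton] at h
  rcases h with h | (h | h) | h
  · have h' : rot m.1 ∈ E := by rw [← hE]; exact Multiset.mem_map_of_mem _ h
    exact Multiset.disjoint_left.1 (Multiset.nodup_add.1 hA).2.2 h' (by simp)
  · exact hne h.symm
  · exact hne (by rw [Equiv.eq_symm_apply] at h; exact h)
  · obtain ⟨m', hm', h⟩ := mem_sum_letters.1 h
    have hd := (Multiset.nodup_add.1 (Multiset.nodup_add.1 hA).2.1).2.2
    rcases h with h | h
    · refine Multiset.disjoint_left.1 hd (show rot m.1 ∈ _ by simp)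
        (mem_sum_letters.2 ⟨m', hm', ?_⟩)
      rw [h, rot_rot hr]; exact Or.inr rfl
    · refine Multiset.disjoint_left.1 hd (show rot.symm m.1 ∈ _ by simp)
        (mem_sum_letters.2 ⟨m', hm', ?_⟩)
      rw [h, symm_symm hr]; exact Or.inl rfl

end SpineLetters

/-- The half-edge is not listed, so its edge collapses from one of its ends. It does not collapse
from the near end, since the neighbour `rot m.1` is in the spine; so a tree hangs at the far end. -/
theorem SpineIs.letter {J : Diagram L} {Q : List (J.H × List (J.H × Bool) × J.H)} {u v : J.H}
    (hQ : J.SpineIs (pathEdges J.rot Q))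
    (hE : (Q.map fun q => ({q.1} + {q.2.2} : Multiset J.H)).sum = orb J.rot u + orb J.rot v)
    {q : J.H × List (J.H × Bool) × J.H} (hq : q ∈ Q) {m : J.H × Bool} (hm : m ∈ q.2.1) :
    J.rot m.1 ≠ m.1 ∧ J.Hanging (J.inv m.1) := by
  have hd := Multiset.coe_nodup.2 hQ.nodup
  rw [coe_darts_pathEdges] at hd
  have hmem : m ∈ Q.flatMap fun q => q.2.1 := List.mem_flatMap.2 ⟨q, hq, hm⟩
  have h1 := rot_ne_of_nodup J.rot_cube hd hmem
  have h2 := notMem_of_nodup J.rot_cube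
    (by rw [hE]; simp [map_rot_orb J.rot_cube]) hd hmem
  rw [← coe_darts_pathEdges, Multiset.mem_coe, hQ.mem_iff, InSpine, not_and_or, not_not,
    not_not] at h2
  refine ⟨h1, h2.resolve_left fun h => ?_⟩
  cases h with
  | leaf _ h => exact h1 h
  | node _ h =>
    exact ((hQ.mem_iff (J.rot m.1)).1
      (mem_darts_pathEdges.2 ⟨q, hq, Or.inr (Or.inr ⟨m, hm, Or.inl rfl⟩)⟩)).2 h

/-- The words of the paths in `P` are read off from the lists of half-edges in `Q`. -/
def Reads (J : Diagram L) (q : J.H × List (J.H × Bool) × J.H) (p : J.H × Word L × J.H) : Prop :=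
  q.1 = p.1 ∧ q.2.2 = p.2.2 ∧ List.Forall₂ (fun m l => m.2 = l.2 ∧
    ∃ N, IsTree J.rot J.label J.inv (J.inv m.1) l.1 N) q.2.1 p.2.1

theorem exists_arePaths {J : Diagram L} (Q : List (J.H × List (J.H × Bool) × J.H))
    (hedge : ∀ p ∈ pathEdges J.rot Q, J.inv p.1 = p.2)
    (hlet : ∀ q ∈ Q, ∀ m ∈ q.2.1, J.rot m.1 ≠ m.1 ∧ J.Hanging (J.inv m.1)) :
    ∃ P M, ArePaths J.rot J.label J.inv P M ∧ List.Forall₂ J.Reads Q P := by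
  induction Q with
  | nil => exact ⟨[], 0, .nil, .nil⟩
  | cons q Q ih =>
    obtain ⟨x, ms, y⟩ := q
    obtain ⟨P, N, h1, h2⟩ := ih
      (fun p hp => hedge p (by
        rw [pathEdges, List.flatMap_cons]; exact List.mem_append_right _ hp))
      (fun q hq => hlet q (List.mem_cons_of_mem _ hq))
    obtain ⟨w, M, k1, k2⟩ := exists_isPath_of_path x y ms
      (fun p hp => hedge p (by
        rw [pathEdges, List.flatMap_cons]; exact List.mem_append_left _ hp))
      (fun m hm => (hlet _ List.mem_cons_self m hm).1)
      (fun m hm => (hlet _ List.mem_cons_self m hm).2)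
    exact ⟨(x, w, y) :: P, _, .cons x w y P M N k1 h1, .cons ⟨rfl, rfl, k2⟩ h2⟩

theorem ends_of_reads {J : Diagram L} {Q : List (J.H × List (J.H × Bool) × J.H)}
    {P : List (J.H × Word L × J.H)} (h : List.Forall₂ J.Reads Q P) :
    ends P = (Q.map fun q => ({q.1} + {q.2.2} : Multiset J.H)).sum := by
  induction h with
  | nil => rfl
  | cons h1 h2 ih =>
    obtain ⟨h1, h2, -⟩ := h1
    rw [List.map_cons, List.sum_cons, ← ih, h1, h2]
    simp [ends]

/-- Translates a spine given by bare half-edges into words of trees. That nothing is missing or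
repeated comes from the multiplicity count `IsTwoLoop.count_eq_one`. -/
theorem IsTwoLoop.exists_skeleton {n : ℕ} {J : Diagram L} (hJ : J.IsTwoLoop n)
    {Q : List (J.H × List (J.H × Bool) × J.H)} {u v : J.H}
    (hQ : J.SpineIs (pathEdges J.rot Q))
    (hE : (Q.map fun q => ({q.1} + {q.2.2} : Multiset J.H)).sum = orb J.rot u + orb J.rot v) :
    ∃ P, Skeleton J.rot J.label J.inv u v P ∧ List.Forall₂ J.Reads Q P := by
  obtain ⟨P, M, h1, h2⟩ := exists_arePaths Q hQ.edge (fun q hq m hm => hQ.letter hE hq hm)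
  have hd := Multiset.coe_nodup.2 hQ.nodup
  rw [coe_darts_pathEdges, hE] at hd
  have hd := (Multiset.nodup_add.1 hd).1
  simp only [orb, Multiset.singleton_add, Multiset.cons_add, Multiset.nodup_cons, Multiset.mem_cons,
    Multiset.mem_singleton, not_or] at hd
  exact ⟨P, hJ.skeleton h1 (by rw [ends_of_reads h2, hE]) (Ne.symm hd.1.1)
    (Ne.symm hd.2.2.2.1.1), h2⟩


/-! ### Following the spine -/

section Follow

variable {J : Diagram L}

theorem hanging_iff_of_rot_ne {h : J.H} (hh : J.rot h ≠ h) :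
    J.Hanging h ↔ J.Hanging (J.inv (J.rot h)) ∧ J.Hanging (J.inv (J.rot.symm h)) := by
  constructor
  · intro h'
    cases h' with
    | leaf _ h1 => exact absurd h1 hh
    | node _ h1 h2 => exact ⟨h1, h2⟩
  · exact fun h' => .node h h'.1 h'.2

/-- If the trees were on different neighbours of the entering half-edge, both neighbours would carry
trees and the half-edge itself would collapse. -/
theorem inDart_injective {t t' : J.H} {s s' : Bool}
    (h : inDart J.rot (t, s) = inDart J.rot (t', s')) (ht : J.Hanging (J.inv t))
    (ht' : J.Hanging (J.inv t')) (hd : ¬ J.Hanging (inDart J.rot (t, s))) : t = t' ∧ s = s' := by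
  cases s <;> cases s' <;> simp only [inDart_true, inDart_false] at h hd
  · exact ⟨J.rot.symm.injective h, rfl⟩
  · refine absurd (.node _ ?_ ?_) hd
    · rwa [Equiv.apply_symm_apply]
    · rwa [h, Equiv.symm_apply_apply]
  · refine absurd (.node _ ?_ ?_) hd
    · rwa [h, Equiv.apply_symm_apply]
    · rwa [Equiv.symm_apply_apply]
  · exact ⟨J.rot.injective h, rfl⟩

theorem not_hanging_inv_outDart {t : J.H} {s : Bool} (ht : J.Hanging (J.inv t))
    (hd : ¬ J.Hanging (inDart J.rot (t, s))) : ¬ J.Hanging (J.inv (outDart J.rot (t, s))) := by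
  intro h
  refine hd (.node _ ?_ ?_) <;> cases s <;>
    simp only [inDart_true, inDart_false, outDart_true, outDart_false, rot_rot J.rot_cube,
      symm_symm J.rot_cube, Equiv.apply_symm_apply, Equiv.symm_apply_apply] at h ⊢ <;> assumption

theorem inSpine_outDart {x t : J.H} {s : Bool} (hx : J.InSpine x)
    (h : J.inv x = inDart J.rot (t, s)) (h2 : J.rot t ≠ t) (ht : J.Hanging (J.inv t)) :
    J.InSpine (outDart J.rot (t, s)) := by
  refine ⟨fun h' => ?_, not_hanging_inv_outDart ht (h ▸ hx.2)⟩
  have hx' : J.inv (inDart J.rot (t, s)) = x := by rw [← h, J.inv_inv]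
  apply hx.1
  rw [← hx']
  cases s
  · rw [outDart_false, hanging_iff_of_rot_ne (rot_rot_ne h2)] at h'
    rw [inDart_false, ← rot_rot J.rot_cube]
    exact h'.1
  · rw [outDart_true, hanging_iff_of_rot_ne (rot_symm_ne h2)] at h'
    rw [inDart_true, ← symm_symm J.rot_cube]
    exact h'.2

theorem isJoint_of_mem_orb {d h : J.H} (hd : d ∈ orb J.rot h) (hh : J.IsJoint h) :
    J.IsJoint d := by
  have : orb J.rot d = orb J.rot h := by
    rcases mem_orb.1 hd with rfl | rfl | rfl
    exacts [rfl, orb_rot J.rot_cube h, orb_symm J.rot_cube h]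
  intro d' hd'
  exact hh d' (this ▸ hd')

theorem not_isJoint_inDart {t : J.H} {s : Bool} (ht : J.Hanging (J.inv t)) :
    ¬ J.IsJoint (inDart J.rot (t, s)) := by
  intro h
  refine (h t ?_).2 ht
  cases s <;> simp [mem_orb]

theorem not_isJoint_outDart {t : J.H} {s : Bool} (ht : J.Hanging (J.inv t)) :
    ¬ J.IsJoint (outDart J.rot (t, s)) := by
  rw [← inDart_not]
  exact not_isJoint_inDart ht

/-- A path never has a choice: each letter is determined by the half-edge of arrival. Since the
vertices of letters are not joints, two paths to joints stop at the same place. -/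
theorem IsPath.eq_of_isJoint {x y y' : J.H} {w w' : Word L} {M M' : Multiset J.H}
    (h : IsPath J.rot J.label J.inv x w y M) (h' : IsPath J.rot J.label J.inv x w' y' M')
    (hx : ¬ J.Hanging (J.inv x)) (hy : J.IsJoint y) (hy' : J.IsJoint y') : w = w' ∧ y = y' := by
  induction h generalizing w' M' with
  | nil x =>
    cases h' with
    | nil => exact ⟨rfl, rfl⟩
    | cons _ t T s w _ M N h1 h2 h3 h4 => exact absurd (h1 ▸ hy) (not_isJoint_inDart h3.hanging)
  | cons x t T s w y M N h1 h2 h3 h4 ih =>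
    cases h' with
    | nil => exact absurd (h1 ▸ hy') (not_isJoint_inDart h3.hanging)
    | cons _ t' T' s' w' _ M' N' h1' h2' h3' h4' =>
      rw [h1] at hx
      obtain ⟨rfl, rfl⟩ := inDart_injective (h1.symm.trans h1') h3.hanging h3'.hanging hx
      obtain ⟨rfl, rfl⟩ := h3.unique h3'
      obtain ⟨rfl, rfl⟩ := ih h4' (not_hanging_inv_outDart h3.hanging hx) hy
      exact ⟨rfl, rfl⟩

/-- Such a path coincides with its own reverse. Its first and last letters are then the same vertex,
and stripping them leaves a shorter path of the same kind. In the end a half-edge would be paired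
with itself, or a vertex would be entered and left through one half-edge. -/
theorem not_isPath_self {x : J.H} {w : Word L} {M : Multiset J.H} (hx : J.InSpine x) :
    ¬ IsPath J.rot J.label J.inv x w x M := by
  induction hn : w.length using Nat.strong_induction_on generalizing x w M with
  | _ n ih =>
    intro h
    cases w with
    | nil => exact J.inv_ne x h.end_eq.1
    | cons l w =>
      cases h with
      | cons _ t T s _ _ M N h1 h2 h3 h4 =>
        rcases List.eq_nil_or_concat w with rfl | ⟨w, l, rfl⟩
        · have h5 := h4.end_eq.1
          have h6 : outDart J.rot (t, s) = inDart J.rot (t, s) := by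
            rw [← h1, ← h5, J.inv_inv]
          cases s
          · exact h2 ((rot_eq_symm_iff J.rot_cube t).1 h6)
          · exact h2 ((rot_eq_symm_iff J.rot_cube t).1 h6.symm)
        · obtain ⟨T', s'⟩ := l
          rw [List.concat_eq_append] at h4 hn
          obtain ⟨t', M₁, N', M₂, k1, k2, k3, k4, -⟩ := h4.split
          have h5 := k4.end_eq.1
          have h6 : inDart J.rot (t, s) = inDart J.rot (t', !s') := by
            rw [← h1, ← h5, J.inv_inv, inDart_not]
          obtain ⟨rfl, rfl⟩ := inDart_injective h6 h3.hanging k3.hanging (h1 ▸ hx.2)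
          rw [← outDart_not] at k1
          refine ih w.length ?_ (inSpine_outDart hx h1 h2 h3.hanging) rfl k1
          simp only [List.length_cons, List.length_append] at hn
          omega

/-- At a spine vertex that is not a joint one of the other two half-edges carries a tree; which one
it is decides the side. -/
theorem exists_letter {x : J.H} (hx : J.InSpine x) (hj : ¬ J.IsJoint (J.inv x)) :
    ∃ m : J.H × Bool, J.inv x = inDart J.rot m ∧ J.rot m.1 ≠ m.1 ∧ J.Hanging (J.inv m.1) := by
  have hd := inSpine_inv.2 hx
  generalize J.inv x = d at hj hd
  have h1 : J.rot d ≠ d := fun h => hd.1 (.leaf d h)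
  by_cases h : J.InSpine (J.rot d)
  · refine ⟨(J.rot.symm d, true), by simp, rot_symm_ne h1, ?_⟩
    by_contra h3
    refine hj fun d' hd' => ?_
    rcases mem_orb.1 hd' with rfl | rfl | rfl
    · exact hd
    · exact h
    · refine ⟨fun h4 => ?_, h3⟩
      rw [hanging_iff_of_rot_ne (rot_symm_ne h1), Equiv.apply_symm_apply] at h4
      exact hd.2 h4.1
  · refine ⟨(J.rot d, false), by simp, rot_rot_ne h1, ?_⟩
    by_contra h3
    refine h ⟨fun h4 => ?_, h3⟩
    rw [hanging_iff_of_rot_ne (rot_rot_ne h1), Equiv.symm_apply_apply] at h4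
    exact hd.2 h4.2

/-- Walking along the spine is an injective self-map of a finite set, so a walk that met no joint
would come back to `x`. But it would come back by leaving a letter, and no half-edge on the strand
at a letter belongs to a joint. -/
theorem exists_isPath_of_isJoint {x : J.H} (hx : J.IsJoint x) :
    ∃ w y M, IsPath J.rot J.label J.inv x w y M ∧ J.IsJoint y := by
  have := J.finite
  choose! m hm using fun (x : J.H) (hx : J.InSpine x) (hj : ¬ J.IsJoint (J.inv x)) =>
    exists_letter hx hj
  -- One step of the walk. At a joint it stops at the half-edge of arrival, which keeps the map
  -- total and injective.
  let g : {x // J.InSpine x} → {x // J.InSpine x} := fun x =>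
    if hj : J.IsJoint (J.inv x.1) then ⟨J.inv x.1, inSpine_inv.2 x.2⟩
    else ⟨outDart J.rot (m x.1),
      inSpine_outDart x.2 (hm x.1 x.2 hj).1 (hm x.1 x.2 hj).2.1 (hm x.1 x.2 hj).2.2⟩
  have hg1 : ∀ x, J.IsJoint (J.inv x.1) → (g x).1 = J.inv x.1 := fun x hj => by
    simp only [g, dif_pos hj]
  have hg2 : ∀ x, ¬ J.IsJoint (J.inv x.1) → (g x).1 = outDart J.rot (m x.1) := fun x hj => by
    simp only [g, dif_neg hj]
  have hinj : Function.Injective g := by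
    intro x y hxy
    have hxy := congrArg Subtype.val hxy
    apply Subtype.ext
    by_cases hx : J.IsJoint (J.inv x.1) <;> by_cases hy : J.IsJoint (J.inv y.1)
    · rw [hg1 x hx, hg1 y hy] at hxy
      exact J.inv.injective hxy
    · rw [hg1 x hx, hg2 y hy] at hxy
      exact absurd (hxy ▸ hx) (not_isJoint_outDart (hm y.1 y.2 hy).2.2)
    · rw [hg2 x hx, hg1 y hy] at hxy
      exact absurd (hxy ▸ hy) (not_isJoint_outDart (hm x.1 x.2 hx).2.2)
    · have h := (g x).2.1
      rw [hg2 x hx] at h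
      rw [hg2 x hx, hg2 y hy, ← inDart_not, ← inDart_not] at hxy
      rw [← inDart_not] at h
      obtain ⟨h1, h2⟩ := inDart_injective hxy (hm x.1 x.2 hx).2.2 (hm y.1 y.2 hy).2.2 h
      have h3 : m x.1 = m y.1 := Prod.ext h1 (by simpa using h2)
      apply J.inv.injective
      rw [(hm x.1 x.2 hx).1, (hm y.1 y.2 hy).1, h3]
  by_contra hcon
  -- By prepending letters, a path to a joint from any iterate would give one from `x`.
  have key : ∀ k : ℕ, ∀ w y M, IsPath J.rot J.label J.inv (g^[k] ⟨x, hx x (self_mem_orb x)⟩).1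
      w y M → ¬ J.IsJoint y := by
    intro k
    induction k with
    | zero => exact fun w y M h hy => hcon ⟨w, y, M, h, hy⟩
    | succ k ih =>
      intro w y M h hy
      rw [Function.iterate_succ_apply'] at h
      set z := g^[k] ⟨x, hx x (self_mem_orb x)⟩
      have hz : ¬ J.IsJoint (J.inv z.1) := ih [] _ 0 (.nil _)
      rw [hg2 z hz] at h
      obtain ⟨h1, h2, h3⟩ := hm z.1 z.2 hz
      obtain ⟨T, N, hT⟩ := exists_isTree_of_hanging h3
      exact ih _ y _ (.cons z.1 (m z.1).1 T (m z.1).2 w y N M h1 h2 hT h) hy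
  -- Periodicity exhibits `x` as the image of the last iterate of the cycle, hence as an outgoing
  -- half-edge of a letter.
  obtain ⟨k, hk, hper⟩ := Function.mem_periodicPts.1
    (hinj.mem_periodicPts ⟨x, hx x (self_mem_orb x)⟩)
  obtain ⟨k, rfl⟩ := Nat.exists_eq_succ_of_ne_zero hk.ne'
  have hper' := congrArg Subtype.val hper.eq
  rw [Function.iterate_succ_apply'] at hper'
  have hz := key k [] _ 0 (.nil _)
  rw [hg2 _ hz] at hper'
  have hj := not_isJoint_outDart (s := (m (g^[k] ⟨x, hx x (self_mem_orb x)⟩).1).2)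
    (hm _ (g^[k] ⟨x, hx x (self_mem_orb x)⟩).2 hz).2.2
  rw [Prod.mk.eta, hper'] at hj
  exact hj hx

end Follow

/-- Otherwise the diagram would be a tree: two trees glued along their root edge have excess `-6`,
which is not a nonnegative multiple of six. -/
theorem IsTwoLoop.not_hanging_both {n : ℕ} {J : Diagram L} (hJ : J.IsTwoLoop n) (h : J.H)
    (h1 : J.Hanging h) : ¬ J.Hanging (J.inv h) := by
  intro h2
  obtain ⟨T, M, hT⟩ := exists_isTree_of_hanging h1
  obtain ⟨T', M', hT'⟩ := exists_isTree_of_hanging h2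
  obtain ⟨d, -, hd⟩ := hJ.count_eq (M := M + M')
    (by rw [Multiset.map_add, hT.map_rot J.rot_cube, hT'.map_rot J.rot_cube]) (by
      have e1 := hT.map_inv J.inv_inv
      have e2 := hT'.map_inv J.inv_inv
      simp only [Multiset.map_add, Multiset.map_singleton, J.inv_inv] at e1 e2 ⊢
      apply add_left_cancel (a := ({h} + {J.inv h} : Multiset J.H))
      calc _ = ({h} + M.map J.inv) + ({J.inv h} + M'.map J.inv) := by abel
        _ = _ := by rw [e1, e2]; abel)
  have e1 := hT.countP
  have e2 := hT'.countP
  simp only [Multiset.countP_add] at hd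
  omega

/-- Double counting of the collapsed ends. Arriving minus departing trees sum to zero over the
diagram, and the contribution of a vertex depends only on whether it is univalent, a joint or
neither. With `IsTwoLoop.card_eq` exactly six half-edges remain for the joints. -/
theorem IsTwoLoop.card_isJoint {n : ℕ} {J : Diagram L} (hJ : J.IsTwoLoop n) :
    Nat.card {h : J.H // J.IsJoint h} = 6 := by
  have := J.finite
  have := Fintype.ofFinite J.H
  have hcard := hJ.card_eq
  simp only [Nat.card_eq_fintype_card, Fintype.card_subtype] at hcard ⊢
  let A : J.H → ℤ := fun h => if J.Hanging h then 1 else 0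
  let B : J.H → ℤ := fun h => A (J.inv h)
  have hAB : ∑ h, B h = ∑ h, A h := Equiv.sum_comp J.inv A
  have hrot : ∀ f : J.H → ℤ, ∑ h, f (J.rot h) = ∑ h, f h := fun f => Equiv.sum_comp J.rot f
  have hsymm : ∀ f : J.H → ℤ, ∑ h, f (J.rot.symm h) = ∑ h, f h :=
    fun f => Equiv.sum_comp J.rot.symm f
  -- `A` marks the ends from which an edge collapses, `B` the ends opposite to them. Reindexing by
  -- the pairing and by rotation makes the total vanish.
  have h0 : ∑ h, ((B h + B (J.rot h) + B (J.rot.symm h)) -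
      (A h + A (J.rot h) + A (J.rot.symm h))) = 0 := by
    rw [Finset.sum_sub_distrib, Finset.sum_add_distrib, Finset.sum_add_distrib,
      Finset.sum_add_distrib, Finset.sum_add_distrib, hrot, hsymm, hrot, hsymm, hAB]
    ring
  -- At a trivalent vertex where `0`, `1` or `2` trees arrive the difference is `0`, `1`, `1`: with
  -- two of them, the third edge collapses from here. Three arriving trees are excluded by
  -- `IsTwoLoop.not_hanging_both`. A univalent vertex gives `-3`.
  have h1 : ∀ h, (B h + B (J.rot h) + B (J.rot.symm h)) -
      (A h + A (J.rot h) + A (J.rot.symm h)) =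
      (if J.rot h ≠ h then 1 else 0) - 3 * (if J.rot h = h then 1 else 0) -
        (if J.IsJoint h then 1 else 0) := by
    intro h
    by_cases hh : J.rot h = h
    · have h2 : J.Hanging h := .leaf h hh
      have h3 := hJ.not_hanging_both h h2
      have h4 : ¬ J.IsJoint h := fun hj => (hj h (self_mem_orb h)).1 h2
      simp [A, B, hh, (symm_eq_self_iff h).2 hh, h2, h3, h4]
    · have e0 := hanging_iff_of_rot_ne hh
      have e1 := hanging_iff_of_rot_ne (rot_rot_ne hh)
      have e2 := hanging_iff_of_rot_ne (rot_symm_ne hh)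
      rw [rot_rot J.rot_cube, Equiv.symm_apply_apply] at e1
      rw [symm_symm J.rot_cube, Equiv.apply_symm_apply] at e2
      have hn := hJ.not_hanging_both h
      have hj : J.IsJoint h ↔ ¬ J.Hanging (J.inv h) ∧ ¬ J.Hanging (J.inv (J.rot h)) ∧
          ¬ J.Hanging (J.inv (J.rot.symm h)) := by
        constructor
        · exact fun hj => ⟨(hj _ (self_mem_orb h)).2, (hj _ (rot_mem_orb h)).2,
            (hj _ (rot_symm_mem_orb h)).2⟩
        · rintro ⟨k0, k1, k2⟩ d hd
          rcases mem_orb.1 hd with rfl | rfl | rfl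
          · exact ⟨fun k => k1 (e0.1 k).1, k0⟩
          · exact ⟨fun k => k0 (e1.1 k).2, k1⟩
          · exact ⟨fun k => k0 (e2.1 k).1, k2⟩
      by_cases b0 : J.Hanging (J.inv h) <;> by_cases b1 : J.Hanging (J.inv (J.rot h)) <;>
        by_cases b2 : J.Hanging (J.inv (J.rot.symm h)) <;>
        simp [A, B, hh, hj, e0, e1, e2, b0, b1, b2] at hn ⊢
  rw [Finset.sum_congr rfl fun h _ => h1 h, Finset.sum_sub_distrib, Finset.sum_sub_distrib,
    ← Finset.mul_sum, Finset.sum_boole, Finset.sum_boole, Finset.sum_boole] at h0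
  omega


/-! ### Eyeglass and theta diagrams -/

section Shapes

variable {H : Type} (rot : Equiv.Perm H) (u v : H)

/-- The paths of an eyeglass graph: the left circle, the line, and the right circle. -/
def eyeglassPaths (l m r : Word L) : List (H × Word L × H) :=
  [(rot.symm u, l, rot u), (u, m, v), (rot.symm v, r, rot v)]

/-- The paths of a planar theta graph. -/
def thetaPaths (a b c : Word L) : List (H × Word L × H) :=
  [(u, a, v), (rot u, b, rot.symm v), (rot.symm u, c, rot v)]

/-- The paths of a theta graph with one of the two cyclic orders reversed. -/
def twistedPaths (a b c : Word L) : List (H × Word L × H) :=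
  [(u, a, v), (rot u, b, rot v), (rot.symm u, c, rot.symm v)]

theorem ends_eyeglassPaths (l m r : Word L) :
    ends (eyeglassPaths rot u v l m r) = orb rot u + orb rot v := by
  simp only [eyeglassPaths, ends_cons, ends_nil, orb]; abel

theorem ends_thetaPaths (a b c : Word L) :
    ends (thetaPaths rot u v a b c) = orb rot u + orb rot v := by
  simp only [thetaPaths, ends_cons, ends_nil, orb]; abel

theorem ends_twistedPaths (a b c : Word L) :
    ends (twistedPaths rot u v a b c) = orb rot u + orb rot v := by
  simp only [twistedPaths, ends_cons, ends_nil, orb]; abel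

end Shapes

/-- `J` is an eyeglass diagram whose left circle, line and right circle carry the trees in the given
words. -/
def IsEyeglass (J : Diagram L) (l m r : Word L) : Prop :=
  ∃ u v, Skeleton J.rot J.label J.inv u v (eyeglassPaths J.rot u v l m r)

/-- `J` is a planar theta diagram whose arms carry the trees in the given words. -/
def IsTheta (J : Diagram L) (a b c : Word L) : Prop :=
  ∃ u v, Skeleton J.rot J.label J.inv u v (thetaPaths J.rot u v a b c)

/-- `J` is a theta diagram, with one cyclic order reversed, whose arms carry the trees in the given
words. -/
def IsTwisted (J : Diagram L) (a b c : Word L) : Prop :=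
  ∃ u v, Skeleton J.rot J.label J.inv u v (twistedPaths J.rot u v a b c)

theorem ArePaths.exists_isPath {H : Type} {rot : Equiv.Perm H} {lab : H → Option L}
    {inv : Equiv.Perm H} {P : List (H × Word L × H)} {M : Multiset H}
    (h : ArePaths rot lab inv P M) {p : H × Word L × H} (hp : p ∈ P) :
    ∃ N, IsPath rot lab inv p.1 p.2.1 p.2.2 N := by
  induction h with
  | nil => simp at hp
  | cons x w y P M N h1 h2 ih =>
    rcases List.mem_cons.1 hp with rfl | hp
    · exact ⟨M, h1⟩
    · exact ih hp

theorem Skeleton.exists_isPath {H : Type} {rot : Equiv.Perm H} {lab : H → Option L}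
    {inv : Equiv.Perm H} {u v : H} {P : List (H × Word L × H)} (h : Skeleton rot lab inv u v P)
    {p : H × Word L × H} (hp : p ∈ P) : ∃ N, IsPath rot lab inv p.1 p.2.1 p.2.2 N :=
  h.2.choose_spec.1.exists_isPath hp

theorem orb_eq_of_mem {J : Diagram L} {d h : J.H} (hd : d ∈ orb J.rot h) :
    orb J.rot d = orb J.rot h := by
  rcases mem_orb.1 hd with rfl | rfl | rfl
  exacts [rfl, orb_rot J.rot_cube h, orb_symm J.rot_cube h]

theorem Skeleton.notMem_orb {H : Type} {rot : Equiv.Perm H} {lab : H → Option L}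
    {inv : Equiv.Perm H} {u v : H} {P : List (H × Word L × H)} (h : Skeleton rot lab inv u v P)
    {d : H} (hu : d ∈ orb rot u) : d ∉ orb rot v :=
  Multiset.disjoint_left.1 (Multiset.nodup_add.1 h.nodup).2.2 hu

/-- Half a turn of the picture, after which the line is read backwards. -/
theorem Skeleton.eyeglass_swap {J : Diagram L} {u v : J.H} {l m r : Word L}
    (h : Skeleton J.rot J.label J.inv u v (eyeglassPaths J.rot u v l m r)) :
    Skeleton J.rot J.label J.inv v u (eyeglassPaths J.rot v u r (bar m) l) := by
  have h1 := h.swap.perm (Q := [(u, m, v), (J.rot.symm u, l, J.rot u),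
    (J.rot.symm v, r, J.rot v)]) (List.Perm.swap _ _ _)
  refine (h1.reverse_head J.inv_inv).perm ?_
  exact (List.reverse_perm _).symm.trans ((List.Perm.swap _ _ _).cons _)

/-- From a joint of an eyeglass only one half-edge leads to the other joint, so `u'` has to be `u`.
After that the paths agree, being determined by their starting half-edges. -/
theorem Skeleton.eyeglass_eq_of_mem_orb {J : Diagram L} {u v u' v' : J.H} {l m r l' m' r' : Word L}
    (h : Skeleton J.rot J.label J.inv u v (eyeglassPaths J.rot u v l m r))
    (h' : Skeleton J.rot J.label J.inv u' v' (eyeglassPaths J.rot u' v' l' m' r'))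
    (hu : u' ∈ orb J.rot u) : l = l' ∧ m = m' ∧ r = r' := by
  obtain ⟨N₁, p1⟩ := h.exists_isPath (p := (J.rot.symm u, l, J.rot u)) (by simp [eyeglassPaths])
  obtain ⟨N₂, p2⟩ := h.exists_isPath (p := (u, m, v)) (by simp [eyeglassPaths])
  obtain ⟨N₃, p3⟩ := h.exists_isPath (p := (J.rot.symm v, r, J.rot v)) (by simp [eyeglassPaths])
  obtain ⟨N₁', p1'⟩ := h'.exists_isPath (p := (J.rot.symm u', l', J.rot u'))
    (by simp [eyeglassPaths])
  obtain ⟨N₂', p2'⟩ := h'.exists_isPath (p := (u', m', v')) (by simp [eyeglassPaths])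
  obtain ⟨N₃', p3'⟩ := h'.exists_isPath (p := (J.rot.symm v', r', J.rot v'))
    (by simp [eyeglassPaths])
  have ju : ∀ d ∈ orb J.rot u, J.IsJoint d := fun d hd => (h.isJoint_iff d).2 (Or.inl hd)
  have jv : ∀ d ∈ orb J.rot v, J.IsJoint d := fun d hd => (h.isJoint_iff d).2 (Or.inr hd)
  have jv' : J.IsJoint v' := (h'.isJoint_iff v').2 (Or.inr (self_mem_orb v'))
  have hx : ∀ d, J.IsJoint d → ¬ J.Hanging (J.inv d) := fun d hd => (hd d (self_mem_orb d)).2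
  have hne : v' ∉ orb J.rot u := by
    rw [← orb_eq_of_mem hu]
    exact fun hv => h'.notMem_orb hv (self_mem_orb v')
  have j1 := ju _ (rot_mem_orb u)
  have j2 := ju _ (rot_symm_mem_orb u)
  rcases mem_orb.1 hu with rfl | rfl | rfl
  · obtain ⟨rfl, rfl⟩ := p2.eq_of_isJoint p2' (hx _ (ju _ hu)) (jv _ (self_mem_orb v)) jv'
    exact ⟨(p1.eq_of_isJoint p1' (hx _ j2) j1 j1).1, rfl,
      (p3.eq_of_isJoint p3' (hx _ (jv _ (rot_symm_mem_orb _))) (jv _ (rot_mem_orb _))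
        (jv _ (rot_mem_orb _))).1⟩
  · have : J.rot.symm u = v' :=
      ((p1.reverse J.inv_inv).eq_of_isJoint p2' (hx _ j1) j2 jv').2
    exact absurd (this ▸ rot_symm_mem_orb u) hne
  · have : J.rot u = v' := (p1.eq_of_isJoint p2' (hx _ j2) j1 jv').2
    exact absurd (this ▸ rot_mem_orb u) hne

/-- The presentation of an eyeglass diagram is unique up to rotating the picture. -/
theorem IsEyeglass.unique {J : Diagram L} {l m r l' m' r' : Word L}
    (h : J.IsEyeglass l m r) (h' : J.IsEyeglass l' m' r') :
    (l = l' ∧ m = m' ∧ r = r') ∨ (r = l' ∧ bar m = m' ∧ l = r') := by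
  obtain ⟨u, v, h⟩ := h
  obtain ⟨u', v', h'⟩ := h'
  have : J.IsJoint u' := (h'.isJoint_iff u').2 (Or.inl (self_mem_orb u'))
  rcases (h.isJoint_iff u').1 this with hu | hv
  · exact Or.inl (h.eyeglass_eq_of_mem_orb h' hu)
  · exact Or.inr (h.eyeglass_swap.eyeglass_eq_of_mem_orb h' hv)

/-- All paths starting at the vertex of `u` end at the vertex of `v`. -/
theorem Skeleton.not_eyeglass {J : Diagram L} {u v : J.H} {P : List (J.H × Word L × J.H)}
    (h : Skeleton J.rot J.label J.inv u v P)
    (hP : ∀ d ∈ orb J.rot u, ∃ w y M, IsPath J.rot J.label J.inv d w y M ∧ y ∈ orb J.rot v)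
    (l m r : Word L) : ¬ J.IsEyeglass l m r := by
  have key : ∀ u' v' l m r, Skeleton J.rot J.label J.inv u' v' (eyeglassPaths J.rot u' v' l m r) →
      u ∈ orb J.rot u' → False := by
    intro u' v' l m r h' hu
    have e := orb_eq_of_mem hu
    obtain ⟨N₁, p1⟩ := h'.exists_isPath (p := (J.rot.symm u', l, J.rot u'))
      (by simp [eyeglassPaths])
    obtain ⟨w, y, M, p, hy⟩ := hP (J.rot.symm u') (e ▸ rot_symm_mem_orb u')
    have j1 := (h'.isJoint_iff _).2 (Or.inl (rot_mem_orb u'))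
    have j2 := (h'.isJoint_iff _).2 (Or.inl (rot_symm_mem_orb u'))
    have : J.rot u' = y :=
      (p1.eq_of_isJoint p (j2 _ (self_mem_orb _)).2 j1 ((h.isJoint_iff y).2 (Or.inr hy))).2
    exact h.notMem_orb (e ▸ rot_mem_orb u') (this ▸ hy)
  rintro ⟨u', v', h'⟩
  have : J.IsJoint u := (h.isJoint_iff u).2 (Or.inl (self_mem_orb u))
  rcases (h'.isJoint_iff u).1 this with hu | hv
  · exact key _ _ _ _ _ h' hu
  · exact key _ _ _ _ _ h'.eyeglass_swap hv

/-- All arms of a theta graph lead to the other joint, whereas the circle of an eyeglass returns to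
its own. Paths in the spine being determined, one diagram cannot have both. -/
theorem HasThetaSpine.not_isEyeglass {n : ℕ} {J : Diagram L} (hJ : J.IsTwoLoop n)
    (h : J.HasThetaSpine) (l m r : Word L) : ¬ J.IsEyeglass l m r := by
  obtain ⟨u, v, w, w', a, b, c, hw, h⟩ := h
  have hQ : J.SpineIs (pathEdges J.rot [(u, a, v), (J.rot u, b, w), (J.rot.symm u, c, w')]) := by
    simpa [pathEdges] using h
  have hww : w ∈ orb J.rot v ∧ w' ∈ orb J.rot v := by
    rcases hw with ⟨rfl, rfl⟩ | ⟨rfl, rfl⟩ <;> simp [mem_orb]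
  obtain ⟨P, hP, hR⟩ := hJ.exists_skeleton (u := u) (v := v) hQ (by
    rcases hw with ⟨rfl, rfl⟩ | ⟨rfl, rfl⟩ <;>
    simp only [List.map_cons, List.map_nil, List.sum_cons, List.sum_nil, orb] <;> abel)
  refine hP.not_eyeglass (fun d hd => ?_) l m r
  have : ∃ q ∈ [(u, a, v), (J.rot u, b, w), (J.rot.symm u, c, w')], d = q.1 ∧
      q.2.2 ∈ orb J.rot v := by
    rcases mem_orb.1 hd with rfl | rfl | rfl
    · exact ⟨_, List.mem_cons_self, rfl, self_mem_orb v⟩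
    · exact ⟨(J.rot u, b, w), by simp, rfl, hww.1⟩
    · exact ⟨(J.rot.symm u, c, w'), by simp, rfl, hww.2⟩
  obtain ⟨q, hq, rfl, hv⟩ := this
  obtain ⟨p, hp, h1, h2, -⟩ := exists_of_forall₂_left hR hq
  obtain ⟨N, hN⟩ := hP.exists_isPath hp
  exact ⟨_, _, N, h1 ▸ hN, h2 ▸ hv⟩

theorem IsTheta.hasThetaSpine {J : Diagram L} {a b c : Word L} (h : J.IsTheta a b c) :
    J.HasThetaSpine := by
  obtain ⟨u, v, h⟩ := h
  obtain ⟨Q, hQ, hs⟩ := h.exists_spineIs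
  cases hQ with
  | cons h1 hQ =>
  cases hQ with
  | cons h2 hQ =>
  cases hQ with
  | cons h3 hQ =>
  cases hQ
  rename_i q1 q2 q3
  obtain ⟨x1, m1, y1⟩ := q1
  obtain ⟨x2, m2, y2⟩ := q2
  obtain ⟨x3, m3, y3⟩ := q3
  obtain ⟨rfl, rfl, -⟩ := h1
  obtain ⟨rfl, rfl, -⟩ := h2
  obtain ⟨rfl, rfl, -⟩ := h3
  exact ⟨_, _, _, _, m1, m2, m3, Or.inr ⟨rfl, rfl⟩, by simpa [pathEdges] using hs⟩

theorem IsTwisted.hasThetaSpine {J : Diagram L} {a b c : Word L} (h : J.IsTwisted a b c) :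
    J.HasThetaSpine := by
  obtain ⟨u, v, h⟩ := h
  obtain ⟨Q, hQ, hs⟩ := h.exists_spineIs
  cases hQ with
  | cons h1 hQ =>
  cases hQ with
  | cons h2 hQ =>
  cases hQ with
  | cons h3 hQ =>
  cases hQ
  rename_i q1 q2 q3
  obtain ⟨x1, m1, y1⟩ := q1
  obtain ⟨x2, m2, y2⟩ := q2
  obtain ⟨x3, m3, y3⟩ := q3
  obtain ⟨rfl, rfl, -⟩ := h1
  obtain ⟨rfl, rfl, -⟩ := h2
  obtain ⟨rfl, rfl, -⟩ := h3
  exact ⟨_, _, _, _, m1, m2, m3, Or.inl ⟨rfl, rfl⟩, by simpa [pathEdges] using hs⟩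

/-! ### Classification -/

/-- One cross pair of a perfect matching on two triples leaves four points, which can be matched in
three ways: the eyeglass, the twisted theta and the planar theta. -/
theorem matching_cases {H : Type} (R : H → H → Prop) {a₀ a₁ a₂ b₀ b₁ b₂ : H}
    (hd : [a₀, a₁, a₂, b₀, b₁, b₂].Nodup)
    (hsymm : ∀ x y, R x y → R y x)
    (huniq : ∀ x ∈ [a₀, a₁, a₂, b₀, b₁, b₂], ∀ y ∈ [a₀, a₁, a₂, b₀, b₁, b₂],
      ∀ z ∈ [a₀, a₁, a₂, b₀, b₁, b₂], R x y → R x z → y = z)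
    (hirr : ∀ x ∈ [a₀, a₁, a₂, b₀, b₁, b₂], ¬ R x x)
    (hex : ∀ x ∈ [a₀, a₁, a₂, b₀, b₁, b₂], ∃ y ∈ [a₀, a₁, a₂, b₀, b₁, b₂], R x y)
    (h : R a₀ b₀) : (R a₁ a₂ ∧ R b₁ b₂) ∨ (R a₁ b₁ ∧ R a₂ b₂) ∨ (R a₁ b₂ ∧ R a₂ b₁) := by
  obtain ⟨y, hy, h1⟩ := hex a₁ (by simp)
  obtain ⟨z, hz, h2⟩ := hex a₂ (by simp)
  obtain ⟨t, ht, h3⟩ := hex b₁ (by simp)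
  simp only [List.nodup_cons, List.mem_cons, List.not_mem_nil, or_false, not_or] at hd
  simp only [List.mem_cons, List.not_mem_nil, or_false] at hy hz ht huniq hirr
  clear hex
  rcases hy with rfl | rfl | rfl | rfl | rfl | rfl <;> grind

/-- An odd set has no perfect matching; this is what yields a strand between the two joints. -/
theorem triple_cases {H : Type} (R : H → H → Prop) {a₀ a₁ a₂ : H}
    (hd : [a₀, a₁, a₂].Nodup)
    (hsymm : ∀ x y, R x y → R y x)
    (huniq : ∀ x ∈ [a₀, a₁, a₂], ∀ y ∈ [a₀, a₁, a₂], ∀ z ∈ [a₀, a₁, a₂], R x y → R x z → y = z)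
    (hirr : ∀ x ∈ [a₀, a₁, a₂], ¬ R x x) : ¬ ∀ x ∈ [a₀, a₁, a₂], ∃ y ∈ [a₀, a₁, a₂], R x y := by
  intro hex
  obtain ⟨x, hx, h0⟩ := hex a₀ (by simp)
  obtain ⟨y, hy, h1⟩ := hex a₁ (by simp)
  obtain ⟨z, hz, h2⟩ := hex a₂ (by simp)
  simp only [List.nodup_cons, List.mem_cons, List.not_mem_nil, or_false, not_or] at hd
  simp only [List.mem_cons, List.not_mem_nil, or_false] at hx hy hz huniq hirr
  grind

theorem nodup_orb_list {J : Diagram L} {h : J.H} (hh : J.rot h ≠ h) :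
    [h, J.rot h, J.rot.symm h].Nodup := by
  have h1 := (rot_eq_symm_iff J.rot_cube h).not.2 hh
  have h2 := (symm_eq_self_iff (rot := J.rot) h).not.2 hh
  simp [Ne.symm hh, h1, Ne.symm h2]

theorem IsJoint.rot_ne {J : Diagram L} {h : J.H} (hh : J.IsJoint h) : J.rot h ≠ h :=
  fun e => (hh h (self_mem_orb h)).1 (.leaf h e)

/-- A vertex contributes all or none of its three half-edges to the six of `IsTwoLoop.card_isJoint`,
so two different joints use them up. -/
theorem IsTwoLoop.exists_joints {n : ℕ} {J : Diagram L} (hJ : J.IsTwoLoop n) :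
    ∃ u, J.IsJoint u ∧ ∀ v, J.IsJoint v → v ∉ orb J.rot u →
      [u, J.rot u, J.rot.symm u, v, J.rot v, J.rot.symm v].Nodup ∧
      ∀ d, J.IsJoint d → d ∈ [u, J.rot u, J.rot.symm u, v, J.rot v, J.rot.symm v] := by
  have := J.finite
  have := Fintype.ofFinite J.H
  have hcard := hJ.card_isJoint
  simp only [Nat.card_eq_fintype_card, Fintype.card_subtype] at hcard
  obtain ⟨u, hu⟩ := Finset.card_pos.1 (by rw [hcard]; norm_num)
  rw [Finset.mem_filter] at hu
  have hu := hu.2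
  refine ⟨u, hu, fun v hv hvu => ?_⟩
  have hnd : [u, J.rot u, J.rot.symm u, v, J.rot v, J.rot.symm v].Nodup := by
    change ([u, J.rot u, J.rot.symm u] ++ [v, J.rot v, J.rot.symm v]).Nodup
    refine List.nodup_append'.2 ⟨nodup_orb_list hu.rot_ne, nodup_orb_list hv.rot_ne, ?_⟩
    intro d hd hd'
    have h1 : d ∈ orb J.rot u := by simpa [mem_orb] using hd
    have h2 : d ∈ orb J.rot v := by simpa [mem_orb] using hd'
    apply hvu
    rw [← orb_eq_of_mem h1, orb_eq_of_mem h2]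
    exact self_mem_orb v
  refine ⟨hnd, fun d hd => ?_⟩
  have hsub : [u, J.rot u, J.rot.symm u, v, J.rot v, J.rot.symm v].toFinset ⊆
      Finset.univ.filter J.IsJoint := by
    intro d hd
    rw [List.mem_toFinset] at hd
    have hd' : d ∈ orb J.rot u ∨ d ∈ orb J.rot v := by
      simpa only [mem_orb, List.mem_cons, List.not_mem_nil, or_false, or_assoc] using hd
    refine Finset.mem_filter.2 ⟨Finset.mem_univ _, ?_⟩
    rcases hd' with h | h
    · exact isJoint_of_mem_orb h hu
    · exact isJoint_of_mem_orb h hv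
  have heq := Finset.eq_of_subset_of_card_le hsub (by
    rw [hcard, List.toFinset_card_of_nodup hnd]; simp)
  rw [← List.mem_toFinset, heq]
  exact Finset.mem_filter.2 ⟨Finset.mem_univ _, hd⟩

/-- Following the spine defines a perfect matching of the six half-edges at the joints. By parity
some strand runs between the joints, and `matching_cases` lists what is left. The three paths fill
the diagram by the multiplicity count. -/
theorem IsTwoLoop.classification {n : ℕ} {J : Diagram L} (hJ : J.IsTwoLoop n) :
    (∃ l m r, J.IsEyeglass l m r) ∨ (∃ a b c, J.IsTheta a b c) ∨ ∃ a b c, J.IsTwisted a b c := by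
  let R : J.H → J.H → Prop := fun x y => ∃ w M, IsPath J.rot J.label J.inv x w y M
  have hsymm : ∀ x y, R x y → R y x := fun x y ⟨w, M, h⟩ => ⟨_, M, h.reverse J.inv_inv⟩
  have hx : ∀ d, J.IsJoint d → J.InSpine d := fun d hd => hd d (self_mem_orb d)
  have huniq : ∀ x y z, J.IsJoint x → J.IsJoint y → J.IsJoint z → R x y → R x z → y = z :=
    fun x y z jx jy jz ⟨w, M, h⟩ ⟨w', M', h'⟩ => (h.eq_of_isJoint h' (hx x jx).2 jy jz).2
  have hirr : ∀ x, J.IsJoint x → ¬ R x x := fun x jx ⟨w, M, h⟩ => not_isPath_self (hx x jx) h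
  have hex : ∀ x, J.IsJoint x → ∃ y, J.IsJoint y ∧ R x y := fun x jx => by
    obtain ⟨w, y, M, h, hy⟩ := exists_isPath_of_isJoint jx
    exact ⟨y, hy, w, M, h⟩
  obtain ⟨u₀, ju₀, hu₀⟩ := hJ.exists_joints
  have mem3 : ∀ u d, d ∈ [u, J.rot u, J.rot.symm u] ↔ d ∈ orb J.rot u := fun u d => by
    simp [mem_orb]
  obtain ⟨u, hu, v, jv, hvu, huv⟩ : ∃ u ∈ orb J.rot u₀, ∃ v, J.IsJoint v ∧ v ∉ orb J.rot u₀ ∧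
      R u v := by
    by_contra hcon
    have j3 : ∀ d ∈ [u₀, J.rot u₀, J.rot.symm u₀], J.IsJoint d := fun d hd =>
      isJoint_of_mem_orb ((mem3 _ _).1 hd) ju₀
    refine triple_cases R (nodup_orb_list ju₀.rot_ne) hsymm
      (fun x hx y hy z hz => huniq x y z (j3 x hx) (j3 y hy) (j3 z hz))
      (fun x hx => hirr x (j3 x hx)) fun x hx => ?_
    obtain ⟨y, jy, hxy⟩ := hex x (j3 x hx)
    refine ⟨y, ?_, hxy⟩
    by_contra hy
    exact hcon ⟨x, (mem3 _ _).1 hx, y, jy, fun h => hy ((mem3 _ _).2 h), hxy⟩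
  have ju : J.IsJoint u := isJoint_of_mem_orb hu ju₀
  obtain ⟨hnd, hall⟩ : [u, J.rot u, J.rot.symm u, v, J.rot v, J.rot.symm v].Nodup ∧
      ∀ d, J.IsJoint d → d ∈ [u, J.rot u, J.rot.symm u, v, J.rot v, J.rot.symm v] := by
    have h := hu₀ v jv hvu
    have hp : [u₀, J.rot u₀, J.rot.symm u₀].Perm [u, J.rot u, J.rot.symm u] := by
      rw [← Multiset.coe_eq_coe]
      exact (orb_eq_of_mem hu).symm
    have hp' := hp.append_right [v, J.rot v, J.rot.symm v]
    exact ⟨hp'.nodup_iff.1 h.1, fun d hd => hp'.mem_iff.1 (h.2 d hd)⟩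
  have j6 : ∀ d ∈ [u, J.rot u, J.rot.symm u, v, J.rot v, J.rot.symm v], J.IsJoint d := by
    intro d hd
    have hd' : d ∈ orb J.rot u ∨ d ∈ orb J.rot v := by
      simpa only [mem_orb, List.mem_cons, List.not_mem_nil, or_false, or_assoc] using hd
    rcases hd' with h | h
    · exact isJoint_of_mem_orb h ju
    · exact isJoint_of_mem_orb h jv
  have hsk : ∀ P : List (J.H × Word L × J.H), ends P = orb J.rot u + orb J.rot v →
      ∀ M, ArePaths J.rot J.label J.inv P M → Skeleton J.rot J.label J.inv u v P :=
    fun P hP M hM => hJ.skeleton hM hP ju.rot_ne jv.rot_ne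
  obtain ⟨w₀, M₀, h₀⟩ := huv
  rcases matching_cases R hnd hsymm
    (fun x hx y hy z hz => huniq x y z (j6 x hx) (j6 y hy) (j6 z hz))
    (fun x hx => hirr x (j6 x hx))
    (fun x hx => by
      obtain ⟨y, jy, hxy⟩ := hex x (j6 x hx)
      exact ⟨y, hall y jy, hxy⟩) ⟨w₀, M₀, h₀⟩ with ⟨h1, h2⟩ | ⟨h1, h2⟩ | ⟨h1, h2⟩
  · obtain ⟨w₁, M₁, h₁⟩ := hsymm _ _ h1
    obtain ⟨w₂, M₂, h₂⟩ := hsymm _ _ h2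
    exact Or.inl ⟨w₁, w₀, w₂, u, v, hsk _ (ends_eyeglassPaths ..) _
      (.cons _ _ _ _ _ _ h₁ (.cons _ _ _ _ _ _ h₀ (.cons _ _ _ _ _ _ h₂ .nil)))⟩
  · obtain ⟨w₁, M₁, h₁⟩ := h1
    obtain ⟨w₂, M₂, h₂⟩ := h2
    exact Or.inr (Or.inr ⟨w₀, w₁, w₂, u, v, hsk _ (ends_twistedPaths ..) _
      (.cons _ _ _ _ _ _ h₀ (.cons _ _ _ _ _ _ h₁ (.cons _ _ _ _ _ _ h₂ .nil)))⟩)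
  · obtain ⟨w₁, M₁, h₁⟩ := h1
    obtain ⟨w₂, M₂, h₂⟩ := h2
    exact Or.inr (Or.inl ⟨w₀, w₁, w₂, u, v, hsk _ (ends_thetaPaths ..) _
      (.cons _ _ _ _ _ _ h₀ (.cons _ _ _ _ _ _ h₁ (.cons _ _ _ _ _ _ h₂ .nil)))⟩)

/-- A two-loop diagram with a self-loop is an eyeglass diagram with an empty left circle. -/
theorem IsTwoLoop.isEyeglass_of_loop {n : ℕ} {J : Diagram L} (hJ : J.IsTwoLoop n) {e : J.H}
    (he : J.inv e = J.rot e) : ∃ m r, J.IsEyeglass [] m r := by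
  have he' : J.inv (J.rot e) = e := by rw [← he, J.inv_inv]
  have hne : J.rot e ≠ e := he ▸ J.inv_ne e
  have hclosed := not_hanging_of_closed (J := J) {d | d = e ∨ d = J.rot e}
    (by rintro d (rfl | rfl); exacts [Or.inr he, Or.inl he'])
    (by
      rintro d (rfl | rfl)
      · exact ⟨hne, Or.inl (Or.inr rfl)⟩
      · exact ⟨rot_rot_ne hne, Or.inr (Or.inl (by simp))⟩)
  have h1 := hclosed e (Or.inl rfl)
  have h2 := hclosed (J.rot e) (Or.inr rfl)
  -- With a tree on its stem the loop would be a closed piece of excess zero, that is, of first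
  -- Betti number one.
  have h3 : ¬ J.Hanging (J.inv (J.rot.symm e)) := by
    intro h
    obtain ⟨T, M, hT⟩ := exists_isTree_of_hanging h
    have e1 := hT.map_inv J.inv_inv
    obtain ⟨d, hd', hd⟩ := hJ.count_eq (M := orb J.rot e + M)
      (by rw [Multiset.map_add, hT.map_rot J.rot_cube, map_rot_orb J.rot_cube]) (by
        simp only [orb, Multiset.map_add, Multiset.map_singleton, J.inv_inv] at e1 ⊢
        rw [he, he']
        calc _ = {J.rot e} + {e} + ({J.inv (J.rot.symm e)} + M.map J.inv) := by abel
          _ = _ := by rw [e1]; abel)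
    have e2 := hT.countP
    have e3 : 0 < (orb J.rot e + M).count e := Multiset.count_pos.2 (by simp [orb])
    rw [hd'] at e3
    simp only [Multiset.countP_add, countP_orb hne] at hd
    omega
  have hj : J.IsJoint e := by
    intro d hd
    rcases mem_orb.1 hd with rfl | rfl | rfl
    · exact ⟨h1, by rwa [he]⟩
    · exact ⟨h2, by rwa [he']⟩
    · refine ⟨fun h => ?_, h3⟩
      rw [hanging_iff_of_rot_ne (rot_symm_ne hne), Equiv.apply_symm_apply, he] at h
      exact h2 h.1
  have hp : IsPath J.rot J.label J.inv e [] (J.rot e) 0 := IsPath.nil' he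
  have hjr : J.IsJoint (J.rot e) := isJoint_of_mem_orb (rot_mem_orb e) hj
  have hnot : ∀ w y M, IsPath J.rot J.label J.inv e w y M → J.IsJoint y → [] = w ∧ J.rot e = y :=
    fun w y M h jy => hp.eq_of_isJoint h (hj _ (self_mem_orb _)).2 hjr jy
  -- A theta graph is impossible because the loop is a strand from a joint to itself.
  have hgen : ∀ u v (P : List (J.H × Word L × J.H)), Skeleton J.rot J.label J.inv u v P →
      ¬ ∀ p ∈ P, p.1 ∈ orb J.rot u ∧ p.2.2 ∈ orb J.rot v := by
    intro u v P h hP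
    have heP : e ∈ ends P := by rw [h.1, Multiset.mem_add]; exact (h.isJoint_iff e).1 hj
    obtain ⟨p, hpP, hep⟩ := mem_ends.1 heP
    obtain ⟨N, hN⟩ := h.exists_isPath hpP
    obtain ⟨k1, k2⟩ := hP p hpP
    rcases hep with hep | hep
    · rw [← hep] at hN k1
      have := (hnot _ _ _ hN ((h.isJoint_iff _).2 (Or.inr k2))).2
      rw [← this] at k2
      exact h.notMem_orb (orb_eq_of_mem k1 ▸ rot_mem_orb e) k2
    · rw [← hep] at hN k2
      have := (hnot _ _ _ (hN.reverse J.inv_inv) ((h.isJoint_iff _).2 (Or.inl k1))).2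
      rw [← this] at k1
      exact h.notMem_orb k1 (orb_eq_of_mem k2 ▸ rot_mem_orb e)
  have key : ∀ u v l m r, Skeleton J.rot J.label J.inv u v (eyeglassPaths J.rot u v l m r) →
      e ∈ orb J.rot u → ∃ m r, J.IsEyeglass [] m r := by
    intro u v l m r h heu
    obtain ⟨N₁, p1⟩ := h.exists_isPath (p := (J.rot.symm u, l, J.rot u)) (by simp [eyeglassPaths])
    obtain ⟨N₂, p2⟩ := h.exists_isPath (p := (u, m, v)) (by simp [eyeglassPaths])
    have ju : ∀ d ∈ orb J.rot u, J.IsJoint d := fun d hd => (h.isJoint_iff d).2 (Or.inl hd)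
    have jv : J.IsJoint v := (h.isJoint_iff v).2 (Or.inr (self_mem_orb v))
    rcases mem_orb.1 heu with rfl | rfl | rfl
    · have : J.rot e = v := (hnot _ _ _ p2 jv).2
      exact absurd (self_mem_orb v) (h.notMem_orb (this ▸ rot_mem_orb e))
    · have : [] = bar l := (hnot _ _ _ (p1.reverse J.inv_inv) (ju _ (rot_symm_mem_orb u))).1
      have hl : l = [] := by rw [← bar_bar l, ← this]; rfl
      exact ⟨m, r, u, v, hl ▸ h⟩
    · have : J.rot (J.rot.symm u) = J.rot u := (hnot _ _ _ p1 (ju _ (rot_mem_orb u))).2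
      rw [Equiv.apply_symm_apply] at this
      exact absurd this.symm h.rot_ne.1
  rcases hJ.classification with ⟨l, m, r, u, v, h⟩ | ⟨a, b, c, u, v, h⟩ | ⟨a, b, c, u, v, h⟩
  · rcases (h.isJoint_iff e).1 hj with heu | hev
    · exact key _ _ _ _ _ h heu
    · exact key _ _ _ _ _ h.eyeglass_swap hev
  · exact absurd (by simp [thetaPaths, mem_orb]) (hgen u v _ h)
  · exact absurd (by simp [twistedPaths, mem_orb]) (hgen u v _ h)

end Diagram


/-! ### Words as elements of the free associative ring -/

/-- The free associative ring on `L`. -/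
abbrev Alg (L : Type) := FreeAbelianGroup (FreeMonoid L)

/-- The generators of the free associative ring. -/
def Alg.gen (l : L) : Alg L := FreeAbelianGroup.of (FreeMonoid.of l)

/-- The monomial given by a list of letters. -/
def monomial (w : List L) : Alg L := FreeAbelianGroup.of (FreeMonoid.ofList w)

@[simp] theorem monomial_nil : monomial ([] : List L) = 1 := rfl

theorem monomial_cons (l : L) (w : List L) : monomial (l :: w) = Alg.gen l * monomial w := by
  rw [monomial, FreeMonoid.ofList_cons, FreeAbelianGroup.of_mul]
  rfl

theorem additive_ext {V : Type*} [AddCommGroup V] {f g : Alg L → V}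
    (hf : ∀ x y, f (x + y) = f x + f y) (hg : ∀ x y, g (x + y) = g x + g y)
    (h : ∀ w, f (monomial w) = g (monomial w)) (x : Alg L) : f x = g x := by
  have : AddMonoidHom.mk' f hf = AddMonoidHom.mk' g hg :=
    FreeAbelianGroup.lift_ext _ _ fun w => h (FreeMonoid.toList w)
  exact DFunLike.congr_fun this x

/-- The Lie element of the free ring represented by a rooted tree. -/
def RTree.toAlg : RTree L → Alg L
  | .leaf l => Alg.gen l
  | .node A B => B.toAlg * A.toAlg - A.toAlg * B.toAlg

/-- The element represented by a tree to the left or to the right of a strand. -/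
def letterAlg (m : RTree L × Bool) : Alg L := if m.2 then m.1.toAlg else -m.1.toAlg

/-- The element of the free ring represented by a word. -/
def wordAlg (w : Word L) : Alg L := (w.map letterAlg).prod

@[simp] theorem letterAlg_true (T : RTree L) : letterAlg (T, true) = T.toAlg := rfl
@[simp] theorem letterAlg_false (T : RTree L) : letterAlg (T, false) = -T.toAlg := rfl

@[simp] theorem letterAlg_not (T : RTree L) (s : Bool) :
    letterAlg (T, !s) = -letterAlg (T, s) := by
  cases s <;> simp

@[simp] theorem wordAlg_nil : wordAlg ([] : Word L) = 1 := rfl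

@[simp] theorem wordAlg_cons (m : RTree L × Bool) (w : Word L) :
    wordAlg (m :: w) = letterAlg m * wordAlg w := rfl

@[simp] theorem wordAlg_append (v w : Word L) : wordAlg (v ++ w) = wordAlg v * wordAlg w := by
  simp [wordAlg]

/-- The word of leaves to the left given by a list of labels. -/
def leafWord (w : List L) : Word L := w.map fun l => (.leaf l, true)

theorem wordAlg_leafWord (w : List L) : wordAlg (leafWord w) = monomial w := by
  induction w with
  | nil => rfl
  | cons l w ih => rw [monomial_cons, ← ih]; rfl

/-- The antipode of the free associative ring, as a homomorphism to the opposite ring. -/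
def antipodeHom : Alg L →+* (Alg L)ᵐᵒᵖ :=
  FreeAbelianGroup.liftMonoid (FreeMonoid.lift fun l => MulOpposite.op (-Alg.gen l))

/-- The antipode of the free associative ring. -/
def antipode : Alg L →+ Alg L :=
  AddMonoidHom.mk' (fun x => (antipodeHom x).unop) fun x y => by simp only [map_add, MulOpposite.unop_add]

theorem antipode_apply (x : Alg L) : antipode x = (antipodeHom x).unop := rfl

@[simp] theorem antipode_one : antipode (1 : Alg L) = 1 := by
  rw [antipode_apply, map_one, MulOpposite.unop_one]

@[simp] theorem antipode_mul (x y : Alg L) :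
    antipode (x * y) = antipode y * antipode x := by
  simp only [antipode_apply, map_mul, MulOpposite.unop_mul]

@[simp] theorem antipode_gen (l : L) : antipode (Alg.gen l) = -Alg.gen l := by
  rw [antipode_apply, antipodeHom, Alg.gen, FreeAbelianGroup.liftMonoid_coe,
    FreeAbelianGroup.lift_apply_of, FreeMonoid.lift_eval_of, MulOpposite.unop_op]
  rfl

theorem antipode_toAlg (T : RTree L) : antipode T.toAlg = -T.toAlg := by
  induction T with
  | leaf l => simp [RTree.toAlg]
  | node A B ihA ihB => simp [RTree.toAlg, ihA, ihB]

theorem antipode_letterAlg (m : RTree L × Bool) : antipode (letterAlg m) = -letterAlg m := by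
  obtain ⟨T, s⟩ := m
  cases s <;> simp [antipode_toAlg]

/-- The antipode negates Lie elements and reverses products; reading a strand backwards changes the
sides of the trees and their order. -/
theorem wordAlg_bar (w : Word L) : wordAlg (bar w) = antipode (wordAlg w) := by
  induction w with
  | nil => simp
  | cons m w ih => simp [ih, antipode_letterAlg]

theorem antipode_antipode (x : Alg L) : antipode (antipode x) = x :=
  additive_ext (f := fun x => antipode (antipode x)) (g := fun x => x) (by simp) (by simp)
    (fun w => by rw [← wordAlg_leafWord, ← wordAlg_bar, ← wordAlg_bar, bar_bar]) x

/-- The adjoint action of the free associative ring on itself. -/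
def adj : Alg L →+* AddMonoid.End (Alg L) :=
  FreeAbelianGroup.liftMonoid (FreeMonoid.lift fun l =>
    AddMonoidHom.mulLeft (Alg.gen l) - AddMonoidHom.mulRight (Alg.gen l))

theorem adj_gen (l : L) (x : Alg L) : adj (Alg.gen l) x = Alg.gen l * x - x * Alg.gen l := by
  have : adj (Alg.gen l) = AddMonoidHom.mulLeft (Alg.gen l) - AddMonoidHom.mulRight (Alg.gen l) := by
    rw [adj, Alg.gen, FreeAbelianGroup.liftMonoid_coe, FreeAbelianGroup.lift_apply_of]
    exact FreeMonoid.lift_eval_of _ _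
  rw [this]
  rfl

theorem adj_mul_apply (x y z : Alg L) : adj (x * y) z = adj x (adj y z) := by
  rw [map_mul]; rfl

theorem adj_sub_apply (x y z : Alg L) : adj (x - y) z = adj x z - adj y z := by
  rw [map_sub]; rfl

theorem adj_add_apply (x y z : Alg L) : adj (x + y) z = adj x z + adj y z := by
  rw [map_add]; rfl

theorem adj_neg_apply (x z : Alg L) : adj (-x) z = -adj x z := by
  rw [map_neg]; rfl

@[simp] theorem adj_one_apply (z : Alg L) : adj 1 z = z := by
  rw [map_one]; rfl

/-- The adjoint action is prescribed on generators and extended multiplicatively, so products do not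
act by commutators. Lie elements do, because a commutator of commutators is the commutator with the
bracket. -/
theorem adj_toAlg (T : RTree L) (x : Alg L) :
    adj T.toAlg x = T.toAlg * x - x * T.toAlg := by
  induction T generalizing x with
  | leaf l => exact adj_gen l x
  | node A B ihA ihB =>
    simp only [RTree.toAlg, adj_sub_apply, adj_mul_apply, ihA, ihB]
    noncomm_ring

/-! ### Triadditive forms with the symmetries of theta diagrams, and the eyeglass form -/

section Forms

variable {V : Type*} [AddCommGroup V]

/-- The triadditive map with given values on monomials. -/
def triadditive (t : List L → List L → List L → V) : Alg L →+ Alg L →+ Alg L →+ V :=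
  FreeAbelianGroup.lift fun a => FreeAbelianGroup.lift fun b => FreeAbelianGroup.lift fun c =>
    t a.toList b.toList c.toList

theorem triadditive_monomial (t : List L → List L → List L → V) (a b c : List L) :
    triadditive t (monomial a) (monomial b) (monomial c) = t a b c := by
  simp [triadditive, monomial]

/-- The symmetries and relations of theta diagrams as a function of the words on the three arms. -/
structure IsThetaForm
    (θ : Alg L →+ Alg L →+ Alg L →+ V) : Prop where
  rotate : ∀ a b c, θ a b c = θ b c a
  reverse : ∀ a b c, θ a b c = θ (antipode a) (antipode c) (antipode b)
  reflect : ∀ a b c, θ a b c = θ a c b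
  slide : ∀ l a b c, θ (Alg.gen l * a) b c + θ a (Alg.gen l * b) c +
    θ a b (Alg.gen l * c) = 0

/-- The value of the rewriting map on an eyeglass diagram. -/
def eyeglassForm (θ : Alg L →+ Alg L →+ Alg L →+ V)
    (l m r : Alg L) : V :=
  θ 1 (adj m r) (antipode l - l)

variable {θ : Alg L →+ Alg L →+ Alg L →+ V}

theorem triadditive_ext {f g : Alg L → Alg L → Alg L → V}
    (hf : (∀ x y b c, f (x + y) b c = f x b c + f y b c) ∧
      (∀ a x y c, f a (x + y) c = f a x c + f a y c) ∧
      ∀ a b x y, f a b (x + y) = f a b x + f a b y)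
    (hg : (∀ x y b c, g (x + y) b c = g x b c + g y b c) ∧
      (∀ a x y c, g a (x + y) c = g a x c + g a y c) ∧
      ∀ a b x y, g a b (x + y) = g a b x + g a b y)
    (h : ∀ a b c, f (monomial a) (monomial b) (monomial c) =
      g (monomial a) (monomial b) (monomial c)) (a b c : Alg L) : f a b c = g a b c := by
  refine additive_ext (f := fun a => f a b c) (g := fun a => g a b c)
    (fun x y => hf.1 x y b c) (fun x y => hg.1 x y b c) (fun u => ?_) a
  refine additive_ext (f := fun b => f _ b c) (g := fun b => g _ b c)
    (fun x y => hf.2.1 _ x y c) (fun x y => hg.2.1 _ x y c) (fun v => ?_) b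
  exact additive_ext (f := fun c => f _ _ c) (g := fun c => g _ _ c)
    (fun x y => hf.2.2 _ _ x y) (fun x y => hg.2.2 _ _ x y) (fun w => h u v w) c

/-- It suffices to check the relations of a theta form on monomials. -/
theorem isThetaForm_of_monomial
    (h1 : ∀ a b c, θ (monomial a) (monomial b) (monomial c) =
      θ (monomial b) (monomial c) (monomial a))
    (h2 : ∀ a b c, θ (monomial a) (monomial b) (monomial c) =
      θ (antipode (monomial a)) (antipode (monomial c)) (antipode (monomial b)))
    (h3 : ∀ a b c, θ (monomial a) (monomial b) (monomial c) =
      θ (monomial a) (monomial c) (monomial b))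
    (h4 : ∀ l a b c, θ (monomial (l :: a)) (monomial b) (monomial c) +
      θ (monomial a) (monomial (l :: b)) (monomial c) +
      θ (monomial a) (monomial b) (monomial (l :: c)) = 0) : IsThetaForm θ where
  rotate := triadditive_ext (f := fun a b c => θ a b c) (g := fun a b c => θ b c a)
    (by simp) (by simp) h1
  reverse := triadditive_ext (f := fun a b c => θ a b c)
    (g := fun a b c => θ (antipode a) (antipode c) (antipode b)) (by simp) (by simp) h2
  reflect := triadditive_ext (f := fun a b c => θ a b c) (g := fun a b c => θ a c b)
    (by simp) (by simp) h3
  slide l := triadditive_ext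
    (f := fun a b c => θ (Alg.gen l * a) b c + θ a (Alg.gen l * b) c + θ a b (Alg.gen l * c))
    (g := fun _ _ _ => 0)
    (by refine ⟨?_, ?_, ?_⟩ <;> intros <;> simp only [mul_add, map_add, AddMonoidHom.add_apply] <;>
          abel)
    (by simp) (by simpa only [monomial_cons] using h4 l)

/-- The slide at the second joint is the slide at the first one with the arms read from their other
ends. -/
theorem IsThetaForm.slide_right (hθ : IsThetaForm θ) (l : L) (a b c : Alg L) :
    θ (a * Alg.gen l) b c + θ a (b * Alg.gen l) c +
      θ a b (c * Alg.gen l) = 0 := by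
  have := hθ.slide l (antipode a) (antipode c) (antipode b)
  rw [hθ.reverse (a * _), hθ.reverse a (b * _), hθ.reverse a b]
  simp only [antipode_mul, antipode_gen, neg_mul, map_neg, AddMonoidHom.neg_apply]
  rw [← neg_eq_zero, ← this]
  abel

/-- This is AS at the left joint: reading the left circle backwards exchanges the two terms of
`antipode l - l`. -/
theorem eyeglassForm_antipode_left (l m r : Alg L) :
    eyeglassForm θ (antipode l) m r = -eyeglassForm θ l m r := by
  simp only [eyeglassForm, antipode_antipode, map_sub]
  abel

/-- This disposes of the self-loop relators: an empty left circle is its own reverse. -/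
theorem eyeglassForm_one (m r : Alg L) : eyeglassForm θ 1 m r = 0 := by
  simp [eyeglassForm]

/-- With an empty first arm, subtracting the slides at its two ends carries a commutator across:
`θ(1, [x, b], c) = -θ(1, b, [x, c])`. Moreover `l ↦ antipode l - l` commutes with `[x, ·]`. -/
theorem eyeglassForm_gen_mul (hθ : IsThetaForm θ) (x : L) (l m r : Alg L) :
    eyeglassForm θ l (Alg.gen x * m) r =
      -eyeglassForm θ (Alg.gen x * l - l * Alg.gen x) m r := by
  have h1 := hθ.slide x 1 (adj m r) (antipode l - l)
  have h2 := hθ.slide_right x 1 (adj m r) (antipode l - l)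
  simp only [eyeglassForm, adj_mul_apply, adj_gen, map_sub, antipode_mul, antipode_gen,
    mul_one, one_mul, mul_sub, sub_mul, AddMonoidHom.sub_apply, mul_neg, neg_mul, map_neg] at h1 h2 ⊢
  rw [← sub_eq_zero]
  rw [← sub_eq_zero.2 (h1.trans h2.symm)]
  abel

theorem eyeglassForm_mul_gen (x : L) (l m r : Alg L) :
    eyeglassForm θ l (m * Alg.gen x) r =
      eyeglassForm θ l m (Alg.gen x * r - r * Alg.gen x) := by
  simp only [eyeglassForm, adj_mul_apply, adj_gen]

theorem eyeglassForm_sub_left (l l' m r : Alg L) :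
    eyeglassForm θ (l - l') m r = eyeglassForm θ l m r - eyeglassForm θ l' m r := by
  simp only [eyeglassForm, map_sub]; abel

theorem eyeglassForm_sub_line (l m m' r : Alg L) :
    eyeglassForm θ l (m - m') r = eyeglassForm θ l m r - eyeglassForm θ l m' r := by
  rw [eyeglassForm, adj_sub_apply]
  simp only [eyeglassForm, map_sub, AddMonoidHom.sub_apply]
  abel

theorem eyeglassForm_zero_left (m r : Alg L) : eyeglassForm θ 0 m r = 0 := by
  simp [eyeglassForm]

/-- For an empty line this is the symmetry of `θ(1, ·, ·)` under exchange and reversal of arms. In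
general the first letter of the line passes to the left circle; in the turned picture it is the last
letter and passes to the right circle, which is the same circle. -/
theorem eyeglassForm_swap (hθ : IsThetaForm θ) (l m r : Alg L) :
    eyeglassForm θ r (antipode m) l = eyeglassForm θ l m r := by
  have add : ∀ x y l r, eyeglassForm θ l (x + y) r =
      eyeglassForm θ l x r + eyeglassForm θ l y r := fun x y l r => by
    rw [eyeglassForm, adj_add_apply]
    simp only [eyeglassForm, map_add, AddMonoidHom.add_apply]
  refine additive_ext (f := fun m => eyeglassForm θ r (antipode m) l)
    (g := fun m => eyeglassForm θ l m r) (fun x y => by simp only [map_add, add])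
    (fun x y => by simp only [add]) (fun w => ?_) m
  induction w generalizing l r with
  | nil =>
    simp only [monomial_nil, eyeglassForm, antipode_one, adj_one_apply, map_sub]
    rw [hθ.reverse 1 l (antipode r), antipode_one, antipode_antipode, hθ.reflect 1 l r]
  | cons x w ih =>
    rw [monomial_cons, eyeglassForm_gen_mul hθ, antipode_mul, antipode_gen, mul_neg, ← ih,
      ← eyeglassForm_mul_gen]
    rw [eyeglassForm, adj_neg_apply]
    simp only [eyeglassForm, map_neg, AddMonoidHom.neg_apply]

/-- The rule for generators propagates to brackets, because two successive commutators differ from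
the opposite order by the commutator with the bracket. -/
theorem eyeglassForm_toAlg_mul (hθ : IsThetaForm θ) (T : RTree L) (l m r : Alg L) :
    eyeglassForm θ l (T.toAlg * m) r = -eyeglassForm θ (T.toAlg * l - l * T.toAlg) m r := by
  induction T generalizing l m with
  | leaf x => exact eyeglassForm_gen_mul hθ x l m r
  | node A B ihA ihB =>
    rw [RTree.toAlg, sub_mul, mul_assoc, mul_assoc, eyeglassForm_sub_line, ihB, ihA, ihA, ihB,
      neg_neg, neg_neg, ← eyeglassForm_sub_left, eq_neg_iff_add_eq_zero]
    have : ∀ x y, eyeglassForm θ x m r + eyeglassForm θ y m r = eyeglassForm θ (x + y) m r :=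
      fun x y => by simp only [eyeglassForm, map_sub, map_add]; abel
    rw [this, ← eyeglassForm_zero_left m r]
    congr 1
    noncomm_ring

end Forms

namespace Diagram

/-! ### Diagrams with the same words are isomorphic -/

section Matching

variable {H H' : Type} {rot : Equiv.Perm H} {lab : H → Option L} {inv : Equiv.Perm H}
  {rot' : Equiv.Perm H'} {lab' : H' → Option L} {inv' : Equiv.Perm H'}

/-- The pairs of corresponding half-edges at two vertices. -/
def orbPairs (rot : Equiv.Perm H) (rot' : Equiv.Perm H') (h : H) (h' : H') :
    Multiset (H × H') := {(h, h')} + {(rot h, rot' h')} + {(rot.symm h, rot'.symm h')}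

theorem map_fst_orbPairs (h : H) (h' : H') :
    (orbPairs rot rot' h h').map Prod.fst = orb rot h := by simp [orbPairs, orb]

theorem map_snd_orbPairs (h : H) (h' : H') :
    (orbPairs rot rot' h h').map Prod.snd = orb rot' h' := by simp [orbPairs, orb]

theorem mem_orbPairs {h : H} {h' : H'} {q : H × H'} : q ∈ orbPairs rot rot' h h' ↔
    q = (h, h') ∨ q = (rot h, rot' h') ∨ q = (rot.symm h, rot'.symm h') := by
  simp [orbPairs]

theorem rot_mem_orbPairs (hr : ∀ h, rot (rot (rot h)) = h) (hr' : ∀ h, rot' (rot' (rot' h)) = h)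
    {h : H} {h' : H'} {q : H × H'} (hq : q ∈ orbPairs rot rot' h h') :
    (rot q.1, rot' q.2) ∈ orbPairs rot rot' h h' := by
  rw [mem_orbPairs] at hq ⊢
  rcases hq with rfl | rfl | rfl
  · exact Or.inr (Or.inl rfl)
  · exact Or.inr (Or.inr (by rw [rot_rot hr, rot_rot hr']))
  · exact Or.inl (by simp)

theorem lab_eq_of_mem_orbPairs (hl : ∀ h, rot h ≠ h → lab h = none)
    (hl' : ∀ h, rot' h ≠ h → lab' h = none) {h : H} {h' : H'} (hh : rot h ≠ h)
    (hh' : rot' h' ≠ h') {q : H × H'} (hq : q ∈ orbPairs rot rot' h h') :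
    lab' q.2 = lab q.1 := by
  rcases mem_orbPairs.1 hq with rfl | rfl | rfl
  · rw [hl _ hh, hl' _ hh']
  · rw [hl _ (rot_rot_ne hh), hl' _ (rot_rot_ne hh')]
  · rw [hl _ (rot_symm_ne hh), hl' _ (rot_symm_ne hh')]

/-- Two copies of one tree are traversed in parallel. The pairs obtained are closed under rotation,
and under the pairing except at the root, whose edge continues outside. -/
theorem IsTree.exists_matching (hr : ∀ h, rot (rot (rot h)) = h)
    (hr' : ∀ h, rot' (rot' (rot' h)) = h) (hl : ∀ h, rot h ≠ h → lab h = none)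
    (hl' : ∀ h, rot' h ≠ h → lab' h = none) (hi : ∀ h, inv (inv h) = h)
    (hi' : ∀ h, inv' (inv' h) = h) {h : H} {h' : H'} {T : RTree L} {M : Multiset H} {M' : Multiset H'}
    (hT : IsTree rot lab inv h T M) (hT' : IsTree rot' lab' inv' h' T M') :
    ∃ Q : Multiset (H × H'), Q.map Prod.fst = M ∧ Q.map Prod.snd = M' ∧ (h, h') ∈ Q ∧
      (∀ q ∈ Q, lab' q.2 = lab q.1) ∧ (∀ q ∈ Q, (rot q.1, rot' q.2) ∈ Q) ∧
      ∀ q ∈ Q, q = (h, h') ∨ (inv q.1, inv' q.2) ∈ Q := by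
  induction hT generalizing h' M' with
  | leaf h l h1 h2 =>
    cases hT' with
    | leaf _ _ h1' h2' =>
      exact ⟨{(h, h')}, by simp, by simp, by simp, by simp [h2, h2'], by simp [h1, h1'], by simp⟩
  | node h A B M N h1 _ _ ihA ihB =>
    cases hT' with
    | node _ _ _ M' N' h1' hA' hB' =>
      obtain ⟨Q₁, a1, a2, a3, a4, a5, a6⟩ := ihA hA'
      obtain ⟨Q₂, b1, b2, b3, b4, b5, b6⟩ := ihB hB'
      refine ⟨orbPairs rot rot' h h' + Q₁ + Q₂, ?_, ?_, ?_, ?_, ?_, ?_⟩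
      · simp only [Multiset.map_add, map_fst_orbPairs, a1, b1]
      · simp only [Multiset.map_add, map_snd_orbPairs, a2, b2]
      · simp [mem_orbPairs]
      · intro q hq
        simp only [Multiset.mem_add] at hq
        rcases hq with (hq | hq) | hq
        exacts [lab_eq_of_mem_orbPairs hl hl' h1 h1' hq, a4 q hq, b4 q hq]
      · intro q hq
        simp only [Multiset.mem_add] at hq ⊢
        rcases hq with (hq | hq) | hq
        exacts [Or.inl (Or.inl (rot_mem_orbPairs hr hr' hq)), Or.inl (Or.inr (a5 q hq)),
          Or.inr (b5 q hq)]
      · intro q hq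
        simp only [Multiset.mem_add] at hq ⊢
        rcases hq with (hq | hq) | hq
        · rcases mem_orbPairs.1 hq with rfl | rfl | rfl
          exacts [Or.inl rfl, Or.inr (Or.inl (Or.inr a3)), Or.inr (Or.inr b3)]
        · rcases a6 q hq with rfl | h
          · exact Or.inr (Or.inl (Or.inl (mem_orbPairs.2 (Or.inr (Or.inl (by simp [hi, hi']))))))
          · exact Or.inr (Or.inl (Or.inr h))
        · rcases b6 q hq with rfl | h
          · exact Or.inr (Or.inl (Or.inl (mem_orbPairs.2 (Or.inr (Or.inr (by simp [hi, hi']))))))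
          · exact Or.inr (Or.inr h)

theorem darts_mem_orbPairs (t : H) (t' : H') (s : Bool) :
    (inDart rot (t, s), inDart rot' (t', s)) ∈ orbPairs rot rot' t t' ∧
    (outDart rot (t, s), outDart rot' (t', s)) ∈ orbPairs rot rot' t t' := by
  cases s <;> simp [mem_orbPairs]

theorem mem_orbPairs_darts {t : H} {t' : H'} (s : Bool) {q : H × H'}
    (hq : q ∈ orbPairs rot rot' t t') : q = (t, t') ∨
      q = (inDart rot (t, s), inDart rot' (t', s)) ∨
      q = (outDart rot (t, s), outDart rot' (t', s)) := by
  rcases mem_orbPairs.1 hq with rfl | rfl | rfl <;> cases s <;> simp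

/-- The pairs of end points occur only in the last clause: their edges are matched here, while their
vertices are matched when the paths are assembled. -/
theorem IsPath.exists_matching (hr : ∀ h, rot (rot (rot h)) = h)
    (hr' : ∀ h, rot' (rot' (rot' h)) = h) (hl : ∀ h, rot h ≠ h → lab h = none)
    (hl' : ∀ h, rot' h ≠ h → lab' h = none) (hi : ∀ h, inv (inv h) = h)
    (hi' : ∀ h, inv' (inv' h) = h) {x y : H} {x' y' : H'} {w : Word L} {M : Multiset H}
    {M' : Multiset H'} (h : IsPath rot lab inv x w y M) (h' : IsPath rot' lab' inv' x' w y' M') :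
    ∃ Q : Multiset (H × H'), Q.map Prod.fst = M ∧ Q.map Prod.snd = M' ∧
      (∀ q ∈ Q, lab' q.2 = lab q.1) ∧ (∀ q ∈ Q, (rot q.1, rot' q.2) ∈ Q) ∧
      ∀ q ∈ {(x, x')} + {(y, y')} + Q, (inv q.1, inv' q.2) ∈ {(x, x')} + {(y, y')} + Q := by
  induction h generalizing x' M' with
  | nil x =>
    obtain ⟨rfl, rfl⟩ := h'.end_eq
    exact ⟨0, by simp, by simp, by simp, by simp, by simp [hi, hi']⟩
  | cons x t T s w y M N h1 h2 h3 h4 ih =>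
    cases h' with
    | cons _ t' _ _ _ _ M' N' h1' h2' h3' h4' =>
      obtain ⟨Q₁, a1, a2, a3, a4, a5, a6⟩ := h3.exists_matching hr hr' hl hl' hi hi' h3'
      obtain ⟨Q₂, b1, b2, b4, b5, b6⟩ := ih h4'
      have hd := darts_mem_orbPairs (rot := rot) (rot' := rot') t t' s
      refine ⟨orbPairs rot rot' t t' + Q₁ + Q₂, ?_, ?_, ?_, ?_, ?_⟩
      · simp only [Multiset.map_add, map_fst_orbPairs, a1, b1]
      · simp only [Multiset.map_add, map_snd_orbPairs, a2, b2]
      · intro q hq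
        simp only [Multiset.mem_add] at hq
        rcases hq with (hq | hq) | hq
        exacts [lab_eq_of_mem_orbPairs hl hl' h2 h2' hq, a4 q hq, b4 q hq]
      · intro q hq
        simp only [Multiset.mem_add] at hq ⊢
        rcases hq with (hq | hq) | hq
        exacts [Or.inl (Or.inl (rot_mem_orbPairs hr hr' hq)), Or.inl (Or.inr (a5 q hq)),
          Or.inr (b5 q hq)]
      · have hfix : ∀ q : H × H', (inv q.1, inv' q.2) ∈
            ({(outDart rot (t, s), outDart rot' (t', s))} + {(y, y')} + Q₂ : Multiset _) →
            (inv q.1, inv' q.2) ∈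
              ({(x, x')} + {(y, y')} + (orbPairs rot rot' t t' + Q₁ + Q₂) : Multiset _) := by
          intro q hq
          simp only [Multiset.mem_add, Multiset.mem_singleton] at hq ⊢
          rcases hq with (hq | hq) | hq
          · rw [hq]; exact Or.inr (Or.inl (Or.inl hd.2))
          · exact Or.inl (Or.inr hq)
          · exact Or.inr (Or.inr hq)
        intro q hq
        have hq0 := hq
        simp only [Multiset.mem_add, Multiset.mem_singleton] at hq
        rcases hq with (rfl | rfl) | (hq | hq) | hq
        · simp only [Multiset.mem_add]
          exact Or.inr (Or.inl (Or.inl (by rw [h1, h1']; exact hd.1)))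
        · exact hfix _ (b6 _ (by simp))
        · rcases mem_orbPairs_darts s hq with rfl | rfl | rfl
          · simp only [Multiset.mem_add]
            exact Or.inr (Or.inl (Or.inr a3))
          · rw [← h1, ← h1', hi, hi']; simp
          · exact hfix _ (b6 _ (by simp))
        · rcases a6 q hq with rfl | h
          · simp only [Multiset.mem_add, hi, hi']
            exact Or.inr (Or.inl (Or.inl (mem_orbPairs.2 (Or.inl rfl))))
          · simp only [Multiset.mem_add]
            exact Or.inr (Or.inl (Or.inr h))
        · exact hfix _ (b6 _ (by simp [hq]))

theorem ArePaths.exists_matching (hr : ∀ h, rot (rot (rot h)) = h)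
    (hr' : ∀ h, rot' (rot' (rot' h)) = h) (hl : ∀ h, rot h ≠ h → lab h = none)
    (hl' : ∀ h, rot' h ≠ h → lab' h = none) (hi : ∀ h, inv (inv h) = h)
    (hi' : ∀ h, inv' (inv' h) = h) {P : List (H × Word L × H)} {P' : List (H' × Word L × H')}
    (hP : List.Forall₂ (fun p p' => p.2.1 = p'.2.1) P P') {M : Multiset H} {M' : Multiset H'}
    (h : ArePaths rot lab inv P M) (h' : ArePaths rot' lab' inv' P' M') :
    ∃ E Q : Multiset (H × H'), (E + Q).map Prod.fst = M ∧ (E + Q).map Prod.snd = M' ∧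
      E = ((P.zip P').map fun p => ({(p.1.1, p.2.1)} + {(p.1.2.2, p.2.2.2)} : Multiset _)).sum ∧
      (∀ q ∈ Q, lab' q.2 = lab q.1) ∧ (∀ q ∈ Q, (rot q.1, rot' q.2) ∈ Q) ∧
      ∀ q ∈ E + Q, (inv q.1, inv' q.2) ∈ E + Q := by
  induction hP generalizing M M' with
  | nil =>
    cases h; cases h'
    exact ⟨0, 0, by simp, by simp, by simp, by simp, by simp, by simp⟩
  | cons hp _ ih =>
    cases h with
    | cons x w y P M N h1 h2 =>
      cases h' with
      | cons x' w' y' P' M' N' h1' h2' =>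
        obtain rfl : w = w' := hp
        obtain ⟨Q₁, a1, a2, a4, a5, a6⟩ := h1.exists_matching hr hr' hl hl' hi hi' h1'
        obtain ⟨E, Q₂, b1, b2, b3, b4, b5, b6⟩ := ih h2 h2'
        refine ⟨{(x, x')} + {(y, y')} + E, Q₁ + Q₂, ?_, ?_, ?_, ?_, ?_, ?_⟩
        · rw [← a1, ← b1]; simp only [Multiset.map_add, Multiset.map_singleton]; abel
        · rw [← a2, ← b2]; simp only [Multiset.map_add, Multiset.map_singleton]; abel
        · simp [b3]
        · intro q hq
          rcases Multiset.mem_add.1 hq with hq | hq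
          exacts [a4 q hq, b4 q hq]
        · intro q hq
          rw [Multiset.mem_add] at hq ⊢
          rcases hq with hq | hq
          exacts [Or.inl (a5 q hq), Or.inr (b5 q hq)]
        · have e : ({(x, x')} + {(y, y')} + E + (Q₁ + Q₂) : Multiset (H × H')) =
              {(x, x')} + {(y, y')} + Q₁ + (E + Q₂) := by abel
          intro q hq
          rw [e, Multiset.mem_add] at hq ⊢
          rcases hq with hq | hq
          exacts [Or.inl (a6 q hq), Or.inr (b6 q hq)]

end Matching

theorem label_eq_none (J : Diagram L) {h : J.H} (hh : J.rot h ≠ h) : J.label h = none := by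
  rw [← Option.not_isSome_iff_eq_none, J.label_isSome]
  exact hh

/-- A multiset of pairs in which every half-edge occurs exactly once gives an isomorphism. -/
theorem nonempty_iso_of_pairs {J K : Diagram L} (Q : Multiset (J.H × K.H))
    (h1 : ∀ h, (Q.map Prod.fst).count h = 1) (h2 : ∀ h, (Q.map Prod.snd).count h = 1)
    (hinv : ∀ q ∈ Q, (J.inv q.1, K.inv q.2) ∈ Q) (hrot : ∀ q ∈ Q, (J.rot q.1, K.rot q.2) ∈ Q)
    (hlab : ∀ q ∈ Q, K.label q.2 = J.label q.1) : Nonempty (Iso J K) := by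
  have n1 : (Q.map Prod.fst).Nodup := Multiset.nodup_iff_count_le_one.2 fun h => (h1 h).le
  have n2 : (Q.map Prod.snd).Nodup := Multiset.nodup_iff_count_le_one.2 fun h => (h2 h).le
  have u1 := Multiset.inj_on_of_nodup_map n1
  have u2 := Multiset.inj_on_of_nodup_map n2
  have e1 : ∀ h, ∃ k, (h, k) ∈ Q := fun h => by
    have : h ∈ Q.map Prod.fst := Multiset.count_pos.1 (by rw [h1]; norm_num)
    obtain ⟨⟨_, k⟩, hq, rfl⟩ := Multiset.mem_map.1 this
    exact ⟨k, hq⟩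
  have e2 : ∀ k, ∃ h, (h, k) ∈ Q := fun k => by
    have : k ∈ Q.map Prod.snd := Multiset.count_pos.1 (by rw [h2]; norm_num)
    obtain ⟨⟨h, _⟩, hq, rfl⟩ := Multiset.mem_map.1 this
    exact ⟨h, hq⟩
  choose φ hφ using e1
  choose ψ hψ using e2
  have key : ∀ {h k}, (h, k) ∈ Q → φ h = k := fun {h k} hq =>
    congrArg Prod.snd (u1 _ (hφ h) _ hq rfl)
  refine ⟨⟨⟨φ, ψ, fun h => ?_, fun k => key (hψ k)⟩, fun h => ?_, fun h => ?_, fun h => ?_⟩⟩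
  · exact congrArg Prod.fst (u2 _ (hψ (φ h)) _ (hφ h) rfl)
  · exact key (hinv _ (hφ h))
  · exact key (hrot _ (hφ h))
  · exact hlab _ (hφ h)

/-- Theta diagrams with the same words are isomorphic. -/
theorem IsTheta.nonempty_iso {J K : Diagram L} {a b c : Word L} (hJ : J.IsTheta a b c)
    (hK : K.IsTheta a b c) : Nonempty (Iso J K) := by
  obtain ⟨u, v, hJ⟩ := hJ
  obtain ⟨u', v', hK⟩ := hK
  obtain ⟨hu, hv⟩ := hJ.rot_ne
  obtain ⟨hu', hv'⟩ := hK.rot_ne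
  obtain ⟨-, M, hM, cM⟩ := hJ
  obtain ⟨-, M', hM', cM'⟩ := hK
  obtain ⟨E, Q, a1, a2, a3, a4, a5, a6⟩ := hM.exists_matching J.rot_cube K.rot_cube
    (fun _ => J.label_eq_none) (fun _ => K.label_eq_none) J.inv_inv K.inv_inv
    (by simp [thetaPaths]) hM'
  have hE : E = orbPairs J.rot K.rot u u' + orbPairs J.rot K.rot v v' := by
    rw [a3]
    simp only [thetaPaths, List.zip_cons_cons, List.zip_nil_right, List.map_cons, List.map_nil,
      List.sum_cons, List.sum_nil, orbPairs]
    abel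
  refine nonempty_iso_of_pairs (E + Q) (fun h => by rw [a1, cM]) (fun h => by rw [a2, cM']) a6 ?_ ?_
  · intro q hq
    rw [hE, Multiset.mem_add, Multiset.mem_add] at hq ⊢
    rcases hq with (hq | hq) | hq
    exacts [Or.inl (Or.inl (rot_mem_orbPairs J.rot_cube K.rot_cube hq)),
      Or.inl (Or.inr (rot_mem_orbPairs J.rot_cube K.rot_cube hq)), Or.inr (a5 q hq)]
  · intro q hq
    rw [hE, Multiset.mem_add, Multiset.mem_add] at hq
    rcases hq with (hq | hq) | hq
    exacts [lab_eq_of_mem_orbPairs (fun _ => J.label_eq_none) (fun _ => K.label_eq_none) hu hu' hq,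
      lab_eq_of_mem_orbPairs (fun _ => J.label_eq_none) (fun _ => K.label_eq_none) hv hv' hq,
      a4 q hq]

/-! ### Invariance under isomorphism -/

theorem IsEyeglass.of_iso {J K : Diagram L} (φ : Iso J K) {l m r : Word L}
    (h : J.IsEyeglass l m r) : K.IsEyeglass l m r := by
  obtain ⟨u, v, h⟩ := h
  have := h.map φ.equiv φ.map_rot φ.map_inv φ.map_label
  refine ⟨φ.equiv u, φ.equiv v, ?_⟩
  convert this using 1
  simp [eyeglassPaths, map_symm_of_map φ.equiv φ.map_rot, φ.map_rot]

theorem IsTwoLoop.of_iso {n : ℕ} {J K : Diagram L} (φ : Iso J K) (h : J.IsTwoLoop n) :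
    K.IsTwoLoop n := by
  obtain ⟨⟨hne, hc⟩, h1, h2⟩ := h
  have e1 : K.numTriv = J.numTriv := by
    unfold numTriv
    rw [Nat.card_congr (φ.equiv.subtypeEquiv fun h => ?_)]
    rw [← φ.map_rot, Ne, Ne, φ.equiv.apply_eq_iff_eq]
  have e2 : K.numUniv = J.numUniv := by
    unfold numUniv
    rw [Nat.card_congr (φ.equiv.subtypeEquiv fun h => ?_)]
    rw [← φ.map_rot, φ.equiv.apply_eq_iff_eq]
  have e3 : K.numEdges = J.numEdges := by
    unfold numEdges
    rw [Nat.card_congr φ.equiv]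
  refine ⟨⟨hne.map φ.equiv, fun x y => ?_⟩, by rw [e1, h1], by rw [betti, e1, e2, e3, ← h2, betti]⟩
  obtain ⟨x, rfl⟩ := φ.equiv.surjective x
  obtain ⟨y, rfl⟩ := φ.equiv.surjective y
  induction hc x y with
  | rel a b hab =>
    refine .rel _ _ ?_
    rcases hab with rfl | rfl
    exacts [Or.inl (φ.map_inv a), Or.inr (φ.map_rot a)]
  | refl a => exact .refl _
  | symm a b _ ih => exact .symm _ _ ih
  | trans a b c _ _ ih1 ih2 => exact .trans _ _ _ ih1 ih2

/-! ### Changing the pairing -/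

theorem reattach_reattach (J : Diagram L) (π σ : Equiv.Perm J.H) :
    (J.reattach π).reattach σ = J.reattach (π * σ) := by
  have : σ⁻¹ * (π⁻¹ * J.inv * π) * σ = (π * σ)⁻¹ * J.inv * (π * σ) := by group
  unfold reattach
  congr 1

/-- An automorphism `ρ` of the labelled vertices, applied before `π`, only renames half-edges. This
identifies flips at different half-edges of one vertex, and edges turned upside down. -/
theorem nonempty_iso_reattach (J : Diagram L) (π ρ : Equiv.Perm J.H)
    (hrot : ∀ h, ρ (J.rot h) = J.rot (ρ h)) (hlab : ∀ h, J.label (ρ h) = J.label h) :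
    Nonempty (Iso (J.reattach (π * ρ)) (J.reattach π)) :=
  ⟨⟨ρ, fun _ => ρ.apply_symm_apply _, hrot, hlab⟩⟩

/-- The vertices and all counts are unchanged, so only connectedness is at stake. It survives when
`π` moves half-edges within components of the new diagram. -/
theorem IsTwoLoop.reattach {n : ℕ} {J : Diagram L} (hJ : J.IsTwoLoop n) (π : Equiv.Perm J.H)
    (hπ : ∀ x, Relation.EqvGen (fun a b => b = (J.reattach π).inv a ∨ b = J.rot a) x (π x)) :
    (J.reattach π).IsTwoLoop n := by
  refine ⟨⟨hJ.1.1, fun x y => ?_⟩, hJ.2⟩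
  change Relation.EqvGen (fun a b => b = (J.reattach π).inv a ∨ b = J.rot a) x y
  induction hJ.1.2 x y with
  | rel a b hab =>
    rcases hab with rfl | rfl
    · have e1 := hπ (π⁻¹ a)
      rw [show π (π⁻¹ a) = a from π.apply_symm_apply a] at e1
      refine .trans _ _ _ (.symm _ _ e1) (.trans _ _ _ (.rel _ _ (Or.inl rfl)) ?_)
      have e2 := hπ ((J.reattach π).inv (π⁻¹ a))
      have : π ((J.reattach π).inv (π⁻¹ a)) = J.inv a :=
        (π.apply_symm_apply _).trans (congrArg J.inv (π.apply_symm_apply a))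
      rwa [this] at e2
    · exact .rel _ _ (Or.inr rfl)
  | refl a => exact .refl _
  | symm a b _ ih => exact .symm _ _ ih
  | trans a b c _ _ ih1 ih2 => exact .trans _ _ _ ih1 ih2

/-! ### Connectedness of trees, paths and theta diagrams -/

section Connected

variable {H : Type} {rot : Equiv.Perm H} {lab : H → Option L} {inv : Equiv.Perm H}

theorem eqvGen_of_mem_orb {x y : H} (h : y ∈ orb rot x) :
    Relation.EqvGen (fun a b => b = inv a ∨ b = rot a) x y := by
  rcases mem_orb.1 h with rfl | rfl | rfl
  · exact .refl _
  · exact .rel _ _ (Or.inr rfl)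
  · exact .symm _ _ (.rel _ _ (Or.inr (by simp)))

theorem IsTree.eqvGen {h : H} {T : RTree L} {M : Multiset H} (hT : IsTree rot lab inv h T M) :
    ∀ x ∈ M, Relation.EqvGen (fun a b => b = inv a ∨ b = rot a) h x := by
  induction hT with
  | leaf h l _ _ => intro x hx; rw [Multiset.mem_singleton.1 hx]; exact .refl _
  | node h A B M N _ _ _ ihA ihB =>
    intro x hx
    simp only [Multiset.mem_add] at hx
    rcases hx with (hx | hx) | hx
    · exact eqvGen_of_mem_orb hx
    · exact .trans _ _ _ (eqvGen_of_mem_orb (rot_mem_orb h))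
        (.trans _ _ _ (.rel _ _ (Or.inl rfl)) (ihA x hx))
    · exact .trans _ _ _ (eqvGen_of_mem_orb (rot_symm_mem_orb h))
        (.trans _ _ _ (.rel _ _ (Or.inl rfl)) (ihB x hx))

theorem IsPath.eqvGen {x y : H} {w : Word L} {M : Multiset H} (h : IsPath rot lab inv x w y M) :
    ∀ z ∈ {x} + {y} + M, Relation.EqvGen (fun a b => b = inv a ∨ b = rot a) x z := by
  induction h with
  | nil x =>
    intro z hz
    simp only [add_zero, Multiset.mem_add, Multiset.mem_singleton] at hz
    rcases hz with rfl | rfl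
    · exact .refl _
    · exact .rel _ _ (Or.inl rfl)
  | cons x t T s w y M N h1 h2 h3 h4 ih =>
    have k0 : Relation.EqvGen (fun a b => b = inv a ∨ b = rot a) t x :=
      .symm _ _ (.trans _ (inv x) _ (.rel _ _ (Or.inl rfl))
        (by rw [h1]; exact .symm _ _ (eqvGen_of_mem_orb (inDart_mem_orb (t, s)))))
    have k1 : ∀ z, Relation.EqvGen (fun a b => b = inv a ∨ b = rot a) t z →
        Relation.EqvGen (fun a b => b = inv a ∨ b = rot a) x z :=
      fun z hz => .trans _ _ _ (.symm _ _ k0) hz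
    have k2 := eqvGen_of_mem_orb (inv := inv) (outDart_mem_orb (rot := rot) (t, s))
    intro z hz
    simp only [Multiset.mem_add, Multiset.mem_singleton] at hz
    rcases hz with (rfl | rfl) | (hz | hz) | hz
    · exact .refl _
    · exact k1 _ (.trans _ _ _ k2 (ih _ (by simp)))
    · exact k1 _ (eqvGen_of_mem_orb hz)
    · exact k1 _ (.trans _ _ _ (.rel _ _ (Or.inl rfl)) (h3.eqvGen z hz))
    · exact k1 _ (.trans _ _ _ k2 (ih _ (by simp [hz])))

theorem ArePaths.eqvGen {P : List (H × Word L × H)} {M : Multiset H}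
    (h : ArePaths rot lab inv P M) {u : H}
    (hu : ∀ p ∈ P, Relation.EqvGen (fun a b => b = inv a ∨ b = rot a) u p.1) :
    ∀ z ∈ M, Relation.EqvGen (fun a b => b = inv a ∨ b = rot a) u z := by
  induction h with
  | nil => simp
  | cons x w y P M N h1 h2 ih =>
    intro z hz
    rcases Multiset.mem_add.1 hz with hz | hz
    · exact .trans _ _ _ (hu _ List.mem_cons_self) (h1.eqvGen z hz)
    · exact ih (fun p hp => hu p (List.mem_cons_of_mem _ hp)) z hz

end Connected

theorem IsTheta.connected {J : Diagram L} {a b c : Word L} (h : J.IsTheta a b c) :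
    J.Connected := by
  obtain ⟨u, v, -, M, hM, cM⟩ := h
  have key : ∀ x, Relation.EqvGen (fun a b => b = J.inv a ∨ b = J.rot a) u x := fun x =>
    hM.eqvGen (u := u) (by
      intro p hp
      simp only [thetaPaths, List.mem_cons, List.not_mem_nil, or_false] at hp
      rcases hp with rfl | rfl | rfl
      exacts [.refl _, eqvGen_of_mem_orb (rot_mem_orb u), eqvGen_of_mem_orb (rot_symm_mem_orb u)])
      x (Multiset.count_pos.1 (by rw [cM]; norm_num))
  exact ⟨⟨u⟩, fun x y => .trans _ _ _ (.symm _ _ (key x)) (key y)⟩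


/-! ### Moving strands -/

theorem formPerm_four {H : Type} {a b c d : H} (h : [a, b, c, d].Nodup) :
    [a, b, c, d].formPerm a = b ∧ [a, b, c, d].formPerm b = c ∧ [a, b, c, d].formPerm c = d ∧
      [a, b, c, d].formPerm d = a ∧
      ∀ z, z ≠ a → z ≠ b → z ≠ c → z ≠ d → [a, b, c, d].formPerm z = z := by
  simp only [List.nodup_cons, List.mem_cons, List.not_mem_nil, or_false, not_or] at h
  simp only [List.formPerm_cons_cons, List.formPerm_singleton, mul_one, Equiv.Perm.mul_apply,
    Equiv.swap_apply_def]
  refine ⟨?_, ?_, ?_, ?_, ?_⟩ <;> intros <;> grind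

theorem formPerm_three {H : Type} {b c d : H} (h : [b, c, d].Nodup) :
    [b, c, d].formPerm b = c ∧ [b, c, d].formPerm c = d ∧ [b, c, d].formPerm d = b ∧
      ∀ z, z ≠ b → z ≠ c → z ≠ d → [b, c, d].formPerm z = z := by
  simp only [List.nodup_cons, List.mem_cons, List.not_mem_nil, or_false, not_or] at h
  simp only [List.formPerm_cons_cons, List.formPerm_singleton, mul_one, Equiv.Perm.mul_apply,
    Equiv.swap_apply_def]
  refine ⟨?_, ?_, ?_, ?_⟩ <;> intros <;> grind

theorem nodup_edge {J : Diagram L} {e : J.H} (h1 : J.rot e ≠ e) (h2 : J.rot (J.inv e) ≠ J.inv e)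
    (h3 : J.inv e ∉ orb J.rot e) :
    [e, J.rot e, J.rot.symm e, J.inv e, J.rot (J.inv e), J.rot.symm (J.inv e)].Nodup := by
  change ([e, J.rot e, J.rot.symm e] ++ [J.inv e, J.rot (J.inv e), J.rot.symm (J.inv e)]).Nodup
  refine List.nodup_append'.2 ⟨nodup_orb_list h1, nodup_orb_list h2, ?_⟩
  intro d hd hd'
  have k1 : d ∈ orb J.rot e := by simpa [mem_orb] using hd
  have k2 : d ∈ orb J.rot (J.inv e) := by simpa [mem_orb] using hd'
  apply h3
  rw [← orb_eq_of_mem k1, orb_eq_of_mem k2]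
  exact self_mem_orb _

theorem IsInner.notMem_orb {J : Diagram L} {e : J.H} (he : J.IsInner e) :
    J.inv e ∉ orb J.rot e := by
  rw [mem_orb]
  rintro (h | h | h)
  exacts [J.inv_ne e h, he.2.2.1 h, he.2.2.2 h]

theorem isInner_of_notMem {J : Diagram L} {e : J.H} (h1 : J.rot e ≠ e)
    (h2 : J.rot (J.inv e) ≠ J.inv e) (h3 : J.inv e ∉ orb J.rot e) : J.IsInner e := by
  rw [mem_orb, not_or, not_or] at h3
  exact ⟨h1, h2, h3.2.1, h3.2.2⟩

theorem IsInner.nodup {J : Diagram L} {e : J.H} (he : J.IsInner e) :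
    [e, J.rot e, J.rot.symm e, J.inv e, J.rot (J.inv e), J.rot.symm (J.inv e)].Nodup :=
  nodup_edge he.1 he.2.1 he.notMem_orb

/-- The strand exchange replacing I by H at the edge of `e`. -/
def permH (J : Diagram L) (e : J.H) : Equiv.Perm J.H :=
  [J.rot e, J.rot.symm e, J.rot (J.inv e), J.rot.symm (J.inv e)].formPerm

/-- The strand exchange replacing I by X at the edge of `e`. -/
def permX (J : Diagram L) (e : J.H) : Equiv.Perm J.H :=
  [J.rot.symm e, J.rot (J.inv e), J.rot.symm (J.inv e)].formPerm

/-- The strand exchange reversing the cyclic order at the vertex of `e`. -/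
def permFlip (J : Diagram L) (e : J.H) : Equiv.Perm J.H := Equiv.swap (J.rot e) (J.rot.symm e)

/-- The pairing after moving the strands by `π`. -/
abbrev via (J : Diagram L) (π : Equiv.Perm J.H) : Equiv.Perm J.H := π⁻¹ * J.inv * π

theorem IsInner.permH_apply {J : Diagram L} {e : J.H} (he : J.IsInner e) :
    J.permH e e = e ∧ J.permH e (J.inv e) = J.inv e ∧
    J.permH e (J.rot e) = J.rot.symm e ∧ J.permH e (J.rot.symm e) = J.rot (J.inv e) ∧
      J.permH e (J.rot (J.inv e)) = J.rot.symm (J.inv e) ∧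
      J.permH e (J.rot.symm (J.inv e)) = J.rot e ∧
      ∀ z, z ∉ orb J.rot e + orb J.rot (J.inv e) → J.permH e z = z := by
  have hn := he.nodup
  have hn' : [J.rot e, J.rot.symm e, J.rot (J.inv e), J.rot.symm (J.inv e)].Nodup := by
    simp only [List.nodup_cons, List.mem_cons, List.not_mem_nil, or_false, not_or] at hn ⊢
    tauto
  obtain ⟨h1, h2, h3, h4, h5⟩ := formPerm_four hn'
  refine ⟨h5 _ ?_ ?_ ?_ ?_, h5 _ ?_ ?_ ?_ ?_, h1, h2, h3, h4, fun z hz => ?_⟩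
  on_goal 9 =>
    simp only [Multiset.mem_add, mem_orb, not_or] at hz
    exact h5 z hz.1.2.1 hz.1.2.2 hz.2.2.1 hz.2.2.2
  all_goals
    simp only [List.nodup_cons, List.mem_cons, List.not_mem_nil, or_false, not_or] at hn
    grind

theorem IsInner.permX_apply {J : Diagram L} {e : J.H} (he : J.IsInner e) :
    J.permX e e = e ∧ J.permX e (J.inv e) = J.inv e ∧
    J.permX e (J.rot e) = J.rot e ∧ J.permX e (J.rot.symm e) = J.rot (J.inv e) ∧
      J.permX e (J.rot (J.inv e)) = J.rot.symm (J.inv e) ∧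
      J.permX e (J.rot.symm (J.inv e)) = J.rot.symm e ∧
      ∀ z, z ∉ orb J.rot e + orb J.rot (J.inv e) → J.permX e z = z := by
  have hn := he.nodup
  have hn' : [J.rot.symm e, J.rot (J.inv e), J.rot.symm (J.inv e)].Nodup := by
    simp only [List.nodup_cons, List.mem_cons, List.not_mem_nil, or_false, not_or] at hn ⊢
    tauto
  obtain ⟨h2, h3, h4, h5⟩ := formPerm_three hn'
  refine ⟨h5 _ ?_ ?_ ?_, h5 _ ?_ ?_ ?_, h5 _ ?_ ?_ ?_, h2, h3, h4, fun z hz => ?_⟩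
  on_goal 10 =>
    simp only [Multiset.mem_add, mem_orb, not_or] at hz
    exact h5 z hz.1.2.2 hz.2.2.1 hz.2.2.2
  all_goals
    simp only [List.nodup_cons, List.mem_cons, List.not_mem_nil, or_false, not_or] at hn
    grind

theorem permFlip_apply {J : Diagram L} {e : J.H} (he : J.rot e ≠ e) :
    J.permFlip e e = e ∧ J.permFlip e (J.rot e) = J.rot.symm e ∧
      J.permFlip e (J.rot.symm e) = J.rot e ∧ ∀ z, z ∉ orb J.rot e → J.permFlip e z = z := by
  refine ⟨Equiv.swap_apply_of_ne_of_ne he.symm (Ne.symm ((symm_eq_self_iff e).not.2 he)),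
    Equiv.swap_apply_left _ _, Equiv.swap_apply_right _ _, fun z hz => ?_⟩
  simp only [mem_orb, not_or] at hz
  exact Equiv.swap_apply_of_ne_of_ne hz.2.1 hz.2.2

section Components

variable {H : Type} {rot : Equiv.Perm H} {lab : H → Option L} {inv : Equiv.Perm H}
  {π : Equiv.Perm H}

theorem conj_apply {x x' y y' : H} (hx : π x' = x) (hy : π y' = y) (h : inv x = y) :
    (π⁻¹ * inv * π) x' = y' := by
  rw [Equiv.Perm.mul_apply, Equiv.Perm.mul_apply, hx, h, Equiv.Perm.inv_eq_iff_eq, hy]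

theorem IsPath.move {x y x' y' : H} {w : Word L} {M : Multiset H}
    (h : IsPath rot lab inv x w y M) (hπ : ∀ z ∈ M, π z = z) (hx : π x' = x) (hy : π y' = y) :
    IsPath rot lab (π⁻¹ * inv * π) x' w y' M := by
  have := h.conj hπ
  rwa [Equiv.Perm.inv_eq_iff_eq.2 hx.symm, Equiv.Perm.inv_eq_iff_eq.2 hy.symm] at this

theorem IsTree.move {t t' : H} {T : RTree L} {M : Multiset H}
    (h : IsTree rot lab inv (inv t) T M) (hπ : ∀ z ∈ M, π z = z) (ht : π t' = t) :
    IsTree rot lab (π⁻¹ * inv * π) ((π⁻¹ * inv * π) t') T M := by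
  rw [conj_apply ht (hπ _ h.root_mem) rfl]
  exact h.conj hπ

/-- Expresses disjointness from the support of `π` as a bound on multiplicities, which can be read
off whenever all half-edges of a decomposition are counted once. -/
theorem fixes_of_count {S M : Multiset H} (hS : ∀ z, z ∉ S → π z = z)
    (h : ∀ z, S.count z + M.count z ≤ 1) : ∀ z ∈ M, π z = z := by
  intro z hz
  refine hS z fun hz' => ?_
  have := Multiset.count_pos.2 hz
  have := Multiset.count_pos.2 hz'
  have := h z
  omega

theorem IsTree.orb_subset (hr : ∀ h, rot (rot (rot h)) = h) {h e : H} {T : RTree L}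
    {M : Multiset H} (hT : IsTree rot lab inv h T M) (he : e ∈ M) : ∀ z ∈ orb rot e, z ∈ M := by
  have key : ∀ z, rot z ∈ M ↔ z ∈ M := fun z => by
    rw [← Multiset.count_pos, count_eq_of_map_eq (hT.map_rot hr), Multiset.count_pos]
  intro z hz
  rcases mem_orb.1 hz with rfl | rfl | rfl
  · exact he
  · rwa [key]
  · rwa [← key, Equiv.apply_symm_apply]

end Components

/-- The terms I, H, X at an edge leading to the first branch of a node, with `C` as the second
branch. -/
theorem RTree.toAlg_jacobi (A B C : RTree L) :
    (RTree.node (.node A B) C).toAlg - (RTree.node A (.node B C)).toAlg +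
      (RTree.node (.node C A) B).toAlg = 0 := by
  simp only [RTree.toAlg]
  noncomm_ring

/-- The same for an edge leading to the second branch; the trees in the places of H and X are
exchanged. -/
theorem RTree.toAlg_jacobi' (A B C : RTree L) :
    (RTree.node C (.node A B)).toAlg - (RTree.node (.node C A) B).toAlg +
      (RTree.node A (.node B C)).toAlg = 0 := by
  simp only [RTree.toAlg]
  noncomm_ring

/-- Reversing the cyclic order at a vertex of a tree changes the sign of the tree. -/
theorem IsTree.flip {J : Diagram L} {h e : J.H} {T : RTree L} {M : Multiset J.H}
    (hT : IsTree J.rot J.label J.inv h T M) (hM : ∀ z, M.count z ≤ 1) (he : e ∈ M)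
    (hne : J.rot e ≠ e) : ∃ g ∈ orb J.rot e, ∃ T', T'.toAlg = -T.toAlg ∧
      ∃ h', J.permFlip g h' = h ∧ IsTree J.rot J.label (J.via (J.permFlip g)) h' T' M := by
  induction hT with
  | leaf h l h1 h2 =>
    rw [Multiset.mem_singleton] at he
    exact absurd (he ▸ h1) hne
  | node h A B M N h1 hA hB ihA ihB =>
    simp only [Multiset.count_add] at hM
    simp only [Multiset.mem_add] at he
    rcases he with (he | he) | he
    -- The vertex is flipped at its half-edge towards the root, which stays in place while the two
    -- branches are exchanged.
    · obtain ⟨p1, p2, p3, p4⟩ := permFlip_apply h1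
      refine ⟨h, by rw [orb_eq_of_mem he]; exact self_mem_orb h, .node B A, ?_, h, p1, ?_⟩
      · simp [RTree.toAlg]
      · have fA := fixes_of_count (M := M) p4 fun z => by have := hM z; omega
        have fB := fixes_of_count (M := N) p4 fun z => by have := hM z; omega
        rw [add_assoc, add_comm M N, ← add_assoc]
        exact .node h B A N M h1 (hB.move fB p2) (hA.move fA p3)
    · obtain ⟨g, hg, T', e1, h', e2, e3⟩ := ihA (fun z => by have := hM z; omega) he
      have hgM := hA.orb_subset J.rot_cube he g hg
      have hgn : J.rot g ≠ g := by
        rcases mem_orb.1 hg with rfl | rfl | rfl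
        exacts [hne, rot_rot_ne hne, rot_symm_ne hne]
      have p4 : ∀ z, z ∉ M → J.permFlip g z = z := fun z hz =>
        (permFlip_apply hgn).2.2.2 z fun hz' => hz (hA.orb_subset J.rot_cube hgM z hz')
      have fO := fixes_of_count (M := orb J.rot h) p4 fun z => by have := hM z; omega
      have fB := fixes_of_count (M := N) p4 fun z => by have := hM z; omega
      refine ⟨g, hg, .node T' B, by simp only [RTree.toAlg, e1]; noncomm_ring, h,
        fO h (self_mem_orb h), .node h T' B M N h1 ?_ (hB.move fB (fO _ (rot_symm_mem_orb h)))⟩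
      have : (J.via (J.permFlip g)) (J.rot h) = h' := conj_apply (fO _ (rot_mem_orb h)) e2 rfl
      rwa [this]
    · obtain ⟨g, hg, T', e1, h', e2, e3⟩ := ihB (fun z => by have := hM z; omega) he
      have hgM := hB.orb_subset J.rot_cube he g hg
      have hgn : J.rot g ≠ g := by
        rcases mem_orb.1 hg with rfl | rfl | rfl
        exacts [hne, rot_rot_ne hne, rot_symm_ne hne]
      have p4 : ∀ z, z ∉ N → J.permFlip g z = z := fun z hz =>
        (permFlip_apply hgn).2.2.2 z fun hz' => hz (hB.orb_subset J.rot_cube hgM z hz')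
      have fO := fixes_of_count (M := orb J.rot h) p4 fun z => by have := hM z; omega
      have fA := fixes_of_count (M := M) p4 fun z => by have := hM z; omega
      refine ⟨g, hg, .node A T', by simp only [RTree.toAlg, e1]; noncomm_ring, h,
        fO h (self_mem_orb h), .node h A T' M N h1 (hA.move fA (fO _ (rot_mem_orb h))) ?_⟩
      have : (J.via (J.permFlip g)) (J.rot.symm h) = h' := conj_apply (fO _ (rot_symm_mem_orb h)) e2 rfl
      rwa [this]

/-- The IHX relation at an edge inside a tree is the Jacobi identity. -/
theorem IsTree.ihx {J : Diagram L} {h e : J.H} {T : RTree L} {M : Multiset J.H}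
    (hT : IsTree J.rot J.label J.inv h T M) (hM : ∀ z, M.count z ≤ 1) (he : e ∈ M)
    (heh : ¬ J.Hanging e) (hc : J.rot (J.inv e) ≠ J.inv e) : J.IsInner e ∧ J.inv e ∈ M ∧
      ∃ TH TX, T.toAlg - TH.toAlg + TX.toAlg = 0 ∧
        (∃ h', J.permH e h' = h ∧ IsTree J.rot J.label (J.via (J.permH e)) h' TH M) ∧
        ∃ h', J.permX e h' = h ∧ IsTree J.rot J.label (J.via (J.permX e)) h' TX M := by
  induction hT with
  | leaf h l h1 h2 =>
    rw [Multiset.mem_singleton] at he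
    exact absurd (Hanging.leaf e (he ▸ h1)) heh
  | node h T₁ T₂ M N h1 hT₁ hT₂ ih₁ ih₂ =>
    have hhang : J.Hanging h := .node h hT₁.hanging hT₂.hanging
    simp only [Multiset.count_add] at hM
    simp only [Multiset.mem_add] at he
    rcases he with (he | he) | he
    -- The half-edge `h` towards the root hangs, so `e` is one of the other two, directed towards
    -- the leaves. The branch there is a node because its root vertex is trivalent.
    · rcases mem_orb.1 he with rfl | rfl | rfl
      · exact absurd hhang heh
      · cases hT₁ with
        | leaf _ _ h' _ => exact absurd h' hc
        | node _ A B MA MB k1 hA hB =>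
          set e := J.rot h with hedef
          have er : J.rot e = J.rot.symm h := by rw [hedef, rot_rot J.rot_cube]
          have es : J.rot.symm e = h := by rw [hedef, Equiv.symm_apply_apply]
          have eo : orb J.rot e = orb J.rot h := orb_rot J.rot_cube h
          simp only [Multiset.count_add] at hM
          have hin : J.IsInner e := isInner_of_notMem (rot_rot_ne h1) hc fun hmem => by
            rw [eo] at hmem
            have := Multiset.count_pos.2 hmem
            have := Multiset.count_pos.2 (self_mem_orb (rot := J.rot) (J.inv e))
            have := hM (J.inv e)
            omega
          -- The root strand is re-hung at `J.rot e` by H and at `J.rot.symm (J.inv e)` by X.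
          refine ⟨hin, by simp [self_mem_orb], .node A (.node B T₂), .node (.node T₂ A) B,
            RTree.toAlg_jacobi A B T₂, ⟨J.rot e, ?_, ?_⟩, ⟨J.rot.symm (J.inv e), ?_, ?_⟩⟩
          · rw [hin.permH_apply.2.2.1, es]
          · obtain ⟨p1, p2, p3, p4, p5, p6, p7⟩ := hin.permH_apply
            rw [eo] at p7
            have fA := fixes_of_count (M := MA) p7 fun z => by
              have := hM z; rw [Multiset.count_add]; omega
            have fB := fixes_of_count (M := MB) p7 fun z => by
              have := hM z; rw [Multiset.count_add]; omega
            have f2 := fixes_of_count (M := N) p7 fun z => by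
              have := hM z; rw [Multiset.count_add]; omega
            have hsub : IsTree J.rot J.label (J.via (J.permH e)) (J.inv e) (.node B T₂)
                (orb J.rot (J.inv e) + MB + N) :=
              .node _ _ _ _ _ k1 (hB.move fB p5) (hT₂.move f2 (p6.trans er))
            have hroot : (J.via (J.permH e)) (J.rot.symm (J.rot e)) = J.inv e := by
              rw [Equiv.symm_apply_apply]; exact conj_apply p1 p2 rfl
            have := IsTree.node (lab := J.label) (inv := J.via (J.permH e)) (J.rot e) A (.node B T₂) MA _ (rot_rot_ne (rot_rot_ne h1))
              (by rw [rot_rot J.rot_cube]; exact hA.move fA p4) (by rw [hroot]; exact hsub)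
            rw [orb_rot J.rot_cube, eo] at this
            convert this using 1
            abel
          · rw [hin.permX_apply.2.2.2.2.2.1, es]
          · obtain ⟨p1, p2, p3, p4, p5, p6, p7⟩ := hin.permX_apply
            rw [eo] at p7
            have fA := fixes_of_count (M := MA) p7 fun z => by
              have := hM z; rw [Multiset.count_add]; omega
            have fB := fixes_of_count (M := MB) p7 fun z => by
              have := hM z; rw [Multiset.count_add]; omega
            have f2 := fixes_of_count (M := N) p7 fun z => by
              have := hM z; rw [Multiset.count_add]; omega
            have hsub : IsTree J.rot J.label (J.via (J.permX e)) e (.node T₂ A)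
                (orb J.rot e + N + MA) :=
              .node _ _ _ _ _ (rot_rot_ne h1) (hT₂.move f2 (p3.trans er)) (hA.move fA p4)
            have hroot : (J.via (J.permX e)) (J.rot (J.rot.symm (J.inv e))) = e := by
              rw [Equiv.apply_symm_apply]; exact conj_apply p2 p1 (J.inv_inv e)
            have := IsTree.node (lab := J.label) (inv := J.via (J.permX e)) (J.rot.symm (J.inv e)) (.node T₂ A) B _ MB (rot_symm_ne k1)
              (by rw [hroot]; exact hsub) (by rw [symm_symm J.rot_cube]; exact hB.move fB p5)
            rw [orb_symm J.rot_cube, eo] at this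
            convert this using 1
            abel
      · cases hT₂ with
        | leaf _ _ h' _ => exact absurd h' hc
        | node _ A B MA MB k1 hA hB =>
          set e := J.rot.symm h with hedef
          have er : J.rot e = h := by rw [hedef, Equiv.apply_symm_apply]
          have es : J.rot.symm e = J.rot h := by rw [hedef, symm_symm J.rot_cube]
          have eo : orb J.rot e = orb J.rot h := orb_symm J.rot_cube h
          simp only [Multiset.count_add] at hM
          have hin : J.IsInner e := isInner_of_notMem (rot_symm_ne h1) hc fun hmem => by
            rw [eo] at hmem
            have := Multiset.count_pos.2 hmem
            have := Multiset.count_pos.2 (self_mem_orb (rot := J.rot) (J.inv e))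
            have := hM (J.inv e)
            omega
          refine ⟨hin, by simp [self_mem_orb], .node (.node T₁ A) B, .node A (.node B T₁),
            RTree.toAlg_jacobi' A B T₁, ⟨J.rot.symm (J.inv e), ?_, ?_⟩, ⟨J.rot e, ?_, ?_⟩⟩
          · rw [hin.permH_apply.2.2.2.2.2.1, er]
          · obtain ⟨p1, p2, p3, p4, p5, p6, p7⟩ := hin.permH_apply
            rw [eo] at p7
            have fA := fixes_of_count (M := MA) p7 fun z => by
              have := hM z; rw [Multiset.count_add]; omega
            have fB := fixes_of_count (M := MB) p7 fun z => by
              have := hM z; rw [Multiset.count_add]; omega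
            have f1 := fixes_of_count (M := M) p7 fun z => by
              have := hM z; rw [Multiset.count_add]; omega
            have hsub : IsTree J.rot J.label (J.via (J.permH e)) e (.node T₁ A)
                (orb J.rot e + M + MA) :=
              .node _ _ _ _ _ (rot_symm_ne h1) (hT₁.move f1 (p3.trans es)) (hA.move fA p4)
            have hroot : (J.via (J.permH e)) (J.rot (J.rot.symm (J.inv e))) = e := by
              rw [Equiv.apply_symm_apply]; exact conj_apply p2 p1 (J.inv_inv e)
            have := IsTree.node (lab := J.label) (inv := J.via (J.permH e)) (J.rot.symm (J.inv e)) (.node T₁ A) B _ MB (rot_symm_ne k1)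
              (by rw [hroot]; exact hsub) (by rw [symm_symm J.rot_cube]; exact hB.move fB p5)
            rw [orb_symm J.rot_cube, eo] at this
            convert this using 1
            abel
          · rw [hin.permX_apply.2.2.1, er]
          · obtain ⟨p1, p2, p3, p4, p5, p6, p7⟩ := hin.permX_apply
            rw [eo] at p7
            have fA := fixes_of_count (M := MA) p7 fun z => by
              have := hM z; rw [Multiset.count_add]; omega
            have fB := fixes_of_count (M := MB) p7 fun z => by
              have := hM z; rw [Multiset.count_add]; omega
            have f1 := fixes_of_count (M := M) p7 fun z => by
              have := hM z; rw [Multiset.count_add]; omega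
            have hsub : IsTree J.rot J.label (J.via (J.permX e)) (J.inv e) (.node B T₁)
                (orb J.rot (J.inv e) + MB + M) :=
              .node _ _ _ _ _ k1 (hB.move fB p5) (hT₁.move f1 (p6.trans es))
            have hroot : (J.via (J.permX e)) (J.rot.symm (J.rot e)) = J.inv e := by
              rw [Equiv.symm_apply_apply]; exact conj_apply p1 p2 rfl
            have := IsTree.node (lab := J.label) (inv := J.via (J.permX e)) (J.rot e) A (.node B T₁) MA _ (rot_rot_ne (rot_symm_ne h1))
              (by rw [rot_rot J.rot_cube]; exact hA.move fA p4) (by rw [hroot]; exact hsub)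
            rw [orb_rot J.rot_cube, eo] at this
            convert this using 1
            abel
    · obtain ⟨hin, him, TH, TX, e0, ⟨h', e1, e2⟩, ⟨h'', e3, e4⟩⟩ :=
        ih₁ (fun z => by have := hM z; omega) he
      -- Both vertices at the edge of `e` lie in this branch, so the moves touch nothing outside it.
      have hsub : ∀ z, z ∉ M → z ∉ orb J.rot e + orb J.rot (J.inv e) := fun z hz hz' =>
        hz ((Multiset.mem_add.1 hz').elim (hT₁.orb_subset J.rot_cube he z)
          (hT₁.orb_subset J.rot_cube him z))
      have pH : ∀ z, z ∉ M → J.permH e z = z := fun z hz =>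
        hin.permH_apply.2.2.2.2.2.2 z (hsub z hz)
      have pX : ∀ z, z ∉ M → J.permX e z = z := fun z hz =>
        hin.permX_apply.2.2.2.2.2.2 z (hsub z hz)
      have fO := fixes_of_count (M := orb J.rot h) pH fun z => by have := hM z; omega
      have f2 := fixes_of_count (M := N) pH fun z => by have := hM z; omega
      have fO' := fixes_of_count (M := orb J.rot h) pX fun z => by have := hM z; omega
      have f2' := fixes_of_count (M := N) pX fun z => by have := hM z; omega
      refine ⟨hin, by simp [him], .node TH T₂, .node TX T₂, ?_,
        ⟨h, fO h (self_mem_orb h), .node h TH T₂ M N h1 ?_ (hT₂.move f2 (fO _ (rot_symm_mem_orb h)))⟩,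
        ⟨h, fO' h (self_mem_orb h), .node h TX T₂ M N h1 ?_
          (hT₂.move f2' (fO' _ (rot_symm_mem_orb h)))⟩⟩
      · have : T₁.toAlg = TH.toAlg - TX.toAlg := by rw [← sub_eq_zero, ← e0]; abel
        simp only [RTree.toAlg, this]
        noncomm_ring
      · have : (J.via (J.permH e)) (J.rot h) = h' := conj_apply (fO _ (rot_mem_orb h)) e1 rfl
        rwa [this]
      · have : (J.via (J.permX e)) (J.rot h) = h'' := conj_apply (fO' _ (rot_mem_orb h)) e3 rfl
        rwa [this]
    · obtain ⟨hin, him, TH, TX, e0, ⟨h', e1, e2⟩, ⟨h'', e3, e4⟩⟩ :=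
        ih₂ (fun z => by have := hM z; omega) he
      have hsub : ∀ z, z ∉ N → z ∉ orb J.rot e + orb J.rot (J.inv e) := fun z hz hz' =>
        hz ((Multiset.mem_add.1 hz').elim (hT₂.orb_subset J.rot_cube he z)
          (hT₂.orb_subset J.rot_cube him z))
      have pH : ∀ z, z ∉ N → J.permH e z = z := fun z hz =>
        hin.permH_apply.2.2.2.2.2.2 z (hsub z hz)
      have pX : ∀ z, z ∉ N → J.permX e z = z := fun z hz =>
        hin.permX_apply.2.2.2.2.2.2 z (hsub z hz)
      have fO := fixes_of_count (M := orb J.rot h) pH fun z => by have := hM z; omega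
      have f1 := fixes_of_count (M := M) pH fun z => by have := hM z; omega
      have fO' := fixes_of_count (M := orb J.rot h) pX fun z => by have := hM z; omega
      have f1' := fixes_of_count (M := M) pX fun z => by have := hM z; omega
      refine ⟨hin, by simp [him], .node T₁ TH, .node T₁ TX, ?_,
        ⟨h, fO h (self_mem_orb h), .node h T₁ TH M N h1 (hT₁.move f1 (fO _ (rot_mem_orb h))) ?_⟩,
        ⟨h, fO' h (self_mem_orb h), .node h T₁ TX M N h1
          (hT₁.move f1' (fO' _ (rot_mem_orb h))) ?_⟩⟩
      · have : T₂.toAlg = TH.toAlg - TX.toAlg := by rw [← sub_eq_zero, ← e0]; abel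
        simp only [RTree.toAlg, this]
        noncomm_ring
      · have : (J.via (J.permH e)) (J.rot.symm h) = h' := conj_apply (fO _ (rot_symm_mem_orb h)) e1 rfl
        rwa [this]
      · have : (J.via (J.permX e)) (J.rot.symm h) = h'' :=
          conj_apply (fO' _ (rot_symm_mem_orb h)) e3 rfl
        rwa [this]


/-! ### Letters -/

section Components

variable {H : Type} (rot : Equiv.Perm H) (lab : H → Option L) (inv : Equiv.Perm H)

/-- The graph consists of the vertices of `u` and `v`, of the paths `P` and of a path from `x` to
`y` which carries the tree `T` on its side `s` at the half-edge `t`. -/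
def LetterAt (u v x : H) (w₁ : Word L) (T : RTree L) (s : Bool) (w₂ : Word L) (y : H)
    (P : List (H × Word L × H)) (t : H) : Prop :=
  {x} + {y} + ends P = orb rot u + orb rot v ∧ rot t ≠ t ∧ ∃ M₁ N M₂ K,
    IsPath rot lab inv x w₁ (inDart rot (t, s)) M₁ ∧ IsTree rot lab inv (inv t) T N ∧
    IsPath rot lab inv (outDart rot (t, s)) w₂ y M₂ ∧ ArePaths rot lab inv P K ∧
    ∀ z, ({x} + {y} + (M₁ + (orb rot t + N + M₂)) + K).count z = 1

variable {rot lab inv} {u v x y t : H} {w₁ w₂ : Word L} {T : RTree L} {s : Bool}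
  {P : List (H × Word L × H)}

theorem LetterAt.skeleton (h : LetterAt rot lab inv u v x w₁ T s w₂ y P t) :
    Skeleton rot lab inv u v ((x, w₁ ++ (T, s) :: w₂, y) :: P) := by
  obtain ⟨hE, ht, M₁, N, M₂, K, h1, hT, h2, hP, hc⟩ := h
  exact ⟨by rw [ends_cons, hE], _, .cons _ _ _ _ _ _ (h1.append rfl ht hT h2) hP, hc⟩

theorem Skeleton.exists_letterAt
    (h : Skeleton rot lab inv u v ((x, w₁ ++ (T, s) :: w₂, y) :: P)) :
    ∃ t, LetterAt rot lab inv u v x w₁ T s w₂ y P t := by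
  obtain ⟨hE, M, hM, hc⟩ := h
  cases hM with
  | cons _ _ _ _ M K hp hP =>
    obtain ⟨t, M₁, N, M₂, k1, k2, k3, k4, rfl⟩ := hp.split
    exact ⟨t, by rw [← hE, ends_cons], k2, M₁, N, M₂, K, k1, k3, k4, hP, hc⟩

end Components

variable {J : Diagram L} {u v x y t : J.H} {w₁ w₂ : Word L} {T : RTree L} {s : Bool}
  {P : List (J.H × Word L × J.H)}

theorem permFlip_inDart (ht : J.rot t ≠ t) (s : Bool) :
    J.permFlip (inDart J.rot (t, s)) (inDart J.rot (t, s)) = inDart J.rot (t, s) ∧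
    J.permFlip (inDart J.rot (t, s)) (outDart J.rot (t, s)) = t ∧
    J.permFlip (inDart J.rot (t, s)) t = outDart J.rot (t, s) ∧
    ∀ z, z ∉ orb J.rot t → J.permFlip (inDart J.rot (t, s)) z = z := by
  cases s
  · obtain ⟨h1, h2, h3, h4⟩ := permFlip_apply (rot_symm_ne ht)
    rw [Equiv.apply_symm_apply, symm_symm J.rot_cube] at h2 h3
    rw [orb_symm J.rot_cube] at h4
    exact ⟨h1, h3, h2, h4⟩
  · obtain ⟨h1, h2, h3, h4⟩ := permFlip_apply (rot_rot_ne ht)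
    rw [Equiv.symm_apply_apply, rot_rot J.rot_cube] at h2 h3
    rw [orb_rot J.rot_cube] at h4
    exact ⟨h1, h2, h3, h4⟩

theorem inDart_outDart (t : J.H) (s : Bool) :
    inDart J.rot (outDart J.rot (t, s), !s) = inDart J.rot (t, s) := by
  cases s
  · exact rot_rot J.rot_cube t
  · exact symm_symm J.rot_cube t

theorem outDart_outDart (t : J.H) (s : Bool) :
    outDart J.rot (outDart J.rot (t, s), !s) = t := by
  cases s <;> simp

theorem orb_outDart (t : J.H) (s : Bool) : orb J.rot (outDart J.rot (t, s)) = orb J.rot t :=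
  orb_eq_of_mem (outDart_mem_orb (t, s))

theorem orb_inDart (t : J.H) (s : Bool) : orb J.rot (inDart J.rot (t, s)) = orb J.rot t :=
  orb_eq_of_mem (inDart_mem_orb (t, s))

theorem rot_outDart_ne (ht : J.rot t ≠ t) (s : Bool) :
    J.rot (outDart J.rot (t, s)) ≠ outDart J.rot (t, s) := by
  cases s
  exacts [rot_rot_ne ht, rot_symm_ne ht]

theorem rot_inDart_ne (ht : J.rot t ≠ t) (s : Bool) :
    J.rot (inDart J.rot (t, s)) ≠ inDart J.rot (t, s) := by
  rw [← outDart_not]; exact rot_outDart_ne ht _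

/-- Reversing the cyclic order at a letter, keeping the incoming half-edge. -/
theorem LetterAt.flip_in (h : LetterAt J.rot J.label J.inv u v x w₁ T s w₂ y P t) :
    LetterAt J.rot J.label (J.via (J.permFlip (inDart J.rot (t, s)))) u v x w₁ T (!s) w₂ y P
      (outDart J.rot (t, s)) := by
  obtain ⟨hE, ht, M₁, N, M₂, K, h1, hT, h2, hP, hc⟩ := h
  obtain ⟨p1, p2, p3, p4⟩ := permFlip_inDart ht s
  simp only [Multiset.count_add] at hc
  have f : ∀ M : Multiset J.H, (∀ z, (orb J.rot t).count z + M.count z ≤ 1) →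
      ∀ z ∈ M, J.permFlip (inDart J.rot (t, s)) z = z := fun M hM => fixes_of_count p4 hM
  have fx := f {x} (fun z => by have := hc z; omega) x (by simp)
  have fy := f {y} (fun z => by have := hc z; omega) y (by simp)
  refine ⟨hE, rot_outDart_ne ht s, M₁, N, M₂, K, ?_, ?_, ?_, ?_, fun z => ?_⟩
  · rw [inDart_outDart]
    exact h1.move (f _ fun z => by have := hc z; omega) fx p1
  · exact hT.move (f _ fun z => by have := hc z; omega) p2
  · rw [outDart_outDart]
    exact h2.move (f _ fun z => by have := hc z; omega) p3 fy
  · exact hP.conj (f _ fun z => by have := hc z; omega)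
  · rw [orb_outDart]
    simp only [Multiset.count_add]
    exact hc z

/-- Reversing the cyclic order at a letter, keeping the outgoing half-edge. -/
theorem LetterAt.flip_out (h : LetterAt J.rot J.label J.inv u v x w₁ T s w₂ y P t) :
    LetterAt J.rot J.label (J.via (J.permFlip (outDart J.rot (t, s)))) u v x w₁ T (!s) w₂ y P
      (inDart J.rot (t, s)) := by
  obtain ⟨hE, ht, M₁, N, M₂, K, h1, hT, h2, hP, hc⟩ := h
  have e1 := permFlip_inDart ht (!s)
  rw [inDart_not, outDart_not] at e1
  obtain ⟨p1, p2, p3, p4⟩ := e1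
  simp only [Multiset.count_add] at hc
  have f : ∀ M : Multiset J.H, (∀ z, (orb J.rot t).count z + M.count z ≤ 1) →
      ∀ z ∈ M, J.permFlip (outDart J.rot (t, s)) z = z := fun M hM => fixes_of_count p4 hM
  have fx := f {x} (fun z => by have := hc z; omega) x (by simp)
  have fy := f {y} (fun z => by have := hc z; omega) y (by simp)
  have e2 : inDart J.rot (inDart J.rot (t, s), s) = outDart J.rot (t, s) := by
    cases s
    exacts [symm_symm J.rot_cube t, rot_rot J.rot_cube t]
  have e3 : outDart J.rot (inDart J.rot (t, s), s) = t := by cases s <;> simp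
  refine ⟨hE, rot_inDart_ne ht s, M₁, N, M₂, K, ?_, ?_, ?_, ?_, fun z => ?_⟩
  · rw [inDart_not, e3]
    exact h1.move (f _ fun z => by have := hc z; omega) fx p3
  · exact hT.move (f _ fun z => by have := hc z; omega) p2
  · rw [outDart_not, e2]
    exact h2.move (f _ fun z => by have := hc z; omega) p1 fy
  · exact hP.conj (f _ fun z => by have := hc z; omega)
  · rw [orb_inDart]
    simp only [Multiset.count_add]
    exact hc z

/-- Reversing the cyclic order at a vertex of a tree. -/
theorem LetterAt.flip_tree (h : LetterAt J.rot J.label J.inv u v x w₁ T s w₂ y P t)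
    {N : Multiset J.H} (hN : IsTree J.rot J.label J.inv (J.inv t) T N) {e : J.H} (he : e ∈ N)
    (hne : J.rot e ≠ e) : ∃ g ∈ orb J.rot e, ∃ T', T'.toAlg = -T.toAlg ∧
      LetterAt J.rot J.label (J.via (J.permFlip g)) u v x w₁ T' s w₂ y P t := by
  obtain ⟨hE, ht, M₁, N', M₂, K, h1, hT, h2, hP, hc⟩ := h
  obtain ⟨-, rfl⟩ := hN.unique hT
  simp only [Multiset.count_add] at hc
  obtain ⟨g, hg, T', e1, h', e2, e3⟩ := hT.flip (fun z => by have := hc z; omega) he hne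
  have hgn : J.rot g ≠ g := by
    rcases mem_orb.1 hg with rfl | rfl | rfl
    exacts [hne, rot_rot_ne hne, rot_symm_ne hne]
  have hgM := hT.orb_subset J.rot_cube he g hg
  have p4 : ∀ z, z ∉ N → J.permFlip g z = z := fun z hz =>
    (permFlip_apply hgn).2.2.2 z fun hz' => hz (hT.orb_subset J.rot_cube hgM z hz')
  have f : ∀ M : Multiset J.H, (∀ z, N.count z + M.count z ≤ 1) →
      ∀ z ∈ M, J.permFlip g z = z := fun M hM => fixes_of_count p4 hM
  have fx := f {x} (fun z => by have := hc z; omega) x (by simp)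
  have fy := f {y} (fun z => by have := hc z; omega) y (by simp)
  have ft := f (orb J.rot t) (fun z => by have := hc z; omega)
  refine ⟨g, hg, T', e1, hE, ht, M₁, N, M₂, K, ?_, ?_, ?_, ?_, fun z => ?_⟩
  · exact h1.move (f _ fun z => by have := hc z; omega) fx (ft _ (inDart_mem_orb (t, s)))
  · rwa [conj_apply (ft t (self_mem_orb t)) e2 rfl]
  · exact h2.move (f _ fun z => by have := hc z; omega) (ft _ (outDart_mem_orb (t, s))) fy
  · exact hP.conj (f _ fun z => by have := hc z; omega)
  · simp only [Multiset.count_add]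
    exact hc z

/-- The IHX relation inside a tree. -/
theorem LetterAt.ihx_tree (h : LetterAt J.rot J.label J.inv u v x w₁ T s w₂ y P t)
    {N : Multiset J.H} (hN : IsTree J.rot J.label J.inv (J.inv t) T N) {e : J.H} (he : e ∈ N)
    (heh : ¬ J.Hanging e) (hc : J.rot (J.inv e) ≠ J.inv e) :
    ∃ TH TX, T.toAlg - TH.toAlg + TX.toAlg = 0 ∧
      LetterAt J.rot J.label (J.via (J.permH e)) u v x w₁ TH s w₂ y P t ∧
      LetterAt J.rot J.label (J.via (J.permX e)) u v x w₁ TX s w₂ y P t := by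
  obtain ⟨hE, ht, M₁, N', M₂, K, h1, hT, h2, hP, hc'⟩ := h
  obtain ⟨-, rfl⟩ := hN.unique hT
  simp only [Multiset.count_add] at hc'
  obtain ⟨hin, him, TH, TX, e0, ⟨h', e1, e2⟩, ⟨h'', e3, e4⟩⟩ :=
    hT.ihx (fun z => by have := hc' z; omega) he heh hc
  have hsub : ∀ z, z ∉ N → z ∉ orb J.rot e + orb J.rot (J.inv e) := fun z hz hz' =>
    hz ((Multiset.mem_add.1 hz').elim (hT.orb_subset J.rot_cube he z)
      (hT.orb_subset J.rot_cube him z))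
  have key : ∀ (π : Equiv.Perm J.H) (T' : RTree L) (k : J.H), (∀ z, z ∉ N → π z = z) →
      π k = J.inv t → IsTree J.rot J.label (J.via π) k T' N →
      LetterAt J.rot J.label (J.via π) u v x w₁ T' s w₂ y P t := by
    intro π T' k hπ hk hT'
    have f : ∀ M : Multiset J.H, (∀ z, N.count z + M.count z ≤ 1) →
        ∀ z ∈ M, π z = z := fun M hM => fixes_of_count hπ hM
    have fx := f {x} (fun z => by have := hc' z; omega) x (by simp)
    have fy := f {y} (fun z => by have := hc' z; omega) y (by simp)
    have ft := f (orb J.rot t) (fun z => by have := hc' z; omega)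
    refine ⟨hE, ht, M₁, N, M₂, K, ?_, ?_, ?_, ?_, fun z => ?_⟩
    · exact h1.move (f _ fun z => by have := hc' z; omega) fx (ft _ (inDart_mem_orb (t, s)))
    · rwa [conj_apply (ft t (self_mem_orb t)) hk rfl]
    · exact h2.move (f _ fun z => by have := hc' z; omega) (ft _ (outDart_mem_orb (t, s))) fy
    · exact hP.conj (f _ fun z => by have := hc' z; omega)
    · simp only [Multiset.count_add]
      exact hc' z
  exact ⟨TH, TX, e0,
    key _ TH h' (fun z hz => hin.permH_apply.2.2.2.2.2.2 z (hsub z hz)) e1 e2,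
    key _ TX h'' (fun z hz => hin.permX_apply.2.2.2.2.2.2 z (hsub z hz)) e3 e4⟩

/-- The IHX relation at the root of a tree on a strand. -/
theorem LetterAt.ihx_root {A B : RTree L}
    (h : LetterAt J.rot J.label J.inv u v x w₁ (.node A B) true w₂ y P t) : J.IsInner t ∧
      Skeleton J.rot J.label (J.via (J.permH t)) u v
        ((x, w₁ ++ (B, true) :: (A, true) :: w₂, y) :: P) ∧
      Skeleton J.rot J.label (J.via (J.permX t)) u v
        ((x, w₁ ++ (A, false) :: (B, false) :: w₂, y) :: P) := by
  obtain ⟨hE, ht, M₁, N, M₂, K, h1, hT, h2, hP, hc⟩ := h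
  cases hT with
  | node _ _ _ MA MB k1 hA hB =>
  simp only [Multiset.count_add] at hc
  set h := J.inv t with hh
  have hin : J.IsInner t := isInner_of_notMem ht k1 fun hmem => by
    rw [← hh] at hmem
    have := Multiset.count_pos.2 hmem
    have := Multiset.count_pos.2 (self_mem_orb (rot := J.rot) h)
    have := hc h
    omega
  have hE' : ∀ w : Word L, ends ((x, w, y) :: P) = orb J.rot u + orb J.rot v := fun w => by
    rw [ends_cons, hE]
  have f : ∀ π : Equiv.Perm J.H, (∀ z, z ∉ orb J.rot t + orb J.rot h → π z = z) →
      ∀ M : Multiset J.H, (∀ z, (orb J.rot t).count z + (orb J.rot h).count z + M.count z ≤ 1) →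
      ∀ z ∈ M, π z = z := fun π hπ M hM => fixes_of_count hπ fun z => by
        rw [Multiset.count_add]; exact hM z
  refine ⟨hin, ?_, ?_⟩
  -- H unrolls the node into `B, A` on the left of the strand; X, treated below, unrolls it into `A,
  -- B` on the right, where the two signs cancel. This is the expansion `BA - AB` of the bracket.
  · obtain ⟨p1, p2, p3, p4, p5, p6, p7⟩ := hin.permH_apply
    have f := f _ p7
    have fx := f {x} (fun z => by have := hc z; omega) x (by simp)
    have fy := f {y} (fun z => by have := hc z; omega) y (by simp)
    have g2 : IsPath J.rot J.label (J.via (J.permH t)) (J.rot t) w₂ y M₂ :=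
      h2.move (f _ fun z => by have := hc z; omega) p3 fy
    have gA : IsTree J.rot J.label (J.via (J.permH t)) _ A MA :=
      hA.move (f _ fun z => by have := hc z; omega) p4
    have gB : IsTree J.rot J.label (J.via (J.permH t)) _ B MB :=
      hB.move (f _ fun z => by have := hc z; omega) p5
    have g1 : IsPath J.rot J.label (J.via (J.permH t)) x w₁ (J.rot.symm h) M₁ :=
      h1.move (f _ fun z => by have := hc z; omega) fx p6
    have g3 := IsPath.cons h (J.rot.symm t) A true w₂ y MA M₂
      (by rw [inDart_true, Equiv.apply_symm_apply]
          exact conj_apply p2 p1 (J.inv_inv t)) (rot_symm_ne ht) gA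
      (by rw [outDart_true, symm_symm J.rot_cube]; exact g2)
    have g4 := g1.append (t := J.rot h) (s := true) (by rw [inDart_true, rot_rot J.rot_cube])
      (rot_rot_ne k1) gB (by rw [outDart_true, Equiv.symm_apply_apply]; exact g3)
    refine ⟨hE' _, _, .cons _ _ _ _ _ _ g4 (hP.conj (f _ fun z => by have := hc z; omega)),
      fun z => ?_⟩
    rw [orb_rot J.rot_cube, orb_symm J.rot_cube]
    simp only [Multiset.count_add]
    have := hc z
    omega
  · obtain ⟨p1, p2, p3, p4, p5, p6, p7⟩ := hin.permX_apply
    have f := f _ p7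
    have fx := f {x} (fun z => by have := hc z; omega) x (by simp)
    have fy := f {y} (fun z => by have := hc z; omega) y (by simp)
    have g2 : IsPath J.rot J.label (J.via (J.permX t)) (J.rot.symm h) w₂ y M₂ :=
      h2.move (f _ fun z => by have := hc z; omega) p6 fy
    have gA : IsTree J.rot J.label (J.via (J.permX t)) _ A MA :=
      hA.move (f _ fun z => by have := hc z; omega) p4
    have gB : IsTree J.rot J.label (J.via (J.permX t)) _ B MB :=
      hB.move (f _ fun z => by have := hc z; omega) p5
    have g1 : IsPath J.rot J.label (J.via (J.permX t)) x w₁ (J.rot t) M₁ :=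
      h1.move (f _ fun z => by have := hc z; omega) fx p3
    have g3 := IsPath.cons t (J.rot h) B false w₂ y MB M₂
      (by rw [inDart_false, Equiv.symm_apply_apply]
          exact conj_apply p1 p2 rfl) (rot_rot_ne k1) gB
      (by rw [outDart_false, rot_rot J.rot_cube]; exact g2)
    have g4 := g1.append (t := J.rot.symm t) (s := false)
      (by rw [inDart_false, symm_symm J.rot_cube])
      (rot_symm_ne ht) gA (by rw [outDart_false, Equiv.apply_symm_apply]; exact g3)
    refine ⟨hE' _, _, .cons _ _ _ _ _ _ g4 (hP.conj (f _ fun z => by have := hc z; omega)),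
      fun z => ?_⟩
    rw [orb_rot J.rot_cube, orb_symm J.rot_cube]
    simp only [Multiset.count_add]
    have := hc z
    omega

/-- Merging two adjacent trees on a strand. -/
theorem LetterAt.merge {T₂ : RTree L} (h : LetterAt J.rot J.label J.inv u v x w₁ T true
      ((T₂, true) :: w₂) y P t) : J.IsInner (J.rot.symm t) ∧
      LetterAt J.rot J.label (J.via (J.permH (J.rot.symm t))) u v x w₁ (.node T₂ T) true w₂ y P
        (J.rot.symm t) := by
  obtain ⟨hE, ht, M₁, N, M₂, K, h1, hT, h2, hP, hc⟩ := h
  cases h2 with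
  | cons _ t' _ _ _ _ N' M₂ k1 k2 hT' h2 =>
  simp only [inDart_true, outDart_true] at h1 k1 h2
  simp only [Multiset.count_add] at hc
  set e := J.rot.symm t with he
  have er : J.rot e = t := by rw [he, Equiv.apply_symm_apply]
  have es : J.rot.symm e = J.rot t := by rw [he, symm_symm J.rot_cube]
  have eo : orb J.rot e = orb J.rot t := orb_symm J.rot_cube t
  have er' : J.rot (J.inv e) = J.rot.symm t' := by rw [k1, rot_rot J.rot_cube]
  have es' : J.rot.symm (J.inv e) = t' := by rw [k1, Equiv.symm_apply_apply]
  have eo' : orb J.rot (J.inv e) = orb J.rot t' := by rw [k1, orb_rot J.rot_cube]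
  have hin : J.IsInner e := isInner_of_notMem (rot_symm_ne ht) (by rw [k1]; exact rot_rot_ne k2)
    fun hmem => by
      rw [eo] at hmem
      have := Multiset.count_pos.2 hmem
      have := Multiset.count_pos.2 (self_mem_orb (rot := J.rot) (J.inv e))
      rw [eo'] at this
      have := hc (J.inv e)
      omega
  refine ⟨hin, ?_⟩
  obtain ⟨p1, p2, p3, p4, p5, p6, p7⟩ := hin.permH_apply
  rw [eo, eo'] at p7
  rw [er', es'] at p5
  rw [es', er] at p6
  rw [er, es] at p3
  rw [es, er'] at p4
  have f : ∀ M : Multiset J.H, (∀ z, (orb J.rot t).count z + (orb J.rot t').count z + M.count z ≤ 1)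
      → ∀ z ∈ M, J.permH e z = z := fun M hM => fixes_of_count p7 fun z => by
        rw [Multiset.count_add]; exact hM z
  have fx := f {x} (fun z => by have := hc z; omega) x (by simp)
  have fy := f {y} (fun z => by have := hc z; omega) y (by simp)
  refine ⟨hE, rot_symm_ne ht, M₁, orb J.rot (J.inv e) + N' + N, M₂, K, ?_, ?_, ?_, ?_, fun z => ?_⟩
  · rw [inDart_true, er]
    exact h1.move (f _ fun z => by have := hc z; omega) fx p3
  · rw [conj_apply (inv := J.inv) p1 p2 rfl]
    refine .node _ _ _ _ _ hin.2.1 ?_ ?_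
    · rw [er']; exact hT'.move (f _ fun z => by have := hc z; omega) p5
    · rw [es']; exact hT.move (f _ fun z => by have := hc z; omega) p6
  · rw [outDart_true, es]
    exact h2.move (f _ fun z => by have := hc z; omega) p4 fy
  · exact hP.conj (f _ fun z => by have := hc z; omega)
  · rw [eo, eo']
    simp only [Multiset.count_add]
    have := hc z
    omega


/-! ### Joints -/

theorem skeleton_three {H : Type} {rot : Equiv.Perm H} {lab : H → Option L} {inv : Equiv.Perm H}
    {u v x₁ x₂ x₃ y₁ y₂ y₃ : H} {w₁ w₂ w₃ : Word L} :
    Skeleton rot lab inv u v [(x₁, w₁, y₁), (x₂, w₂, y₂), (x₃, w₃, y₃)] ↔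
      ends [(x₁, w₁, y₁), (x₂, w₂, y₂), (x₃, w₃, y₃)] = orb rot u + orb rot v ∧
      ∃ M₁ M₂ M₃, IsPath rot lab inv x₁ w₁ y₁ M₁ ∧ IsPath rot lab inv x₂ w₂ y₂ M₂ ∧
        IsPath rot lab inv x₃ w₃ y₃ M₃ ∧
        ∀ z, (orb rot u + orb rot v + (M₁ + M₂ + M₃)).count z = 1 := by
  have key : ∀ M₁ M₂ M₃ : Multiset H,
      ends [(x₁, w₁, y₁), (x₂, w₂, y₂), (x₃, w₃, y₃)] = orb rot u + orb rot v →
      {x₁} + {y₁} + M₁ + ({x₂} + {y₂} + M₂ + ({x₃} + {y₃} + M₃ + 0)) =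
        orb rot u + orb rot v + (M₁ + M₂ + M₃) := fun M₁ M₂ M₃ h => by
    rw [← h]
    simp only [ends_cons, ends_nil]
    abel
  constructor
  · rintro ⟨hE, M, hM, hc⟩
    refine ⟨hE, ?_⟩
    cases hM with
    | cons _ _ _ _ M₁ _ h1 hM =>
    cases hM with
    | cons _ _ _ _ M₂ _ h2 hM =>
    cases hM with
    | cons _ _ _ _ M₃ _ h3 hM =>
    cases hM
    rw [key _ _ _ hE] at hc
    exact ⟨M₁, M₂, M₃, h1, h2, h3, hc⟩
  · rintro ⟨hE, M₁, M₂, M₃, h1, h2, h3, hc⟩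
    refine ⟨hE, _, .cons _ _ _ _ _ _ h1 (.cons _ _ _ _ _ _ h2 (.cons _ _ _ _ _ _ h3 .nil)), ?_⟩
    rw [key _ _ _ hE]
    exact hc

variable {J : Diagram L} {u v : J.H} {l m r a b c w : Word L} {T : RTree L}

/-- Reversing the cyclic order at the left joint. -/
theorem Skeleton.eyeglass_flip
    (h : Skeleton J.rot J.label J.inv u v (eyeglassPaths J.rot u v l m r)) :
    Skeleton J.rot J.label (J.via (J.permFlip (J.rot u))) (J.rot.symm u) v
      (eyeglassPaths J.rot (J.rot.symm u) v (bar l) m r) := by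
  have hu := h.rot_ne.1
  obtain ⟨hE, M₁, M₂, M₃, h1, h2, h3, hc⟩ := skeleton_three.1 h
  obtain ⟨p1, p2, p3, p4⟩ := permFlip_apply (rot_rot_ne hu)
  rw [rot_rot J.rot_cube, Equiv.symm_apply_apply] at p2 p3
  rw [orb_rot J.rot_cube] at p4
  simp only [Multiset.count_add] at hc
  have f : ∀ M : Multiset J.H, (∀ z, (orb J.rot u).count z + M.count z ≤ 1) →
      ∀ z ∈ M, J.permFlip (J.rot u) z = z := fun M hM => fixes_of_count p4 hM
  have fv := f (orb J.rot v) (fun z => by have := hc z; omega)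
  refine skeleton_three.2 ⟨ends_eyeglassPaths .., M₁, M₂, M₃, ?_, ?_, ?_, fun z => ?_⟩
  · have := h1.move (f _ fun z => by have := hc z; omega) p3 p1
    rw [symm_symm J.rot_cube, Equiv.apply_symm_apply]
    exact this.reverse (J.reattach _).inv_inv
  · exact h2.move (f _ fun z => by have := hc z; omega) p2 (fv _ (self_mem_orb v))
  · exact h3.move (f _ fun z => by have := hc z; omega) (fv _ (rot_symm_mem_orb v))
      (fv _ (rot_mem_orb v))
  · rw [orb_symm J.rot_cube]
    simp only [Multiset.count_add]
    exact hc z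

/-- At `u` the second and third arms exchange their half-edges while they arrive at `v` as before,
so one of the two cyclic orders no longer fits the plane. -/
theorem Skeleton.theta_flip
    (h : Skeleton J.rot J.label J.inv u v (thetaPaths J.rot u v a b c)) :
    Skeleton J.rot J.label (J.via (J.permFlip u)) u v (twistedPaths J.rot u v a c b) := by
  have hu := h.rot_ne.1
  obtain ⟨hE, M₁, M₂, M₃, h1, h2, h3, hc⟩ := skeleton_three.1 h
  obtain ⟨p1, p2, p3, p4⟩ := permFlip_apply hu
  simp only [Multiset.count_add] at hc
  have f : ∀ M : Multiset J.H, (∀ z, (orb J.rot u).count z + M.count z ≤ 1) →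
      ∀ z ∈ M, J.permFlip u z = z := fun M hM => fixes_of_count p4 hM
  have fv := f (orb J.rot v) (fun z => by have := hc z; omega)
  refine skeleton_three.2 ⟨ends_twistedPaths .., M₁, M₃, M₂, ?_, ?_, ?_, fun z => ?_⟩
  · exact h1.move (f _ fun z => by have := hc z; omega) p1 (fv _ (self_mem_orb v))
  · exact h3.move (f _ fun z => by have := hc z; omega) p2 (fv _ (rot_mem_orb v))
  · exact h2.move (f _ fun z => by have := hc z; omega) p3 (fv _ (rot_symm_mem_orb v))
  · simp only [Multiset.count_add]
    have := hc z
    omega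

/-- Flipping at the end `v` undoes the twist and keeps the order of the arms. -/
theorem Skeleton.twisted_flip
    (h : Skeleton J.rot J.label J.inv u v (twistedPaths J.rot u v a b c)) :
    Skeleton J.rot J.label (J.via (J.permFlip v)) u v (thetaPaths J.rot u v a b c) := by
  have hv := h.rot_ne.2
  obtain ⟨hE, M₁, M₂, M₃, h1, h2, h3, hc⟩ := skeleton_three.1 h
  obtain ⟨p1, p2, p3, p4⟩ := permFlip_apply hv
  simp only [Multiset.count_add] at hc
  have f : ∀ M : Multiset J.H, (∀ z, (orb J.rot v).count z + M.count z ≤ 1) →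
      ∀ z ∈ M, J.permFlip v z = z := fun M hM => fixes_of_count p4 hM
  have fu := f (orb J.rot u) (fun z => by have := hc z; omega)
  refine skeleton_three.2 ⟨ends_thetaPaths .., M₁, M₂, M₃, ?_, ?_, ?_, fun z => ?_⟩
  · exact h1.move (f _ fun z => by have := hc z; omega) (fu _ (self_mem_orb u)) p1
  · exact h2.move (f _ fun z => by have := hc z; omega) (fu _ (rot_mem_orb u)) p3
  · exact h3.move (f _ fun z => by have := hc z; omega) (fu _ (rot_symm_mem_orb u)) p2
  · simp only [Multiset.count_add]
    exact hc z

/-- The diagram is the same; only the chosen half-edges at the two joints move on, in opposite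
directions. -/
theorem IsTheta.rotate (h : J.IsTheta a b c) : J.IsTheta b c a := by
  obtain ⟨u, v, h⟩ := h
  refine ⟨J.rot u, J.rot.symm v, ?_⟩
  obtain ⟨hE, M₁, M₂, M₃, h1, h2, h3, hc⟩ := skeleton_three.1 h
  refine skeleton_three.2 ⟨ends_thetaPaths .., M₂, M₃, M₁, h2, ?_, ?_, fun z => ?_⟩
  · rwa [rot_rot J.rot_cube, symm_symm J.rot_cube]
  · rwa [Equiv.symm_apply_apply, Equiv.apply_symm_apply]
  · rw [orb_rot J.rot_cube, orb_symm J.rot_cube, ← hc z]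
    simp only [Multiset.count_add]
    omega

/-- The joints exchange roles, so the arms are read backwards and their cyclic order is inverted. -/
theorem IsTheta.reverse (h : J.IsTheta a b c) : J.IsTheta (bar a) (bar c) (bar b) := by
  obtain ⟨u, v, h⟩ := h
  refine ⟨v, u, ?_⟩
  obtain ⟨hE, M₁, M₂, M₃, h1, h2, h3, hc⟩ := skeleton_three.1 h
  refine skeleton_three.2 ⟨ends_thetaPaths .., M₁, M₃, M₂, h1.reverse J.inv_inv,
    h3.reverse J.inv_inv, h2.reverse J.inv_inv, fun z => ?_⟩
  rw [← hc z]
  simp only [Multiset.count_add]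
  omega

/-- The paths and half-edges at a joint followed by a tree to the left of the strand. -/
theorem slide_setup {t : J.H} (hu : J.rot u ≠ u) (ht : J.rot t ≠ t) (h : J.inv u = J.rot t)
    (hc : ∀ z, (orb J.rot u).count z + (orb J.rot t).count z ≤ 1) :
    J.IsInner u ∧
    (J.permH u u = u ∧ J.permH u (J.rot t) = J.rot t ∧
    J.permH u (J.rot u) = J.rot.symm u ∧ J.permH u (J.rot.symm u) = J.rot.symm t ∧
      J.permH u (J.rot.symm t) = t ∧ J.permH u t = J.rot u ∧
      ∀ z, z ∉ orb J.rot u + orb J.rot t → J.permH u z = z) ∧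
    (J.permX u u = u ∧ J.permX u (J.rot t) = J.rot t ∧
    J.permX u (J.rot u) = J.rot u ∧ J.permX u (J.rot.symm u) = J.rot.symm t ∧
      J.permX u (J.rot.symm t) = t ∧ J.permX u t = J.rot.symm u ∧
      ∀ z, z ∉ orb J.rot u + orb J.rot t → J.permX u z = z) := by
  have hin : J.IsInner u := isInner_of_notMem hu (by rw [h]; exact rot_rot_ne ht) fun hmem => by
    rw [h] at hmem
    have := Multiset.count_pos.2 hmem
    have := Multiset.count_pos.2 (rot_mem_orb (rot := J.rot) t)
    have := hc (J.rot t)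
    omega
  have e1 := hin.permH_apply
  have e2 := hin.permX_apply
  rw [h, rot_rot J.rot_cube, Equiv.symm_apply_apply, orb_rot J.rot_cube] at e1 e2
  exact ⟨hin, e1, e2⟩

/-- Sliding the first tree of the line of an eyeglass diagram onto the left circle. -/
theorem Skeleton.eyeglass_slide
    (h : Skeleton J.rot J.label J.inv u v (eyeglassPaths J.rot u v l ((T, true) :: w) r)) :
    J.IsInner u ∧
    Skeleton J.rot J.label (J.via (J.permH u)) (J.rot.symm u) v
      (eyeglassPaths J.rot (J.rot.symm u) v (l ++ [(T, true)]) w r) ∧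
    Skeleton J.rot J.label (J.via (J.permX u)) (J.rot.symm u) v
      (eyeglassPaths J.rot (J.rot.symm u) v (bar l ++ [(T, true)]) w r) := by
  have hu := h.rot_ne.1
  obtain ⟨hE, M₁, M₂, M₃, h1, h2, h3, hc⟩ := skeleton_three.1 h
  cases h2 with
  | cons _ t _ _ _ _ N M₂ k1 k2 hT h2 =>
  simp only [Multiset.count_add] at hc
  obtain ⟨hin, ⟨p1, p2, p3, p4, p5, p6, p7⟩, ⟨q1, q2, q3, q4, q5, q6, q7⟩⟩ :=
    slide_setup hu k2 k1 fun z => by have := hc z; omega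
  have f : ∀ π : Equiv.Perm J.H, (∀ z, z ∉ orb J.rot u + orb J.rot t → π z = z) →
      ∀ M : Multiset J.H, (∀ z, (orb J.rot u).count z + (orb J.rot t).count z + M.count z ≤ 1) →
      ∀ z ∈ M, π z = z := fun π hπ M hM => fixes_of_count hπ fun z => by
        rw [Multiset.count_add]; exact hM z
  have hi : J.inv (J.rot t) = u := by
    change J.inv u = J.rot t at k1
    rw [← k1, J.inv_inv]
  refine ⟨hin, ?_, ?_⟩
  · have f := f _ p7
    have fv := f (orb J.rot v) (fun z => by have := hc z; omega)
    have g1 := h1.move (f _ fun z => by have := hc z; omega) p3 p6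
    have gT := hT.move (f _ fun z => by have := hc z; omega) p5
    have g := g1.append (t := J.rot.symm t) (s := true) (w := []) (z := u) (K := 0)
      (by simp) (rot_symm_ne k2) gT
      (IsPath.nil' (by rw [outDart_true, symm_symm J.rot_cube]; exact conj_apply p2 p1 hi))
    refine skeleton_three.2 ⟨ends_eyeglassPaths .., M₁ + (orb J.rot (J.rot.symm t) + N + 0), M₂, M₃,
      ?_, ?_, ?_, fun z => ?_⟩
    · rw [symm_symm J.rot_cube, Equiv.apply_symm_apply]
      exact g
    · exact h2.move (f _ fun z => by have := hc z; omega) p4 (fv _ (self_mem_orb v))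
    · exact h3.move (f _ fun z => by have := hc z; omega) (fv _ (rot_symm_mem_orb v))
        (fv _ (rot_mem_orb v))
    · rw [orb_symm J.rot_cube, orb_symm J.rot_cube, ← hc z]
      simp only [Multiset.count_add, Multiset.count_zero]
      omega
  · have f := f _ q7
    have fv := f (orb J.rot v) (fun z => by have := hc z; omega)
    have g1 := (h1.move (f _ fun z => by have := hc z; omega) q6 q3).reverse
      (J.reattach _).inv_inv
    have gT := hT.move (f _ fun z => by have := hc z; omega) q5
    have g := g1.append (t := J.rot.symm t) (s := true) (w := []) (z := u) (K := 0)
      (by simp) (rot_symm_ne k2) gT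
      (IsPath.nil' (by rw [outDart_true, symm_symm J.rot_cube]; exact conj_apply q2 q1 hi))
    refine skeleton_three.2 ⟨ends_eyeglassPaths .., M₁ + (orb J.rot (J.rot.symm t) + N + 0), M₂, M₃,
      ?_, ?_, ?_, fun z => ?_⟩
    · rw [symm_symm J.rot_cube, Equiv.apply_symm_apply]
      exact g
    · exact h2.move (f _ fun z => by have := hc z; omega) q4 (fv _ (self_mem_orb v))
    · exact h3.move (f _ fun z => by have := hc z; omega) (fv _ (rot_symm_mem_orb v))
        (fv _ (rot_mem_orb v))
    · rw [orb_symm J.rot_cube, orb_symm J.rot_cube, ← hc z]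
      simp only [Multiset.count_add, Multiset.count_zero]
      omega

/-- Sliding a tree over a joint of a theta diagram. -/
theorem Skeleton.theta_slide
    (h : Skeleton J.rot J.label J.inv u v (thetaPaths J.rot u v ((T, true) :: a) b c)) :
    J.IsInner u ∧
    Skeleton J.rot J.label (J.via (J.permH u)) (J.rot.symm u) v
      (thetaPaths J.rot (J.rot.symm u) v a ((T, false) :: b) c) ∧
    Skeleton J.rot J.label (J.via (J.permX u)) (J.rot.symm u) v
      (twistedPaths J.rot (J.rot.symm u) v a ((T, false) :: c) b) := by
  have hu := h.rot_ne.1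
  obtain ⟨hE, M₁, M₂, M₃, h1, h2, h3, hc⟩ := skeleton_three.1 h
  cases h1 with
  | cons _ t _ _ _ _ N M₁ k1 k2 hT h1 =>
  simp only [Multiset.count_add] at hc
  obtain ⟨hin, ⟨p1, p2, p3, p4, p5, p6, p7⟩, ⟨q1, q2, q3, q4, q5, q6, q7⟩⟩ :=
    slide_setup hu k2 k1 fun z => by have := hc z; omega
  have f : ∀ π : Equiv.Perm J.H, (∀ z, z ∉ orb J.rot u + orb J.rot t → π z = z) →
      ∀ M : Multiset J.H, (∀ z, (orb J.rot u).count z + (orb J.rot t).count z + M.count z ≤ 1) →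
      ∀ z ∈ M, π z = z := fun π hπ M hM => fixes_of_count hπ fun z => by
        rw [Multiset.count_add]; exact hM z
  refine ⟨hin, ?_, ?_⟩
  · have f := f _ p7
    have fv := f (orb J.rot v) (fun z => by have := hc z; omega)
    have gT := hT.move (f _ fun z => by have := hc z; omega) p5
    have g2 := h2.move (f _ fun z => by have := hc z; omega) p6 (fv _ (rot_symm_mem_orb v))
    have g := IsPath.cons u (J.rot.symm t) T false b _ _ _
      (by rw [inDart_false, symm_symm J.rot_cube]; exact conj_apply p1 p2 k1) (rot_symm_ne k2) gT
      (by rw [outDart_false, Equiv.apply_symm_apply]; exact g2)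
    refine skeleton_three.2 ⟨ends_thetaPaths .., M₁, orb J.rot (J.rot.symm t) + N + M₂, M₃,
      h1.move (f _ fun z => by have := hc z; omega) p4 (fv _ (self_mem_orb v)), ?_, ?_,
      fun z => ?_⟩
    · rw [Equiv.apply_symm_apply]
      exact g
    · rw [symm_symm J.rot_cube]
      exact h3.move (f _ fun z => by have := hc z; omega) p3 (fv _ (rot_mem_orb v))
    · rw [orb_symm J.rot_cube, orb_symm J.rot_cube, ← hc z]
      simp only [Multiset.count_add]
      omega
  · have f := f _ q7
    have fv := f (orb J.rot v) (fun z => by have := hc z; omega)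
    have gT := hT.move (f _ fun z => by have := hc z; omega) q5
    have g3 := h3.move (f _ fun z => by have := hc z; omega) q6 (fv _ (rot_mem_orb v))
    have g := IsPath.cons u (J.rot.symm t) T false c _ _ _
      (by rw [inDart_false, symm_symm J.rot_cube]; exact conj_apply q1 q2 k1) (rot_symm_ne k2) gT
      (by rw [outDart_false, Equiv.apply_symm_apply]; exact g3)
    refine skeleton_three.2 ⟨ends_twistedPaths .., M₁, orb J.rot (J.rot.symm t) + N + M₃, M₂,
      h1.move (f _ fun z => by have := hc z; omega) q4 (fv _ (self_mem_orb v)), ?_, ?_,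
      fun z => ?_⟩
    · rw [Equiv.apply_symm_apply]
      exact g
    · rw [symm_symm J.rot_cube]
      exact h2.move (f _ fun z => by have := hc z; omega) q3 (fv _ (rot_symm_mem_orb v))
    · rw [orb_symm J.rot_cube, orb_symm J.rot_cube, ← hc z]
      simp only [Multiset.count_add]
      omega

/-- Sliding the first tree of the left circle onto the line. -/
theorem Skeleton.eyeglass_slide_back
    (h : Skeleton J.rot J.label J.inv u v (eyeglassPaths J.rot u v ((T, true) :: l) m r)) :
    J.IsInner (J.rot.symm u) ∧
    Skeleton J.rot J.label (J.via (J.permH (J.rot.symm u))) (J.rot.symm u) v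
      (eyeglassPaths J.rot (J.rot.symm u) v l ((T, false) :: m) r) := by
  have hu := h.rot_ne.1
  obtain ⟨hE, M₁, M₂, M₃, h1, h2, h3, hc⟩ := skeleton_three.1 h
  cases h1 with
  | cons _ t _ _ _ _ N M₁ k1 k2 hT h1 =>
  simp only [Multiset.count_add] at hc
  obtain ⟨hin, ⟨p1, p2, p3, p4, p5, p6, p7⟩, -⟩ :=
    slide_setup (rot_symm_ne hu) k2 k1 fun z => by
      rw [orb_symm J.rot_cube]; have := hc z; omega
  rw [Equiv.apply_symm_apply, symm_symm J.rot_cube] at p3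
  rw [symm_symm J.rot_cube] at p4
  rw [Equiv.apply_symm_apply] at p6
  rw [orb_symm J.rot_cube] at p7
  have f : ∀ M : Multiset J.H, (∀ z, (orb J.rot u).count z + (orb J.rot t).count z + M.count z ≤ 1)
      → ∀ z ∈ M, J.permH (J.rot.symm u) z = z := fun M hM => fixes_of_count p7 fun z => by
        rw [Multiset.count_add]; exact hM z
  refine ⟨hin, ?_⟩
  have fv := f (orb J.rot v) (fun z => by have := hc z; omega)
  have gT := hT.move (f _ fun z => by have := hc z; omega) p5
  have g2 := h2.move (f _ fun z => by have := hc z; omega) p6 (fv _ (self_mem_orb v))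
  have g := IsPath.cons (J.rot.symm u) (J.rot.symm t) T false m _ _ _
    (by rw [inDart_false, symm_symm J.rot_cube]; exact conj_apply p1 p2 k1) (rot_symm_ne k2) gT
    (by rw [outDart_false, Equiv.apply_symm_apply]; exact g2)
  refine skeleton_three.2 ⟨ends_eyeglassPaths .., M₁, _, M₃, ?_, g, ?_, fun z => ?_⟩
  · rw [symm_symm J.rot_cube, Equiv.apply_symm_apply]
    exact h1.move (f _ fun z => by have := hc z; omega) p4 p3
  · exact h3.move (f _ fun z => by have := hc z; omega) (fv _ (rot_symm_mem_orb v))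
      (fv _ (rot_mem_orb v))
  · rw [orb_symm J.rot_cube, orb_symm J.rot_cube, ← hc z]
    simp only [Multiset.count_add]
    omega

/-- The IHX relation at a line without trees. -/
theorem Skeleton.eyeglass_contract
    (h : Skeleton J.rot J.label J.inv u v (eyeglassPaths J.rot u v l [] r)) :
    J.IsInner u ∧
    Skeleton J.rot J.label (J.via (J.permH u)) u v (thetaPaths J.rot u v [] l (bar r)) ∧
    Skeleton J.rot J.label (J.via (J.permX u)) u v (thetaPaths J.rot u v [] (bar l) (bar r)) := by
  obtain ⟨hu, hv⟩ := h.rot_ne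
  obtain ⟨hE, M₁, M₂, M₃, h1, h2, h3, hc⟩ := skeleton_three.1 h
  obtain ⟨k, rfl⟩ := h2.end_eq
  simp only [Multiset.count_add, Multiset.count_zero] at hc
  have hin : J.IsInner u := isInner_of_notMem hu (by rwa [k]) fun hmem => by
    rw [k] at hmem
    have := Multiset.count_pos.2 hmem
    have := Multiset.count_pos.2 (self_mem_orb (rot := J.rot) v)
    have := hc v
    omega
  have e1 := hin.permH_apply
  have e2 := hin.permX_apply
  rw [k] at e1 e2
  obtain ⟨p1, p2, p3, p4, p5, p6, p7⟩ := e1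
  obtain ⟨q1, q2, q3, q4, q5, q6, q7⟩ := e2
  have f : ∀ π : Equiv.Perm J.H, (∀ z, z ∉ orb J.rot u + orb J.rot v → π z = z) →
      ∀ M : Multiset J.H, (∀ z, (orb J.rot u).count z + (orb J.rot v).count z + M.count z ≤ 1) →
      ∀ z ∈ M, π z = z := fun π hπ M hM => fixes_of_count hπ fun z => by
        rw [Multiset.count_add]; exact hM z
  refine ⟨hin, ?_, ?_⟩
  · have f := f _ p7
    refine skeleton_three.2 ⟨ends_thetaPaths .., 0, M₁, M₃, IsPath.nil' (conj_apply p1 p2 k),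
      h1.move (f _ fun z => by have := hc z; omega) p3 p6,
      (h3.move (f _ fun z => by have := hc z; omega) p5 p4).reverse (J.reattach _).inv_inv,
      fun z => ?_⟩
    rw [← hc z]
    simp only [Multiset.count_add, Multiset.count_zero]
    omega
  · have f := f _ q7
    refine skeleton_three.2 ⟨ends_thetaPaths .., 0, M₁, M₃, IsPath.nil' (conj_apply q1 q2 k),
      (h1.move (f _ fun z => by have := hc z; omega) q6 q3).reverse (J.reattach _).inv_inv,
      (h3.move (f _ fun z => by have := hc z; omega) q5 q4).reverse (J.reattach _).inv_inv,
      fun z => ?_⟩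
    rw [← hc z]
    simp only [Multiset.count_add, Multiset.count_zero]
    omega


/-! ### Connectedness of modified diagrams -/

/-- It suffices that everything `π` moves is still connected to one half-edge `e`. -/
theorem IsTwoLoop.reattach_of_support {n : ℕ} {J : Diagram L} (hJ : J.IsTwoLoop n)
    {π : Equiv.Perm J.H} {S : Multiset J.H} (hS : ∀ z, z ∉ S → π z = z) (e : J.H)
    (hc : ∀ z ∈ S, Relation.EqvGen (fun a b => b = (J.reattach π).inv a ∨ b = J.rot a) e z) :
    (J.reattach π).IsTwoLoop n := by
  refine hJ.reattach π fun x => ?_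
  by_cases hx : x ∈ S
  · have : π x ∈ S := by
      by_contra h
      have := π.injective (hS _ h)
      exact h (by rwa [this])
    exact .trans _ _ _ (.symm _ _ (hc x hx)) (hc _ this)
  · rw [hS x hx]
    exact .refl _

theorem IsTwoLoop.flip {n : ℕ} {J : Diagram L} (hJ : J.IsTwoLoop n) {e : J.H}
    (he : J.rot e ≠ e) : (J.flip e).IsTwoLoop n :=
  hJ.reattach_of_support (permFlip_apply he).2.2.2 e fun _ hz => eqvGen_of_mem_orb hz

/-- The edge of `e` survives the move and keeps its two end vertices, where all moved strands are
attached, connected. -/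
theorem IsTwoLoop.reattach_edge {n : ℕ} {J : Diagram L} (hJ : J.IsTwoLoop n) {e : J.H}
    {π : Equiv.Perm J.H} (h1 : π e = e) (h2 : π (J.inv e) = J.inv e)
    (h3 : ∀ z, z ∉ orb J.rot e + orb J.rot (J.inv e) → π z = z) :
    (J.reattach π).IsTwoLoop n := by
  refine hJ.reattach_of_support h3 e fun z hz => ?_
  rcases Multiset.mem_add.1 hz with hz | hz
  · exact eqvGen_of_mem_orb hz
  · exact .trans _ (J.inv e) _ (.rel _ _ (Or.inl (conj_apply (inv := J.inv) h1 h2 rfl).symm))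
      (eqvGen_of_mem_orb hz)

theorem IsTwoLoop.toH {n : ℕ} {J : Diagram L} (hJ : J.IsTwoLoop n) {e : J.H}
    (he : J.IsInner e) : (J.toH e).IsTwoLoop n :=
  hJ.reattach_edge he.permH_apply.1 he.permH_apply.2.1 he.permH_apply.2.2.2.2.2.2

theorem IsTwoLoop.toX {n : ℕ} {J : Diagram L} (hJ : J.IsTwoLoop n) {e : J.H}
    (he : J.IsInner e) : (J.toX e).IsTwoLoop n :=
  hJ.reattach_edge he.permX_apply.1 he.permX_apply.2.1 he.permX_apply.2.2.2.2.2.2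

end Diagram

open Diagram

/-! ### Classes of diagrams and membership in the two sets of diagrams -/

theorem cls_eq_cls {J K : Diagram L} : cls J = cls K ↔ Nonempty (Iso J K) := Quotient.eq

theorem mem_twoLoop {n : ℕ} {J : Diagram L} : cls J ∈ TwoLoop L n ↔ J.IsTwoLoop n := by
  constructor
  · rintro ⟨K, hK, h⟩
    obtain ⟨φ⟩ := cls_eq_cls.1 hK
    exact h.of_iso φ
  · exact fun h => ⟨J, rfl, h⟩

/-- By the classification, theta diagrams are the complement of eyeglass diagrams. The negative
description is the one that passes easily through isomorphisms and surgery. -/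
theorem mem_theta_iff {n : ℕ} {J : Diagram L} :
    cls J ∈ Theta L n ↔ J.IsTwoLoop n ∧ ∀ l m r, ¬ J.IsEyeglass l m r := by
  constructor
  · rintro ⟨K, hK, h, hs⟩
    obtain ⟨φ⟩ := cls_eq_cls.1 hK
    obtain ⟨ψ⟩ := cls_eq_cls.1 hK.symm
    exact ⟨h.of_iso φ, fun l m r hJ => hs.not_isEyeglass h l m r (hJ.of_iso ψ)⟩
  · rintro ⟨h, hn⟩
    refine ⟨J, rfl, h, ?_⟩
    rcases h.classification with ⟨l, m, r, h⟩ | ⟨a, b, c, h⟩ | ⟨a, b, c, h⟩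
    exacts [absurd h (hn l m r), h.hasThetaSpine, h.hasThetaSpine]

theorem mem_theta_of_isTheta {n : ℕ} {J : Diagram L} (hJ : J.IsTwoLoop n) {a b c : Word L}
    (h : J.IsTheta a b c) : cls J ∈ Theta L n := ⟨J, rfl, hJ, h.hasThetaSpine⟩

theorem mem_theta_of_isTwisted {n : ℕ} {J : Diagram L} (hJ : J.IsTwoLoop n) {a b c : Word L}
    (h : J.IsTwisted a b c) : cls J ∈ Theta L n := ⟨J, rfl, hJ, h.hasThetaSpine⟩

theorem isTwoLoop_of_mem_theta {n : ℕ} {J : Diagram L} (h : cls J ∈ Theta L n) :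
    J.IsTwoLoop n := (mem_theta_iff.1 h).1

theorem gen_congr {D : Set (IsoClass L)} {J K : Diagram L} (hJK : Nonempty (Iso J K))
    (h : cls J ∈ D) (h' : cls K ∈ D) : gen D J h = gen D K h' := by
  have := cls_eq_cls.2 hJK
  simp only [gen, this]

theorem thetaMk_congr {n : ℕ} {J K : Diagram L} (hJK : Nonempty (Iso J K))
    (h : cls J ∈ Theta L n) (h' : cls K ∈ Theta L n) : thetaMk J h = thetaMk K h' := by
  rw [thetaMk, thetaMk, gen_congr hJK h h']

theorem thetaMk_flip {n : ℕ} {J : Diagram L} {e : J.H} (he : J.rot e ≠ e)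
    (h : cls J ∈ Theta L n) (h' : cls (J.flip e) ∈ Theta L n) :
    thetaMk (J.flip e) h' = -thetaMk J h := by
  rw [eq_neg_iff_add_eq_zero, add_comm]
  exact (Submodule.Quotient.mk_eq_zero _).2
    (Submodule.subset_span (Or.inl ⟨J, e, h, h', he, rfl⟩))

theorem thetaMk_ihx {n : ℕ} {J : Diagram L} {e : J.H} (he : J.IsInner e)
    (h : cls J ∈ Theta L n) (h' : cls (J.toH e) ∈ Theta L n) (h'' : cls (J.toX e) ∈ Theta L n) :
    thetaMk J h - thetaMk (J.toH e) h' + thetaMk (J.toX e) h'' = 0 :=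
  (Submodule.Quotient.mk_eq_zero _).2
    (Submodule.subset_span (Or.inr ⟨J, e, h, h', h'', he, rfl⟩))

/-! ### Theta diagrams as a function of their words -/

/-- The class of the theta diagram with the given labels on its arms, zero if this diagram does not
have `n` trivalent vertices. -/
def thetaValue (n : ℕ) (a b c : List L) : ThetaMod L n :=
  if h : ∃ (J : Diagram L) (_ : cls J ∈ Theta L n), J.IsTheta (leafWord a) (leafWord b) (leafWord c)
  then thetaMk h.choose h.choose_spec.choose else 0

/-- The triadditive extension of `thetaValue`. -/
def thetaForm (L : Type) (n : ℕ) : Alg L →+ Alg L →+ Alg L →+ ThetaMod L n :=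
  triadditive (thetaValue n)

/-- The choice in `thetaValue` is harmless because the words determine a planar theta diagram up to
isomorphism. -/
theorem thetaForm_monomial {n : ℕ} {J : Diagram L} (hJ : cls J ∈ Theta L n) {a b c : List L}
    (h : J.IsTheta (leafWord a) (leafWord b) (leafWord c)) :
    thetaForm L n (monomial a) (monomial b) (monomial c) = thetaMk J hJ := by
  have hex : ∃ (J : Diagram L) (_ : cls J ∈ Theta L n),
    J.IsTheta (leafWord a) (leafWord b) (leafWord c) := ⟨J, hJ, h⟩
  rw [thetaForm, triadditive_monomial, thetaValue, dif_pos hex]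
  exact thetaMk_congr (hex.choose_spec.choose_spec.nonempty_iso h) _ _

theorem thetaForm_monomial_of_not {n : ℕ} {a b c : List L}
    (h : ¬ ∃ (J : Diagram L) (_ : cls J ∈ Theta L n),
      J.IsTheta (leafWord a) (leafWord b) (leafWord c)) :
    thetaForm L n (monomial a) (monomial b) (monomial c) = 0 := by
  rw [thetaForm, triadditive_monomial, thetaValue, dif_neg h]

theorem thetaForm_rotate (n : ℕ) (a b c : Alg L) : thetaForm L n a b c = thetaForm L n b c a := by
  refine triadditive_ext (f := fun a b c => thetaForm L n a b c)
    (g := fun a b c => thetaForm L n b c a) (by simp) (by simp) (fun a b c => ?_) a b c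
  by_cases h : ∃ (J : Diagram L) (_ : cls J ∈ Theta L n),
    J.IsTheta (leafWord a) (leafWord b) (leafWord c)
  · obtain ⟨J, hJ, h⟩ := h
    rw [thetaForm_monomial hJ h, thetaForm_monomial hJ h.rotate]
  · rw [thetaForm_monomial_of_not h, thetaForm_monomial_of_not]
    rintro ⟨J, hJ, h'⟩
    exact h ⟨J, hJ, h'.rotate.rotate⟩

/-- The number of trivalent vertices of a tree. -/
def RTree.size : RTree L → ℕ
  | .leaf _ => 0
  | .node A B => A.size + B.size + 1

/-- A measure for how far a word is from a word of leaves to the left. -/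
def wordRank (w : Word L) : ℕ := (w.map fun m => 3 * m.1.size + if m.2 then 0 else 1).sum

theorem wordRank_append (v w : Word L) : wordRank (v ++ w) = wordRank v + wordRank w := by
  simp [wordRank]

theorem wordRank_cons (m : RTree L × Bool) (w : Word L) :
    wordRank (m :: w) = (3 * m.1.size + if m.2 then 0 else 1) + wordRank w := by
  simp [wordRank]

theorem word_cases (w : Word L) : (∃ a, w = leafWord a) ∨
    (∃ w₁ T w₂, w = w₁ ++ (T, false) :: w₂) ∨
    ∃ w₁ A B w₂, w = w₁ ++ (.node A B, true) :: w₂ := by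
  induction w with
  | nil => exact Or.inl ⟨[], rfl⟩
  | cons m w ih =>
    obtain ⟨T, s⟩ := m
    cases s with
    | false => exact Or.inr (Or.inl ⟨[], T, w, rfl⟩)
    | true =>
      cases T with
      | node A B => exact Or.inr (Or.inr ⟨[], A, B, w, rfl⟩)
      | leaf l =>
        rcases ih with ⟨a, rfl⟩ | ⟨w₁, T, w₂, rfl⟩ | ⟨w₁, A, B, w₂, rfl⟩
        · exact Or.inl ⟨l :: a, rfl⟩
        · exact Or.inr (Or.inl ⟨(.leaf l, true) :: w₁, T, w₂, rfl⟩)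
        · exact Or.inr (Or.inr ⟨(.leaf l, true) :: w₁, A, B, w₂, rfl⟩)

/-- The algebraic counterpart of `LetterAt.ihx_root`: on the right of the strand the two minus signs
cancel in `AB`. -/
theorem wordAlg_node (w₁ w₂ : Word L) (A B : RTree L) :
    wordAlg (w₁ ++ (.node A B, true) :: w₂) =
      wordAlg (w₁ ++ (B, true) :: (A, true) :: w₂) -
        wordAlg (w₁ ++ (A, false) :: (B, false) :: w₂) := by
  simp only [wordAlg_append, wordAlg_cons, letterAlg_true, letterAlg_false, RTree.toAlg]
  noncomm_ring

theorem wordAlg_neg {w₁ w₂ : Word L} {m m' : RTree L × Bool} (h : letterAlg m' = -letterAlg m) :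
    wordAlg (w₁ ++ m' :: w₂) = -wordAlg (w₁ ++ m :: w₂) := by
  simp only [wordAlg_append, wordAlg_cons, h, neg_mul, mul_neg]

/-- One reduction on the first arm: AS brings a tree from the right to the left, and IHX at its root
expands a node. Rotating the arms makes this enough for all three. -/
theorem thetaForm_wordAlg_of_smaller {n N : ℕ}
    (ih : ∀ (J : Diagram L) (hJ : cls J ∈ Theta L n) (a b c : Word L),
      wordRank a + wordRank b + wordRank c < N → J.IsTheta a b c →
      thetaForm L n (wordAlg a) (wordAlg b) (wordAlg c) = thetaMk J hJ)
    {J : Diagram L} (hJ : cls J ∈ Theta L n) {a b c : Word L}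
    (hN : wordRank a + wordRank b + wordRank c = N) (h : J.IsTheta a b c)
    (ha : ¬ ∃ a', a = leafWord a') :
    thetaForm L n (wordAlg a) (wordAlg b) (wordAlg c) = thetaMk J hJ := by
  have h2 := isTwoLoop_of_mem_theta hJ
  obtain ⟨u, v, h⟩ := h
  rcases word_cases a with h' | ⟨w₁, T, w₂, rfl⟩ | ⟨w₁, A, B, w₂, rfl⟩
  · exact absurd h' ha
  · obtain ⟨t, ht⟩ := h.exists_letterAt
    have hne := rot_inDart_ne ht.2.1 false
    have hK2 := h2.flip hne
    have hK : (J.flip (inDart J.rot (t, false))).IsTheta (w₁ ++ (T, true) :: w₂) b c :=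
      ⟨u, v, ht.flip_in.skeleton⟩
    have hK' := mem_theta_of_isTheta hK2 hK
    have := ih _ hK' _ _ _ (by
      simp only [wordRank_append, wordRank_cons] at hN ⊢
      simp at hN ⊢
      omega) hK
    rw [thetaMk_flip hne hJ hK'] at this
    rw [wordAlg_neg (m := (T, true)) rfl, map_neg, AddMonoidHom.neg_apply, AddMonoidHom.neg_apply,
      this, neg_neg]
  · obtain ⟨t, ht⟩ := h.exists_letterAt
    obtain ⟨hin, kH, kX⟩ := ht.ihx_root
    have hH : (J.toH t).IsTheta (w₁ ++ (B, true) :: (A, true) :: w₂) b c := ⟨u, v, kH⟩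
    have hX : (J.toX t).IsTheta (w₁ ++ (A, false) :: (B, false) :: w₂) b c := ⟨u, v, kX⟩
    have hH' := mem_theta_of_isTheta (h2.toH hin) hH
    have hX' := mem_theta_of_isTheta (h2.toX hin) hX
    have e1 := ih _ hH' _ _ _ (by
      simp only [wordRank_append, wordRank_cons, RTree.size] at hN ⊢
      simp at hN ⊢
      omega) hH
    -- Two letters now lie on the right, which costs `2`, while the removed node saves `3`; this is
    -- the reason for the weight in `wordRank`.
    have e2 := ih _ hX' _ _ _ (by
      simp only [wordRank_append, wordRank_cons, RTree.size] at hN ⊢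
      simp at hN ⊢
      omega) hX
    have e3 := thetaMk_ihx hin hJ hH' hX'
    rw [wordAlg_node, map_sub, AddMonoidHom.sub_apply, AddMonoidHom.sub_apply, e1, e2,
      ← sub_eq_zero, ← neg_eq_zero, ← e3]
    abel

/-- The class of a theta diagram in terms of its words. -/
theorem thetaForm_wordAlg {n : ℕ} {J : Diagram L} (hJ : cls J ∈ Theta L n) {a b c : Word L}
    (h : J.IsTheta a b c) :
    thetaForm L n (wordAlg a) (wordAlg b) (wordAlg c) = thetaMk J hJ := by
  induction hN : wordRank a + wordRank b + wordRank c using Nat.strong_induction_on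
    generalizing J a b c with
  | _ N ih =>
  have ih' : ∀ (J : Diagram L) (hJ : cls J ∈ Theta L n) (a b c : Word L),
      wordRank a + wordRank b + wordRank c < N → J.IsTheta a b c →
      thetaForm L n (wordAlg a) (wordAlg b) (wordAlg c) = thetaMk J hJ :=
    fun J hJ a b c hlt hth => ih _ hlt hJ hth rfl
  by_cases ha : ∃ a', a = leafWord a'
  · by_cases hb : ∃ b', b = leafWord b'
    · by_cases hc : ∃ c', c = leafWord c'
      · obtain ⟨a, rfl⟩ := ha
        obtain ⟨b, rfl⟩ := hb
        obtain ⟨c, rfl⟩ := hc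
        rw [wordAlg_leafWord, wordAlg_leafWord, wordAlg_leafWord, thetaForm_monomial hJ h]
      · rw [thetaForm_rotate, thetaForm_rotate]
        exact thetaForm_wordAlg_of_smaller ih' hJ (by omega) h.rotate.rotate hc
    · rw [thetaForm_rotate]
      exact thetaForm_wordAlg_of_smaller ih' hJ (by omega) h.rotate hb
  · exact thetaForm_wordAlg_of_smaller ih' hJ hN h ha

/-- A single flip, at the second joint, makes the diagram planar with the same arms, whence one
sign. -/
theorem thetaForm_twisted {n : ℕ} {J : Diagram L} (hJ : cls J ∈ Theta L n) {a b c : Word L}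
    (h : J.IsTwisted a b c) :
    thetaForm L n (wordAlg a) (wordAlg b) (wordAlg c) = -thetaMk J hJ := by
  obtain ⟨u, v, h⟩ := h
  have hv := h.rot_ne.2
  have hK : (J.flip v).IsTheta a b c := ⟨u, v, h.twisted_flip⟩
  have hK' := mem_theta_of_isTheta ((isTwoLoop_of_mem_theta hJ).flip hv) hK
  rw [thetaForm_wordAlg hK' hK, thetaMk_flip hv hJ hK']

/-- Flipping the first joint exchanges two arms and gives a twisted diagram. The sign of the flip
cancels the sign of the twist. -/
theorem thetaForm_reflect_of_isTheta {n : ℕ} {J : Diagram L} (hJ : cls J ∈ Theta L n)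
    {a b c : Word L} (h : J.IsTheta a b c) :
    thetaForm L n (wordAlg a) (wordAlg b) (wordAlg c) =
      thetaForm L n (wordAlg a) (wordAlg c) (wordAlg b) := by
  have e := thetaForm_wordAlg hJ h
  obtain ⟨u, v, h⟩ := h
  have hu := h.rot_ne.1
  have hK : (J.flip u).IsTwisted a c b := ⟨u, v, h.theta_flip⟩
  have hK' := mem_theta_of_isTwisted ((isTwoLoop_of_mem_theta hJ).flip hu) hK
  rw [e, thetaForm_twisted hK' hK, thetaMk_flip hu hJ hK', neg_neg]

theorem thetaForm_reflect (n : ℕ) (a b c : Alg L) :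
    thetaForm L n a b c = thetaForm L n a c b := by
  refine triadditive_ext (f := fun a b c => thetaForm L n a b c)
    (g := fun a b c => thetaForm L n a c b) (by simp) (by simp) (fun a b c => ?_) a b c
  by_cases h : ∃ (J : Diagram L) (_ : cls J ∈ Theta L n),
    J.IsTheta (leafWord a) (leafWord b) (leafWord c)
  · obtain ⟨J, hJ, h⟩ := h
    have := thetaForm_reflect_of_isTheta hJ h
    rwa [wordAlg_leafWord, wordAlg_leafWord, wordAlg_leafWord] at this
  · by_cases h' : ∃ (J : Diagram L) (_ : cls J ∈ Theta L n),
      J.IsTheta (leafWord a) (leafWord c) (leafWord b)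
    · obtain ⟨J, hJ, h'⟩ := h'
      have := thetaForm_reflect_of_isTheta hJ h'
      rw [wordAlg_leafWord, wordAlg_leafWord, wordAlg_leafWord] at this
      exact this.symm
    · rw [thetaForm_monomial_of_not h, thetaForm_monomial_of_not h']

/-- Up to sign the antipode preserves monomials, so that monomials realised by no diagram can be
dealt with after reversal too. -/
theorem antipode_monomial (a : List L) :
    antipode (monomial a) = monomial a.reverse ∨ antipode (monomial a) = -monomial a.reverse := by
  induction a with
  | nil => simp
  | cons x a ih =>
    have : monomial (a.reverse ++ [x]) = monomial a.reverse * Alg.gen x := by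
      rw [← wordAlg_leafWord, ← wordAlg_leafWord]
      simp [leafWord, RTree.toAlg]
    rw [monomial_cons, antipode_mul, antipode_gen, List.reverse_cons, this]
    rcases ih with ih | ih <;> rw [ih] <;> simp

theorem thetaForm_reverse (n : ℕ) (a b c : Alg L) :
    thetaForm L n a b c = thetaForm L n (antipode a) (antipode c) (antipode b) := by
  refine triadditive_ext (f := fun a b c => thetaForm L n a b c)
    (g := fun a b c => thetaForm L n (antipode a) (antipode c) (antipode b)) (by simp) (by simp)
    (fun a b c => ?_) a b c
  have key : ∀ a b c : List L, (∃ (J : Diagram L) (_ : cls J ∈ Theta L n),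
      J.IsTheta (leafWord a) (leafWord b) (leafWord c)) →
      thetaForm L n (monomial a) (monomial b) (monomial c) =
        thetaForm L n (antipode (monomial a)) (antipode (monomial c)) (antipode (monomial b)) := by
    rintro a b c ⟨J, hJ, h⟩
    rw [thetaForm_monomial hJ h]
    simp only [← wordAlg_leafWord, ← wordAlg_bar]
    rw [thetaForm_wordAlg hJ h.reverse]
  by_cases h : ∃ (J : Diagram L) (_ : cls J ∈ Theta L n),
    J.IsTheta (leafWord a) (leafWord b) (leafWord c)
  · exact key a b c h
  · by_cases h' : ∃ (J : Diagram L) (_ : cls J ∈ Theta L n),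
      J.IsTheta (leafWord a.reverse) (leafWord c.reverse) (leafWord b.reverse)
    -- The case already treated is applied to the reversed monomials; the three signs of
    -- `antipode_monomial` occur equally on both sides.
    · have e := key _ _ _ h'
      have e' : thetaForm L n (antipode (monomial a)) (antipode (monomial c))
          (antipode (monomial b)) = thetaForm L n (antipode (antipode (monomial a)))
            (antipode (antipode (monomial b))) (antipode (antipode (monomial c))) := by
        rcases antipode_monomial a with ha | ha <;> rcases antipode_monomial b with hb | hb <;>
          rcases antipode_monomial c with hc | hc <;> rw [ha, hb, hc] <;>
          simp only [map_neg, AddMonoidHom.neg_apply, e]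
      rw [e', antipode_antipode, antipode_antipode, antipode_antipode]
    · rw [thetaForm_monomial_of_not h]
      have e := thetaForm_monomial_of_not h'
      rcases antipode_monomial a with ha | ha <;> rcases antipode_monomial b with hb | hb <;>
        rcases antipode_monomial c with hc | hc <;>
        simp only [ha, hb, hc, map_neg, AddMonoidHom.neg_apply, e, neg_zero]

/-- IHX at the edge from the joint to the tree `T`: H puts the tree on the second arm, and X puts it
on the third with a twist, both times on the right. Sides and twist turn the relator into a sum
without signs. -/
theorem thetaForm_slide_of_isTheta {n : ℕ} {J : Diagram L} (hJ : cls J ∈ Theta L n)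
    {T : RTree L} {a b c : Word L} (h : J.IsTheta ((T, true) :: a) b c) :
    thetaForm L n (T.toAlg * wordAlg a) (wordAlg b) (wordAlg c) +
      thetaForm L n (wordAlg a) (T.toAlg * wordAlg b) (wordAlg c) +
      thetaForm L n (wordAlg a) (wordAlg b) (T.toAlg * wordAlg c) = 0 := by
  have e := thetaForm_wordAlg hJ h
  obtain ⟨u, v, h⟩ := h
  obtain ⟨hin, kH, kX⟩ := h.theta_slide
  have h2 := isTwoLoop_of_mem_theta hJ
  have hH : (J.toH u).IsTheta a ((T, false) :: b) c := ⟨_, v, kH⟩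
  have hX : (J.toX u).IsTwisted a ((T, false) :: c) b := ⟨_, v, kX⟩
  have hH' := mem_theta_of_isTheta (h2.toH hin) hH
  have hX' := mem_theta_of_isTwisted (h2.toX hin) hX
  have e1 := thetaForm_wordAlg hH' hH
  have e2 := thetaForm_twisted hX' hX
  rw [thetaForm_reflect] at e2
  have e3 := thetaMk_ihx hin hJ hH' hX'
  rw [← e, ← e1, ← neg_eq_iff_eq_neg.2 e2] at e3
  simp only [wordAlg_cons, letterAlg_true, letterAlg_false, neg_mul, map_neg,
    AddMonoidHom.neg_apply, neg_neg, sub_neg_eq_add] at e3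
  exact e3

theorem isThetaForm_thetaForm (L : Type) (n : ℕ) : IsThetaForm (thetaForm L n) := by
  refine isThetaForm_of_monomial (fun a b c => thetaForm_rotate n _ _ _)
    (fun a b c => thetaForm_reverse n _ _ _) (fun a b c => thetaForm_reflect n _ _ _)
    fun l a b c => ?_
  have key : ∀ a b c : List L, (∃ (J : Diagram L) (_ : cls J ∈ Theta L n),
      J.IsTheta (leafWord (l :: a)) (leafWord b) (leafWord c)) →
      thetaForm L n (monomial (l :: a)) (monomial b) (monomial c) +
        thetaForm L n (monomial a) (monomial (l :: b)) (monomial c) +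
        thetaForm L n (monomial a) (monomial b) (monomial (l :: c)) = 0 := by
    rintro a b c ⟨J, hJ, h⟩
    have := thetaForm_slide_of_isTheta (T := .leaf l) (a := leafWord a) hJ h
    simpa only [wordAlg_leafWord, monomial_cons, RTree.toAlg] using this
  by_cases h1 : ∃ (J : Diagram L) (_ : cls J ∈ Theta L n),
    J.IsTheta (leafWord (l :: a)) (leafWord b) (leafWord c)
  · exact key a b c h1
  by_cases h2 : ∃ (J : Diagram L) (_ : cls J ∈ Theta L n),
    J.IsTheta (leafWord a) (leafWord (l :: b)) (leafWord c)
  · obtain ⟨J, hJ, h⟩ := h2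
    rw [← key b c a ⟨J, hJ, h.rotate⟩, thetaForm_rotate n (monomial (l :: a)),
      thetaForm_rotate n (monomial a), thetaForm_rotate n (monomial a)]
    abel
  by_cases h3 : ∃ (J : Diagram L) (_ : cls J ∈ Theta L n),
    J.IsTheta (leafWord a) (leafWord b) (leafWord (l :: c))
  · obtain ⟨J, hJ, h⟩ := h3
    rw [← key c a b ⟨J, hJ, h.rotate.rotate⟩, thetaForm_rotate n (monomial (l :: c)),
      thetaForm_rotate n (monomial c), thetaForm_rotate n (monomial c)]
    abel
  -- No diagram realises any of the three terms, so all have the default value zero. Had one of them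
  -- been realised, `key` would apply after rotating it into first position.
  rw [thetaForm_monomial_of_not h1, thetaForm_monomial_of_not h2, thetaForm_monomial_of_not h3,
    add_zero, add_zero]

namespace Diagram

/-! ### Locating half-edges -/

theorem ArePaths.exists_mem {H : Type} {rot : Equiv.Perm H} {lab : H → Option L}
    {inv : Equiv.Perm H} {Q : List (H × Word L × H)} {M : Multiset H}
    (h : ArePaths rot lab inv Q M) {e : H} (he : e ∈ M) (hne : e ∉ ends Q) :
    ∃ x w y P M' K, Q.Perm ((x, w, y) :: P) ∧ IsPath rot lab inv x w y M' ∧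
      ArePaths rot lab inv P K ∧ M = {x} + {y} + M' + K ∧ e ∈ M' := by
  induction h with
  | nil => simp at he
  | cons x w y P M N h1 h2 ih =>
    rw [ends_cons, Multiset.mem_add, not_or] at hne
    simp only [Multiset.mem_add (t := N), Multiset.mem_add (t := M), hne.1, false_or] at he
    rcases he with he | he
    · exact ⟨x, w, y, P, M, N, .refl _, h1, h2, rfl, he⟩
    · obtain ⟨x', w', y', P', M', K, k1, k2, k3, rfl, k5⟩ := ih he hne.2
      exact ⟨x', w', y', (x, w, y) :: P', M', _, (k1.cons _).trans (.swap _ _ _), k2,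
        .cons _ _ _ _ _ _ h1 k3, by abel, k5⟩

/-- Away from the joints every half-edge is at the vertex of a letter or in its tree. Isolating this
letter lets surgery be done there with everything else kept as context. -/
theorem Skeleton.exists_letter {H : Type} {rot : Equiv.Perm H} {lab : H → Option L}
    {inv : Equiv.Perm H} {u v : H} {Q : List (H × Word L × H)}
    (h : Skeleton rot lab inv u v Q) {e : H} (hu : e ∉ orb rot u) (hv : e ∉ orb rot v) :
    ∃ x w₁ T s w₂ y P t N, Q.Perm ((x, w₁ ++ (T, s) :: w₂, y) :: P) ∧
      LetterAt rot lab inv u v x w₁ T s w₂ y P t ∧ IsTree rot lab inv (inv t) T N ∧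
      (e ∈ orb rot t ∨ e ∈ N) := by
  obtain ⟨hE, M, hM, hc⟩ := h
  have he : e ∈ M := Multiset.count_pos.1 (by rw [hc]; norm_num)
  obtain ⟨x, w, y, P, M', K, hp, h1, h2, rfl, h3⟩ := hM.exists_mem he (by
    rw [hE, Multiset.mem_add]; tauto)
  obtain ⟨w₁, T, s, w₂, rfl, t, M₁, N, M₂, k1, k2, k3, k4, rfl, k5⟩ := h1.mem_cases h3
  refine ⟨x, w₁, T, s, w₂, y, P, t, N, hp, ⟨?_, k2, M₁, N, M₂, K, k1, k3, k4, h2, hc⟩, k3, k5⟩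
  rw [← hE, ends_perm hp, ends_cons]

section Letters

variable {H : Type} {rot : Equiv.Perm H} {lab : H → Option L} {inv : Equiv.Perm H}
  {u v x y t : H} {w₁ w₂ : Word L} {T T₂ : RTree L} {s s₂ : Bool} {P : List (H × Word L × H)}

theorem LetterAt.next (h : LetterAt rot lab inv u v x w₁ T s ((T₂, s₂) :: w₂) y P t) :
    ∃ t₂, inv (outDart rot (t, s)) = inDart rot (t₂, s₂) ∧
      LetterAt rot lab inv u v x (w₁ ++ [(T, s)]) T₂ s₂ w₂ y P t₂ := by
  obtain ⟨hE, ht, M₁, N, M₂, K, h1, hT, h2, hP, hc⟩ := h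
  cases h2 with
  | cons _ t₂ _ _ _ _ N' M₂ k1 k2 hT' h2 =>
  refine ⟨t₂, k1, hE, k2, M₁ + (orb rot t + N + 0), N', M₂, K,
    h1.append rfl ht hT (IsPath.nil' k1), hT', h2, hP, fun z => ?_⟩
  rw [← hc z]
  simp only [Multiset.count_add, Multiset.count_zero]
  omega

theorem LetterAt.prev (h : LetterAt rot lab inv u v x (w₁ ++ [(T, s)]) T₂ s₂ w₂ y P t) :
    ∃ t₁, inv (outDart rot (t₁, s)) = inDart rot (t, s₂) ∧
      LetterAt rot lab inv u v x w₁ T s ((T₂, s₂) :: w₂) y P t₁ := by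
  obtain ⟨hE, ht, M₁, N, M₂, K, h1, hT, h2, hP, hc⟩ := h
  obtain ⟨t₁, M₁, N', M', k1, k2, k3, k4, rfl⟩ := h1.split
  obtain ⟨k5, rfl⟩ := k4.end_eq
  refine ⟨t₁, k5, hE, k2, M₁, N', orb rot t + N + M₂, K, k1, k3,
    .cons _ t _ _ _ _ _ _ k5 ht hT h2, hP, fun z => ?_⟩
  rw [← hc z]
  simp only [Multiset.count_add, Multiset.count_zero]
  omega

theorem LetterAt.inv_inDart (hi : ∀ h, inv (inv h) = h)
    (h : LetterAt rot lab inv u v x [] T s w₂ y P t) : inv (inDart rot (t, s)) = x := by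
  obtain ⟨-, -, M₁, -, -, -, h1, -⟩ := h
  rw [← h1.end_eq.1, hi]

theorem LetterAt.inv_outDart
    (h : LetterAt rot lab inv u v x w₁ T s [] y P t) : inv (outDart rot (t, s)) = y := by
  obtain ⟨-, -, _, _, M₂, _, -, -, h2, -⟩ := h
  exact h2.end_eq.1

theorem LetterAt.mem_ends (h : LetterAt rot lab inv u v x w₁ T s w₂ y P t) :
    (x ∈ orb rot u ∨ x ∈ orb rot v) ∧ (y ∈ orb rot u ∨ y ∈ orb rot v) := by
  rw [← Multiset.mem_add, ← Multiset.mem_add, ← h.1]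
  simp

end Letters

/-- Reversing the cyclic order at a letter, keeping the half-edge of the tree. -/
theorem LetterAt.flip_root {J : Diagram L} {u v x y t : J.H} {w₁ w₂ : Word L} {T : RTree L}
    {s : Bool} {P : List (J.H × Word L × J.H)}
    (h : LetterAt J.rot J.label J.inv u v x w₁ T s w₂ y P t) :
    LetterAt J.rot J.label (J.via (J.permFlip t)) u v x w₁ T (!s) w₂ y P t := by
  obtain ⟨hE, ht, M₁, N, M₂, K, h1, hT, h2, hP, hc⟩ := h
  obtain ⟨p1, p2, p3, p4⟩ := permFlip_apply ht
  simp only [Multiset.count_add] at hc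
  have f : ∀ M : Multiset J.H, (∀ z, (orb J.rot t).count z + M.count z ≤ 1) →
      ∀ z ∈ M, J.permFlip t z = z := fun M hM => fixes_of_count p4 hM
  have fx := f {x} (fun z => by have := hc z; omega) x (by simp)
  have fy := f {y} (fun z => by have := hc z; omega) y (by simp)
  refine ⟨hE, ht, M₁, N, M₂, K, ?_, ?_, ?_, ?_, fun z => ?_⟩
  · refine h1.move (f _ fun z => by have := hc z; omega) fx ?_
    cases s
    exacts [p2, p3]
  · exact hT.move (f _ fun z => by have := hc z; omega) p1
  · refine h2.move (f _ fun z => by have := hc z; omega) ?_ fy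
    cases s
    exacts [p3, p2]
  · exact hP.conj (f _ fun z => by have := hc z; omega)
  · simp only [Multiset.count_add]
    exact hc z

theorem nonempty_iso_flip_rot (J : Diagram L) {e : J.H} (he : J.rot e ≠ e) :
    Nonempty (Iso (J.flip (J.rot e)) (J.flip e)) := by
  obtain ⟨p1, p2, p3, p4⟩ := permFlip_apply he
  obtain ⟨q1, q2, q3, q4⟩ := permFlip_apply (rot_rot_ne he)
  rw [rot_rot J.rot_cube, Equiv.symm_apply_apply] at q2 q3
  rw [orb_rot J.rot_cube] at q4
  -- Two reflections of a cyclic order on three elements compose to a rotation, which is an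
  -- automorphism of the vertex.
  let ρ : Equiv.Perm J.H := J.permFlip e * J.permFlip (J.rot e)
  have hρ : ∀ h ∈ orb J.rot e, ρ h = J.rot h := by
    intro h hh
    rcases mem_orb.1 hh with rfl | rfl | rfl
    · simp only [ρ, Equiv.Perm.mul_apply, q3, p3]
    · simp only [ρ, Equiv.Perm.mul_apply, q1, p2, rot_rot J.rot_cube]
    · simp only [ρ, Equiv.Perm.mul_apply, q2, p1, Equiv.apply_symm_apply]
  have hρ' : ∀ h, h ∉ orb J.rot e → ρ h = h := by
    intro h hh
    simp only [ρ, Equiv.Perm.mul_apply, q4 h hh, p4 h hh]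
  have hmem : ∀ h, J.rot h ∈ orb J.rot e ↔ h ∈ orb J.rot e := fun h => by
    rw [← Multiset.count_pos, count_eq_of_map_eq (map_rot_orb J.rot_cube e), Multiset.count_pos]
  have heq : J.permFlip (J.rot e) = J.permFlip e * ρ := by
    have hs : J.permFlip e * J.permFlip e = 1 := Equiv.swap_mul_self _ _
    change _ = J.permFlip e * (J.permFlip e * J.permFlip (J.rot e))
    rw [← mul_assoc, hs, one_mul]
  have := J.nonempty_iso_reattach (J.permFlip e) ρ (fun h => ?_) (fun h => ?_)
  · rwa [← heq] at this
  · by_cases hh : h ∈ orb J.rot e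
    · rw [hρ _ ((hmem h).2 hh), hρ h hh]
    · rw [hρ' _ (fun h' => hh ((hmem h).1 h')), hρ' h hh]
  · by_cases hh : h ∈ orb J.rot e
    · have hne : J.rot h ≠ h := by
        rcases mem_orb.1 hh with rfl | rfl | rfl
        exacts [he, rot_rot_ne he, rot_symm_ne he]
      rw [hρ h hh, J.label_eq_none hne, J.label_eq_none (rot_rot_ne hne)]
    · rw [hρ' h hh]

/-- Up to isomorphism, reversing the cyclic order only depends on the vertex. -/
theorem nonempty_iso_flip (J : Diagram L) {e g : J.H} (he : J.rot e ≠ e) (hg : g ∈ orb J.rot e) :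
    Nonempty (Iso (J.flip g) (J.flip e)) := by
  rcases mem_orb.1 hg with rfl | rfl | rfl
  · exact cls_eq_cls.1 rfl
  · exact J.nonempty_iso_flip_rot he
  · have := J.nonempty_iso_flip_rot (rot_symm_ne he)
    rw [Equiv.apply_symm_apply] at this
    exact cls_eq_cls.1 (cls_eq_cls.2 this).symm

end Diagram
/-! ### The rewriting map on diagrams -/

/-- The value of the rewriting map on a diagram. -/
def rewriteValue (n : ℕ) (J : Diagram L) : ThetaMod L n :=
  if h : cls J ∈ Theta L n then thetaMk J h
  else if h : ∃ l m r, J.IsEyeglass l m r then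
    eyeglassForm (thetaForm L n) (wordAlg h.choose) (wordAlg h.choose_spec.choose)
      (wordAlg h.choose_spec.choose_spec.choose)
  else 0

theorem rewriteValue_of_mem {n : ℕ} {J : Diagram L} (h : cls J ∈ Theta L n) :
    rewriteValue n J = thetaMk J h := dif_pos h

theorem rewriteValue_isTheta {n : ℕ} {J : Diagram L} (hJ : J.IsTwoLoop n) {a b c : Word L}
    (h : J.IsTheta a b c) :
    rewriteValue n J = thetaForm L n (wordAlg a) (wordAlg b) (wordAlg c) := by
  rw [rewriteValue_of_mem (mem_theta_of_isTheta hJ h), thetaForm_wordAlg _ h]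

/-- By `IsEyeglass.unique` the chosen words differ from the given ones at most by half a turn, under
which the eyeglass form is invariant. -/
theorem rewriteValue_isEyeglass {n : ℕ} {J : Diagram L} {l m r : Word L}
    (h : J.IsEyeglass l m r) :
    rewriteValue n J = eyeglassForm (thetaForm L n) (wordAlg l) (wordAlg m) (wordAlg r) := by
  have hex : ∃ l m r, J.IsEyeglass l m r := ⟨l, m, r, h⟩
  rw [rewriteValue, dif_neg fun h' => (mem_theta_iff.1 h').2 l m r h, dif_pos hex]
  have hch := hex.choose_spec.choose_spec.choose_spec
  generalize hex.choose_spec.choose_spec.choose = r' at hch ⊢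
  generalize hex.choose_spec.choose = m' at hch ⊢
  generalize hex.choose = l' at hch ⊢
  rcases hch.unique h with ⟨rfl, rfl, rfl⟩ | ⟨rfl, rfl, rfl⟩
  · rfl
  · rw [wordAlg_bar, eyeglassForm_swap (isThetaForm_thetaForm L n)]

theorem rewriteValue_congr {n : ℕ} {J K : Diagram L} (h : Nonempty (Iso J K)) :
    rewriteValue n J = rewriteValue n K := by
  by_cases hJ : cls J ∈ Theta L n
  · have hK : cls K ∈ Theta L n := cls_eq_cls.2 h ▸ hJ
    rw [rewriteValue_of_mem hJ, rewriteValue_of_mem hK, thetaMk_congr h]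
  · have hK : cls K ∉ Theta L n := cls_eq_cls.2 h ▸ hJ
    obtain ⟨φ⟩ := h
    obtain ⟨ψ⟩ := cls_eq_cls.1 (cls_eq_cls.2 ⟨φ⟩).symm
    by_cases he : ∃ l m r, J.IsEyeglass l m r
    · obtain ⟨l, m, r, he⟩ := he
      rw [rewriteValue_isEyeglass he, rewriteValue_isEyeglass (he.of_iso φ)]
    · have he' : ¬ ∃ l m r, K.IsEyeglass l m r := fun ⟨l, m, r, h⟩ => he ⟨l, m, r, h.of_iso ψ⟩
      rw [rewriteValue, rewriteValue, dif_neg hJ, dif_neg hK, dif_neg he, dif_neg he']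

/-- The graph is an eyeglass graph for every word put on the path from `x` to `y`, and the value of
the rewriting map is then given by `ψ`. -/
def IsContext {H : Type} (n : ℕ) (rot : Equiv.Perm H) (u v x y : H) (P : List (H × Word L × H))
    (ψ : Alg L →+ ThetaMod L n) : Prop :=
  ∀ w : Word L, ∃ l m r, ((x, w, y) :: P).Perm (eyeglassPaths rot u v l m r) ∧
    eyeglassForm (thetaForm L n) (wordAlg l) (wordAlg m) (wordAlg r) = ψ (wordAlg w)

/-- The eyeglass form is additive in each argument, so the letter under study may sit on either
circle or on the line. -/
theorem exists_isContext {H : Type} (n : ℕ) {rot : Equiv.Perm H} {u v x y : H} {w l m r : Word L}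
    {P : List (H × Word L × H)} (h : (eyeglassPaths rot u v l m r).Perm ((x, w, y) :: P)) :
    ∃ ψ : Alg L →+ ThetaMod L n, IsContext n rot u v x y P ψ := by
  have hm : (x, w, y) ∈ eyeglassPaths rot u v l m r := h.mem_iff.2 List.mem_cons_self
  simp only [eyeglassPaths, List.mem_cons, List.not_mem_nil, or_false, Prod.mk.injEq] at hm
  rcases hm with ⟨rfl, rfl, rfl⟩ | ⟨rfl, rfl, rfl⟩ | ⟨rfl, rfl, rfl⟩
  · have hP := List.Perm.cons_inv h
    refine ⟨AddMonoidHom.mk' (fun a => eyeglassForm (thetaForm L n) a (wordAlg m) (wordAlg r))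
      fun a b => ?_, fun w' => ⟨w', m, r, hP.symm.cons _, rfl⟩⟩
    simp only [eyeglassForm, map_add, map_sub]
    abel
  · have hP := List.Perm.cons_inv ((List.Perm.swap _ _ _).trans h)
    refine ⟨AddMonoidHom.mk' (fun a => eyeglassForm (thetaForm L n) (wordAlg l) a (wordAlg r))
      fun a b => ?_, fun w' => ⟨l, w', r, (hP.symm.cons _).trans (.swap _ _ _), rfl⟩⟩
    rw [eyeglassForm, adj_add_apply]
    simp only [eyeglassForm, map_add, AddMonoidHom.add_apply]
  · have e : ∀ w' : Word L, (eyeglassPaths rot u v l m w').Perm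
        [(rot.symm v, w', rot v), (u, m, v), (rot.symm u, l, rot u)] :=
      fun w' => (List.reverse_perm _).symm
    have hP := List.Perm.cons_inv ((e _).symm.trans h)
    refine ⟨AddMonoidHom.mk' (fun a => eyeglassForm (thetaForm L n) (wordAlg l) (wordAlg m) a)
      fun a b => ?_, fun w' => ⟨l, m, w', (hP.symm.cons _).trans (e w').symm, rfl⟩⟩
    simp only [eyeglassForm, map_add, AddMonoidHom.add_apply]

theorem IsContext.rewriteValue_eq {n : ℕ} {J : Diagram L} {u v x y : J.H}
    {P : List (J.H × Word L × J.H)} {ψ : Alg L →+ ThetaMod L n}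
    (hψ : IsContext n J.rot u v x y P ψ) {w : Word L}
    (h : Skeleton J.rot J.label J.inv u v ((x, w, y) :: P)) :
    (∃ l m r, J.IsEyeglass l m r) ∧ rewriteValue n J = ψ (wordAlg w) := by
  obtain ⟨l, m, r, hp, e⟩ := hψ w
  have hJ : J.IsEyeglass l m r := ⟨u, v, h.perm hp⟩
  exact ⟨⟨l, m, r, hJ⟩, by rw [rewriteValue_isEyeglass hJ, e]⟩

/-- Flipping the left joint reads the left circle backwards, which negates the form. The right joint
is reached through `Skeleton.eyeglass_swap`. -/
theorem IsEyeglass.flip_joint (n : ℕ) {J : Diagram L} {u v e : J.H} {l m r : Word L}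
    (h : Skeleton J.rot J.label J.inv u v (eyeglassPaths J.rot u v l m r)) (he : e ∈ orb J.rot u) :
    (∃ l m r, (J.flip e).IsEyeglass l m r) ∧ rewriteValue n (J.flip e) = -rewriteValue n J := by
  have hu := h.rot_ne.1
  obtain ⟨φ⟩ := J.nonempty_iso_flip hu (rot_mem_orb u)
  obtain ⟨ψ⟩ := cls_eq_cls.1 (cls_eq_cls.2 (J.nonempty_iso_flip hu he)).symm
  have hK : (J.flip (J.rot u)).IsEyeglass (bar l) m r := ⟨_, _, h.eyeglass_flip⟩
  have hK' := (hK.of_iso φ).of_iso ψ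
  refine ⟨⟨_, _, _, hK'⟩, ?_⟩
  rw [rewriteValue_isEyeglass hK', rewriteValue_isEyeglass (n := n) ⟨u, v, h⟩, wordAlg_bar,
    eyeglassForm_antipode_left]

/-- Reversing a cyclic order of an eyeglass diagram. -/
theorem IsEyeglass.flip (n : ℕ) {J : Diagram L} {l m r : Word L} (h : J.IsEyeglass l m r) {e : J.H}
    (he : J.rot e ≠ e) :
    (∃ l m r, (J.flip e).IsEyeglass l m r) ∧ rewriteValue n (J.flip e) = -rewriteValue n J := by
  obtain ⟨u, v, h⟩ := h
  by_cases hu : e ∈ orb J.rot u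
  · exact IsEyeglass.flip_joint n h hu
  by_cases hv : e ∈ orb J.rot v
  · exact IsEyeglass.flip_joint n h.eyeglass_swap hv
  obtain ⟨x, w₁, T, s, w₂, y, P, t, N, hp, hL, hT, hd⟩ := h.exists_letter hu hv
  obtain ⟨ψ, hψ⟩ := exists_isContext n hp
  have e1 := (hψ.rewriteValue_eq hL.skeleton).2
  -- By additivity in the word it suffices to replace one letter by its negative; up to isomorphism
  -- the flip may be made at any half-edge `g` of the same vertex.
  have key : ∀ g, g ∈ orb J.rot e → ∀ T' s', letterAlg (T', s') = -letterAlg (T, s) →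
      Skeleton J.rot J.label (J.via (J.permFlip g)) u v ((x, w₁ ++ (T', s') :: w₂, y) :: P) →
      (∃ l m r, (J.flip e).IsEyeglass l m r) ∧
        rewriteValue n (J.flip e) = -rewriteValue n J := by
    intro g hg T' s' hs hK
    obtain ⟨φ⟩ := J.nonempty_iso_flip he hg
    obtain ⟨⟨l, m, r, k1⟩, k2⟩ := IsContext.rewriteValue_eq (J := J.flip g) hψ hK
    refine ⟨⟨l, m, r, k1.of_iso φ⟩, ?_⟩
    rw [← rewriteValue_congr ⟨φ⟩, k2, e1, wordAlg_neg hs, map_neg]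
  rcases hd with hd | hd
  · exact key t (by rw [orb_eq_of_mem hd]; exact self_mem_orb t) T (!s) (letterAlg_not T s)
      hL.flip_root.skeleton
  · obtain ⟨g, hg, T', e2, hK⟩ := hL.flip_tree hT hd he
    exact key g hg T' s (by cases s <;> simp [e2]) hK.skeleton

theorem flip_flip (J : Diagram L) (e : J.H) : Nonempty (Iso ((J.flip e).flip e) J) := by
  have : (J.flip e).flip e = J.reattach (J.permFlip e * J.permFlip e) := reattach_reattach J _ _
  rw [this, permFlip, Equiv.swap_mul_self]
  exact ⟨⟨Equiv.refl _, fun _ => rfl, fun _ => rfl, fun _ => rfl⟩⟩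

/-- If the flipped diagram were an eyeglass, then so would be the diagram obtained by flipping back.
-/
theorem mem_theta_flip {n : ℕ} {J : Diagram L} (hJ : cls J ∈ Theta L n) {e : J.H}
    (he : J.rot e ≠ e) : cls (J.flip e) ∈ Theta L n := by
  rw [mem_theta_iff] at hJ ⊢
  refine ⟨hJ.1.flip he, fun l m r h => ?_⟩
  obtain ⟨⟨l', m', r', h'⟩, -⟩ := IsEyeglass.flip n h (e := e) he
  obtain ⟨φ⟩ := flip_flip J e
  exact hJ.2 _ _ _ (h'.of_iso φ)

theorem rewriteValue_flip {n : ℕ} {J : Diagram L} (hJ : J.IsTwoLoop n) {e : J.H}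
    (he : J.rot e ≠ e) : rewriteValue n (J.flip e) = -rewriteValue n J := by
  by_cases h : ∃ l m r, J.IsEyeglass l m r
  · obtain ⟨l, m, r, h⟩ := h
    exact (IsEyeglass.flip n h he).2
  · have hm : cls J ∈ Theta L n :=
      mem_theta_iff.2 ⟨hJ, fun l m r hlmr => h ⟨l, m, r, hlmr⟩⟩
    rw [rewriteValue_of_mem hm, rewriteValue_of_mem (mem_theta_flip hm he), thetaMk_flip he hm]

namespace Diagram

/-! ### Symmetries of the IHX relation -/

section Perms

variable {H : Type} {a b c d : H}

theorem formPerm_four_eq (a b c d : H) :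
    [a, b, c, d].formPerm = Equiv.swap a b * (Equiv.swap b c * Equiv.swap c d) := by
  simp [List.formPerm_cons_cons]

theorem formPerm_three_eq (b c d : H) :
    [b, c, d].formPerm = Equiv.swap b c * Equiv.swap c d := by
  simp [List.formPerm_cons_cons]

/-- Let `a, b, c, d` be the four strands at an edge; `swap a c * swap b d` turns the edge over, and
`swap a b`, `swap c d` flip its ends. This identity and those that follow compute the composites of
the moves H and X up to turns and flips. -/
theorem formPerm_mul_self (h : [a, b, c, d].Nodup) :
    [a, b, c, d].formPerm * [a, b, c, d].formPerm = Equiv.swap a c * Equiv.swap b d := by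
  simp only [List.nodup_cons, List.mem_cons, List.not_mem_nil, or_false, not_or] at h
  simp only [formPerm_four_eq]
  ext z
  simp only [Equiv.Perm.mul_apply, Equiv.swap_apply_def]
  grind

theorem formPerm_four_mul_three (h : [a, b, c, d].Nodup) :
    [a, b, c, d].formPerm * [b, c, d].formPerm =
      [b, c, d].formPerm * Equiv.swap c d * (Equiv.swap a c * Equiv.swap b d) := by
  simp only [List.nodup_cons, List.mem_cons, List.not_mem_nil, or_false, not_or] at h
  simp only [formPerm_four_eq, formPerm_three_eq]
  ext z
  simp only [Equiv.Perm.mul_apply, Equiv.swap_apply_def]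
  grind

theorem formPerm_three_mul_four (h : [a, b, c, d].Nodup) :
    [b, c, d].formPerm * [a, b, c, d].formPerm =
      Equiv.swap a b * (Equiv.swap a c * Equiv.swap b d) := by
  simp only [List.nodup_cons, List.mem_cons, List.not_mem_nil, or_false, not_or] at h
  simp only [formPerm_four_eq, formPerm_three_eq]
  ext z
  simp only [Equiv.Perm.mul_apply, Equiv.swap_apply_def]
  grind

theorem formPerm_three_mul_self (h : [a, b, c, d].Nodup) :
    [b, c, d].formPerm * [b, c, d].formPerm =
      [a, b, c, d].formPerm * Equiv.swap c d * (Equiv.swap a c * Equiv.swap b d) := by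
  simp only [List.nodup_cons, List.mem_cons, List.not_mem_nil, or_false, not_or] at h
  simp only [formPerm_four_eq, formPerm_three_eq]
  ext z
  simp only [Equiv.Perm.mul_apply, Equiv.swap_apply_def]
  grind

theorem swap_mul_formPerm (a b c d : H) :
    Equiv.swap a b * [a, b, c, d].formPerm = [b, c, d].formPerm := by
  rw [formPerm_four_eq, formPerm_three_eq, ← mul_assoc, Equiv.swap_mul_self, one_mul]

theorem formPerm_three_rotate (h : [a, b, c, d].Nodup) :
    [d, a, b].formPerm = [b, c, d].formPerm * Equiv.swap a b * Equiv.swap c d *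
      (Equiv.swap a c * Equiv.swap b d) := by
  simp only [List.nodup_cons, List.mem_cons, List.not_mem_nil, or_false, not_or] at h
  simp only [formPerm_three_eq]
  ext z
  simp only [Equiv.Perm.mul_apply, Equiv.swap_apply_def]
  grind

theorem formPerm_four_rotate (h : [a, b, c, d].Nodup) :
    [c, d, a, b].formPerm = [a, b, c, d].formPerm :=
  List.formPerm_eq_of_isRotated (by
    simp only [List.nodup_cons, List.mem_cons, List.not_mem_nil, or_false, not_or] at h ⊢
    grind) ⟨2, rfl⟩

end Perms

/-- The permutation only moves strands at the two ends of the edge of `e`. -/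
structure MovesAt (J : Diagram L) (e : J.H) (σ : Equiv.Perm J.H) : Prop where
  fix : σ e = e
  fix_inv : σ (J.inv e) = J.inv e
  fix_off : ∀ z, z ∉ orb J.rot e + orb J.rot (J.inv e) → σ z = z

variable {J : Diagram L} {e : J.H} {σ τ : Equiv.Perm J.H}

theorem MovesAt.one : J.MovesAt e 1 := ⟨rfl, rfl, fun _ _ => rfl⟩

theorem MovesAt.mul (h : J.MovesAt e σ) (h' : J.MovesAt e τ) : J.MovesAt e (σ * τ) :=
  ⟨by rw [Equiv.Perm.mul_apply, h'.fix, h.fix], by rw [Equiv.Perm.mul_apply, h'.fix_inv, h.fix_inv],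
    fun z hz => by rw [Equiv.Perm.mul_apply, h'.fix_off z hz, h.fix_off z hz]⟩

theorem MovesAt.swap {x y : J.H} (h1 : x ≠ e) (h2 : x ≠ J.inv e) (h3 : y ≠ e) (h4 : y ≠ J.inv e)
    (hx : x ∈ orb J.rot e + orb J.rot (J.inv e)) (hy : y ∈ orb J.rot e + orb J.rot (J.inv e)) :
    J.MovesAt e (Equiv.swap x y) :=
  ⟨Equiv.swap_apply_of_ne_of_ne h1.symm h3.symm, Equiv.swap_apply_of_ne_of_ne h2.symm h4.symm,
    fun _ hz => Equiv.swap_apply_of_ne_of_ne (fun h => hz (h ▸ hx)) (fun h => hz (h ▸ hy))⟩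

theorem IsInner.movesAt_permH (he : J.IsInner e) : J.MovesAt e (J.permH e) :=
  ⟨he.permH_apply.1, he.permH_apply.2.1, he.permH_apply.2.2.2.2.2.2⟩

theorem IsInner.movesAt_permX (he : J.IsInner e) : J.MovesAt e (J.permX e) :=
  ⟨he.permX_apply.1, he.permX_apply.2.1, he.permX_apply.2.2.2.2.2.2⟩

theorem IsInner.movesAt_permFlip (he : J.IsInner e) : J.MovesAt e (J.permFlip e) := by
  have h := he.nodup
  simp only [List.nodup_cons, List.mem_cons, List.not_mem_nil, or_false, not_or] at h
  refine .swap ?_ ?_ ?_ ?_ ?_ ?_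
  on_goal 5 => exact Multiset.mem_add.2 (.inl (rot_mem_orb e))
  on_goal 5 => exact Multiset.mem_add.2 (.inl (rot_symm_mem_orb e))
  all_goals grind

theorem IsInner.movesAt_permFlip_inv (he : J.IsInner e) : J.MovesAt e (J.permFlip (J.inv e)) := by
  have h := he.nodup
  simp only [List.nodup_cons, List.mem_cons, List.not_mem_nil, or_false, not_or] at h
  refine .swap ?_ ?_ ?_ ?_ ?_ ?_
  on_goal 5 => exact Multiset.mem_add.2 (.inr (rot_mem_orb _))
  on_goal 5 => exact Multiset.mem_add.2 (.inr (rot_symm_mem_orb _))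
  all_goals grind

/-- The strand exchange turning the edge of `e` upside down. -/
def permTurn (J : Diagram L) (e : J.H) : Equiv.Perm J.H :=
  Equiv.swap (J.rot e) (J.rot (J.inv e)) * Equiv.swap (J.rot.symm e) (J.rot.symm (J.inv e))

theorem IsInner.movesAt_permTurn (he : J.IsInner e) : J.MovesAt e (J.permTurn e) := by
  have h := he.nodup
  simp only [List.nodup_cons, List.mem_cons, List.not_mem_nil, or_false, not_or] at h
  refine .mul (.swap ?_ ?_ ?_ ?_ ?_ ?_) (.swap ?_ ?_ ?_ ?_ ?_ ?_)
  on_goal 5 => exact Multiset.mem_add.2 (.inl (rot_mem_orb _))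
  on_goal 5 => exact Multiset.mem_add.2 (.inr (rot_mem_orb _))
  on_goal 9 => exact Multiset.mem_add.2 (.inl (rot_symm_mem_orb _))
  on_goal 9 => exact Multiset.mem_add.2 (.inr (rot_symm_mem_orb _))
  all_goals grind

theorem MovesAt.inv_eq (h : J.MovesAt e σ) : (J.reattach σ).inv e = J.inv e :=
  conj_apply (inv := J.inv) h.fix h.fix_inv rfl

theorem MovesAt.isInner (h : J.MovesAt e σ) (he : J.IsInner e) : (J.reattach σ).IsInner e := by
  unfold IsInner
  rw [h.inv_eq]
  exact he

/-- The edge stays in place under `σ`, so H is given by the same permutation as before and the two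
moves compose. -/
theorem MovesAt.toH_eq (h : J.MovesAt e σ) : (J.reattach σ).toH e = J.reattach (σ * J.permH e) := by
  have : (J.reattach σ).permH e = J.permH e := by unfold permH; rw [h.inv_eq]; rfl
  rw [← reattach_reattach, ← this]
  rfl

theorem MovesAt.toX_eq (h : J.MovesAt e σ) : (J.reattach σ).toX e = J.reattach (σ * J.permX e) := by
  have : (J.reattach σ).permX e = J.permX e := by unfold permX; rw [h.inv_eq]; rfl
  rw [← reattach_reattach, ← this]
  rfl

theorem reattach_swap_edge (J : Diagram L) (e : J.H) : J.reattach (Equiv.swap e (J.inv e)) = J := by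
  have : (Equiv.swap e (J.inv e))⁻¹ * J.inv * Equiv.swap e (J.inv e) = J.inv := by
    rw [Equiv.swap_inv, mul_assoc, Equiv.mul_swap_eq_swap_mul, ← mul_assoc, J.inv_inv,
      Equiv.swap_comm, Equiv.swap_mul_self, one_mul]
  unfold reattach
  congr 1

/-- Turning the edge over together with exchanging its two halves is an automorphism of the
vertices, and exchanging the halves alone does not change the pairing. -/
theorem MovesAt.nonempty_iso_turn (hσ : J.MovesAt e σ) (he : J.IsInner e) :
    Nonempty (Iso (J.reattach (σ * J.permTurn e)) (J.reattach σ)) := by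
  have hm := hσ.mul he.movesAt_permTurn
  have e1 : J.reattach (σ * (J.permTurn e * Equiv.swap e (J.inv e))) =
      J.reattach (σ * J.permTurn e) := by
    have := reattach_swap_edge (J.reattach (σ * J.permTurn e)) e
    rw [hm.inv_eq] at this
    rw [← mul_assoc]
    exact (reattach_reattach J _ _).symm.trans this
  rw [← e1]
  have h := he.nodup
  simp only [List.nodup_cons, List.mem_cons, List.not_mem_nil, or_false, not_or] at h
  set ρ := J.permTurn e * Equiv.swap e (J.inv e) with hρ
  have ρ1 : ρ e = J.inv e := by
    simp only [hρ, permTurn, Equiv.Perm.mul_apply, Equiv.swap_apply_def]; grind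
  have ρ2 : ρ (J.inv e) = e := by
    simp only [hρ, permTurn, Equiv.Perm.mul_apply, Equiv.swap_apply_def]; grind
  have ρ3 : ρ (J.rot e) = J.rot (J.inv e) := by
    simp only [hρ, permTurn, Equiv.Perm.mul_apply, Equiv.swap_apply_def]; grind
  have ρ4 : ρ (J.rot (J.inv e)) = J.rot e := by
    simp only [hρ, permTurn, Equiv.Perm.mul_apply, Equiv.swap_apply_def]; grind
  have ρ5 : ρ (J.rot.symm e) = J.rot.symm (J.inv e) := by
    simp only [hρ, permTurn, Equiv.Perm.mul_apply, Equiv.swap_apply_def]; grind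
  have ρ6 : ρ (J.rot.symm (J.inv e)) = J.rot.symm e := by
    simp only [hρ, permTurn, Equiv.Perm.mul_apply, Equiv.swap_apply_def]; grind
  have ρ7 : ∀ z, z ∉ orb J.rot e + orb J.rot (J.inv e) → ρ z = z := fun z hz => by
    rw [Multiset.mem_add, mem_orb, mem_orb] at hz
    simp only [hρ, permTurn, Equiv.Perm.mul_apply, Equiv.swap_apply_def]; grind
  have hmem : ∀ z, J.rot z ∈ orb J.rot e + orb J.rot (J.inv e) ↔
      z ∈ orb J.rot e + orb J.rot (J.inv e) := fun z => by
    rw [← Multiset.count_pos, count_eq_of_map_eq (M := orb J.rot e + orb J.rot (J.inv e)) (by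
      rw [Multiset.map_add, map_rot_orb J.rot_cube, map_rot_orb J.rot_cube]), Multiset.count_pos]
  have r1 := rot_rot J.rot_cube e
  have r2 := rot_rot J.rot_cube (J.inv e)
  refine J.nonempty_iso_reattach σ ρ (fun z => ?_) (fun z => ?_)
  · by_cases hz : z ∈ orb J.rot e + orb J.rot (J.inv e)
    · simp only [Multiset.mem_add, mem_orb] at hz
      rcases hz with (rfl | rfl | rfl) | (rfl | rfl | rfl)
      · rw [ρ1, ρ3]
      · rw [r1, ρ3, ρ5, r2]
      · rw [Equiv.apply_symm_apply, ρ1, ρ5, Equiv.apply_symm_apply]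
      · rw [ρ2, ρ4]
      · rw [r2, ρ4, ρ6, r1]
      · rw [Equiv.apply_symm_apply, ρ2, ρ6, Equiv.apply_symm_apply]
    · rw [ρ7 z hz, ρ7 _ fun hz' => hz ((hmem z).1 hz')]
  · by_cases hz : z ∈ orb J.rot e + orb J.rot (J.inv e)
    · have n1 := J.label_eq_none he.1
      have n2 := J.label_eq_none he.2.1
      have n3 := J.label_eq_none (rot_rot_ne he.1)
      have n4 := J.label_eq_none (rot_rot_ne he.2.1)
      have n5 := J.label_eq_none (rot_symm_ne he.1)
      have n6 := J.label_eq_none (rot_symm_ne he.2.1)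
      simp only [Multiset.mem_add, mem_orb] at hz
      rcases hz with (rfl | rfl | rfl) | (rfl | rfl | rfl)
      · rw [ρ1, n1, n2]
      · rw [ρ3, n3, n4]
      · rw [ρ5, n5, n6]
      · rw [ρ2, n1, n2]
      · rw [ρ4, n3, n4]
      · rw [ρ6, n5, n6]
    · rw [ρ7 z hz]

theorem IsInner.nodup_strands (he : J.IsInner e) :
    [J.rot e, J.rot.symm e, J.rot (J.inv e), J.rot.symm (J.inv e)].Nodup := by
  have hn := he.nodup
  simp only [List.nodup_cons, List.mem_cons, List.not_mem_nil, or_false, not_or] at hn ⊢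
  tauto

theorem IsInner.inv_right (he : J.IsInner e) : J.IsInner (J.inv e) := by
  have hn := he.nodup
  simp only [List.nodup_cons, List.mem_cons, List.not_mem_nil, or_false, not_or] at hn
  refine ⟨he.2.1, by rw [J.inv_inv]; exact he.1, ?_, ?_⟩ <;> rw [J.inv_inv] <;> grind

end Diagram
/-- The rewriting map vanishes on the IHX relator at `e`. -/
def RespectsIHX (n : ℕ) (J : Diagram L) (e : J.H) : Prop :=
  rewriteValue n J - rewriteValue n (J.toH e) + rewriteValue n (J.toX e) = 0

/-! ### Invariance of the IHX condition under the symmetries of the relator -/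

section Symmetry

variable {n : ℕ} {J : Diagram L} {e : J.H} {σ : Equiv.Perm J.H}

theorem Diagram.MovesAt.isTwoLoop (h : J.MovesAt e σ) (hJ : J.IsTwoLoop n) :
    (J.reattach σ).IsTwoLoop n :=
  hJ.reattach_edge h.fix h.fix_inv h.fix_off

theorem Diagram.MovesAt.rewriteValue_flip (h : J.MovesAt e σ) (hJ : J.IsTwoLoop n)
    (he : J.rot e ≠ e) : rewriteValue n (J.reattach (σ * J.permFlip e)) =
      -rewriteValue n (J.reattach σ) := by
  rw [← reattach_reattach]
  exact Jacobi.rewriteValue_flip (J := J.reattach σ) (h.isTwoLoop hJ) (e := e) he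

theorem Diagram.MovesAt.rewriteValue_flip_inv (h : J.MovesAt e σ) (hJ : J.IsTwoLoop n)
    (he : J.rot (J.inv e) ≠ J.inv e) :
    rewriteValue n (J.reattach (σ * J.permFlip (J.inv e))) =
      -rewriteValue n (J.reattach σ) := by
  rw [← reattach_reattach]
  exact Jacobi.rewriteValue_flip (J := J.reattach σ) (h.isTwoLoop hJ) (e := J.inv e) he

theorem Diagram.MovesAt.rewriteValue_turn (h : J.MovesAt e σ) (he : J.IsInner e) :
    rewriteValue n (J.reattach (σ * J.permTurn e)) = rewriteValue n (J.reattach σ) :=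
  rewriteValue_congr (h.nonempty_iso_turn he)

/-- Starting from H, the triple `(I, H, X)` becomes `(H, I, -X)` modulo AS, which negates the
relator. -/
theorem RespectsIHX.of_toH (hJ : J.IsTwoLoop n) (he : J.IsInner e)
    (h : RespectsIHX n (J.toH e) e) : RespectsIHX n J e := by
  have hH := he.movesAt_permH
  have hX := he.movesAt_permX
  have e1 : (J.toH e).toH e = J.reattach (1 * J.permTurn e) := by
    rw [one_mul, permTurn, ← formPerm_mul_self he.nodup_strands]; exact hH.toH_eq
  have e2 : (J.toH e).toX e =
      J.reattach (J.permX e * J.permFlip (J.inv e) * J.permTurn e) := by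
    refine hH.toX_eq.trans (congrArg J.reattach ?_)
    exact formPerm_four_mul_three he.nodup_strands
  unfold RespectsIHX at h ⊢
  rw [e1, e2, MovesAt.one.rewriteValue_turn he,
    (hX.mul he.movesAt_permFlip_inv).rewriteValue_turn he, hX.rewriteValue_flip_inv hJ he.2.1] at h
  change rewriteValue n (J.toH e) - rewriteValue n J + -rewriteValue n (J.toX e) = 0 at h
  rw [← neg_eq_zero, ← h]
  abel

/-- Starting from X, the triple becomes `(X, -I, -H)`, with the same relator. -/
theorem RespectsIHX.of_toX (hJ : J.IsTwoLoop n) (he : J.IsInner e)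
    (h : RespectsIHX n (J.toX e) e) : RespectsIHX n J e := by
  have hH := he.movesAt_permH
  have hX := he.movesAt_permX
  have e1 : (J.toX e).toH e = J.reattach (1 * J.permFlip e * J.permTurn e) := by
    refine hX.toH_eq.trans (congrArg J.reattach ?_)
    rw [one_mul]
    exact formPerm_three_mul_four he.nodup_strands
  have e2 : (J.toX e).toX e =
      J.reattach (J.permH e * J.permFlip (J.inv e) * J.permTurn e) := by
    refine hX.toX_eq.trans (congrArg J.reattach ?_)
    exact formPerm_three_mul_self he.nodup_strands
  unfold RespectsIHX at h ⊢
  rw [e1, e2, (MovesAt.one.mul he.movesAt_permFlip).rewriteValue_turn he,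
    MovesAt.one.rewriteValue_flip hJ he.1,
    (hH.mul he.movesAt_permFlip_inv).rewriteValue_turn he, hH.rewriteValue_flip_inv hJ he.2.1] at h
  change rewriteValue n (J.toX e) - -rewriteValue n J + -rewriteValue n (J.toH e) = 0 at h
  rw [← h]
  abel

/-- A flip at `e` turns I into `-I` and exchanges H with X, which negates the relator. -/
theorem RespectsIHX.of_flip (hJ : J.IsTwoLoop n) (he : J.IsInner e)
    (h : RespectsIHX n (J.flip e) e) : RespectsIHX n J e := by
  have hs := he.movesAt_permFlip
  have e1 : (J.flip e).toH e = J.toX e := by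
    refine hs.toH_eq.trans (congrArg J.reattach ?_)
    exact swap_mul_formPerm _ _ _ _
  have e2 : (J.flip e).toX e = J.toH e := by
    refine hs.toX_eq.trans (congrArg J.reattach ?_)
    exact (formPerm_four_eq ..).symm ▸ (formPerm_three_eq ..).symm ▸ rfl
  unfold RespectsIHX at h ⊢
  rw [e1, e2, Jacobi.rewriteValue_flip hJ he.1] at h
  rw [← neg_eq_zero, ← h]
  abel

/-- Seen from the other half of the edge, I and H are the same and X has both ends flipped, so that
its sign is unchanged. -/
theorem RespectsIHX.of_inv (hJ : J.IsTwoLoop n) (he : J.IsInner e)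
    (h : RespectsIHX n J (J.inv e)) : RespectsIHX n J e := by
  have hX := he.movesAt_permX
  have e1 : J.toH (J.inv e) = J.toH e := by
    refine congrArg J.reattach ?_
    rw [J.inv_inv]
    exact formPerm_four_rotate he.nodup_strands
  have e2 : J.toX (J.inv e) =
      J.reattach (J.permX e * J.permFlip e * J.permFlip (J.inv e) * J.permTurn e) := by
    refine congrArg J.reattach ?_
    rw [J.inv_inv]
    exact formPerm_three_rotate he.nodup_strands
  unfold RespectsIHX at h ⊢
  rw [e1, e2, ((hX.mul he.movesAt_permFlip).mul he.movesAt_permFlip_inv).rewriteValue_turn he,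
    (hX.mul he.movesAt_permFlip).rewriteValue_flip_inv hJ he.2.1, hX.rewriteValue_flip hJ he.1,
    neg_neg] at h
  exact h

theorem RespectsIHX.inv (hJ : J.IsTwoLoop n) (he : J.IsInner e) (h : RespectsIHX n J e) :
    RespectsIHX n J (J.inv e) :=
  .of_inv hJ he.inv_right (by rwa [J.inv_inv])

theorem RespectsIHX.of_flip_inv (hJ : J.IsTwoLoop n) (he : J.IsInner e)
    (h : RespectsIHX n (J.flip (J.inv e)) e) : RespectsIHX n J e := by
  have hs := he.movesAt_permFlip_inv
  have hi : (J.flip (J.inv e)).inv e = J.inv e := hs.inv_eq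
  refine .of_inv hJ he (.of_flip hJ he.inv_right ?_)
  have := RespectsIHX.inv (J := J.flip (J.inv e)) (hs.isTwoLoop hJ) (hs.isInner he) h
  rwa [hi] at this

end Symmetry

/-! ### The rewriting map respects IHX -/

section IHX

variable {n : ℕ} {J : Diagram L} {u v x y t e : J.H} {l m r w₁ w₂ : Word L} {T T₂ : RTree L}
  {s s₂ : Bool} {P : List (J.H × Word L × J.H)} {ψ : Alg L →+ ThetaMod L n}

/-- IHX at a bare line opens both circles. H and X become planar theta diagrams with an empty arm,
and the relation is the definition of the form, up to reversing the arms. -/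
theorem respectsIHX_line_nil (hJ : J.IsTwoLoop n)
    (h : Skeleton J.rot J.label J.inv u v (eyeglassPaths J.rot u v l [] r)) :
    RespectsIHX n J u := by
  obtain ⟨he, hH, hX⟩ := h.eyeglass_contract
  have hθ := isThetaForm_thetaForm L n
  have r1 := hθ.reverse 1 (wordAlg r) (antipode (wordAlg l))
  have r2 := hθ.reverse 1 (wordAlg r) (wordAlg l)
  have e0 : adj 1 (wordAlg r) = wordAlg r := by rw [map_one adj]; rfl
  have eH : (J.toH u).IsTheta [] l (bar r) := ⟨u, v, hH⟩
  have eX : (J.toX u).IsTheta [] (bar l) (bar r) := ⟨u, v, hX⟩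
  unfold RespectsIHX
  rw [rewriteValue_isEyeglass (n := n) ⟨u, v, h⟩, rewriteValue_isTheta (hJ.toH he) eH,
    rewriteValue_isTheta (hJ.toX he) eX, eyeglassForm, wordAlg_nil, e0, wordAlg_bar,
    wordAlg_bar, map_sub]
  rw [antipode_one, antipode_antipode] at r1
  rw [antipode_one] at r2
  rw [r1, r2]
  abel

/-- H and X slide the tree onto the left circle, with the circle reversed in X. Undoing this
reversal by `eyeglassForm_antipode_left` leaves the commutator of the tree with the circle, as in
`eyeglassForm_toAlg_mul`. -/
theorem respectsIHX_line_cons (h : Skeleton J.rot J.label J.inv u v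
    (eyeglassPaths J.rot u v l ((T, true) :: m) r)) : RespectsIHX n J u := by
  obtain ⟨-, hH, hX⟩ := h.eyeglass_slide
  have hθ := isThetaForm_thetaForm L n
  have eH : (J.toH u).IsEyeglass (l ++ [(T, true)]) m r := ⟨_, v, hH⟩
  have eX : (J.toX u).IsEyeglass (bar l ++ [(T, true)]) m r := ⟨_, v, hX⟩
  have e1 := eyeglassForm_antipode_left (θ := thetaForm L n) (T.toAlg * wordAlg l) (wordAlg m)
    (wordAlg r)
  have e2 : eyeglassForm (thetaForm L n) (-(antipode (wordAlg l) * T.toAlg)) (wordAlg m)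
      (wordAlg r) = -eyeglassForm (thetaForm L n) (antipode (wordAlg l) * T.toAlg) (wordAlg m)
      (wordAlg r) := by
    rw [← zero_sub, eyeglassForm_sub_left, eyeglassForm_zero_left, zero_sub]
  rw [antipode_mul, antipode_toAlg, mul_neg, e2, neg_inj] at e1
  unfold RespectsIHX
  rw [rewriteValue_isEyeglass (n := n) ⟨u, v, h⟩, rewriteValue_isEyeglass eH,
    rewriteValue_isEyeglass eX]
  simp only [wordAlg_append, wordAlg_cons, wordAlg_nil, mul_one, letterAlg_true, wordAlg_bar]
  rw [eyeglassForm_toAlg_mul hθ, eyeglassForm_sub_left, e1]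
  abel

/-- A first tree below the line is brought above it by a flip at the far end of the edge under
consideration. -/
theorem respectsIHX_line (hJ : J.IsTwoLoop n) (he : J.IsInner u)
    (h : Skeleton J.rot J.label J.inv u v (eyeglassPaths J.rot u v l m r)) :
    RespectsIHX n J u := by
  rcases m with _ | ⟨⟨T, s⟩, m⟩
  · exact respectsIHX_line_nil hJ h
  cases s
  · have hp : ∀ s, (eyeglassPaths J.rot u v l ((T, s) :: m) r).Perm
        ((u, [] ++ (T, s) :: m, v) :: [(J.rot.symm u, l, J.rot u), (J.rot.symm v, r, J.rot v)]) :=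
      fun s => .swap _ _ _
    obtain ⟨t, ht⟩ := (h.perm (hp false)).exists_letterAt
    have hi : J.inv u = inDart J.rot (t, false) := by
      rw [← ht.inv_inDart J.inv_inv, J.inv_inv]
    have hf := ht.flip_in
    rw [← hi] at hf
    exact .of_flip_inv hJ he (respectsIHX_line_cons (J := J.flip (J.inv u))
      (hf.skeleton.perm (hp true).symm))
  · exact respectsIHX_line_cons h

/-- H at the first edge of the circle pushes its first tree back onto the line, so the relator
becomes one at an edge of a line. -/
theorem respectsIHX_circle (hJ : J.IsTwoLoop n) (he : J.IsInner (J.rot.symm u))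
    (h : Skeleton J.rot J.label J.inv u v (eyeglassPaths J.rot u v l m r)) :
    RespectsIHX n J (J.rot.symm u) := by
  have key : ∀ (K : Diagram L) (u v : K.H) (T : RTree L) (l m r : Word L), K.IsTwoLoop n →
      Skeleton K.rot K.label K.inv u v (eyeglassPaths K.rot u v ((T, true) :: l) m r) →
      RespectsIHX n K (K.rot.symm u) := fun K u v T l m r hK h => by
    obtain ⟨hin, h'⟩ := h.eyeglass_slide_back
    exact .of_toH hK hin (respectsIHX_line (J := K.toH (K.rot.symm u)) (hK.toH hin)
      (hin.movesAt_permH.isInner hin) h')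
  rcases l with _ | ⟨⟨T, s⟩, l⟩
  · obtain ⟨-, M₁, -, -, h1, -⟩ := skeleton_three.1 h
    -- An empty circle is a self-loop, and its edge is not inner.
    refine absurd ?_ he.2.2.2
    rw [h1.end_eq.1, symm_symm J.rot_cube]
  cases s
  · have hp : ∀ s, (eyeglassPaths J.rot u v ((T, s) :: l) m r).Perm
        ((J.rot.symm u, [] ++ (T, s) :: l, J.rot u) :: [(u, m, v), (J.rot.symm v, r, J.rot v)]) :=
      fun s => .refl _
    obtain ⟨t, ht⟩ := (h.perm (hp false)).exists_letterAt
    have hi : J.inv (J.rot.symm u) = inDart J.rot (t, false) := by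
      rw [← ht.inv_inDart J.inv_inv, J.inv_inv]
    have hf := ht.flip_in
    rw [← hi] at hf
    exact .of_flip_inv hJ he (key (J.flip (J.inv (J.rot.symm u))) u v T l m r
      (hJ.flip he.2.1) (hf.skeleton.perm (hp true).symm))
  · exact key J u v T l m r hJ h

/-- A flip of the joint makes the last edge of the circle the first one. -/
theorem respectsIHX_joint (hJ : J.IsTwoLoop n) (he : J.IsInner e)
    (h : Skeleton J.rot J.label J.inv u v (eyeglassPaths J.rot u v l m r))
    (hu : e ∈ orb J.rot u) : RespectsIHX n J e := by
  rcases mem_orb.1 hu with rfl | rfl | rfl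
  · exact respectsIHX_line hJ he h
  · have hK := h.eyeglass_flip
    have := respectsIHX_circle (J := J.flip (J.rot u)) (n := n) (hJ.flip he.1) (by
      change (J.flip (J.rot u)).IsInner (J.rot.symm (J.rot.symm u))
      rw [symm_symm J.rot_cube]
      exact he.movesAt_permFlip.isInner he) hK
    change RespectsIHX n (J.flip (J.rot u)) (J.rot.symm (J.rot.symm u)) at this
    rw [symm_symm J.rot_cube] at this
    exact .of_flip hJ he this
  · exact respectsIHX_circle hJ he h

/-- The relation is the expansion of a bracket inside an additive context. -/
theorem respectsIHX_letter_true (hψ : IsContext n J.rot u v x y P ψ)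
    {A B : RTree L} (h : LetterAt J.rot J.label J.inv u v x w₁ (.node A B) true w₂ y P t) :
    RespectsIHX n J t := by
  obtain ⟨-, hH, hX⟩ := h.ihx_root
  have eH := (IsContext.rewriteValue_eq (J := J.toH t) hψ hH).2
  have eX := (IsContext.rewriteValue_eq (J := J.toX t) hψ hX).2
  unfold RespectsIHX
  rw [(hψ.rewriteValue_eq h.skeleton).2, eH, eX, ← map_sub, ← map_add, wordAlg_node]
  convert map_zero ψ using 2
  abel

theorem respectsIHX_letter (hJ : J.IsTwoLoop n) (he : J.IsInner t)
    (hψ : IsContext n J.rot u v x y P ψ)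
    (h : LetterAt J.rot J.label J.inv u v x w₁ T s w₂ y P t) : RespectsIHX n J t := by
  obtain ⟨A, B, rfl⟩ : ∃ A B, T = .node A B := by
    obtain ⟨-, -, _, _, _, _, -, hT, -⟩ := h
    cases hT with
    | leaf _ _ h1 => exact absurd h1 he.2.1
    | node => exact ⟨_, _, rfl⟩
  cases s
  · exact .of_flip hJ he (respectsIHX_letter_true (J := J.flip t) hψ h.flip_root)
  · exact respectsIHX_letter_true hψ h

/-- H at an edge between neighbouring trees fuses them into one tree, of which this edge becomes the
root edge. -/
theorem respectsIHX_between_true_true (hJ : J.IsTwoLoop n) (hψ : IsContext n J.rot u v x y P ψ)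
    (h : LetterAt J.rot J.label J.inv u v x w₁ T true ((T₂, true) :: w₂) y P t) :
    RespectsIHX n J (J.rot.symm t) := by
  obtain ⟨he, h'⟩ := h.merge
  exact .of_toH hJ he (respectsIHX_letter (J := J.toH (J.rot.symm t)) (hJ.toH he)
    (he.movesAt_permH.isInner he) hψ h')

theorem respectsIHX_between_true (hJ : J.IsTwoLoop n) (he : J.IsInner (J.rot.symm t))
    (hψ : IsContext n J.rot u v x y P ψ)
    (h : LetterAt J.rot J.label J.inv u v x w₁ T true ((T₂, s₂) :: w₂) y P t) :
    RespectsIHX n J (J.rot.symm t) := by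
  cases s₂
  · obtain ⟨t₂, hi, h₂⟩ := h.next
    have hm := he.movesAt_permFlip_inv
    have hf := h₂.flip_in
    have hi' : inDart J.rot (t₂, false) = J.inv (J.rot.symm t) := hi.symm
    rw [hi'] at hf
    obtain ⟨t₁, hi₁, h₁⟩ := hf.prev
    rw [inDart_outDart, hi'] at hi₁
    have e2 : J.rot.symm t₁ = J.rot.symm t :=
      (J.via (J.permFlip (J.inv (J.rot.symm t)))).injective (hi₁.trans hm.inv_eq.symm)
    have hK : (J.flip (J.inv (J.rot.symm t))).IsTwoLoop n := hJ.flip he.2.1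
    refine .of_flip_inv hJ he ?_
    generalize J.rot.symm t = e at *
    subst e2
    exact respectsIHX_between_true_true (J := J.flip (J.inv (J.rot.symm t₁))) hK hψ h₁
  · exact respectsIHX_between_true_true hJ hψ h

/-- Trees on the right are first brought to the left. The flips are made at the two halves of the
edge in question, so that the edge and its relator are kept. -/
theorem respectsIHX_between (hJ : J.IsTwoLoop n) (he : J.IsInner (outDart J.rot (t, s)))
    (hψ : IsContext n J.rot u v x y P ψ)
    (h : LetterAt J.rot J.label J.inv u v x w₁ T s ((T₂, s₂) :: w₂) y P t) :
    RespectsIHX n J (outDart J.rot (t, s)) := by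
  cases s
  · have e1 : J.rot.symm (inDart J.rot (t, false)) = outDart J.rot (t, false) :=
      symm_symm J.rot_cube t
    have hf := h.flip_out
    refine .of_flip hJ he ?_
    have := respectsIHX_between_true (J := J.flip (outDart J.rot (t, false))) (hJ.flip he.1) (by
      change (J.flip (outDart J.rot (t, false))).IsInner (J.rot.symm (inDart J.rot (t, false)))
      rw [e1]
      exact he.movesAt_permFlip.isInner he) hψ hf
    change RespectsIHX n (J.flip (outDart J.rot (t, false)))
      (J.rot.symm (inDart J.rot (t, false))) at this
    rwa [e1] at this
  · exact respectsIHX_between_true hJ he hψ h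

/-- The rewriting map respects the IHX relations at the edges of an eyeglass diagram. -/
theorem respectsIHX_of_isEyeglass (hJ : J.IsTwoLoop n) (he : J.IsInner e)
    (h : J.IsEyeglass l m r) : RespectsIHX n J e := by
  obtain ⟨u, v, h⟩ := h
  have joint : ∀ e, J.IsInner e → (e ∈ orb J.rot u ∨ e ∈ orb J.rot v) → RespectsIHX n J e := by
    rintro e he (hu | hv)
    · exact respectsIHX_joint hJ he h hu
    · exact respectsIHX_joint hJ he h.eyeglass_swap hv
  by_cases hu : e ∈ orb J.rot u ∨ e ∈ orb J.rot v
  · exact joint e he hu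
  rw [not_or] at hu
  obtain ⟨x, w₁, T, s, w₂, y, P, t, N, hp, hL, hT, hd⟩ := h.exists_letter hu.1 hu.2
  obtain ⟨ψ, hψ⟩ := exists_isContext n hp
  -- For an edge inside the tree, directed towards the leaves, the relation is the Jacobi identity
  -- for one letter of an additive context.
  have tree : ∀ e, J.IsInner e → e ∈ N → ¬ J.Hanging e → RespectsIHX n J e := by
    intro e he hm hh
    obtain ⟨TH, TX, hJac, hH, hX⟩ := hL.ihx_tree hT hm hh he.2.1
    have eH := (IsContext.rewriteValue_eq (J := J.toH e) hψ hH.skeleton).2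
    have eX := (IsContext.rewriteValue_eq (J := J.toX e) hψ hX.skeleton).2
    unfold RespectsIHX
    rw [(hψ.rewriteValue_eq hL.skeleton).2, eH, eX, ← map_sub, ← map_add]
    convert map_zero ψ using 2
    have : letterAlg (T, s) - letterAlg (TH, s) + letterAlg (TX, s) = 0 := by
      cases s
      · rw [letterAlg_false, letterAlg_false, letterAlg_false, ← neg_eq_zero, ← hJac]
        abel
      · exact hJac
    simp only [wordAlg_append, wordAlg_cons, ← mul_sub, ← mul_add, ← sub_mul, ← add_mul, this,
      zero_mul, mul_zero]
  have out : ∀ e, J.IsInner e → ∀ w₁ T s w₂ t,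
      LetterAt J.rot J.label J.inv u v x w₁ T s w₂ y P t → e = outDart J.rot (t, s) →
      RespectsIHX n J e := by
    rintro e he w₁ T s w₂ t hL rfl
    rcases w₂ with _ | ⟨⟨T₂, s₂⟩, w₂⟩
    · refine .of_inv hJ he (joint _ he.inv_right ?_)
      rw [hL.inv_outDart]
      exact hL.mem_ends.2
    · exact respectsIHX_between hJ he hψ hL
  have inn : ∀ e, J.IsInner e → ∀ w₁ T s w₂ t,
      LetterAt J.rot J.label J.inv u v x w₁ T s w₂ y P t → e = inDart J.rot (t, s) →
      RespectsIHX n J e := by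
    rintro e he w₁ T s w₂ t hL rfl
    rcases List.eq_nil_or_concat w₁ with rfl | ⟨w₁, ⟨T₁, s₁⟩, rfl⟩
    · refine .of_inv hJ he (joint _ he.inv_right ?_)
      rw [hL.inv_inDart J.inv_inv]
      exact hL.mem_ends.1
    · rw [List.concat_eq_append] at hL
      obtain ⟨t₁, hi, hL'⟩ := hL.prev
      refine .of_inv hJ he (out _ he.inv_right _ _ _ _ _ hL' ?_)
      rw [← hi, J.inv_inv]
  rcases hd with hd | hd
  · have : e = t ∨ e = inDart J.rot (t, s) ∨ e = outDart J.rot (t, s) := by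
      rcases mem_orb.1 hd with rfl | rfl | rfl
      · exact .inl rfl
      · cases s
        exacts [.inr (.inr rfl), .inr (.inl rfl)]
      · cases s
        exacts [.inr (.inl rfl), .inr (.inr rfl)]
    rcases this with rfl | h' | h'
    · exact respectsIHX_letter hJ he hψ hL
    · exact inn e he _ _ _ _ _ hL h'
    · exact out e he _ _ _ _ _ hL h'
  -- If `e` is directed towards the root, its opposite half either is the half-edge `t` on the
  -- strand or lies in the tree and is directed towards the leaves.
  · by_cases hh : J.Hanging e
    · have hh' := hJ.not_hanging_both e hh
      have hm := hT.map_inv J.inv_inv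
      rw [J.inv_inv] at hm
      have : J.inv e ∈ ({t} + N : Multiset J.H) := by
        rw [← hm]
        exact Multiset.mem_map_of_mem _ (Multiset.mem_add.2 (.inr hd))
      rw [Multiset.mem_add, Multiset.mem_singleton] at this
      refine .of_inv hJ he ?_
      rcases this with h' | h'
      · rw [h']
        exact respectsIHX_letter hJ (h' ▸ he.inv_right) hψ hL
      · exact tree _ he.inv_right h' hh'
    · exact tree e he hd hh

/-- If one of the three diagrams is an eyeglass, the symmetries of the relator make it the first
one. If none is, the relator is among those divided out in `ThetaMod`. -/
theorem respectsIHX (hJ : J.IsTwoLoop n) (he : J.IsInner e) : RespectsIHX n J e := by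
  by_cases h1 : ∃ l m r, J.IsEyeglass l m r
  · obtain ⟨l, m, r, h⟩ := h1
    exact respectsIHX_of_isEyeglass hJ he h
  by_cases h2 : ∃ l m r, (J.toH e).IsEyeglass l m r
  · obtain ⟨l, m, r, h⟩ := h2
    exact .of_toH hJ he (respectsIHX_of_isEyeglass (hJ.toH he) (he.movesAt_permH.isInner he) h)
  by_cases h3 : ∃ l m r, (J.toX e).IsEyeglass l m r
  · obtain ⟨l, m, r, h⟩ := h3
    exact .of_toX hJ he (respectsIHX_of_isEyeglass (hJ.toX he) (he.movesAt_permX.isInner he) h)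
  have m1 : cls J ∈ Theta L n := mem_theta_iff.2 ⟨hJ, fun l m r h => h1 ⟨l, m, r, h⟩⟩
  have m2 : cls (J.toH e) ∈ Theta L n :=
    mem_theta_iff.2 ⟨hJ.toH he, fun l m r h => h2 ⟨l, m, r, h⟩⟩
  have m3 : cls (J.toX e) ∈ Theta L n :=
    mem_theta_iff.2 ⟨hJ.toX he, fun l m r h => h3 ⟨l, m, r, h⟩⟩
  unfold RespectsIHX
  rw [rewriteValue_of_mem m1, rewriteValue_of_mem m2, rewriteValue_of_mem m3]
  exact thetaMk_ihx he m1 m2 m3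

end IHX

namespace Diagram

/-! ### Reading off the trees along a path -/

/-- The word with one letter given by the tree hanging at the half-edge `m.1`, if there is one. -/
def letterWord (J : Diagram L) (m : J.H × Bool) : Word L :=
  if h : ∃ T N, IsTree J.rot J.label J.inv (J.inv m.1) T N then [(h.choose, m.2)] else []

/-- The half-edges of the tree hanging at the half-edge `t`. -/
def letterDarts (J : Diagram L) (t : J.H) : Multiset J.H :=
  if h : ∃ T N, IsTree J.rot J.label J.inv (J.inv t) T N then h.choose_spec.choose else 0

/-- The word read off along a path. -/
def readWord (J : Diagram L) (ms : List (J.H × Bool)) : Word L := ms.flatMap J.letterWord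

/-- The half-edges at the vertices passed by a path and in the trees there. -/
def readDarts (J : Diagram L) (ms : List (J.H × Bool)) : Multiset J.H :=
  ((ms.map Prod.fst).map fun t => orb J.rot t + J.letterDarts t).sum

/-- There is a tree hanging at the trivalent vertex of the half-edge `t`, opposite to `t`. -/
def IsLetter (J : Diagram L) (t : J.H) : Prop := J.rot t ≠ t ∧ J.Hanging (J.inv t)

variable {J : Diagram L}

/-- `letterWord` and `letterDarts` choose from the same existence statement, so they describe the
same tree. -/
theorem IsLetter.exists_tree {t : J.H} (h : J.IsLetter t) :
    ∃ T, IsTree J.rot J.label J.inv (J.inv t) T (J.letterDarts t) ∧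
      ∀ s, J.letterWord (t, s) = [(T, s)] := by
  have hex := exists_isTree_of_hanging h.2
  refine ⟨hex.choose, ?_, fun s => dif_pos hex⟩
  rw [letterDarts, dif_pos hex]
  exact hex.choose_spec.choose_spec

/-- Applied to the rewiring of the spine, which leaves the trees intact. -/
theorem IsTree.congr_inv {H : Type} {rot : Equiv.Perm H} {lab : H → Option L}
    {inv inv' : Equiv.Perm H} {h : H} {T : RTree L} {M : Multiset H}
    (hT : IsTree rot lab inv h T M) (hM : ∀ z ∈ M, inv' z = inv z) :
    IsTree rot lab inv' h T M := by
  induction hT with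
  | leaf h l h1 h2 => exact .leaf h l h1 h2
  | node h A B M N h1 hA hB ihA ihB =>
    refine .node h A B M N h1 ?_ ?_
    · rw [hM _ (by simp [orb])]
      exact ihA fun z hz => hM z (by simp [hz])
    · rw [hM _ (by simp [orb])]
      exact ihB fun z hz => hM z (by simp [hz])

/-- Reading the word of a path after changing the pairing on the spine. -/
theorem isPath_readWord {inv : Equiv.Perm J.H} (hinv : ∀ z, ¬ J.InSpine z → inv z = J.inv z)
    (x y : J.H) (ms : List (J.H × Bool)) (hedge : ∀ p ∈ path J.rot x ms y, inv p.1 = p.2)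
    (hms : ∀ m ∈ ms, J.IsLetter m.1) :
    IsPath J.rot J.label inv x (J.readWord ms) y (J.readDarts ms) := by
  induction ms generalizing x with
  | nil => exact IsPath.nil' (hedge (x, y) (by simp [path]))
  | cons m ms ih =>
    obtain ⟨t, s⟩ := m
    have h1 := ih (outDart J.rot (t, s)) (fun p hp => hedge p (List.mem_cons_of_mem _ hp))
      (fun m hm => hms m (List.mem_cons_of_mem _ hm))
    have hl := hms _ List.mem_cons_self
    obtain ⟨T, hT, hw⟩ := hl.exists_tree
    have ht : inv t = J.inv t := hinv t fun h => h.2 hl.2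
    have hT' := hT.congr_inv (inv' := inv) fun z hz => hinv z fun h =>
      (hT.hanging_mem z hz).elim h.1 h.2
    rw [← ht] at hT'
    have hx : inv x = inDart J.rot (t, s) := hedge (x, inDart J.rot (t, s)) (by simp [path])
    have := IsPath.cons x t T s _ y _ _ hx hl.1 hT' h1
    rw [readWord, List.flatMap_cons, hw]
    exact this

theorem EyeglassForm.isLetter (E : J.EyeglassForm) :
    (J.rot E.u ≠ E.u ∧ J.rot E.v ≠ E.v) ∧ (∀ t ∈ E.left, J.IsLetter t) ∧
      (∀ t ∈ E.line, J.IsLetter t) ∧ ∀ t ∈ E.right, J.IsLetter t := by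
  let Q : List (J.H × List (J.H × Bool) × J.H) :=
    [(J.rot.symm E.u, onLeft E.left, J.rot E.u), (E.u, onLeft E.line, E.v),
      (J.rot.symm E.v, onLeft E.right, J.rot E.v)]
  have hQ : J.SpineIs (pathEdges J.rot Q) := by
    have := E.spine
    simpa [Q, pathEdges, eyeglassEdges] using this
  have hE : (Q.map fun q => ({q.1} + {q.2.2} : Multiset J.H)).sum =
      orb J.rot E.u + orb J.rot E.v := by
    simp only [Q, List.map_cons, List.map_nil, List.sum_cons, List.sum_nil, orb]
    abel
  have hd := Multiset.coe_nodup.2 hQ.nodup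
  rw [coe_darts_pathEdges, hE] at hd
  have hd := (Multiset.nodup_add.1 hd).1
  simp only [orb, Multiset.singleton_add, Multiset.cons_add, Multiset.nodup_cons, Multiset.mem_cons,
    Multiset.mem_singleton, not_or] at hd
  refine ⟨⟨Ne.symm hd.1.1, Ne.symm hd.2.2.2.1.1⟩, fun t ht => ?_, fun t ht => ?_, fun t ht => ?_⟩
  · exact hQ.letter hE (q := (J.rot.symm E.u, onLeft E.left, J.rot E.u)) (by simp [Q])
      (m := (t, true)) (by simpa [onLeft] using ht)
  · exact hQ.letter hE (q := (E.u, onLeft E.line, E.v)) (by simp [Q])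
      (m := (t, true)) (by simpa [onLeft] using ht)
  · exact hQ.letter hE (q := (J.rot.symm E.v, onLeft E.right, J.rot E.v)) (by simp [Q])
      (m := (t, true)) (by simpa [onLeft] using ht)

theorem mem_onLeft {H : Type} {ts : List H} {m : H × Bool} (h : m ∈ onLeft ts) : m.1 ∈ ts := by
  obtain ⟨t, ht, rfl⟩ := List.mem_map.1 h
  exact ht

theorem EyeglassForm.arePaths (E : J.EyeglassForm) :
    ArePaths J.rot J.label J.inv (eyeglassPaths J.rot E.u E.v (J.readWord (onLeft E.left))
      (J.readWord (onLeft E.line)) (J.readWord (onLeft E.right)))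
      ({J.rot.symm E.u} + {J.rot E.u} + J.readDarts (onLeft E.left) +
        ({E.u} + {E.v} + J.readDarts (onLeft E.line) +
          ({J.rot.symm E.v} + {J.rot E.v} + J.readDarts (onLeft E.right) + 0))) := by
  obtain ⟨-, h1, h2, h3⟩ := E.isLetter
  have he := E.spine.edge
  simp only [eyeglassEdges, List.mem_append] at he
  refine .cons _ _ _ _ _ _ (isPath_readWord (fun _ _ => rfl) _ _ _ (fun p hp => he p ?_) ?_)
    (.cons _ _ _ _ _ _ (isPath_readWord (fun _ _ => rfl) _ _ _ (fun p hp => he p ?_) ?_)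
    (.cons _ _ _ _ _ _ (isPath_readWord (fun _ _ => rfl) _ _ _ (fun p hp => he p ?_) ?_) .nil))
  · exact .inl (.inl hp)
  · exact fun m hm => h1 _ (mem_onLeft hm)
  · exact .inl (.inr hp)
  · exact fun m hm => h2 _ (mem_onLeft hm)
  · exact .inr hp
  · exact fun m hm => h3 _ (mem_onLeft hm)

theorem EyeglassForm.isEyeglass {n : ℕ} (hJ : J.IsTwoLoop n) (E : J.EyeglassForm) :
    J.IsEyeglass (J.readWord (onLeft E.left)) (J.readWord (onLeft E.line))
      (J.readWord (onLeft E.right)) :=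
  ⟨E.u, E.v, hJ.skeleton E.arePaths (ends_eyeglassPaths ..) E.isLetter.1.1 E.isLetter.1.2⟩

theorem mem_shuffleWord {H : Type} {line right : List H} {S : Finset H} {m : H × Bool}
    (h : m ∈ shuffleWord line right S) : m.1 ∈ line ∨ m.1 ∈ right := by
  simp only [shuffleWord, onLeft, onRight, List.mem_append, List.mem_map, List.mem_reverse,
    List.mem_filter] at h
  grind

theorem count_list_sum {α β : Type} (l : List α) (f : α → Multiset β) (z : β) :
    (l.map f).sum.count z = (l.map fun a => (f a).count z).sum := by
  induction l with
  | nil => simp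
  | cons a l ih => simp [ih]

/-- Each tree of the line goes to exactly one of the two strands, whatever `S` is; so the theta
diagrams use the half-edges of the eyeglass. -/
theorem count_readDarts_shuffleWord (line right : List J.H) (S : Finset J.H) (z : J.H) :
    (J.readDarts (shuffleWord line right S)).count z =
      (J.readDarts (onLeft line)).count z + (J.readDarts (onLeft right)).count z := by
  have e : ∀ l : List J.H, (onLeft l).map Prod.fst = l := fun l => by
    simp [onLeft, Function.comp_def]
  simp only [readDarts, count_list_sum]
  rw [sum_shuffleWord, e, e]

theorem EyeglassForm.count_shuffle {n : ℕ} (hJ : J.IsTwoLoop n) (E : J.EyeglassForm)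
    (S : Finset J.H) (z : J.H) :
    (orb J.rot E.u + orb J.rot E.v + (0 + J.readDarts (shuffleWord E.line E.right S) +
      J.readDarts (onLeft E.left))).count z = 1 := by
  rw [← hJ.count_eq_one E.arePaths (ends_eyeglassPaths ..) E.isLetter.1.1 E.isLetter.1.2 z]
  simp only [orb, Multiset.count_add, count_readDarts_shuffleWord, Multiset.count_zero]
  omega

/-- The vertical bar is the empty first arm. The left arc runs from `v` to `u`, against the
direction of the arms, whence `bar`: the first sum carries the antipode of the left circle. -/
theorem EyeglassForm.isTheta_theta {n : ℕ} (hJ : J.IsTwoLoop n) (E : J.EyeglassForm)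
    (S : Finset J.H) : (E.theta S).IsTheta [] (J.readWord (shuffleWord E.line E.right S))
      (bar (J.readWord (onLeft E.left))) := by
  obtain ⟨-, h1, h2, h3⟩ := E.isLetter
  have hn : (darts (thetaEdges J.rot E.u E.v E.left E.line E.right S)).Nodup :=
    (thetaEdges_perm ..).nodup_iff.2 E.spine.nodup
  have hinv : ∀ z, ¬ J.InSpine z → (E.theta S).inv z = J.inv z := fun z hz => by
    refine overrideEdges_of_notMem _ _ z fun hm => hz ?_
    rwa [(thetaEdges_perm ..).mem_iff, E.spine.mem_iff] at hm
  have hedge : ∀ p ∈ thetaEdges J.rot E.u E.v E.left E.line E.right S,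
      (E.theta S).inv p.1 = p.2 := fun p hp => (overrideEdges_of_mem _ _ hn p hp).1
  simp only [thetaEdges, List.mem_cons, List.mem_append] at hedge
  have p1 : IsPath J.rot J.label (E.theta S).inv E.u [] E.v 0 :=
    IsPath.nil' (hedge (E.u, E.v) (.inl rfl))
  have p2 := isPath_readWord hinv _ _ _ (fun p hp => hedge p (.inr (.inr hp))) fun m hm =>
    (mem_shuffleWord hm).elim (h2 _) (h3 _)
  have p3 := (isPath_readWord hinv _ _ _ (fun p hp => hedge p (.inr (.inl hp))) fun m hm =>
    h1 _ (mem_onLeft hm)).reverse (E.theta S).inv_inv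
  exact ⟨E.u, E.v, skeleton_three.2 ⟨ends_thetaPaths .., _, _, _, p1, p2, p3,
    E.count_shuffle hJ S⟩⟩

/-- With its ends interchanged the left arc runs in the direction of the arms, so the second sum
carries the left circle itself. -/
theorem EyeglassForm.isTheta_crossed {n : ℕ} (hJ : J.IsTwoLoop n) (E : J.EyeglassForm)
    (S : Finset J.H) : (E.crossed S).IsTheta [] (J.readWord (shuffleWord E.line E.right S))
      (J.readWord (onLeft E.left)) := by
  obtain ⟨-, h1, h2, h3⟩ := E.isLetter
  have hn : (darts (crossedEdges J.rot E.u E.v E.left E.line E.right S)).Nodup :=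
    (crossedEdges_perm ..).nodup_iff.2 E.spine.nodup
  have hinv : ∀ z, ¬ J.InSpine z → (E.crossed S).inv z = J.inv z := fun z hz => by
    refine overrideEdges_of_notMem _ _ z fun hm => hz ?_
    rwa [(crossedEdges_perm ..).mem_iff, E.spine.mem_iff] at hm
  have hedge : ∀ p ∈ crossedEdges J.rot E.u E.v E.left E.line E.right S,
      (E.crossed S).inv p.1 = p.2 := fun p hp => (overrideEdges_of_mem _ _ hn p hp).1
  simp only [crossedEdges, List.mem_cons, List.mem_append] at hedge
  have p1 : IsPath J.rot J.label (E.crossed S).inv E.u [] E.v 0 :=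
    IsPath.nil' (hedge (E.u, E.v) (.inl rfl))
  have p2 := isPath_readWord hinv _ _ _ (fun p hp => hedge p (.inr (.inr hp))) fun m hm =>
    (mem_shuffleWord hm).elim (h2 _) (h3 _)
  have p3 := isPath_readWord hinv _ _ _ (fun p hp => hedge p (.inr (.inl hp))) fun m hm =>
    h1 _ (mem_onLeft hm)
  exact ⟨E.u, E.v, skeleton_three.2 ⟨ends_thetaPaths .., _, _, _, p1, p2, p3,
    E.count_shuffle hJ S⟩⟩

theorem EyeglassForm.isTwoLoop_theta {n : ℕ} (hJ : J.IsTwoLoop n) (E : J.EyeglassForm)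
    (S : Finset J.H) : (E.theta S).IsTwoLoop n :=
  ⟨(E.isTheta_theta hJ S).connected, hJ.2⟩

theorem EyeglassForm.isTwoLoop_crossed {n : ℕ} (hJ : J.IsTwoLoop n) (E : J.EyeglassForm)
    (S : Finset J.H) : (E.crossed S).IsTwoLoop n :=
  ⟨(E.isTheta_crossed hJ S).connected, hJ.2⟩

end Diagram

/-! ### The shuffle sum -/
-- The first tree of the line is the outermost letter on either strand. In `S` it multiplies from
-- the left; outside `S` it ends the lower strand, which is read backwards, and multiplies from the
-- right with a minus sign. This is one step of the adjoint action.
theorem sum_shuffleWord_eq_adj {J : Diagram L} {line right : List J.H} (hn : line.Nodup)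
    (hl : ∀ t ∈ line, J.IsLetter t) :
    ∑ S ∈ line.toFinset.powerset, wordAlg (J.readWord (shuffleWord line right S)) =
      adj (wordAlg (J.readWord (onLeft line))) (wordAlg (J.readWord (onLeft right))) := by
  induction line with
  | nil =>
    simp [shuffleWord, onLeft, onRight, readWord]
  | cons t line ih =>
    rw [List.nodup_cons] at hn
    have ih := ih hn.2 fun t ht => hl t (List.mem_cons_of_mem _ ht)
    obtain ⟨T, -, hw⟩ := (hl t List.mem_cons_self).exists_tree
    have e1 : ∀ S ∈ line.toFinset.powerset,
        wordAlg (J.readWord (shuffleWord (t :: line) right S)) =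
          -(wordAlg (J.readWord (shuffleWord line right S)) * T.toAlg) := by
      intro S hS
      have htS : t ∉ S := fun h => hn.1 (List.mem_toFinset.1 (Finset.mem_powerset.1 hS h))
      simp only [shuffleWord, readWord, List.filter_cons, htS, decide_false, not_false_eq_true,
        decide_true, if_true, Bool.false_eq_true, if_false, List.reverse_cons, onRight,
        List.map_append, List.map_cons, List.map_nil, List.flatMap_append, List.flatMap_cons,
        List.flatMap_nil, hw, wordAlg_append, wordAlg_cons, wordAlg_nil, letterAlg_false,
        List.append_nil, mul_one, mul_neg, mul_assoc]
    have e2 : ∀ S ∈ line.toFinset.powerset,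
        wordAlg (J.readWord (shuffleWord (t :: line) right (insert t S))) =
          T.toAlg * wordAlg (J.readWord (shuffleWord line right S)) := by
      intro S hS
      have f1 : line.filter (· ∈ insert t S) = line.filter (· ∈ S) :=
        List.filter_congr fun x hx => by
          have : x ≠ t := fun h => hn.1 (h ▸ hx)
          simp [this]
      have f2 : line.filter (· ∉ insert t S) = line.filter (· ∉ S) :=
        List.filter_congr fun x hx => by
          have : x ≠ t := fun h => hn.1 (h ▸ hx)
          simp [this]
      simp only [shuffleWord, readWord, List.filter_cons, Finset.mem_insert_self, decide_true,
        if_true, not_true_eq_false, decide_false, Bool.false_eq_true, if_false, f1, f2, onLeft,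
        List.map_cons, List.cons_append, List.flatMap_cons, hw, wordAlg_cons,
        letterAlg_true, List.nil_append]
    rw [List.toFinset_cons, Finset.sum_powerset_insert (fun h => hn.1 (List.mem_toFinset.1 h)),
      Finset.sum_congr rfl e1, Finset.sum_congr rfl e2, Finset.sum_neg_distrib, ← Finset.sum_mul,
      ← Finset.mul_sum, ih]
    have e3 : J.readWord (onLeft (t :: line)) = (T, true) :: J.readWord (onLeft line) := by
      simp [readWord, onLeft, hw]
    rw [e3, wordAlg_cons, letterAlg_true, adj_mul_apply, adj_toAlg]
    abel

/-! ### The rewriting map -/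

/-- The value of the rewriting map on an isomorphism class. -/
def rewriteClass (n : ℕ) : IsoClass L → ThetaMod L n :=
  Quotient.lift (rewriteValue n) fun _ _ h => rewriteValue_congr h

/-- The rewriting map on the free abelian group. -/
def rewriteFree (L : Type) (n : ℕ) : Free (TwoLoop L n) →ₗ[ℤ] ThetaMod L n :=
  Finsupp.linearCombination ℤ fun c : TwoLoop L n => rewriteClass n c.1

theorem rewriteFree_gen {n : ℕ} (J : Diagram L) (h : cls J ∈ TwoLoop L n) :
    rewriteFree L n (gen _ J h) = rewriteValue n J := by
  rw [rewriteFree, gen, Finsupp.linearCombination_single, one_smul]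
  rfl

theorem rewriteFree_of_mem_relAS {n : ℕ} {x : Free (TwoLoop L n)}
    (hx : x ∈ relAS (TwoLoop L n)) : rewriteFree L n x = 0 := by
  obtain ⟨J, e, h, h', he, rfl⟩ := hx
  rw [map_add, rewriteFree_gen, rewriteFree_gen, rewriteValue_flip (mem_twoLoop.1 h) he,
    add_neg_cancel]

theorem rewriteFree_of_mem_relIHX {n : ℕ} {x : Free (TwoLoop L n)}
    (hx : x ∈ relIHX (TwoLoop L n)) : rewriteFree L n x = 0 := by
  obtain ⟨J, e, h, h', h'', he, rfl⟩ := hx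
  rw [map_add, map_sub, rewriteFree_gen, rewriteFree_gen, rewriteFree_gen]
  exact respectsIHX (mem_twoLoop.1 h) he

theorem rewriteFree_of_mem_relLoop {n : ℕ} {x : Free (TwoLoop L n)}
    (hx : x ∈ relLoop (TwoLoop L n)) : rewriteFree L n x = 0 := by
  obtain ⟨J, e, h, he, rfl⟩ := hx
  obtain ⟨m, r, hJ⟩ := (mem_twoLoop.1 h).isEyeglass_of_loop he
  rw [rewriteFree_gen, rewriteValue_isEyeglass hJ, wordAlg_nil, eyeglassForm_one]

/-- The rewriting map modulo AS. -/
def rewriteMap (L : Type) (n : ℕ) : TwoLoopModAS L n →ₗ[ℤ] ThetaMod L n :=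
  (Submodule.span ℤ (relAS (TwoLoop L n))).liftQ (rewriteFree L n)
    (Submodule.span_le.2 fun _ hx => rewriteFree_of_mem_relAS hx)

/-- The rewriting map modulo all relations. -/
def rewriteQuot (L : Type) (n : ℕ) : A2 L n →ₗ[ℤ] ThetaMod L n :=
  (Submodule.span ℤ (relAS (TwoLoop L n) ∪ relIHX (TwoLoop L n) ∪ relLoop (TwoLoop L n))).liftQ
    (rewriteFree L n) (Submodule.span_le.2 fun _ hx => hx.elim (fun hx => hx.elim
      rewriteFree_of_mem_relAS rewriteFree_of_mem_relIHX) rewriteFree_of_mem_relLoop)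

theorem rewriteMap_modAS {n : ℕ} (J : Diagram L) (h : cls J ∈ TwoLoop L n) :
    rewriteMap L n (modAS J h) = rewriteValue n J :=
  rewriteFree_gen J h

theorem sublist_darts_path {H : Type} (rot : Equiv.Perm H) (x : H) (ms : List (H × Bool)) (y : H) :
    (ms.map (inDart rot)).Sublist (darts (path rot x ms y)) := by
  induction ms generalizing x with
  | nil => simp
  | cons m ms ih =>
    rw [path, darts_cons, List.map_cons]
    exact ((ih _).cons_cons _).cons _

/-- Subsets of positions are encoded as sets of half-edges, which is faithful only if no half-edge
repeats along the line. -/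
theorem Diagram.EyeglassForm.nodup_line {J : Diagram L} (E : J.EyeglassForm) : E.line.Nodup := by
  have h := E.spine.nodup
  rw [eyeglassEdges, darts_append, darts_append] at h
  have h := ((List.nodup_append.1 (List.nodup_append.1 h).1).2.1).sublist (sublist_darts_path ..)
  simp only [onLeft, List.map_map] at h
  exact h.of_map _

/-- The two sums expand `θ(1, ad(m) r, antipode l)` and `θ(1, ad(m) r, l)`, whose difference is the
eyeglass form. -/
theorem isRewriting_rewriteMap (L : Type) (n : ℕ) : IsRewriting (rewriteMap L n) where
  theta J h := by rw [rewriteMap_modAS, rewriteValue_of_mem h]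
  eyeglass J h E := by
    have hJ := mem_twoLoop.1 h
    have hθ := E.isTheta_theta hJ
    have hc := E.isTheta_crossed hJ
    refine ⟨fun S => mem_theta_of_isTheta (E.isTwoLoop_theta hJ S) (hθ S),
      fun S => mem_theta_of_isTheta (E.isTwoLoop_crossed hJ S) (hc S), ?_⟩
    rw [rewriteMap_modAS, rewriteValue_isEyeglass (E.isEyeglass hJ), eyeglassForm,
      ← sum_shuffleWord_eq_adj E.nodup_line E.isLetter.2.2.1, map_sub, map_sum,
      AddMonoidHom.finsetSum_apply, AddMonoidHom.finsetSum_apply]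
    congr 1
    · refine Finset.sum_congr rfl fun S _ => ?_
      rw [← thetaForm_wordAlg _ (hθ S), wordAlg_bar, wordAlg_nil]
    · refine Finset.sum_congr rfl fun S _ => ?_
      rw [← thetaForm_wordAlg _ (hc S), wordAlg_nil]

/-! ### Reaching eyeglass form -/

theorem modAS_flip {n : ℕ} {J : Diagram L} {e : J.H} (he : J.rot e ≠ e)
    (h : cls J ∈ TwoLoop L n) (h' : cls (J.flip e) ∈ TwoLoop L n) :
    modAS J h = -modAS (J.flip e) h' := by
  rw [eq_neg_iff_add_eq_zero]
  exact (Submodule.Quotient.mk_eq_zero _).2 (Submodule.subset_span ⟨J, e, h, h', he, rfl⟩)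

theorem eq_onLeft {H : Type} {ms : List (H × Bool)} (h : ∀ m ∈ ms, m.2 = true) :
    ∃ ts, ms = onLeft ts := by
  refine ⟨ms.map Prod.fst, ?_⟩
  rw [onLeft, List.map_map]
  refine (List.map_id ms).symm.trans (List.map_congr_left fun m hm => ?_)
  exact Prod.ext rfl (h m hm)

theorem Diagram.Skeleton.nonempty_eyeglassForm {J : Diagram L} {u v : J.H} {l m r : Word L}
    (h : Skeleton J.rot J.label J.inv u v (eyeglassPaths J.rot u v l m r))
    (ht : ∀ p ∈ eyeglassPaths J.rot u v l m r, ∀ a ∈ p.2.1, a.2 = true) :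
    Nonempty J.EyeglassForm := by
  obtain ⟨Q, hQ, hs⟩ := h.exists_spineIs
  have key : ∀ (ms : List (J.H × Bool)) (w : Word L), ms.map Prod.snd = w.map Prod.snd →
      (∀ a ∈ w, a.2 = true) → ∃ ts, ms = onLeft ts := fun ms w h1 h2 => by
    refine eq_onLeft fun a ha => ?_
    have : a.2 ∈ w.map Prod.snd := h1 ▸ List.mem_map_of_mem ha
    obtain ⟨b, hb, e⟩ := List.mem_map.1 this
    rw [← e, h2 b hb]
  cases hQ with
  | cons h1 hQ =>
  cases hQ with
  | cons h2 hQ =>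
  cases hQ with
  | cons h3 hQ =>
  cases hQ
  rename_i q1 q2 q3
  obtain ⟨x1, m1, y1⟩ := q1
  obtain ⟨x2, m2, y2⟩ := q2
  obtain ⟨x3, m3, y3⟩ := q3
  obtain ⟨rfl, rfl, e1⟩ := h1
  obtain ⟨rfl, rfl, e2⟩ := h2
  obtain ⟨rfl, rfl, e3⟩ := h3
  obtain ⟨t1, rfl⟩ := key _ _ e1 (ht _ (by simp [eyeglassPaths]))
  obtain ⟨t2, rfl⟩ := key _ _ e2 (ht _ (by simp [eyeglassPaths]))
  obtain ⟨t3, rfl⟩ := key _ _ e3 (ht _ (by simp [eyeglassPaths]))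
  exact ⟨⟨x2, y2, t1, t2, t3, by simpa [pathEdges, eyeglassEdges] using hs⟩⟩

/-- The number of trees to the right of their path. -/
def rightCount {H : Type} (P : List (H × Word L × H)) : ℕ :=
  (P.map fun p => p.2.1.countP fun a => a.2 = false).sum

theorem rightCount_perm {H : Type} {P Q : List (H × Word L × H)} (h : P.Perm Q) :
    rightCount P = rightCount Q := (h.map _).sum_eq

/-- The trees on the wrong side are flipped one at a time; each flip costs a sign and decreases
`rightCount`. -/
theorem exists_eyeglassForm_of_skeleton {n : ℕ} {J : Diagram L} {u v : J.H} {l m r : Word L}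
    (hJ : cls J ∈ TwoLoop L n)
    (h : Skeleton J.rot J.label J.inv u v (eyeglassPaths J.rot u v l m r)) :
    ∃ (K : Diagram L) (h' : cls K ∈ TwoLoop L n) (ε : ℤˣ),
      Nonempty K.EyeglassForm ∧ modAS J hJ = ε • modAS K h' := by
  generalize hk : rightCount (eyeglassPaths J.rot u v l m r) = k
  induction k using Nat.strong_induction_on generalizing J l m r with
  | _ k ih =>
  by_cases ht : ∀ p ∈ eyeglassPaths J.rot u v l m r, ∀ a ∈ p.2.1, a.2 = true
  · exact ⟨J, hJ, 1, h.nonempty_eyeglassForm ht, (one_smul _ _).symm⟩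
  push Not at ht
  obtain ⟨⟨x, w, y⟩, hp, ⟨T, s⟩, ha, hs⟩ := ht
  obtain rfl : s = false := by simpa using hs
  obtain ⟨w₁, w₂, rfl⟩ := List.append_of_mem ha
  obtain ⟨P, hP⟩ : ∃ P, (eyeglassPaths J.rot u v l m r).Perm
      ((x, w₁ ++ (T, false) :: w₂, y) :: P) := ⟨_, List.perm_cons_erase hp⟩
  obtain ⟨ψ, hψ⟩ := exists_isContext n hP
  obtain ⟨t, hL⟩ := (h.perm hP).exists_letterAt
  have hne := hL.2.1
  obtain ⟨l', m', r', hp', -⟩ := hψ (w₁ ++ (T, true) :: w₂)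
  have hK : cls (J.flip t) ∈ TwoLoop L n := mem_twoLoop.2 ((mem_twoLoop.1 hJ).flip hne)
  obtain ⟨K, h', ε, hE, e⟩ := ih (rightCount (eyeglassPaths J.rot u v l' m' r')) (by
    rw [← hk, rightCount_perm hP, ← rightCount_perm hp']
    simp [rightCount]) (J := J.flip t) hK (hL.flip_root.skeleton.perm hp') rfl
  refine ⟨K, h', -ε, hE, ?_⟩
  rw [modAS_flip hne hJ hK, e, Units.neg_smul]

theorem exists_eyeglassForm {n : ℕ} {J : Diagram L} (hJ : cls J ∈ TwoLoop L n)
    (hn : cls J ∉ Theta L n) : ∃ (K : Diagram L) (h' : cls K ∈ TwoLoop L n) (ε : ℤˣ),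
      Nonempty K.EyeglassForm ∧ modAS J hJ = ε • modAS K h' := by
  obtain ⟨l, m, r, u, v, h⟩ : ∃ l m r, J.IsEyeglass l m r := by
    by_contra hc
    exact hn (mem_theta_iff.2 ⟨mem_twoLoop.1 hJ, fun l m r h => hc ⟨l, m, r, h⟩⟩)
  exact exists_eyeglassForm_of_skeleton hJ h

/-- Theta diagrams and diagrams in eyeglass form generate modulo AS, and the two conditions
prescribe the value on each of them. -/
theorem IsRewriting.unique {n : ℕ} {f g : TwoLoopModAS L n →ₗ[ℤ] ThetaMod L n}
    (hf : IsRewriting f) (hg : IsRewriting g) : f = g := by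
  have key : ∀ (J : Diagram L) (h : cls J ∈ TwoLoop L n), f (modAS J h) = g (modAS J h) := by
    intro J h
    by_cases hJ : cls J ∈ Theta L n
    · exact (hf.theta J hJ).trans (hg.theta J hJ).symm
    · obtain ⟨K, h', ε, ⟨E⟩, e⟩ := exists_eyeglassForm h hJ
      obtain ⟨h₁, h₂, e1⟩ := hf.eyeglass K h' E
      obtain ⟨_, _, e2⟩ := hg.eyeglass K h' E
      rw [e, Units.smul_def, map_smul, map_smul, e1, e2]
  refine Submodule.linearMap_qext _ (Finsupp.lhom_ext' fun c => LinearMap.ext_ring ?_)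
  obtain ⟨c, hc⟩ := c
  obtain ⟨J, rfl⟩ : ∃ J, cls J = c := Quotient.exists_rep c
  exact key J hc

/-! ### The inverse -/

theorem incl_gen {n : ℕ} (J : Diagram L) (h : cls J ∈ Theta L n) :
    incl L n (gen _ J h) = gen _ J (theta_subset L n h) := by
  rw [incl, gen, Finsupp.lmapDomain_apply, Finsupp.mapDomain_single]
  rfl

/-- The map induced by the inclusion of the theta diagrams. -/
def thetaIncl (L : Type) (n : ℕ) : ThetaMod L n →ₗ[ℤ] A2 L n :=
  Submodule.mapQ _ _ (incl L n) (Submodule.span_le.2 (by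
    rintro x (⟨J, e, h, h', he, rfl⟩ | ⟨J, e, h, h', h'', he, rfl⟩)
    · rw [SetLike.mem_coe, Submodule.mem_comap, map_add, incl_gen, incl_gen]
      exact Submodule.subset_span (.inl (.inl ⟨J, e, _, _, he, rfl⟩))
    · rw [SetLike.mem_coe, Submodule.mem_comap, map_add, map_sub, incl_gen, incl_gen, incl_gen]
      exact Submodule.subset_span (.inl (.inr ⟨J, e, _, _, _, he, rfl⟩))))

/-- The class of a 2-loop diagram modulo all relations. -/
def a2Mk {n : ℕ} (J : Diagram L) (h : cls J ∈ TwoLoop L n) : A2 L n :=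
  Submodule.Quotient.mk (gen _ J h)

theorem a2Mk_mem_range_of_flip {n : ℕ} {J : Diagram L} {e : J.H} (he : J.rot e ≠ e)
    (h : cls J ∈ TwoLoop L n) (h' : cls (J.flip e) ∈ TwoLoop L n)
    (hr : a2Mk (J.flip e) h' ∈ LinearMap.range (thetaIncl L n)) :
    a2Mk J h ∈ LinearMap.range (thetaIncl L n) := by
  have : a2Mk J h + a2Mk (J.flip e) h' = 0 := (Submodule.Quotient.mk_eq_zero _).2
    (Submodule.subset_span (.inl (.inl ⟨J, e, h, h', he, rfl⟩)))
  rw [eq_neg_of_add_eq_zero_left this]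
  exact neg_mem hr

theorem a2Mk_mem_range_of_ihx {n : ℕ} {J : Diagram L} {e : J.H} (he : J.IsInner e)
    (h : cls J ∈ TwoLoop L n) (h' : cls (J.toH e) ∈ TwoLoop L n)
    (h'' : cls (J.toX e) ∈ TwoLoop L n)
    (hr' : a2Mk (J.toH e) h' ∈ LinearMap.range (thetaIncl L n))
    (hr'' : a2Mk (J.toX e) h'' ∈ LinearMap.range (thetaIncl L n)) :
    a2Mk J h ∈ LinearMap.range (thetaIncl L n) := by
  have : a2Mk J h - a2Mk (J.toH e) h' + a2Mk (J.toX e) h'' = 0 :=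
    (Submodule.Quotient.mk_eq_zero _).2
      (Submodule.subset_span (.inl (.inr ⟨J, e, h, h', h'', he, rfl⟩)))
  have e1 : a2Mk J h = a2Mk (J.toH e) h' - a2Mk (J.toX e) h'' := by
    rw [eq_sub_iff_add_eq, ← sub_eq_zero, ← this]
    abel
  rw [e1]
  exact sub_mem hr' hr''

theorem a2Mk_mem_range_of_mem {n : ℕ} {J : Diagram L} (h : cls J ∈ TwoLoop L n)
    (hJ : cls J ∈ Theta L n) : a2Mk J h ∈ LinearMap.range (thetaIncl L n) := by
  refine ⟨thetaMk J hJ, ?_⟩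
  change Submodule.Quotient.mk (incl L n (gen _ J hJ)) = _
  rw [incl_gen]
  rfl

/-- IHX at the first edge of the line removes one tree from it; once the line is bare, IHX replaces
the eyeglass by two theta diagrams. -/
theorem a2Mk_mem_range_of_isEyeglass {n : ℕ} {J : Diagram L} {l m r : Word L}
    (h : cls J ∈ TwoLoop L n) (hE : J.IsEyeglass l m r) :
    a2Mk J h ∈ LinearMap.range (thetaIncl L n) := by
  induction m generalizing J l with
  | nil =>
    obtain ⟨u, v, hE⟩ := hE
    have hJ := mem_twoLoop.1 h
    obtain ⟨he, hH, hX⟩ := hE.eyeglass_contract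
    have eH : (J.toH u).IsTheta [] l (bar r) := ⟨u, v, hH⟩
    have eX : (J.toX u).IsTheta [] (bar l) (bar r) := ⟨u, v, hX⟩
    exact a2Mk_mem_range_of_ihx he h (mem_twoLoop.2 (hJ.toH he)) (mem_twoLoop.2 (hJ.toX he))
      (a2Mk_mem_range_of_mem _ (mem_theta_of_isTheta (hJ.toH he) eH))
      (a2Mk_mem_range_of_mem _ (mem_theta_of_isTheta (hJ.toX he) eX))
  | cons a m ih =>
    obtain ⟨T, s⟩ := a
    have slide : ∀ (K : Diagram L) (h : cls K ∈ TwoLoop L n),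
        K.IsEyeglass l ((T, true) :: m) r → a2Mk K h ∈ LinearMap.range (thetaIncl L n) := by
      rintro K h ⟨u, v, hE⟩
      have hK := mem_twoLoop.1 h
      obtain ⟨he, hH, hX⟩ := hE.eyeglass_slide
      exact a2Mk_mem_range_of_ihx he h (mem_twoLoop.2 (hK.toH he)) (mem_twoLoop.2 (hK.toX he))
        (ih (J := K.toH u) _ ⟨_, v, hH⟩) (ih (J := K.toX u) _ ⟨_, v, hX⟩)
    cases s
    · obtain ⟨u, v, hE⟩ := hE
      have hp : ∀ s, (eyeglassPaths J.rot u v l ((T, s) :: m) r).Perm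
          ((u, [] ++ (T, s) :: m, v) :: [(J.rot.symm u, l, J.rot u), (J.rot.symm v, r, J.rot v)]) :=
        fun s => .swap _ _ _
      obtain ⟨t, hL⟩ := (hE.perm (hp false)).exists_letterAt
      exact a2Mk_mem_range_of_flip hL.2.1 h (mem_twoLoop.2 ((mem_twoLoop.1 h).flip hL.2.1))
        (slide (J.flip t) _ ⟨u, v, hL.flip_root.skeleton.perm (hp true).symm⟩)
    · exact slide J h hE

theorem thetaIncl_surjective (L : Type) (n : ℕ) : Function.Surjective (thetaIncl L n) := by
  rw [← LinearMap.range_eq_top, eq_top_iff]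
  rintro x -
  obtain ⟨x, rfl⟩ := Submodule.Quotient.mk_surjective _ x
  induction x using Finsupp.induction_linear with
  | zero => exact zero_mem _
  | add x y hx hy => exact add_mem hx hy
  | single c k =>
    obtain ⟨c, hc⟩ := c
    obtain ⟨J, rfl⟩ : ∃ J, cls J = c := Quotient.exists_rep c
    have hJ : a2Mk J hc ∈ LinearMap.range (thetaIncl L n) := by
      by_cases hE : ∃ l m r, J.IsEyeglass l m r
      · obtain ⟨l, m, r, hE⟩ := hE
        exact a2Mk_mem_range_of_isEyeglass hc hE
      · exact a2Mk_mem_range_of_mem hc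
          (mem_theta_iff.2 ⟨mem_twoLoop.1 hc, fun l m r h => hE ⟨l, m, r, h⟩⟩)
    have e : (Finsupp.single ⟨cls J, hc⟩ k : Free (TwoLoop L n)) = k • gen _ J hc := by
      rw [gen, Finsupp.smul_single, smul_eq_mul, mul_one]
    change Submodule.Quotient.mk (Finsupp.single ⟨cls J, hc⟩ k : Free (TwoLoop L n)) ∈ _
    rw [e, Submodule.Quotient.mk_smul]
    exact Submodule.smul_mem _ k hJ

/-- Rewriting fixes theta diagrams, so `thetaIncl` is injective; with surjectivity the two maps are
mutually inverse. -/
theorem rewriteQuot_thetaIncl {n : ℕ} (x : ThetaMod L n) :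
    rewriteQuot L n (thetaIncl L n x) = x := by
  suffices rewriteQuot L n ∘ₗ thetaIncl L n = LinearMap.id from LinearMap.congr_fun this x
  refine Submodule.linearMap_qext _ (Finsupp.lhom_ext' fun c => LinearMap.ext_ring ?_)
  obtain ⟨c, hc⟩ := c
  obtain ⟨J, rfl⟩ : ∃ J, cls J = c := Quotient.exists_rep c
  change rewriteFree L n (incl L n (gen _ J hc)) = thetaMk J hc
  rw [incl_gen, rewriteFree_gen, rewriteValue_of_mem hc]

/-- The isomorphism induced by the rewriting map. -/
def rewriteEquiv (L : Type) (n : ℕ) : A2 L n ≃ₗ[ℤ] ThetaMod L n :=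
  LinearEquiv.ofLinearMap (rewriteQuot L n) (thetaIncl L n)
    (LinearMap.ext rewriteQuot_thetaIncl)
    (LinearMap.ext fun x => by
      obtain ⟨y, rfl⟩ := thetaIncl_surjective L n x
      rw [LinearMap.comp_apply, rewriteQuot_thetaIncl, LinearMap.id_apply])

end Jacobi

end

/-- The labels `1⁺, …, g⁺, 1⁻, …, g⁻` are the elements of `Fin g × Bool`. -/
theorem proposition4p2 (g n : ℕ) :
    -- modulo AS, every diagram which is not a theta diagram is, up to sign, in eyeglass form
    (∀ (J : Jacobi.Diagram (Fin g × Bool)) (h : Jacobi.cls J ∈ Jacobi.TwoLoop (Fin g × Bool) n),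
      Jacobi.cls J ∉ Jacobi.Theta (Fin g × Bool) n →
      ∃ (K : Jacobi.Diagram (Fin g × Bool))
        (h' : Jacobi.cls K ∈ Jacobi.TwoLoop (Fin g × Bool) n) (ε : ℤˣ),
        Nonempty K.EyeglassForm ∧ Jacobi.modAS J h = ε • Jacobi.modAS K h') ∧
    -- the rewriting map is well-defined
    (∃! f : Jacobi.TwoLoopModAS (Fin g × Bool) n →ₗ[ℤ] Jacobi.ThetaMod (Fin g × Bool) n,
      Jacobi.IsRewriting f) ∧
    -- it induces an isomorphism, whose inverse is induced by the inclusion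
    (∀ f : Jacobi.TwoLoopModAS (Fin g × Bool) n →ₗ[ℤ] Jacobi.ThetaMod (Fin g × Bool) n,
      Jacobi.IsRewriting f →
      ∃ F : Jacobi.A2 (Fin g × Bool) n ≃ₗ[ℤ] Jacobi.ThetaMod (Fin g × Bool) n,
        (∀ x : Jacobi.Free (Jacobi.TwoLoop (Fin g × Bool) n),
          F (Submodule.Quotient.mk x) = f (Submodule.Quotient.mk x)) ∧
        (∀ y : Jacobi.Free (Jacobi.Theta (Fin g × Bool) n),
          F.symm (Submodule.Quotient.mk y) =
            Submodule.Quotient.mk (Jacobi.incl (Fin g × Bool) n y))) := by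
  refine ⟨fun J h hn => Jacobi.exists_eyeglassForm h hn,
    ⟨_, Jacobi.isRewriting_rewriteMap _ n, fun f hf => hf.unique (Jacobi.isRewriting_rewriteMap _ n)⟩,
    fun f hf => ⟨Jacobi.rewriteEquiv _ n, fun x => ?_, fun y => rfl⟩⟩
  -- Uniqueness identifies an arbitrary such `f` with the constructed map, for which the equality
  -- holds by definition.
  rw [hf.unique (Jacobi.isRewriting_rewriteMap _ n)]
  rfl
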